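/- Let $\tau_m,\tau_k>0$ be such that $\kappa:=(\tau_m\tau_k)^{-1/4}<1$, and put $\alpha=\kappa/(\kappa^2-1)$, $\lambda_*=(1-\kappa^2)/\kappa$, $\mathbb C_+=\{z:\operatorname{Im}z>0\}$, $\mathbb D=\mathbb C\setminus(-\infty,\lambda_*]$ and, for $\eta>0$, $\Omega_\eta=\{z\in\mathbb C_+:\operatorname{Im}z>\eta,\ |z|<\eta^{-1}\}$. Let $m=m_n$, $k=k_n$ be positive integers for large $n$ with $n/m\to\tau_m$ and $n/k\to\tau_k$. Let $U\in\mathbb R^{n\times m}$ and $V\in\mathbb R^{n\times k}$ be independent, with i.i.d. entries $U_{ij}\sim\mathcal N(0,1/m)$ and $V_{ij}\sim\mathcal N(0,1/k)$ (the CCA null model), and let $$\mathcal L(z)=\begin{pmatrix}-zI_m&0&\sqrt\kappa\,U^{\top}&0\\0&-zI_k&0&\sqrt\kappa\,V^{\top}\\ \sqrt\kappa\,U&0&\alpha\kappa I_n&\alpha I_n\\0&\sqrt\kappa\,V&\alpha I_n&\alpha\kappa I_n\end{pmatrix},\qquad \mathcal G(z)=\mathcal L(z)^{-1}.$$ Events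 $\mathcal E_n$ hold with overwhelming probability if for every $A>0$ one has $\mathbb P(\mathcal E_n)\ge 1-n^{-A}$ for all sufficiently large $n$. (0) For each $z\in\mathbb C_+$ there is exactly one triple $r(z),s(z)\in\mathbb C_+$, $T(z)=(t_{ij}(z))\in\mathbb C^{2\times2}$ with $$r=\frac1{-z-\kappa\tau_m t_{11}},\qquad s=\frac1{-z-\kappa\tau_k t_{22}},\qquad T\begin{pmatrix}\alpha\kappa-\kappa r&\alpha\\ \alpha&\alpha\kappa-\kappa s\end{pmatrix}=I_2,$$ and $r,s,T$ extend analytically to $\mathbb D$. For $z\in\mathbb D$ let $\mathcal M(z)$ be the block matrix (with the same block shape as $\mathcal L$) $$\mathcal M(z)=\begin{pmatrix}r(z)I_m&0&0&0\\0&s(z)I_k&0&0\\0&0&t_{11}(z)I_n&t_{12}(z)I_n\\0&0&t_{21}(z)I_n&t_{22}(z)I_n\end{pmatrix}.$$ (1) For all $\eta,\varepsilon>0$ there is a constant $C$, depending only on $\tau_m,\tau_k,\eta,\varepsilon$, such that for all deterministic unit vectors $x,y\in\mathbb R^{m+k+2n}$, with overwhelming probability, $\mathcal L(z)$ is invertible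 for every $z\in\Omega_\eta$ and $$\sup_{z\in\Omega_\eta}\bigl|x^{\top}\mathcal G(z)y-x^{\top}\mathcal M(z)y\bigr|\le C\Bigl(n^{-1/2+\varepsilon}+\bigl|\tfrac nm-\tau_m\bigr|+\bigl|\tfrac nk-\tau_k\bigr|\Bigr).$$ In particular the bound is $O(n^{-1/2+\varepsilon})$ whenever $n/m-\tau_m$ and $n/k-\tau_k$ are $O(n^{-1/2+\varepsilon})$. (2) For every compact $K\subset(\lambda_*,\infty)$ and all $i,j\in\{1,2,3,4\}$ there is a deterministic sequence $\delta_n\to0$ such that, with overwhelming probability, $\mathcal L(z)$ is invertible for every $z\in K$ and $$\sup_{z\in K}\frac1n\bigl|\operatorname{Tr}\mathcal G^{(ij)}(z)-\operatorname{Tr}\mathcal M^{(ij)}(z)\bigr|\le\delta_n,$$ where $A^{(ij)}$ is the $(i,j)$ block of $A$ and $\operatorname{Tr}$ of a rectangular block is the sum of its diagonal entries (those with equal row and column number). -/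

import Mathlib

open Filter Topology MeasureTheory ProbabilityTheory
open scoped NNReal ENNReal

noncomputable section

namespace CCA

/-- The law of (the family of entries of) an `n × p` real matrix with i.i.d. entries
`N(0, 1/p)`. -/
def gaussianMatrix (n p : ℕ) : Measure (Fin n → Fin p → ℝ) :=
  Measure.pi fun _ : Fin n => Measure.pi fun _ : Fin p => gaussianReal 0 ((p : ℝ≥0)⁻¹)

/-- The null model: `U` (`n × m`, entries `N(0, 1/m)`) and `V` (`n × k`, entries `N(0, 1/k)`)
are independent Gaussian matrices. -/
def nullLaw (n m k : ℕ) :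
    Measure ((Fin n → Fin m → ℝ) × (Fin n → Fin k → ℝ)) :=
  (gaussianMatrix n m).prod (gaussianMatrix n k)

/-- The events `E n` hold with overwhelming probability: for every `A > 0` the complement of `E n`
has (outer) probability at most `n ^ (-A)` for all sufficiently large `n`. -/
def WithOverwhelmingProbability {Ω : ℕ → Type} [∀ n, MeasurableSpace (Ω n)]
    (P : ∀ n, Measure (Ω n)) (E : ∀ n, Set (Ω n)) : Prop :=
  ∀ A : ℝ, 0 < A → ∀ᶠ n : ℕ in atTop, P n (E n)ᶜ ≤ ENNReal.ofReal ((n : ℝ) ^ (-A))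

/-- The threshold `κ = (τ_m τ_k)^(-1/4)`. -/
def kappa (τm τk : ℝ) : ℝ := (τm * τk) ^ (-(1 / 4) : ℝ)

/-- `α = κ / (κ² - 1)`. -/
def alpha (τm τk : ℝ) : ℝ := kappa τm τk / (kappa τm τk ^ 2 - 1)

/-- `λ_* = (1 - κ²) / κ`. -/
def lambdaStar (τm τk : ℝ) : ℝ := (1 - kappa τm τk ^ 2) / kappa τm τk

/-- The index set of `(m + k + n + n)`-dimensional vectors, split into four blocks. -/
abbrev Idx (n m k : ℕ) : Type := (Fin m ⊕ Fin k) ⊕ (Fin n ⊕ Fin n)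

/-- The linearized matrix `L(z)`. -/
def lin (τm τk : ℝ) {n m k : ℕ} (U : Matrix (Fin n) (Fin m) ℝ) (V : Matrix (Fin n) (Fin k) ℝ)
    (z : ℂ) : Matrix (Idx n m k) (Idx n m k) ℂ :=
  let κ : ℝ := kappa τm τk
  let α : ℝ := alpha τm τk
  let U' : Matrix (Fin n) (Fin m) ℂ := ((√κ : ℝ) : ℂ) • U.map Complex.ofReal
  let V' : Matrix (Fin n) (Fin k) ℂ := ((√κ : ℝ) : ℂ) • V.map Complex.ofReal
  Matrix.fromBlocks
    (Matrix.fromBlocks ((-z) • 1) 0 0 ((-z) • 1))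
    (Matrix.fromBlocks U'.transpose 0 0 V'.transpose)
    (Matrix.fromBlocks U' 0 0 V')
    (Matrix.fromBlocks (((α * κ : ℝ) : ℂ) • 1) ((α : ℂ) • 1)
      ((α : ℂ) • 1) (((α * κ : ℝ) : ℂ) • 1))

/-- The linearized resolvent `G(z) = L(z)⁻¹`. -/
def resolvent (τm τk : ℝ) {n m k : ℕ} (U : Matrix (Fin n) (Fin m) ℝ)
    (V : Matrix (Fin n) (Fin k) ℝ) (z : ℂ) : Matrix (Idx n m k) (Idx n m k) ℂ :=
  (lin τm τk U V z)⁻¹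

/-- `(r, s, T)` with `r, s` in the upper half-plane solves the self-consistent system at `z`. -/
structure SolvesSystem (τm τk : ℝ) (z r s : ℂ) (T : Matrix (Fin 2) (Fin 2) ℂ) : Prop where
  im_r_pos : 0 < r.im
  im_s_pos : 0 < s.im
  eq_r : r = 1 / (-z - kappa τm τk * τm * T 0 0)
  eq_s : s = 1 / (-z - kappa τm τk * τk * T 1 1)
  eq_T : T * !![alpha τm τk * kappa τm τk - kappa τm τk * r, (alpha τm τk : ℂ);
                (alpha τm τk : ℂ), alpha τm τk * kappa τm τk - kappa τm τk * s] = 1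

/-- `𝔻 = ℂ \ (-∞, λ_*]`. -/
def slitDomain (τm τk : ℝ) : Set ℂ := {z | ¬(z.im = 0 ∧ z.re ≤ lambdaStar τm τk)}

/-- The functions `r, s, T` are analytic on `𝔻` and solve the system on the upper half-plane, that
is, they are the analytic extension to `𝔻` of the solution on the upper half-plane. -/
structure IsDetSolution (τm τk : ℝ) (r s : ℂ → ℂ) (T : ℂ → Matrix (Fin 2) (Fin 2) ℂ) :
    Prop where
  solves : ∀ z : ℂ, 0 < z.im → SolvesSystem τm τk z (r z) (s z) (T z)
  analytic_r : AnalyticOnNhd ℂ r (slitDomain τm τk)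
  analytic_s : AnalyticOnNhd ℂ s (slitDomain τm τk)
  analytic_T : ∀ i j, AnalyticOnNhd ℂ (fun z => T z i j) (slitDomain τm τk)

/-- The deterministic matrix `M` with blocks `r I_m`, `s I_k` and `T ⊗ I_n`. -/
def detMatrix (n m k : ℕ) (r s : ℂ) (T : Matrix (Fin 2) (Fin 2) ℂ) :
    Matrix (Idx n m k) (Idx n m k) ℂ :=
  Matrix.fromBlocks
    (Matrix.fromBlocks (r • 1) 0 0 (s • 1)) 0 0
    (Matrix.fromBlocks (T 0 0 • 1) (T 0 1 • 1) (T 1 0 • 1) (T 1 1 • 1))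

/-- `Ω_η`. -/
def Omega (η : ℝ) : Set ℂ := {z | η < z.im ∧ ‖z‖ < η⁻¹}

/-- The bilinear form `xᵀ A y` of real vectors `x, y` and a complex matrix `A`. -/
def bilin {ι : Type} [Fintype ι] (x : EuclideanSpace ℝ ι) (A : Matrix ι ι ℂ)
    (y : EuclideanSpace ℝ ι) : ℂ :=
  (fun i => (x i : ℂ)) ⬝ᵥ A.mulVec (fun i => (y i : ℂ))

/-- The sizes `m, k, n, n` of the four blocks. -/
def blockDim (n m k : ℕ) : Fin 4 → ℕ
  | 0 => m
  | 1 => k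
  | 2 => n
  | 3 => n

/-- The inclusion of the `i`-th block of indices. -/
def blockEmb (n m k : ℕ) : (i : Fin 4) → Fin (blockDim n m k i) → Idx n m k
  | 0, a => Sum.inl (Sum.inl a)
  | 1, a => Sum.inl (Sum.inr a)
  | 2, a => Sum.inr (Sum.inl a)
  | 3, a => Sum.inr (Sum.inr a)

/-- The block `A^{(ij)}`. -/
def block {n m k : ℕ} (A : Matrix (Idx n m k) (Idx n m k) ℂ) (i j : Fin 4) :
    Matrix (Fin (blockDim n m k i)) (Fin (blockDim n m k j)) ℂ :=
  A.submatrix (blockEmb n m k i) (blockEmb n m k j)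

/-- The sum of the diagonal entries of a possibly rectangular matrix; for a square matrix this is
the usual trace. -/
def diagSum {p q : ℕ} (A : Matrix (Fin p) (Fin q) ℂ) : ℂ :=
  ∑ a : Fin p, ∑ b : Fin q, if (a : ℕ) = (b : ℕ) then A a b else 0

theorem diagSum_eq_trace {p : ℕ} (A : Matrix (Fin p) (Fin p) ℂ) : diagSum A = A.trace := by
  simp [diagSum, Matrix.trace, Fin.val_inj]

end CCA

end

/-! Invertibility. Eliminating the last two block rows of L(z) leaves the Schur complement Q - z on
the first two, where Q is the real quadratic form -κ|Ua|² - κ|Vb|² + 2⟨Ua,Vb⟩ (`lin_identity`).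
Hence L(z) is invertible as soon as z keeps a distance d from the values of Q on unit vectors, and
then the resolvent is at most a constant times K²(1 + 1/d), where K ≥ 1 bounds the norms of U and V
(`resolvent_bound`). In the upper half-plane Im z supplies this distance. To the right of λ_* it
comes from Gordon's comparison theorem: Ua may be replaced by |a|h plus an error of norm about |a|,
with h a Gaussian vector, and similarly for Vb with an independent h'; since h and h' are nearly
orthogonal, completing a square bounds Q by λ_*(1 + o(1)) (`quad_le`, `gordon_edge`, `negl_edge`).

Concentration. A bilinear form of the resolvent has gradient of size n^(-1/2) in the Gaussian
entries. Rotating a Gaussian vector into an independent copy of itself turns this into bounds for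
all central moments (`lintegral_concentration`, `lintegral_bform_sub_pow`), and a grid of mesh 1/n
makes the resulting tail bound uniform on Ω_η (`stdG_sup_tail`).

The mean. Gaussian integration by parts shows that E = 𝔼G satisfies (L₀ - ψ(E))E = 1 + O(n^(-1/2)),
where ψ(E) involves only block traces (`schwinger_dyson`, `norm_selfConsistent_le`). The matrix L₀ -
ψ(E) is therefore scalar on blocks, and so is its exact inverse, which lies close to E; reading off
its entries gives an approximate solution of the limiting system (`approx_system`).

Stability. Taking imaginary parts in the system exhibits (Im r, Im s) as a positive vector that a
matrix of squared moduli contracts strictly. By Cauchy–Schwarz the map governing the difference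
between an exact and an approximate solution is then a contraction in a weighted norm
(`system_stable`). With error zero this is uniqueness; existence follows by compactness from the
approximate solutions of the finite models (`exists_solution`); and E is close to M
(`norm_expG_sub_le`). Together with concentration this is the local law (`local_law`).

Beyond the half-plane. For good realizations the resolvent entries are analytic and bounded away
from (-∞, λ_*], and they are close to the solution in the upper half-plane. A disc around x + i of
radius slightly above 1 contains x and avoids the half-line; Cauchy's estimates on this disc and on
a small concentric one carry smallness down to the real line (`norm_le_discBound`). Applied to a
sequence of realizations this produces the analytic extension (`exists_continuation`,
`exists_isDetSolution`); applied to a single good realization it compares every entry of the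
resolvent with that of M, and hence the traces (`Good.norm_entry_sub_le`). -/

noncomputable section

namespace CCA

/-! ### Standard Gaussian vectors -/

/-- The law of a family of independent standard Gaussian variables. -/
def stdG (ι : Type*) [Fintype ι] : Measure (ι → ℝ) :=
  Measure.pi fun _ : ι => gaussianReal 0 1

section StdG

variable {ι : Type*} [Fintype ι]

instance : IsProbabilityMeasure (stdG ι) := by unfold stdG; infer_instance

lemma stdG_eq_map_stdGaussian :
    stdG ι = (stdGaussian (EuclideanSpace ℝ ι)).map (EuclideanSpace.equiv ι ℝ) := by
  rw [← map_pi_eq_stdGaussian, Measure.map_map (by fun_prop) (by fun_prop)]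
  exact (Measure.map_id).symm

instance : IsGaussian (stdG ι) := by
  rw [stdG_eq_map_stdGaussian]; infer_instance

lemma stdG_dual_zero (L : StrongDual ℝ (ι → ℝ)) : ∫ x, L x ∂(stdG ι) = 0 := by
  rw [stdG_eq_map_stdGaussian, integral_map (by fun_prop) (by fun_prop)]
  exact integral_strongDual_stdGaussian
    (L.comp (EuclideanSpace.equiv ι ℝ : EuclideanSpace ℝ ι →L[ℝ] (ι → ℝ)))

lemma stdG_map_dual (L : StrongDual ℝ (ι → ℝ)) [DecidableEq ι] :
    (stdG ι).map L = gaussianReal 0 (∑ i, L (Pi.single i 1) ^ 2).toNNReal := by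
  rw [IsGaussian.map_eq_gaussianReal, stdG_dual_zero]
  congr
  obtain ⟨c, hc⟩ : ∃ c : ι → ℝ, ∀ i, L (Pi.single i 1) = c i := ⟨_, fun i => rfl⟩
  have h : (L : (ι → ℝ) → ℝ) = ∑ i, fun x : ι → ℝ => c i * x i := by
    ext x
    conv_lhs => rw [pi_eq_sum_univ' x]
    simp [map_sum, Finset.sum_apply, mul_comm, ← hc]
  simp only [hc]
  rw [h, stdG, variance_sum_pi]
  · refine Finset.sum_congr rfl fun i _ => ?_
    change Var[fun x => _ * (id x); gaussianReal 0 1] = _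
    rw [variance_const_mul, variance_id_gaussianReal]; simp
  · exact fun i => (IsGaussian.memLp_two_id).const_mul _

lemma gaussianReal_eq_map (v : ℝ≥0) :
    gaussianReal 0 v = (gaussianReal 0 1).map (fun t => √v * t) := by
  rw [gaussianReal_map_const_mul]
  congr 1
  · simp
  · ext; simp

/-- Absolute moments of the standard Gaussian. -/
def gMom (q : ℕ) : ℝ≥0∞ := ∫⁻ t, ‖t‖ₑ ^ q ∂(gaussianReal 0 1)

lemma gMom_lt_top (q : ℕ) : gMom q < ∞ := by
  rcases Nat.eq_zero_or_pos q with rfl | hq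
  · simp [gMom]
  have h := (memLp_id_gaussianReal (μ := 0) (v := 1) q).eLpNorm_lt_top
  rw [eLpNorm_lt_top_iff_lintegral_rpow_enorm_lt_top (by simpa using hq.ne') (by simp)] at h
  simpa [gMom] using h

/-- A linear functional of a standard Gaussian vector is a centred Gaussian whose standard deviation
is the Euclidean norm of its coefficients, so its moments are those of one variable, rescaled. -/
lemma lintegral_dual_pow [DecidableEq ι] (L : StrongDual ℝ (ι → ℝ)) (q : ℕ) :
    ∫⁻ y, ‖L y‖ₑ ^ q ∂(stdG ι) =
      gMom q * ENNReal.ofReal (√(∑ i, L (Pi.single i 1) ^ 2)) ^ q := by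
  have h : ∫⁻ y, ‖L y‖ₑ ^ q ∂(stdG ι) = ∫⁻ t, ‖t‖ₑ ^ q ∂((stdG ι).map L) := by
    rw [lintegral_map (by fun_prop) (by fun_prop)]
  rw [h, stdG_map_dual, gaussianReal_eq_map, lintegral_map (by fun_prop) (by fun_prop), gMom,
    mul_comm, ← lintegral_const_mul _ (by fun_prop)]
  refine lintegral_congr fun t => ?_
  rw [enorm_mul, mul_pow, Real.enorm_of_nonneg (by positivity),
    Real.coe_toNNReal _ (Finset.sum_nonneg fun i _ => sq_nonneg _)]

/-- Resampling one coordinate does not change the law. This reduces integration by parts in many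
variables to the one-dimensional formula on almost every line. -/
lemma measurePreserving_update [DecidableEq ι] (e : ι) :
    MeasurePreserving (fun p : (ι → ℝ) × ℝ => Function.update p.1 e p.2)
      ((stdG ι).prod (gaussianReal 0 1)) (stdG ι) := by
  have hm : Measurable (fun p : (ι → ℝ) × ℝ => Function.update p.1 e p.2) := by
    refine measurable_pi_iff.2 fun i => ?_
    by_cases h : i = e
    · subst h; simpa using measurable_snd
    · simp only [Function.update_of_ne h]; fun_prop
  refine ⟨hm, ?_⟩
  refine (Measure.pi_eq fun s hs => ?_).symm
  rw [Measure.map_apply hm (MeasurableSet.univ_pi hs)]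
  have : (fun p : (ι → ℝ) × ℝ => Function.update p.1 e p.2) ⁻¹' (Set.univ.pi s) =
      (Set.univ.pi (Function.update s e Set.univ)) ×ˢ s e := by
    ext ⟨x, t⟩
    simp only [Set.mem_preimage, Set.mem_pi, Set.mem_univ, forall_const, Set.mem_prod]
    constructor
    · intro h
      refine ⟨fun i => ?_, by simpa using h e⟩
      by_cases hi : i = e
      · subst hi; simp
      · simpa [hi] using h i
    · rintro ⟨h1, h2⟩ i
      by_cases hi : i = e
      · subst hi; simpa using h2
      · simpa [hi] using h1 i
  rw [this, Measure.prod_prod, stdG, Measure.pi_pi, mul_comm,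
    ← Finset.mul_prod_erase _ _ (Finset.mem_univ e),
    ← Finset.mul_prod_erase (s := Finset.univ) (f := fun i => (gaussianReal 0 1) (s i))
      (Finset.mem_univ e)]
  congr 1
  simp only [Function.update_self, measure_univ, one_mul]
  refine Finset.prod_congr rfl fun i hi => ?_
  rw [Function.update_of_ne (Finset.ne_of_mem_erase hi)]

variable {F : Type*} [NormedAddCommGroup F] [NormedSpace ℝ F]

lemma hasDerivAt_gaussianPDFReal (t : ℝ) :
    HasDerivAt (gaussianPDFReal 0 1) (-t * gaussianPDFReal 0 1 t) t := by
  unfold gaussianPDFReal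
  have h : HasDerivAt (fun x : ℝ => -(x - 0) ^ 2 / (2 * ((1 : ℝ≥0) : ℝ))) (-t) t := by
    have := (((hasDerivAt_id t).sub_const 0).pow 2).neg.div_const (2 * ((1 : ℝ≥0) : ℝ))
    refine this.congr_deriv ?_
    simp; ring
  exact ((h.exp).const_mul _).congr_deriv (by ring)

/-- Gaussian integration by parts in one variable. -/
lemma integral_mul_gaussianReal [CompleteSpace F] {g g' : ℝ → F} (hg : ∀ t, HasDerivAt g (g' t) t)
    (h0 : Integrable g (gaussianReal 0 1)) (h1 : Integrable (fun t => t • g t) (gaussianReal 0 1))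
    (h2 : Integrable g' (gaussianReal 0 1)) :
    ∫ t, t • g t ∂(gaussianReal 0 1) = ∫ t, g' t ∂(gaussianReal 0 1) := by
  have key : ∀ f : ℝ → F, Integrable f (gaussianReal 0 1) →
      Integrable (fun t => gaussianPDFReal 0 1 t • f t) := by
    intro f hf
    rw [gaussianReal_of_var_ne_zero _ one_ne_zero,
      integrable_withDensity_iff_integrable_smul' (measurable_gaussianPDF _ _)
        (ae_of_all _ fun _ => gaussianPDF_lt_top)] at hf
    simpa [toReal_gaussianPDF] using hf
  rw [integral_gaussianReal_eq_integral_smul one_ne_zero,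
    integral_gaussianReal_eq_integral_smul one_ne_zero]
  -- The Gaussian density φ satisfies φ' = -tφ; integrability of all the products makes the boundary
  -- terms at infinity vanish.
  have := integral_bilinear_hasDerivAt_right_eq_neg_left_of_integrable
    (L := ContinuousLinearMap.lsmul ℝ ℝ) (u := gaussianPDFReal 0 1)
    (u' := fun t => -t * gaussianPDFReal 0 1 t) (v := g) (v' := g')
    (fun t _ => hasDerivAt_gaussianPDFReal t) (fun t _ => hg t) (key _ h2) ?_ (key _ h0)
  · simp only [ContinuousLinearMap.lsmul_apply] at this
    rw [this, ← integral_neg]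
    refine integral_congr_ae (ae_of_all _ fun t => ?_)
    simp only [smul_smul, neg_mul, neg_smul, neg_neg]
    rw [mul_comm]
  · refine (key _ h1).neg.congr (ae_of_all _ fun t => ?_)
    simp only [Pi.neg_apply, ContinuousLinearMap.lsmul_apply, smul_smul, neg_mul, neg_smul]
    rw [mul_comm]

/-- Gaussian integration by parts. -/
lemma integral_mul_stdG [DecidableEq ι] [CompleteSpace F] (e : ι) {f f' : (ι → ℝ) → F}
    (hf : ∀ x t, HasDerivAt (fun s => f (Function.update x e s)) (f' (Function.update x e t)) t)
    (h0 : Integrable f (stdG ι)) (h1 : Integrable (fun x => x e • f x) (stdG ι))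
    (h2 : Integrable f' (stdG ι)) :
    ∫ x, x e • f x ∂(stdG ι) = ∫ x, f' x ∂(stdG ι) := by
  have mp := measurePreserving_update (ι := ι) e
  have tr : ∀ g : (ι → ℝ) → F, Integrable g (stdG ι) →
      Integrable (fun p : (ι → ℝ) × ℝ => g (Function.update p.1 e p.2))
        ((stdG ι).prod (gaussianReal 0 1)) ∧
      ∫ x, g x ∂(stdG ι) = ∫ x, ∫ t, g (Function.update x e t) ∂(gaussianReal 0 1) ∂(stdG ι) := by
    intro g hg
    have hi : Integrable (fun p : (ι → ℝ) × ℝ => g (Function.update p.1 e p.2))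
        ((stdG ι).prod (gaussianReal 0 1)) := mp.integrable_comp_of_integrable hg
    refine ⟨hi, ?_⟩
    rw [← integral_prod _ hi]
    conv_lhs => rw [← mp.map_eq]
    rw [integral_map mp.measurable.aemeasurable]
    rw [mp.map_eq]; exact hg.1
  rw [(tr _ h1).2, (tr _ h2).2]
  refine integral_congr_ae ?_
  filter_upwards [(tr _ h0).1.prod_right_ae, (tr _ h1).1.prod_right_ae,
    (tr _ h2).1.prod_right_ae] with x a0 a1 a2
  simp only [Function.update_self] at a1 ⊢
  exact integral_mul_gaussianReal (hf x) a0 a1 a2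

end StdG

/-! ### Concentration of smooth functions -/

/-- Hölder's inequality against the constant 1. The total mass is kept because the bound is applied
to Lebesgue measure on an interval, to counting measure and to probability measures. -/
lemma lintegral_pow_le {α : Type*} [MeasurableSpace α] (μ : Measure α) {f : α → ℝ≥0∞}
    (hf : AEMeasurable f μ) (q : ℕ) :
    (∫⁻ a, f a ∂μ) ^ (q + 1) ≤ μ Set.univ ^ q * ∫⁻ a, f a ^ (q + 1) ∂μ := by
  rcases Nat.eq_zero_or_pos q with rfl | hq
  · simp
  have hq' : (0 : ℝ) < q := by exact_mod_cast hq
  have hpq : ((q : ℝ) + 1).HolderConjugate (((q : ℝ) + 1) / q) := by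
    rw [Real.holderConjugate_iff]; constructor
    · linarith
    · field_simp; ring
  have h := ENNReal.lintegral_mul_le_Lp_mul_Lq μ hpq hf (g := fun _ => 1) aemeasurable_const
  simp only [Pi.mul_apply, mul_one, ENNReal.one_rpow, lintegral_const, one_mul] at h
  calc (∫⁻ a, f a ∂μ) ^ (q + 1) ≤ _ := pow_le_pow_left' h (q + 1)
    _ = μ Set.univ ^ q * ∫⁻ a, f a ^ (q + 1) ∂μ := by
      rw [mul_pow, ← ENNReal.rpow_natCast, ← ENNReal.rpow_natCast, ← ENNReal.rpow_mul,
        ← ENNReal.rpow_mul, mul_comm]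
      congr 1
      · rw [← ENNReal.rpow_natCast]; congr 1; push_cast; field_simp
      · have : 1 / ((q : ℝ) + 1) * ((q + 1 : ℕ) : ℝ) = 1 := by push_cast; field_simp
        rw [this, ENNReal.rpow_one]
        refine lintegral_congr fun a => ?_
        rw [← ENNReal.rpow_natCast]; push_cast; rfl

section Conc

variable {ι : Type*} [Fintype ι]
variable {F : Type*} [NormedAddCommGroup F] [NormedSpace ℝ F] [CompleteSpace F]

/-- The path cos θ · x + sin θ · y leads from x to y for θ in [0, π/2], and its velocity is the
second component of the same rotation. For Gaussian x and y, position and velocity are therefore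
independent at every θ. -/
lemma sub_eq_integral_rotation {f : (ι → ℝ) → F} (hf : ContDiff ℝ 1 f) (p : (ι → ℝ) × (ι → ℝ)) :
    f p.2 - f p.1 = ∫ θ in (0 : ℝ)..(Real.pi / 2),
      fderiv ℝ f (ContinuousLinearMap.rotation θ p).1 (ContinuousLinearMap.rotation θ p).2 := by
  have hd : ∀ θ : ℝ, HasDerivAt (fun θ : ℝ => f (ContinuousLinearMap.rotation θ p).1)
      (fderiv ℝ f (ContinuousLinearMap.rotation θ p).1 (ContinuousLinearMap.rotation θ p).2) θ := by
    intro θ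
    have h1 : HasDerivAt (fun θ : ℝ => (ContinuousLinearMap.rotation θ p).1)
        (ContinuousLinearMap.rotation θ p).2 θ := by
      simp only [ContinuousLinearMap.rotation_apply]
      exact ((Real.hasDerivAt_cos θ).smul_const p.1).add ((Real.hasDerivAt_sin θ).smul_const p.2)
    exact ((hf.differentiable one_ne_zero).differentiableAt.hasFDerivAt.comp_hasDerivAt θ h1)
  rw [intervalIntegral.integral_eq_sub_of_hasDerivAt (fun θ _ => hd θ)]
  · simp [ContinuousLinearMap.rotation_apply]
  · refine Continuous.intervalIntegrable ?_ _ _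
    have h1 : Continuous fun θ : ℝ => (ContinuousLinearMap.rotation θ p).1 := by
      simp only [ContinuousLinearMap.rotation_apply]; fun_prop
    have h2 : Continuous fun θ : ℝ => (ContinuousLinearMap.rotation θ p).2 := by
      simp only [ContinuousLinearMap.rotation_apply]; fun_prop
    exact ((hf.continuous_fderiv one_ne_zero).comp h1).clm_apply h2

lemma stdG_map_rotation (θ : ℝ) :
    ((stdG ι).prod (stdG ι)).map (ContinuousLinearMap.rotation θ) = (stdG ι).prod (stdG ι) :=
  IsGaussian.map_rotation_eq_self_of_forall_strongDual_eq_zero stdG_dual_zero θ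

/-- The Maurey–Pisier argument: Hölder in θ, Fubini, and the rotation invariance of the Gaussian
pair, which makes the integral over the pair independent of θ. -/
lemma lintegral_sub_pow_le {f : (ι → ℝ) → F} (hf : ContDiff ℝ 1 f) (q : ℕ) :
    ∫⁻ p, ‖f p.2 - f p.1‖ₑ ^ (q + 1) ∂((stdG ι).prod (stdG ι)) ≤
      ENNReal.ofReal (Real.pi / 2) ^ (q + 1) *
        ∫⁻ p, ‖fderiv ℝ f p.1 p.2‖ₑ ^ (q + 1) ∂((stdG ι).prod (stdG ι)) := by
  obtain ⟨R, hR⟩ : ∃ R : ℝ → (ι → ℝ) × (ι → ℝ) → (ι → ℝ) × (ι → ℝ),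
    R = fun θ p => ContinuousLinearMap.rotation θ p := ⟨_, rfl⟩
  have hRc : Continuous (Function.uncurry R) := by
    simp only [hR, Function.uncurry_def, ContinuousLinearMap.rotation_apply]; fun_prop
  obtain ⟨D, hD⟩ : ∃ D : (ι → ℝ) × (ι → ℝ) → ℝ≥0∞, D = fun p => ‖fderiv ℝ f p.1 p.2‖ₑ := ⟨_, rfl⟩
  have hDc : Continuous D := by
    have : Continuous fun p : (ι → ℝ) × (ι → ℝ) => fderiv ℝ f p.1 p.2 :=
      ((hf.continuous_fderiv one_ne_zero).comp continuous_fst).clm_apply continuous_snd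
    rw [hD]; exact this.enorm
  set ν := (volume : Measure ℝ).restrict (Set.Ioc 0 (Real.pi / 2)) with hν
  have hνu : ν Set.univ = ENNReal.ofReal (Real.pi / 2) := by simp [hν]
  have pt : ∀ p : (ι → ℝ) × (ι → ℝ), ‖f p.2 - f p.1‖ₑ ^ (q + 1) ≤
      ν Set.univ ^ q * ∫⁻ θ, D (R θ p) ^ (q + 1) ∂ν := by
    intro p
    have hm : Measurable fun θ => D (R θ p) :=
      (hDc.comp (hRc.comp (by fun_prop : Continuous fun θ : ℝ => (θ, p)))).measurable
    refine le_trans (pow_le_pow_left' ?_ _) (lintegral_pow_le ν hm.aemeasurable q)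
    rw [sub_eq_integral_rotation hf p, intervalIntegral.integral_of_le (by positivity)]
    refine (enorm_integral_le_lintegral_enorm _).trans (le_of_eq ?_)
    rw [hD, hR]
  have hmm : Measurable fun z : ((ι → ℝ) × (ι → ℝ)) × ℝ => D (R z.2 z.1) ^ (q + 1) := by
    have : Continuous fun z : ((ι → ℝ) × (ι → ℝ)) × ℝ => D (R z.2 z.1) :=
      hDc.comp (hRc.comp (by fun_prop : Continuous fun z : ((ι → ℝ) × (ι → ℝ)) × ℝ => (z.2, z.1)))
    exact this.measurable.pow_const _
  calc _ ≤ ∫⁻ p, ν Set.univ ^ q * ∫⁻ θ, D (R θ p) ^ (q + 1) ∂ν ∂((stdG ι).prod (stdG ι)) :=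
        lintegral_mono pt
    _ = ν Set.univ ^ q * ∫⁻ θ, ∫⁻ p, D (R θ p) ^ (q + 1) ∂((stdG ι).prod (stdG ι)) ∂ν := by
        have h1 : Measurable fun p => ∫⁻ θ, D (R θ p) ^ (q + 1) ∂ν := hmm.lintegral_prod_right'
        have h2 := lintegral_lintegral_swap (μ := (stdG ι).prod (stdG ι)) (ν := ν)
          (f := fun p θ => D (R θ p) ^ (q + 1)) hmm.aemeasurable
        rw [lintegral_const_mul _ h1, h2]
    _ = ν Set.univ ^ q * ∫⁻ _θ, ∫⁻ p, D p ^ (q + 1) ∂((stdG ι).prod (stdG ι)) ∂ν := by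
        congr 1
        refine lintegral_congr fun θ => ?_
        have h := lintegral_map (μ := (stdG ι).prod (stdG ι)) (f := fun p => D p ^ (q + 1))
          (hDc.measurable.pow_const _) (ContinuousLinearMap.rotation θ).continuous.measurable
        rw [stdG_map_rotation] at h
        rw [h, hR]
    _ = _ := by
        rw [hD]
        rw [lintegral_const, hνu, pow_succ]; ring

/-- Moment form of Gaussian concentration. -/
lemma lintegral_sub_integral_pow_le {f : (ι → ℝ) → F} (hf : ContDiff ℝ 1 f)
    (hi : Integrable f (stdG ι)) (q : ℕ) :
    ∫⁻ x, ‖f x - ∫ y, f y ∂(stdG ι)‖ₑ ^ (q + 1) ∂(stdG ι) ≤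
      ENNReal.ofReal (Real.pi / 2) ^ (q + 1) *
        ∫⁻ x, ∫⁻ y, ‖fderiv ℝ f x y‖ₑ ^ (q + 1) ∂(stdG ι) ∂(stdG ι) := by
  have hm : Measurable fun p : (ι → ℝ) × (ι → ℝ) => ‖fderiv ℝ f p.1 p.2‖ₑ ^ (q + 1) := by
    have : Continuous fun p : (ι → ℝ) × (ι → ℝ) => fderiv ℝ f p.1 p.2 :=
      ((hf.continuous_fderiv one_ne_zero).comp continuous_fst).clm_apply continuous_snd
    exact this.enorm.measurable.pow_const _
  have hm2 : Measurable fun p : (ι → ℝ) × (ι → ℝ) => ‖f p.2 - f p.1‖ₑ ^ (q + 1) :=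
    ((hf.continuous.comp continuous_snd).sub
      (hf.continuous.comp continuous_fst)).enorm.measurable.pow_const _
  rw [← lintegral_prod _ hm.aemeasurable]
  refine le_trans ?_ (lintegral_sub_pow_le hf q)
  rw [lintegral_prod _ hm2.aemeasurable]
  refine lintegral_mono fun x => ?_
  -- The mean is an average over an independent copy, so the centred moment is controlled by the
  -- difference of two copies.
  have h1 : ‖f x - ∫ y, f y ∂(stdG ι)‖ₑ ≤ ∫⁻ y, ‖f y - f x‖ₑ ∂(stdG ι) := by
    have : f x - ∫ y, f y ∂(stdG ι) = - ∫ y, (f y - f x) ∂(stdG ι) := by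
      rw [integral_sub hi (integrable_const _)]; simp
    rw [this, enorm_neg]
    exact enorm_integral_le_lintegral_enorm _
  refine (pow_le_pow_left' h1 _).trans ?_
  refine (lintegral_pow_le (stdG ι) ?_ q).trans ?_
  · exact (hf.continuous.sub continuous_const).enorm.measurable.aemeasurable
  · simp

/-- Concentration of complex functions with a bound on the gradient. -/
lemma lintegral_concentration [DecidableEq ι] {f : (ι → ℝ) → ℂ} (hf : ContDiff ℝ 1 f)
    (hi : Integrable f (stdG ι)) (q : ℕ) {g : (ι → ℝ) → ℝ} (hg0 : ∀ x, 0 ≤ g x)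
    (hg : ∀ x, ∑ e, ‖fderiv ℝ f x (Pi.single e 1)‖ ^ 2 ≤ g x ^ 2) :
    ∫⁻ x, ‖f x - ∫ y, f y ∂(stdG ι)‖ₑ ^ (q + 1) ∂(stdG ι) ≤
      ENNReal.ofReal (Real.pi / 2) ^ (q + 1) * (2 ^ (q + 1) * gMom (q + 1)) *
        ∫⁻ x, ENNReal.ofReal (g x) ^ (q + 1) ∂(stdG ι) := by
  refine (lintegral_sub_integral_pow_le hf hi q).trans ?_
  rw [mul_assoc]
  gcongr
  rw [← lintegral_const_mul' _ _ (ENNReal.mul_ne_top (by finiteness) (gMom_lt_top _).ne)]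
  refine lintegral_mono fun x => ?_
  -- For fixed x, the real and imaginary parts of the derivative are real Gaussian variables in the
  -- direction y, each of variance at most `g x ^ 2`.
  set Lr : StrongDual ℝ (ι → ℝ) := Complex.reCLM.comp (fderiv ℝ f x) with hLr
  set Li : StrongDual ℝ (ι → ℝ) := Complex.imCLM.comp (fderiv ℝ f x) with hLi
  have pt : ∀ y, ‖fderiv ℝ f x y‖ₑ ^ (q + 1) ≤
      2 ^ q * (‖Lr y‖ₑ ^ (q + 1) + ‖Li y‖ₑ ^ (q + 1)) := by
    intro y
    have h1 : ‖fderiv ℝ f x y‖ₑ ≤ ‖Lr y‖ₑ + ‖Li y‖ₑ := by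
      rw [← ofReal_norm, ← ofReal_norm, ← ofReal_norm,
        ← ENNReal.ofReal_add (norm_nonneg _) (norm_nonneg _)]
      exact ENNReal.ofReal_le_ofReal (Complex.norm_le_abs_re_add_abs_im _)
    refine (pow_le_pow_left' h1 _).trans ?_
    have := ENNReal.rpow_add_le_mul_rpow_add_rpow ‖Lr y‖ₑ ‖Li y‖ₑ (p := ((q + 1 : ℕ) : ℝ))
      (by simp)
    simp only [ENNReal.rpow_natCast] at this
    refine this.trans (le_of_eq ?_)
    push_cast
    rw [add_sub_cancel_right, ENNReal.rpow_natCast]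
  have key : ∀ Lx : StrongDual ℝ (ι → ℝ), (∀ y, |Lx y| ≤ ‖fderiv ℝ f x y‖) →
      ∫⁻ y, ‖Lx y‖ₑ ^ (q + 1) ∂(stdG ι) ≤ gMom (q + 1) * ENNReal.ofReal (g x) ^ (q + 1) := by
    intro Lx hLx
    rw [lintegral_dual_pow]
    gcongr
    refine Real.sqrt_le_iff.2 ⟨hg0 x, le_trans ?_ (hg x)⟩
    refine Finset.sum_le_sum fun e _ => ?_
    rw [← sq_abs]
    exact pow_le_pow_left₀ (abs_nonneg _) (hLx _) 2
  calc _ ≤ ∫⁻ y, 2 ^ q * (‖Lr y‖ₑ ^ (q + 1) + ‖Li y‖ₑ ^ (q + 1)) ∂(stdG ι) := lintegral_mono pt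
    _ = 2 ^ q * (∫⁻ y, ‖Lr y‖ₑ ^ (q + 1) ∂(stdG ι) + ∫⁻ y, ‖Li y‖ₑ ^ (q + 1) ∂(stdG ι)) := by
        rw [lintegral_const_mul _ (by fun_prop), lintegral_add_left (by fun_prop)]
    _ ≤ 2 ^ q * (gMom (q + 1) * ENNReal.ofReal (g x) ^ (q + 1) +
          gMom (q + 1) * ENNReal.ofReal (g x) ^ (q + 1)) := by
        gcongr
        · exact key Lr fun y => Complex.abs_re_le_norm _
        · exact key Li fun y => Complex.abs_im_le_norm _
    _ = _ := by ring

end Conc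

end CCA

end


noncomputable section

namespace CCA

/-! ### Gaussian comparison -/

section Interpolation

variable {ι : Type*} [Fintype ι] [DecidableEq ι]
variable {E : Type*} [NormedAddCommGroup E] [NormedSpace ℝ E]

lemma integrable_stdG_of_bounded {f : (ι → ℝ) → ℝ} (hf : Continuous f) {C : ℝ}
    (hC : ∀ x, |f x| ≤ C) : Integrable f (stdG ι) :=
  Integrable.of_bound hf.measurable.aestronglyMeasurable C (ae_of_all _ hC)

lemma integrable_coord (e : ι) : Integrable (fun x : ι → ℝ => x e) (stdG ι) :=
  (ContinuousLinearMap.proj (R := ℝ) (φ := fun _ : ι => ℝ) e).integrable_comp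
    (IsGaussian.integrable_id (μ := stdG ι))

lemma integrable_coord_mul_of_bounded (e : ι) {f : (ι → ℝ) → ℝ} (hf : Continuous f) {C : ℝ}
    (hC : ∀ x, |f x| ≤ C) : Integrable (fun x => x e • f x) (stdG ι) :=
  (integrable_coord e).mul_bdd (c := C) hf.measurable.aestronglyMeasurable (ae_of_all _ hC)

/-- Gaussian integration by parts along a linear image. -/
lemma integral_fderiv_linear {F1 : E → E →L[ℝ] ℝ} {F2 : E → E →L[ℝ] E →L[ℝ] ℝ}
    (h1 : ∀ z, HasFDerivAt F1 (F2 z) z) (hF2 : Continuous F2) {C1 C2 : ℝ}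
    (hC1 : ∀ z, ‖F1 z‖ ≤ C1) (hC2 : ∀ z, ‖F2 z‖ ≤ C2) (B B' : (ι → ℝ) →L[ℝ] E) :
    Integrable (fun x => F1 (B x) (B' x)) (stdG ι) ∧
    ∫ x, F1 (B x) (B' x) ∂(stdG ι) =
      ∫ x, ∑ e, F2 (B x) (B (Pi.single e 1)) (B' (Pi.single e 1)) ∂(stdG ι) := by
  have hF1 : Continuous F1 := continuous_iff_continuousAt.2 fun z => (h1 z).continuousAt
  -- Expanding `B' x` in coordinates writes the integrand as a sum of terms `x e` times a bounded
  -- function, the form required by integration by parts.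
  have hexp : ∀ x : ι → ℝ, F1 (B x) (B' x) =
      ∑ e, x e • F1 (B x) (B' (Pi.single e 1)) := by
    intro x
    conv_lhs => rw [show B' x = ∑ e, x e • B' (Pi.single e 1) by
      conv_lhs => rw [pi_eq_sum_univ' x]
      simp [map_sum]]
    simp [map_sum]
  have bd1 : ∀ e, ∀ x : ι → ℝ, |F1 (B x) (B' (Pi.single e 1))| ≤ C1 * ‖B' (Pi.single e 1)‖ :=
    fun e x => ((F1 (B x)).le_opNorm _).trans (by gcongr; exact hC1 _)
  have c1 : ∀ e, Continuous fun x : ι → ℝ => F1 (B x) (B' (Pi.single e 1)) := fun e =>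
    (hF1.comp B.continuous).clm_apply continuous_const
  have i1 := fun e => integrable_coord_mul_of_bounded e (c1 e) (bd1 e)
  have bd2 : ∀ e, ∀ x : ι → ℝ, |F2 (B x) (B (Pi.single e 1)) (B' (Pi.single e 1))| ≤
      C2 * ‖B (Pi.single e 1)‖ * ‖B' (Pi.single e 1)‖ :=
    fun e x => ((F2 (B x)).le_opNorm₂ _ _).trans (by gcongr; exact hC2 _)
  have c2 : ∀ e, Continuous fun x : ι → ℝ => F2 (B x) (B (Pi.single e 1)) (B' (Pi.single e 1)) :=
    fun e => ((hF2.comp B.continuous).clm_apply continuous_const).clm_apply continuous_const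
  have i2 := fun e => integrable_stdG_of_bounded (c2 e) (bd2 e)
  simp only [hexp]
  refine ⟨integrable_finsetSum _ fun e _ => i1 e, ?_⟩
  rw [integral_finsetSum _ fun e _ => i1 e, integral_finsetSum _ fun e _ => i2 e]
  refine Finset.sum_congr rfl fun e _ => ?_
  refine integral_mul_stdG e (fun x t => ?_) (integrable_stdG_of_bounded (c1 e) (bd1 e)) (i1 e)
    (i2 e)
  have hu : HasDerivAt (fun s => B (Function.update x e s)) (B (Pi.single e 1)) t :=
    B.hasFDerivAt.comp_hasDerivAt t (hasDerivAt_update x e t)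
  have := (h1 (B (Function.update x e t))).comp_hasDerivAt t hu
  exact (ContinuousLinearMap.apply ℝ ℝ (B' (Pi.single e 1))).hasFDerivAt.comp_hasDerivAt t this

/-- Comparison of the Gaussian vectors `A x` and `C x`, which depend on disjoint sets of
coordinates, for a test function with suitable second derivatives. -/
lemma integral_comparison {F : E → ℝ} {F1 : E → E →L[ℝ] ℝ} {F2 : E → E →L[ℝ] E →L[ℝ] ℝ}
    (h0 : ∀ z, HasFDerivAt F (F1 z) z)
    (h1 : ∀ z, HasFDerivAt F1 (F2 z) z) (hF2 : Continuous F2) {C0 C1 C2 : ℝ}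
    (hC0 : ∀ z, |F z| ≤ C0) (hC1 : ∀ z, ‖F1 z‖ ≤ C1) (hC2 : ∀ z, ‖F2 z‖ ≤ C2)
    (A C : (ι → ℝ) →L[ℝ] E)
    (hAC : ∀ e, A (Pi.single e 1) = 0 ∨ C (Pi.single e 1) = 0)
    (hle : ∀ z, ∑ e, F2 z (C (Pi.single e 1)) (C (Pi.single e 1)) ≤
      ∑ e, F2 z (A (Pi.single e 1)) (A (Pi.single e 1))) :
    ∫ x, F (C x) ∂(stdG ι) ≤ ∫ x, F (A x) ∂(stdG ι) := by
  have hF : Continuous F := continuous_iff_continuousAt.2 fun z => (h0 z).continuousAt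
  have hF1 : Continuous F1 := continuous_iff_continuousAt.2 fun z => (h1 z).continuousAt
  -- The interpolation from A at θ = 0 to C at θ = π/2. The claim follows once the expectation of F
  -- along it is nonincreasing.
  set B : ℝ → (ι → ℝ) →L[ℝ] E := fun θ => Real.cos θ • A + Real.sin θ • C with hB
  set B' : ℝ → (ι → ℝ) →L[ℝ] E := fun θ => (-Real.sin θ) • A + Real.cos θ • C with hB'
  have hBd : ∀ θ x, HasDerivAt (fun θ => B θ x) (B' θ x) θ := fun θ x => by
    simp only [hB, hB', add_apply, smul_apply]
    exact ((Real.hasDerivAt_cos θ).smul_const _).add ((Real.hasDerivAt_sin θ).smul_const _)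
  have hB'n : ∀ θ x, ‖B' θ x‖ ≤ (‖A‖ + ‖C‖) * ‖x‖ := fun θ x => by
    refine ((B' θ).le_opNorm x).trans ?_
    gcongr
    refine (norm_add_le _ _).trans (add_le_add ?_ ?_)
    · rw [norm_smul]
      exact mul_le_of_le_one_left (norm_nonneg _) (by simpa using Real.abs_sin_le_one θ)
    · rw [norm_smul]
      exact mul_le_of_le_one_left (norm_nonneg _) (by simpa using Real.abs_cos_le_one θ)
  have hC1' : 0 ≤ C1 := (norm_nonneg _).trans (hC1 0)
  have hder : ∀ θ, HasDerivAt (fun θ => ∫ x, F (B θ x) ∂(stdG ι))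
      (∫ x, F1 (B θ x) (B' θ x) ∂(stdG ι)) θ := by
    intro θ
    refine (hasDerivAt_integral_of_dominated_loc_of_deriv_le (μ := stdG ι) (s := Set.univ)
      (F := fun θ x => F (B θ x)) (F' := fun θ x => F1 (B θ x) (B' θ x))
      (bound := fun x => C1 * ((‖A‖ + ‖C‖) * ‖x‖)) Filter.univ_mem ?_ ?_ ?_ ?_ ?_ ?_).2
    · exact Eventually.of_forall fun θ =>
        (hF.comp (B θ).continuous).measurable.aestronglyMeasurable
    · exact integrable_stdG_of_bounded (hF.comp (B θ).continuous) fun x => hC0 _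
    · exact ((hF1.comp (B θ).continuous).clm_apply
        (B' θ).continuous).measurable.aestronglyMeasurable
    · refine ae_of_all _ fun x θ _ => ((F1 _).le_opNorm _).trans ?_
      exact mul_le_mul (hC1 _) (hB'n θ x) (norm_nonneg _) hC1'
    · exact ((IsGaussian.integrable_id (μ := stdG ι)).norm.const_mul _).const_mul _
    · exact ae_of_all _ fun x θ _ => (h0 _).comp_hasDerivAt θ (hBd θ x)
  have hnonpos : ∀ θ ∈ Set.Icc (0 : ℝ) (Real.pi / 2),
      ∫ x, F1 (B θ x) (B' θ x) ∂(stdG ι) ≤ 0 := by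
    intro θ hθ
    have hs : 0 ≤ Real.sin θ := Real.sin_nonneg_of_nonneg_of_le_pi hθ.1 (by linarith [hθ.2, Real.pi_pos])
    have hc : 0 ≤ Real.cos θ := Real.cos_nonneg_of_neg_pi_div_two_le_of_le
      (by linarith [hθ.1, Real.pi_pos]) hθ.2
    rw [(integral_fderiv_linear h1 hF2 hC1 hC2 (B θ) (B' θ)).2]
    refine integral_nonpos fun x => ?_
    -- Each Gaussian coordinate feeds only A or only C, so no cross terms arise: a coordinate of A
    -- contributes with sign -sin θ cos θ, a coordinate of C with +sin θ cos θ.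
    have : ∀ e, F2 (B θ x) (B θ (Pi.single e 1)) (B' θ (Pi.single e 1)) =
        Real.sin θ * Real.cos θ * (F2 (B θ x) (C (Pi.single e 1)) (C (Pi.single e 1)) -
          F2 (B θ x) (A (Pi.single e 1)) (A (Pi.single e 1))) := by
      intro e
      rcases hAC e with h | h <;> simp [hB, hB', h] <;> ring
    simp only [this, ← Finset.mul_sum, Finset.sum_sub_distrib, Pi.zero_apply]
    exact mul_nonpos_of_nonneg_of_nonpos (by positivity) (by linarith [hle (B θ x)])
  have hanti : AntitoneOn (fun θ => ∫ x, F (B θ x) ∂(stdG ι)) (Set.Icc 0 (Real.pi / 2)) := by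
    refine antitoneOn_of_deriv_nonpos (convex_Icc _ _)
      (fun θ _ => (hder θ).continuousAt.continuousWithinAt)
      (fun θ _ => (hder θ).differentiableAt.differentiableWithinAt) fun θ hθ => ?_
    rw [(hder θ).deriv]
    exact hnonpos θ (interior_subset hθ)
  have hp : (0 : ℝ) ≤ Real.pi / 2 := by positivity
  have := hanti (Set.left_mem_Icc.2 hp) (Set.right_mem_Icc.2 hp) hp
  simpa [hB] using this

end Interpolation

/-! ### Derivatives of products of test functions -/

section Product

variable {N : Type*} [Fintype N] [DecidableEq N]
variable {V : Type*} [NormedAddCommGroup V] [NormedSpace ℝ V]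

/-- The first derivative of `Z ↦ ∏ x, χ x (Z x)`. -/
def prodD1 (χ : N → V → ℝ) (D : N → V → V →L[ℝ] ℝ) (Z : N → V) : (N → V) →L[ℝ] ℝ :=
  ∑ x, (∏ y ∈ Finset.univ.erase x, χ y (Z y)) • (D x (Z x)).comp (ContinuousLinearMap.proj x)

/-- The second derivative of `Z ↦ ∏ x, χ x (Z x)`. -/
def prodD2 (χ : N → V → ℝ) (D : N → V → V →L[ℝ] ℝ) (D2 : N → V → V →L[ℝ] V →L[ℝ] ℝ) (Z : N → V) :
    (N → V) →L[ℝ] (N → V) →L[ℝ] ℝ :=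
  ∑ x, ((∏ y ∈ Finset.univ.erase x, χ y (Z y)) •
      ((ContinuousLinearMap.precomp ℝ (ContinuousLinearMap.proj (R := ℝ) (φ := fun _ : N => V) x)).comp
        ((D2 x (Z x)).comp (ContinuousLinearMap.proj (R := ℝ) (φ := fun _ : N => V) x))) +
    (∑ y ∈ Finset.univ.erase x, (∏ w ∈ (Finset.univ.erase x).erase y, χ w (Z w)) •
      (D y (Z y)).comp (ContinuousLinearMap.proj (R := ℝ) (φ := fun _ : N => V) y)).smulRight
      ((D x (Z x)).comp (ContinuousLinearMap.proj (R := ℝ) (φ := fun _ : N => V) x)))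

variable {χ : N → V → ℝ} {D : N → V → V →L[ℝ] ℝ} {D2 : N → V → V →L[ℝ] V →L[ℝ] ℝ}

lemma hasFDerivAt_prod_erase (s : Finset N) (h0 : ∀ x v, HasFDerivAt (χ x) (D x v) v) (Z : N → V) :
    HasFDerivAt (fun Z : N → V => ∏ y ∈ s, χ y (Z y))
      (∑ y ∈ s, (∏ w ∈ s.erase y, χ w (Z w)) •
        (D y (Z y)).comp (ContinuousLinearMap.proj (R := ℝ) (φ := fun _ : N => V) y)) Z := by
  refine HasFDerivAt.finsetProd fun y _ => ?_
  exact (h0 y (Z y)).comp Z (ContinuousLinearMap.proj (R := ℝ) (φ := fun _ : N => V) y).hasFDerivAt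

lemma hasFDerivAt_prodD1 (h0 : ∀ x v, HasFDerivAt (χ x) (D x v) v) (h1 : ∀ x v, HasFDerivAt (D x) (D2 x v) v)
    (Z : N → V) : HasFDerivAt (prodD1 χ D) (prodD2 χ D D2 Z) Z := by
  unfold prodD1 prodD2
  refine HasFDerivAt.fun_sum fun x _ => ?_
  have hpc := ((ContinuousLinearMap.precomp ℝ
    (ContinuousLinearMap.proj (R := ℝ) (φ := fun _ : N => V) x)) :
      (V →L[ℝ] ℝ) →L[ℝ] ((N → V) →L[ℝ] ℝ)).hasFDerivAt (x := D x (Z x))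
  have hD := (h1 x (Z x)).comp Z (ContinuousLinearMap.proj (R := ℝ) (φ := fun _ : N => V) x).hasFDerivAt
  exact HasFDerivAt.fun_smul (𝕜 := ℝ) (𝕜' := ℝ) (hasFDerivAt_prod_erase _ h0 Z) (hpc.comp Z hD)

lemma prodD2_apply (Z W W' : N → V) :
    prodD2 χ D D2 Z W W' = ∑ x, ((∏ y ∈ Finset.univ.erase x, χ y (Z y)) * D2 x (Z x) (W x) (W' x) +
      ∑ y ∈ Finset.univ.erase x, (∏ w ∈ (Finset.univ.erase x).erase y, χ w (Z w)) *
        (D y (Z y) (W y) * D x (Z x) (W' x))) := by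
  simp only [prodD2, sum_apply, add_apply,
    smul_apply, ContinuousLinearMap.comp_apply,
    ContinuousLinearMap.smulRight_apply, ContinuousLinearMap.proj_apply, smul_eq_mul,
    ContinuousLinearMap.precomp_apply, Finset.sum_mul, mul_assoc]

variable (hχ0 : ∀ x v, 0 ≤ χ x v) (hχ1 : ∀ x v, χ x v ≤ 1)
include hχ0 hχ1

lemma prod_mem_unit (s : Finset N) (Z : N → V) : |∏ y ∈ s, χ y (Z y)| ≤ 1 := by
  rw [abs_of_nonneg (Finset.prod_nonneg fun _ _ => hχ0 _ _)]
  exact Finset.prod_le_one (fun _ _ => hχ0 _ _) fun _ _ => hχ1 _ _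

/-- Together with the bound for the second derivative this only supplies the integrability needed
for interpolation, so the dependence on the number of factors is harmless. -/
lemma norm_prodD1_le {C1 : ℝ} (h0C : 0 ≤ C1) (hC1 : ∀ x v, ‖D x v‖ ≤ C1) (Z : N → V) :
    ‖prodD1 χ D Z‖ ≤ Fintype.card N * C1 := by
  have hC : 0 ≤ C1 := h0C
  refine (norm_sum_le _ _).trans ?_
  rw [← nsmul_eq_mul, ← Finset.card_univ]
  refine Finset.sum_le_card_nsmul _ _ _ fun x _ => ?_
  rw [norm_smul]
  refine (mul_le_of_le_one_left (norm_nonneg _) (prod_mem_unit hχ0 hχ1 _ Z)).trans ?_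
  refine ContinuousLinearMap.opNorm_le_bound _ hC fun W => ?_
  exact ((D x (Z x)).le_opNorm _).trans (mul_le_mul (hC1 _ _) (norm_le_pi_norm W x) (norm_nonneg _) hC)

lemma norm_prodD2_le {C1 C2 : ℝ} (h0C : 0 ≤ C1) (hC1 : ∀ x v, ‖D x v‖ ≤ C1) (h0C' : 0 ≤ C2) (hC2 : ∀ x v, ‖D2 x v‖ ≤ C2) (Z : N → V) :
    ‖prodD2 χ D D2 Z‖ ≤ Fintype.card N * (C2 + Fintype.card N * (C1 * C1)) := by
  have hC : 0 ≤ C1 := h0C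
  have hC' : 0 ≤ C2 := h0C'
  refine ContinuousLinearMap.opNorm_le_bound₂ _ (by positivity) fun W W' => ?_
  have hD : ∀ x, ∀ W : N → V, |D x (Z x) (W x)| ≤ C1 * ‖W‖ := fun x W =>
    ((D x (Z x)).le_opNorm _).trans (mul_le_mul (hC1 _ _) (norm_le_pi_norm W x) (norm_nonneg _) hC)
  rw [prodD2_apply, Real.norm_eq_abs]
  refine (Finset.abs_sum_le_sum_abs _ _).trans ?_
  rw [mul_assoc, mul_assoc, ← nsmul_eq_mul, ← Finset.card_univ]
  refine Finset.sum_le_card_nsmul _ _ _ fun x _ => (abs_add_le _ _).trans ?_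
  rw [add_mul]
  refine add_le_add ?_ ?_
  · rw [abs_mul]
    refine (mul_le_of_le_one_left (abs_nonneg _) (prod_mem_unit hχ0 hχ1 _ Z)).trans ?_
    refine ((D2 x (Z x)).le_opNorm₂ _ _).trans ?_
    rw [← mul_assoc]
    gcongr
    · exact hC2 _ _
    · exact norm_le_pi_norm W x
    · exact norm_le_pi_norm W' x
  · refine (Finset.abs_sum_le_sum_abs _ _).trans ?_
    calc _ ≤ (Finset.univ.erase x).card • (C1 * ‖W‖ * (C1 * ‖W'‖)) := by
          refine Finset.sum_le_card_nsmul _ _ _ fun y _ => ?_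
          rw [abs_mul]
          refine (mul_le_of_le_one_left (abs_nonneg _) (prod_mem_unit hχ0 hχ1 _ Z)).trans ?_
          rw [abs_mul]
          exact mul_le_mul (hD y W) (hD x W') (abs_nonneg _) (by positivity)
      _ ≤ (Finset.univ : Finset N).card * (C1 * ‖W‖ * (C1 * ‖W'‖)) := by
          rw [nsmul_eq_mul]; gcongr; exact Finset.erase_subset _ _
      _ = _ := by ring

end Product

end CCA

end


noncomputable section

namespace CCA

/-! ### Smoothing of indicator functions -/

section Mollify

variable {V : Type*} [NormedAddCommGroup V] [NormedSpace ℝ V] [FiniteDimensional ℝ V]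
  [MeasureSpace V] [BorelSpace V] [(volume : Measure V).IsAddHaarMeasure]

open scoped Convolution

lemma norm_convolution_le {E' F : Type*} [NormedAddCommGroup E'] [NormedSpace ℝ E']
    [NormedAddCommGroup F] [NormedSpace ℝ F] (L : E' →L[ℝ] ℝ →L[ℝ] F) {f : V → E'} {g : V → ℝ}
    (hf : Integrable f) (hg : ∀ v, |g v| ≤ 1) (v : V) :
    ‖(f ⋆[L, volume] g) v‖ ≤ ‖L‖ * ∫ t, ‖f t‖ := by
  rw [convolution_def, ← integral_const_mul]
  refine norm_integral_le_of_norm_le (hf.norm.const_mul _) (ae_of_all _ fun t => ?_)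
  refine (L.le_opNorm₂ _ _).trans ?_
  exact mul_le_of_le_one_right (by positivity) (hg _)

/-- All derivatives fall on the smooth kernel `f`, while `g` is merely bounded and locally
integrable. The kernel is vector valued so that the statement can be applied again to its own
derivative. -/
lemma exists_hasFDerivAt_convolution {E' F : Type*} [NormedAddCommGroup E'] [NormedSpace ℝ E']
    [NormedAddCommGroup F] [NormedSpace ℝ F] (L : E' →L[ℝ] ℝ →L[ℝ] F) {f : V → E'} {g : V → ℝ}
    (hfc : HasCompactSupport f) (hf : ContDiff ℝ 1 f) (hg : LocallyIntegrable g volume)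
    (hg1 : ∀ v, |g v| ≤ 1) :
    ∃ (L' : (V →L[ℝ] E') →L[ℝ] ℝ →L[ℝ] (V →L[ℝ] F)) (C : ℝ),
      (∀ v, HasFDerivAt (f ⋆[L, volume] g) ((fderiv ℝ f ⋆[L', volume] g) v) v) ∧
      (∀ v, ‖(fderiv ℝ f ⋆[L', volume] g) v‖ ≤ C) ∧ Continuous (fderiv ℝ f ⋆[L', volume] g) :=
  ⟨L.precompL V, _, fun v => hfc.hasFDerivAt_convolution_left L hf hg v,
    norm_convolution_le _ ((hf.continuous_fderiv one_ne_zero).integrable_of_hasCompactSupport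
      (hfc.fderiv ℝ)) hg1,
    (hfc.fderiv ℝ).continuous_convolution_left _ (hf.continuous_fderiv one_ne_zero) hg⟩

lemma exists_hasFDerivAt_convolution_two {ρ g : V → ℝ}
    (hfc : HasCompactSupport ρ) (hρ : ContDiff ℝ 2 ρ) (hg : LocallyIntegrable g volume)
    (hg1 : ∀ v, |g v| ≤ 1) :
    ∃ (D : V → V →L[ℝ] ℝ) (D2 : V → V →L[ℝ] V →L[ℝ] ℝ) (C : ℝ),
      (∀ v, HasFDerivAt (fun v => ∫ t, ρ t * g (v - t)) (D v) v) ∧ (∀ v, HasFDerivAt D (D2 v) v) ∧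
      Continuous D2 ∧ (∀ v, ‖D v‖ ≤ C) ∧ (∀ v, ‖D2 v‖ ≤ C) := by
  obtain ⟨L1, C1, a1, a2, -⟩ := exists_hasFDerivAt_convolution (ContinuousLinearMap.mul ℝ ℝ) hfc
    (hρ.of_le (by norm_num)) hg hg1
  obtain ⟨L2, C2, b1, b2, b3⟩ := exists_hasFDerivAt_convolution L1 (hfc.fderiv ℝ)
    (hρ.fderiv_right (by norm_num)) hg hg1
  exact ⟨_, _, max C1 C2, a1, b1, b3, fun v => (a2 v).trans (le_max_left _ _),
    fun v => (b2 v).trans (le_max_right _ _)⟩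

/-- Smoothing of a function with values in `[0, 1]` at scale `r`. -/
lemma exists_mollification {g : V → ℝ} (hgm : Measurable g) (hg0 : ∀ v, 0 ≤ g v)
    (hg1 : ∀ v, g v ≤ 1) {r : ℝ} (hr : 0 < r) :
    ∃ (χ : V → ℝ) (D : V → V →L[ℝ] ℝ) (D2 : V → V →L[ℝ] V →L[ℝ] ℝ) (C : ℝ),
      (∀ v, HasFDerivAt χ (D v) v) ∧ (∀ v, HasFDerivAt D (D2 v) v) ∧ Continuous D2 ∧
      (∀ v, ‖D v‖ ≤ C) ∧ (∀ v, ‖D2 v‖ ≤ C) ∧ (∀ v, 0 ≤ χ v) ∧ (∀ v, χ v ≤ 1) ∧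
      (∀ v c, (∀ w, ‖w - v‖ < r → g w = c) → χ v = c) ∧
      (∀ d, (∀ v (t : ℝ), 0 ≤ t → g (v + t • d) ≤ g v) → ∀ v, D v d ≤ 0) := by
  let b : ContDiffBump (0 : V) := ⟨r / 2, r, by positivity, by linarith⟩
  set ρ : V → ℝ := b.normed volume with hρ
  have hρc : HasCompactSupport ρ := b.hasCompactSupport_normed
  have hρs : ContDiff ℝ (⊤ : ℕ∞) ρ := b.contDiff_normed
  have hρ0 : ∀ v, 0 ≤ ρ v := fun v => b.nonneg_normed v
  have hρi : ∫ v, ρ v = 1 := b.integral_normed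
  have hgabs : ∀ v, |g v| ≤ 1 := fun v => by rw [abs_of_nonneg (hg0 v)]; exact hg1 v
  have hgl : LocallyIntegrable g volume := by
    refine (locallyIntegrable_const (1 : ℝ)).mono hgm.aestronglyMeasurable (ae_of_all _ fun v => ?_)
    simpa using hgabs v
  have hint : ∀ v, Integrable (fun t => ρ t * g (v - t)) := fun v => by
    refine (b.integrable_normed (μ := volume)).mul_bdd (c := 1) ?_ (ae_of_all _ fun t => hgabs _)
    exact (hgm.comp (measurable_const.sub measurable_id)).aestronglyMeasurable
  obtain ⟨D, D2, C, h1, h2, h3, h4, h5⟩ :=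
    exists_hasFDerivAt_convolution_two hρc (hρs.of_le (by norm_cast)) hgl hgabs
  refine ⟨_, D, D2, C, h1, h2, h3, h4, h5, ?_, ?_, ?_, ?_⟩
  · intro v
    exact integral_nonneg fun t => mul_nonneg (hρ0 t) (hg0 _)
  · intro v
    rw [← hρi]
    exact integral_mono (hint v) b.integrable_normed
      fun t => mul_le_of_le_one_right (hρ0 t) (hg1 _)
  · intro v c h
    have h' : ∀ t, ρ t * g (v - t) = ρ t * c := fun t => by
      by_cases ht : ρ t = 0
      · simp [ht]
      · have : t ∈ Function.support ρ := ht
        rw [hρ, b.support_normed_eq] at this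
        rw [h (v - t) (by simpa [b] using this)]
    simp only [h', integral_mul_const, hρi, one_mul]
  · intro d hd v
    -- Smoothing preserves monotonicity along d, and `D v d` is the limit of right difference
    -- quotients, all of which are nonpositive.
    have hline : HasDerivAt (fun t : ℝ => ∫ s, ρ s * g (v + t • d - s)) (D v d) 0 := by
      have h1' : HasDerivAt (fun t : ℝ => v + t • d) d 0 := by
        simpa using ((hasDerivAt_id (0 : ℝ)).smul_const d).const_add v
      have h2' := h1 (v + (0 : ℝ) • d)
      have := h2'.comp_hasDerivAt (0 : ℝ) h1'
      simpa [Function.comp_def] using this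
    have hmono : ∀ t : ℝ, 0 ≤ t → ∫ s, ρ s * g (v + t • d - s) ≤ ∫ s, ρ s * g (v - s) := by
      intro t ht
      refine integral_mono (hint _) (hint _) fun s => ?_
      refine mul_le_mul_of_nonneg_left ?_ (hρ0 s)
      have := hd (v - s) t ht
      rwa [show v + t • d - s = v - s + t • d by abel]
    have hslope := hline.tendsto_slope_zero_right
    refine le_of_tendsto hslope ?_
    filter_upwards [self_mem_nhdsWithin] with t ht
    have ht' : 0 < t := ht
    simp only [zero_add, zero_smul, add_zero, smul_eq_mul]
    exact mul_nonpos_of_nonneg_of_nonpos (by positivity) (by linarith [hmono t ht'.le])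

end Mollify

/-! ### Linear images and sign changes of Gaussian vectors -/

section Maps

variable {ι κ : Type*} [Fintype ι] [Fintype κ] [DecidableEq ι] [DecidableEq κ]

/-- A centred Gaussian law is determined by the variances of its linear functionals, and the
hypothesis says that B reproduces them. -/
lemma stdG_map_linear (B : (ι → ℝ) →L[ℝ] (κ → ℝ))
    (hB : ∀ L : StrongDual ℝ (κ → ℝ), ∑ i, L (B (Pi.single i 1)) ^ 2 = ∑ k, L (Pi.single k 1) ^ 2) :
    (stdG ι).map B = stdG κ := by
  refine Measure.ext_of_charFunDual ?_
  ext L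
  rw [charFunDual_map, charFunDual_eq_charFun_map_one, charFunDual_eq_charFun_map_one,
    stdG_map_dual, stdG_map_dual, ← hB L]
  rfl

lemma stdG_map_comp {f : κ → ι} (hf : Function.Injective f) :
    (stdG ι).map (fun w => w ∘ f) = stdG κ := by
  set B : (ι → ℝ) →L[ℝ] (κ → ℝ) :=
    ContinuousLinearMap.pi fun k => ContinuousLinearMap.proj (R := ℝ) (φ := fun _ : ι => ℝ) (f k)
  refine stdG_map_linear B fun L => ?_
  have h1 : ∀ k, B (Pi.single (f k) 1) = Pi.single k 1 := fun k => by
    ext k'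
    simp only [B, ContinuousLinearMap.pi_apply, ContinuousLinearMap.proj_apply, Pi.single_apply,
      hf.eq_iff]
  have h2 : ∀ i, (∀ k, f k ≠ i) → B (Pi.single i 1) = 0 := fun i hi => by
    ext k'
    simp [B, hi k']
  symm
  refine Finset.sum_of_injOn f hf.injOn (by simp) (fun i _ hi => ?_) (fun k _ => by rw [h1])
  rw [h2 i (fun k hk => hi ⟨k, by simp, hk⟩)]; simp

lemma stdG_map_flip (e : ι) :
    (stdG ι).map (fun w i => if i = e then - w i else w i) = stdG ι := by
  set B : (ι → ℝ) →L[ℝ] (ι → ℝ) := ContinuousLinearMap.pi fun i => if i = e then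
    -ContinuousLinearMap.proj (R := ℝ) (φ := fun _ : ι => ℝ) i else
    ContinuousLinearMap.proj (R := ℝ) (φ := fun _ : ι => ℝ) i
  have hB : (B : (ι → ℝ) → ι → ℝ) = fun w i => if i = e then - w i else w i := by
    ext w i; by_cases h : i = e <;> simp [B, h]
  rw [← hB]
  refine stdG_map_linear B fun L => Finset.sum_congr rfl fun i _ => ?_
  by_cases h : i = e
  · have : B (Pi.single i 1) = - Pi.single i 1 := by
      rw [hB]; ext j
      by_cases hj : j = e
      · simp [hj]
      · simp [hj, h]
    rw [this]; simp
  · have : B (Pi.single i 1) = Pi.single i 1 := by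
      rw [hB]; ext j
      by_cases hj : j = e
      · subst hj; simp [Ne.symm h]
      · simp [hj]
    rw [this]

/-- T is the union of its part with `0 ≤ w e` and the mirror image of that part, and the reflection
preserves the law. -/
lemma stdG_le_two_mul (e : ι) {T : Set (ι → ℝ)} (hT : MeasurableSet T)
    (hflip : ∀ w, w ∈ T → (fun i => if i = e then - w i else w i) ∈ T) :
    stdG ι T ≤ 2 * stdG ι (T ∩ {w | 0 ≤ w e}) := by
  have hm : Measurable (fun (w : ι → ℝ) i => if i = e then - w i else w i) := by
    refine measurable_pi_iff.2 fun i => ?_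
    by_cases h : i = e
    · simp only [h, if_true]; fun_prop
    · simp only [h, if_false]; fun_prop
  have hs : MeasurableSet {w : ι → ℝ | 0 ≤ w e} := measurableSet_le measurable_const (measurable_pi_apply e)
  have h1 : T ⊆ (T ∩ {w | 0 ≤ w e}) ∪
      (fun (w : ι → ℝ) i => if i = e then - w i else w i) ⁻¹' (T ∩ {w | 0 ≤ w e}) := by
    intro w hw
    rcases le_total 0 (w e) with h | h
    · exact Or.inl ⟨hw, h⟩
    · exact Or.inr ⟨hflip w hw, by simpa using h⟩
  refine (measure_mono h1).trans ((measure_union_le _ _).trans ?_)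
  rw [← Measure.map_apply hm (hT.inter hs), stdG_map_flip, two_mul]

end Maps

end CCA

end


noncomputable section

namespace CCA

/-- The Euclidean norm of a family of reals. -/
def l2 {ι : Type*} [Fintype ι] (v : ι → ℝ) : ℝ := √(∑ i, v i ^ 2)

/-! ### Euclidean norms of real vectors -/

section L2

variable {ι : Type*} [Fintype ι]

lemma l2_eq_norm (v : ι → ℝ) : l2 v = ‖WithLp.toLp 2 v‖ := by
  rw [l2, EuclideanSpace.norm_eq]; simp

lemma l2_nonneg (v : ι → ℝ) : 0 ≤ l2 v := Real.sqrt_nonneg _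

lemma sq_l2 (v : ι → ℝ) : l2 v ^ 2 = ∑ i, v i ^ 2 :=
  Real.sq_sqrt (Finset.sum_nonneg fun _ _ => sq_nonneg _)

lemma l2_add_le (v w : ι → ℝ) : l2 (v + w) ≤ l2 v + l2 w := by
  simp only [l2_eq_norm, WithLp.toLp_add]; exact norm_add_le _ _

lemma l2_smul (c : ℝ) (v : ι → ℝ) : l2 (c • v) = |c| * l2 v := by
  simp only [l2_eq_norm, WithLp.toLp_smul, norm_smul, Real.norm_eq_abs]

lemma l2_sub_comm (v w : ι → ℝ) : l2 (v - w) = l2 (w - v) := by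
  simp only [l2_eq_norm, WithLp.toLp_sub]; exact norm_sub_rev _ _

lemma sum_mul_le_l2 (v w : ι → ℝ) : ∑ i, v i * w i ≤ l2 v * l2 w := by
  rw [l2, l2]; exact Real.sum_mul_le_sqrt_mul_sqrt _ _ _

lemma l2_le_sum_abs (v : ι → ℝ) : l2 v ≤ ∑ i, |v i| := by
  rw [l2, Real.sqrt_le_left (Finset.sum_nonneg fun i _ => abs_nonneg _)]
  calc ∑ i, v i ^ 2 = ∑ i, |v i| ^ 2 := by simp
    _ ≤ _ := Finset.sum_sq_le_sq_sum_of_nonneg fun i _ => abs_nonneg _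

lemma continuous_l2 : Continuous (l2 : (ι → ℝ) → ℝ) := by unfold l2; fun_prop

end L2

/-! ### Gordon's comparison for finite families -/

section Gordon

variable {R P N : Type*} [Fintype R] [Fintype P] [Fintype N] [DecidableEq R] [DecidableEq P]
  [DecidableEq N]

/-- Coordinates of a Gaussian matrix with an extra variable, and of two Gaussian vectors. -/
abbrev GIdx (R P : Type*) := ((R × P) ⊕ Unit) ⊕ (R ⊕ P)

/-- The process `u ↦ (G u, |u| ξ)`. -/
def procA (u : N → P → ℝ) : (GIdx R P → ℝ) →L[ℝ] (N → Option R → ℝ) :=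
  ContinuousLinearMap.pi fun x => ContinuousLinearMap.pi fun o => match o with
    | some i => ∑ j, u x j •
        ContinuousLinearMap.proj (R := ℝ) (φ := fun _ : GIdx R P => ℝ) (Sum.inl (Sum.inl (i, j)))
    | none => l2 (u x) •
        ContinuousLinearMap.proj (R := ℝ) (φ := fun _ : GIdx R P => ℝ) (Sum.inl (Sum.inr ()))

/-- The process `u ↦ (|u| h, g ⬝ u)`. -/
def procC (u : N → P → ℝ) : (GIdx R P → ℝ) →L[ℝ] (N → Option R → ℝ) :=
  ContinuousLinearMap.pi fun x => ContinuousLinearMap.pi fun o => match o with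
    | some i => l2 (u x) •
        ContinuousLinearMap.proj (R := ℝ) (φ := fun _ : GIdx R P => ℝ) (Sum.inr (Sum.inl i))
    | none => ∑ j, u x j •
        ContinuousLinearMap.proj (R := ℝ) (φ := fun _ : GIdx R P => ℝ) (Sum.inr (Sum.inr j))

variable (u : N → P → ℝ)

lemma procA_some (w : GIdx R P → ℝ) (x : N) (i : R) :
    procA u w x (some i) = ∑ j, u x j * w (Sum.inl (Sum.inl (i, j))) := by simp [procA]

lemma procA_none (w : GIdx R P → ℝ) (x : N) :
    procA (R := R) u w x none = l2 (u x) * w (Sum.inl (Sum.inr ())) := by simp [procA]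

lemma procC_some (w : GIdx R P → ℝ) (x : N) (i : R) :
    procC u w x (some i) = l2 (u x) * w (Sum.inr (Sum.inl i)) := by simp [procC]

lemma procC_none (w : GIdx R P → ℝ) (x : N) :
    procC (R := R) u w x none = ∑ j, u x j * w (Sum.inr (Sum.inr j)) := by simp [procC]

lemma procA_entry (x : N) (i : R) (j : P) :
    procA u (Pi.single (Sum.inl (Sum.inl (i, j))) 1) x = u x j • Pi.single (some i) 1 := by
  ext o
  cases o with
  | none => simp [procA_none]
  | some k => 
    simp only [procA_some, Pi.single_apply, Sum.inl.injEq, Prod.mk.injEq, Pi.smul_apply,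
      Option.some.injEq, smul_eq_mul]
    by_cases h : k = i <;> simp [h]

lemma procA_unit (x : N) :
    procA (R := R) u (Pi.single (Sum.inl (Sum.inr ())) 1) x = l2 (u x) • Pi.single none 1 := by
  ext o
  cases o with
  | none => simp [procA_none]
  | some k => simp [procA_some]

lemma procA_inr (e : R ⊕ P) : procA (R := R) u (Pi.single (Sum.inr e) 1) = 0 := by
  ext x o
  cases o with
  | none => simp [procA_none]
  | some k => simp [procA_some]

lemma procC_row (x : N) (i : R) :
    procC u (Pi.single (Sum.inr (Sum.inl i)) 1) x = l2 (u x) • Pi.single (some i) 1 := by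
  ext o
  cases o with
  | none => simp [procC_none]
  | some k => simp [procC_some, Pi.single_apply]

lemma procC_col (x : N) (j : P) :
    procC (R := R) u (Pi.single (Sum.inr (Sum.inr j)) 1) x = u x j • Pi.single none 1 := by
  ext o
  cases o with
  | none => simp [procC_none, Pi.single_apply]
  | some k => simp [procC_some]

lemma procC_inl (e : (R × P) ⊕ Unit) : procC (R := R) u (Pi.single (Sum.inl e) 1) = 0 := by
  ext x o
  cases o with
  | none => simp [procC_none]
  | some k => simp [procC_some]

/-- This sum is `b` contracted with the covariance of the process at x and y: the scalar product of
`u x` and `u y` on the first coordinates, the product of their norms on the last one. In `procC` the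
two roles are exchanged, and they coincide when x = y. -/
lemma sum_bilin_procA (b : (Option R → ℝ) → (Option R → ℝ) → ℝ)
    (hb : ∀ c d v w, b (c • v) (d • w) = c * d * b v w) (x y : N) :
    ∑ e, b (procA u (Pi.single e 1) x) (procA u (Pi.single e 1) y) =
      (∑ j, u x j * u y j) * ∑ i : R, b (Pi.single (some i) 1) (Pi.single (some i) 1) +
        l2 (u x) * l2 (u y) * b (Pi.single none 1) (Pi.single none 1) := by
  have h0 : b 0 0 = 0 := by simpa using hb 0 0 0 0
  simp only [Fintype.sum_sum_type, procA_entry, procA_unit, procA_inr, Pi.zero_apply, h0, hb,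
    Finset.sum_const_zero, add_zero, Fintype.sum_prod_type, Finset.univ_unique, Finset.sum_singleton,
    show (default : Unit) = () from rfl, ← Finset.sum_mul, Finset.mul_sum]

lemma sum_bilin_procC (b : (Option R → ℝ) → (Option R → ℝ) → ℝ)
    (hb : ∀ c d v w, b (c • v) (d • w) = c * d * b v w) (x y : N) :
    ∑ e, b (procC u (Pi.single e 1) x) (procC u (Pi.single e 1) y) =
      l2 (u x) * l2 (u y) * ∑ i : R, b (Pi.single (some i) 1) (Pi.single (some i) 1) +
        (∑ j, u x j * u y j) * b (Pi.single none 1) (Pi.single none 1) := by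
  have h0 : b 0 0 = 0 := by simpa using hb 0 0 0 0
  simp only [Fintype.sum_sum_type, procC_row, procC_col, procC_inl, Pi.zero_apply, h0, hb,
    Finset.sum_const_zero, zero_add, ← Finset.sum_mul, Finset.mul_sum]

variable {u}

/-- A linear form that is nonpositive on the light cone has a timelike gradient. -/
lemma gradient_cone {D D' : (Option R → ℝ) →L[ℝ] ℝ}
    (h : ∀ (e : Option R → ℝ), l2 (fun i => e (some i)) ≤ e none → D e ≤ 0)
    (h' : ∀ (e : Option R → ℝ), l2 (fun i => e (some i)) ≤ e none → D' e ≤ 0) :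
    ∑ i : R, D (Pi.single (some i) 1) * D' (Pi.single (some i) 1) ≤
      D (Pi.single none 1) * D' (Pi.single none 1) := by
  have key : ∀ D : (Option R → ℝ) →L[ℝ] ℝ,
      (∀ (e : Option R → ℝ), l2 (fun i => e (some i)) ≤ e none → D e ≤ 0) →
      l2 (fun i => D (Pi.single (some i) 1)) ≤ - D (Pi.single none 1) := by
    intro D h
    set a : R → ℝ := fun i => D (Pi.single (some i) 1) with ha
    have hexp : ∀ e : Option R → ℝ, D e = e none * D (Pi.single none 1) + ∑ i, e (some i) * a i := by
      intro e
      conv_lhs => rw [pi_eq_sum_univ' e]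
      simp [map_sum, ha, Fintype.sum_option]
    -- Two directions in the cone suffice: the axis itself, and the light-like direction whose
    -- spatial part is the spatial gradient.
    have h1 := h (fun o => o.elim 1 fun _ => 0) (by simp [l2])
    rw [hexp] at h1
    simp only [Option.elim, one_mul, zero_mul, Finset.sum_const_zero, add_zero] at h1
    have h2 := h (fun o => o.elim (l2 a) a) (by simp)
    rw [hexp] at h2
    simp only [Option.elim] at h2
    have h3 : ∑ i, a i * a i = l2 a ^ 2 := by rw [sq_l2]; simp [sq]
    rw [h3] at h2
    rcases (l2_nonneg a).eq_or_lt with h4 | h4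
    · rw [← h4]; linarith
    · nlinarith
  have h1 := key D h
  have h2 := key D' h'
  refine (sum_mul_le_l2 _ _).trans ?_
  nlinarith [l2_nonneg (fun i => D (Pi.single (some i) 1)),
    l2_nonneg (fun i => D' (Pi.single (some i) 1))]

/-- The cone of points from which `S` can be reached at cost at most `ξ + 2 δ`. -/
def reach (S : Set (R → ℝ)) (δ : ℝ) : Set (Option R → ℝ) :=
  {v | ∃ y ∈ S, l2 (y - fun i => v (some i)) < v none + 2 * δ}

lemma isOpen_reach (S : Set (R → ℝ)) (δ : ℝ) : IsOpen (reach S δ) := by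
  have : reach S δ = ⋃ y ∈ S, {v : Option R → ℝ | l2 (y - fun i => v (some i)) < v none + 2 * δ} := by
    ext v; simp [reach]
  rw [this]
  refine isOpen_biUnion fun y _ => isOpen_lt ?_ (by fun_prop)
  exact continuous_l2.comp (by fun_prop)

lemma l2_add_norm_le {r : ℝ} (v w : Option R → ℝ) (h : ‖w - v‖ < r) :
    l2 ((fun i => w (some i)) - fun i => v (some i)) + |w none - v none| ≤
      (Fintype.card R + 1) * r := by
  have hc : ∀ o, |w o - v o| ≤ r := fun o => ((norm_le_pi_norm (w - v) o).trans h.le)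
  have := l2_le_sum_abs ((fun i => w (some i)) - fun i => v (some i))
  have h2 : ∑ i : R, |((fun i => w (some i)) - fun i => v (some i)) i| ≤ Fintype.card R * r := by
    rw [← nsmul_eq_mul, ← Finset.card_univ]
    exact Finset.sum_le_card_nsmul _ _ _ fun i _ => hc (some i)
  linarith [hc none]

/-- Gaussian comparison for finite families, before passing to marginals. -/
lemma gordon_finite_aux (u : N → P → ℝ) (S : N → Set (R → ℝ)) {δ : ℝ} (hδ : 0 < δ) :
    stdG (GIdx R P) {w | ∃ x, (fun i => procA u w x (some i)) ∈ S x ∧ 0 ≤ procA u w x none} ≤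
      stdG (GIdx R P) {w | ∃ x, ∃ y ∈ S x,
        l2 (y - fun i => procC u w x (some i)) < procC u w x none + 4 * δ} := by
  classical
  -- The mollification radius in the supremum norm, chosen so that a move of size r changes
  -- Euclidean distance and last coordinate together by at most δ.
  set r : ℝ := δ / (Fintype.card R + 1) with hr
  have hr0 : 0 < r := by positivity
  have hrδ : (Fintype.card R + 1) * r = δ := by rw [hr]; field_simp
  have hmol : ∀ x, _ := fun x => exists_mollification (V := Option R → ℝ)
    (g := (reach (S x) δ)ᶜ.indicator fun _ => (1 : ℝ))
    (measurable_const.indicator (isOpen_reach (S x) δ).measurableSet.compl)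
    (fun v => Set.indicator_nonneg (fun _ _ => zero_le_one) v)
    (fun v => Set.indicator_le_self' (fun _ _ => zero_le_one) v) hr0
  choose χ D D2 C a1 a2 a3 a4 a5 a6 a7 a8 a9 using hmol
  obtain ⟨C0, hC0⟩ : ∃ C0, ∀ x, C x ≤ C0 := ⟨∑ x, |C x|, fun x => (le_abs_self _).trans
    (Finset.single_le_sum (f := fun x => |C x|) (fun _ _ => abs_nonneg _) (Finset.mem_univ x))⟩
  have hCC : ∀ x, C x ≤ max C0 0 := fun x => (hC0 x).trans (le_max_left _ _)
  have hcone : ∀ x v (e : Option R → ℝ), l2 (fun i => e (some i)) ≤ e none → D x v e ≤ 0 := by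
    intro x v e he
    refine a9 x e (fun v t ht => ?_) v
    by_cases hv : v ∈ (reach (S x) δ)ᶜ
    · rw [Set.indicator_of_mem hv]
      exact Set.indicator_le_self' (fun _ _ => zero_le_one) _
    · rw [Set.indicator_of_notMem hv, Set.indicator_of_notMem]
      rw [Set.notMem_compl_iff] at hv ⊢
      obtain ⟨y, hy, hyv⟩ := hv
      refine ⟨y, hy, ?_⟩
      have : (y - fun i => (v + t • e) (some i)) =
          (y - fun i => v (some i)) + (-t) • fun i => e (some i) := by
        ext i; simp; ring
      rw [this]
      refine (l2_add_le _ _).trans_lt ?_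
      rw [l2_smul, abs_neg, abs_of_nonneg ht]
      simp only [Pi.add_apply, Pi.smul_apply, smul_eq_mul]
      nlinarith [mul_le_mul_of_nonneg_left he ht]
  -- A smooth version of the indicator that no index x reaches its set; `1 - F` approximates the
  -- probabilities to be compared.
  set F : (N → Option R → ℝ) → ℝ := fun Z => ∏ x, χ x (Z x) with hF
  have hF0 : ∀ Z, 0 ≤ F Z := fun Z => Finset.prod_nonneg fun _ _ => a6 _ _
  have hF1 : ∀ Z, F Z ≤ 1 := fun Z => Finset.prod_le_one (fun _ _ => a6 _ _) fun _ _ => a7 _ _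
  have hFc : Continuous F := continuous_finsetProd _ fun x _ =>
    (continuous_iff_continuousAt.2 fun v => (a1 x v).continuousAt).comp (continuous_apply x)
  have hFA : Continuous fun w : GIdx R P → ℝ => F (procA u w) := hFc.comp (procA u).continuous
  have hFC : Continuous fun w : GIdx R P → ℝ => F (procC u w) := hFc.comp (procC u).continuous
  have hcomp : ∫ w, F (procC u w) ∂(stdG (GIdx R P)) ≤ ∫ w, F (procA u w) ∂(stdG (GIdx R P)) := by
    refine integral_comparison (F1 := prodD1 χ D) (F2 := prodD2 χ D D2)
      (fun Z => hasFDerivAt_prod_erase _ a1 Z) (hasFDerivAt_prodD1 a1 a2) ?_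
      (C0 := 1) (fun Z => abs_le.2 ⟨by linarith [hF0 Z], hF1 Z⟩)
      (norm_prodD1_le a6 a7 (le_max_right _ _) fun x v => (a4 x v).trans (hCC x))
      (norm_prodD2_le a6 a7 (le_max_right _ _) (fun x v => (a4 x v).trans (hCC x))
        (le_max_right _ _) fun x v => (a5 x v).trans (hCC x))
      (procA u) (procC u) ?_ ?_
    · have hc1 : ∀ x, Continuous fun Z : N → Option R → ℝ => χ x (Z x) := fun x =>
        (continuous_iff_continuousAt.2 fun v => (a1 x v).continuousAt).comp (continuous_apply x)
      have hc2 : ∀ x, Continuous fun Z : N → Option R → ℝ => D x (Z x) := fun x =>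
        (continuous_iff_continuousAt.2 fun v => (a2 x v).continuousAt).comp (continuous_apply x)
      have hc3 : ∀ x, Continuous fun Z : N → Option R → ℝ => D2 x (Z x) := fun x =>
        (a3 x).comp (continuous_apply x)
      refine continuous_clm_apply.2 fun W => continuous_clm_apply.2 fun W' => ?_
      simp only [prodD2_apply]
      refine continuous_finsetSum _ fun x _ => ?_
      refine Continuous.add ?_ ?_
      · exact (continuous_finsetProd _ fun y _ => hc1 y).mul
          (((hc3 x).clm_apply continuous_const).clm_apply continuous_const)
      · refine continuous_finsetSum _ fun y _ => ?_
        exact (continuous_finsetProd _ fun y _ => hc1 y).mul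
          (((hc2 y).clm_apply continuous_const).mul ((hc2 x).clm_apply continuous_const))
    · rintro (e | e)
      · exact Or.inr (procC_inl u e)
      · exact Or.inl (procA_inr u e)
    · intro Z
      have hswap : ∀ A : (GIdx R P → ℝ) →L[ℝ] (N → Option R → ℝ),
          ∑ e, prodD2 χ D D2 Z (A (Pi.single e 1)) (A (Pi.single e 1)) =
          ∑ x, ((∏ y ∈ Finset.univ.erase x, χ y (Z y)) *
              ∑ e, D2 x (Z x) (A (Pi.single e 1) x) (A (Pi.single e 1) x) +
            ∑ y ∈ Finset.univ.erase x, (∏ w ∈ (Finset.univ.erase x).erase y, χ w (Z w)) *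
              ∑ e, D y (Z y) (A (Pi.single e 1) y) * D x (Z x) (A (Pi.single e 1) x)) := by
        intro A
        simp only [prodD2_apply]
        rw [Finset.sum_comm]
        refine Finset.sum_congr rfl fun x _ => ?_
        rw [Finset.sum_add_distrib, ← Finset.mul_sum, Finset.sum_comm]
        simp only [Finset.mul_sum]
      rw [hswap, hswap]
      -- The diagonal terms agree because the covariances at a single index coincide. Off the
      -- diagonal, C minus A is the factor |u||u'| - ⟨u,u'⟩ ≥ 0 times a quantity that is nonpositive
      -- because both gradients are timelike.
      refine Finset.sum_le_sum fun x _ => add_le_add (le_of_eq ?_) (Finset.sum_le_sum fun y _ => ?_)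
      · rw [sum_bilin_procA u (fun v w => D2 x (Z x) v w) (by intros; simp; ring),
          sum_bilin_procC u (fun v w => D2 x (Z x) v w) (by intros; simp; ring)]
        have : ∑ j, u x j * u x j = l2 (u x) * l2 (u x) := by rw [← sq, sq_l2]; simp [sq]
        rw [this]
      · refine mul_le_mul_of_nonneg_left ?_ (Finset.prod_nonneg fun _ _ => a6 _ _)
        rw [sum_bilin_procA u (fun v w => D y (Z y) v * D x (Z x) w) (by intros; simp; ring),
          sum_bilin_procC u (fun v w => D y (Z y) v * D x (Z x) w) (by intros; simp; ring)]
        have h1 := gradient_cone (hcone y (Z y)) (hcone x (Z x))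
        have h2 := sum_mul_le_l2 (u y) (u x)
        nlinarith
  have hsub1 : {w | ∃ x, (fun i => procA u w x (some i)) ∈ S x ∧ 0 ≤ procA u w x none} ⊆
      {w | F (procA u w) = 0} := by
    rintro w ⟨x, hx, hx0⟩
    refine Finset.prod_eq_zero (Finset.mem_univ x) (a8 x _ _ fun v hv => ?_)
    rw [Set.indicator_of_notMem]
    rw [Set.notMem_compl_iff]
    refine ⟨_, hx, ?_⟩
    have h1 := l2_add_norm_le _ _ hv
    rw [hrδ, l2_sub_comm] at h1
    have := (abs_le.1 (le_refl |v none - procA u w x none|)).1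
    linarith
  have hsub2 : {w | F (procC u w) ≠ 1} ⊆ {w | ∃ x, ∃ y ∈ S x,
        l2 (y - fun i => procC u w x (some i)) < procC u w x none + 4 * δ} := by
    intro w hw
    by_contra hcon
    simp only [Set.mem_ofPred_eq, not_exists, not_and, not_lt] at hcon
    refine hw (Finset.prod_eq_one fun x _ => a8 x _ _ fun v hv => ?_)
    rw [Set.indicator_of_mem]
    rintro ⟨y, hy, hyv⟩
    have h1 := l2_add_norm_le _ _ hv
    rw [hrδ] at h1
    have h2 := hcon x y hy
    have h3 := l2_add_le (y - fun i => v (some i))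
      ((fun i => v (some i)) - fun i => procC u w x (some i))
    rw [sub_add_sub_cancel] at h3
    have := (abs_le.1 (le_refl |v none - procC u w x none|)).2
    linarith
  refine (measure_mono hsub1).trans (le_trans ?_ (measure_mono hsub2))
  have mA : MeasurableSet {w | F (procA u w) = 0} := (isClosed_eq hFA continuous_const).measurableSet
  have mC : MeasurableSet {w | F (procC u w) ≠ 1} :=
    (isClosed_eq hFC continuous_const).measurableSet.compl
  have iA := integrable_stdG_of_bounded hFA (C := 1)
    fun w => abs_le.2 ⟨by linarith [hF0 (procA u w)], hF1 _⟩
  have iC := integrable_stdG_of_bounded hFC (C := 1)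
    fun w => abs_le.2 ⟨by linarith [hF0 (procC u w)], hF1 _⟩
  have e1 : (stdG (GIdx R P)).real {w | F (procA u w) = 0} ≤
      ∫ w, (1 - F (procA u w)) ∂(stdG (GIdx R P)) := by
    rw [← integral_indicator_one mA]
    refine integral_mono ((integrable_const _).indicator mA) ((integrable_const _).sub iA) fun w => ?_
    by_cases h : w ∈ {w | F (procA u w) = 0}
    · rw [Set.indicator_of_mem h]
      have : F (procA u w) = 0 := h
      simp [this]
    · rw [Set.indicator_of_notMem h]
      simpa using hF1 _
  have e2 : ∫ w, (1 - F (procC u w)) ∂(stdG (GIdx R P)) ≤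
      (stdG (GIdx R P)).real {w | F (procC u w) ≠ 1} := by
    rw [← integral_indicator_one mC]
    refine integral_mono ((integrable_const _).sub iC) ((integrable_const _).indicator mC) fun w => ?_
    by_cases h : w ∈ {w | F (procC u w) ≠ 1}
    · rw [Set.indicator_of_mem h]
      simpa using hF0 _
    · rw [Set.indicator_of_notMem h]
      have : F (procC u w) = 1 := by simpa using h
      simp [this]
  rw [integral_sub (integrable_const _) iA] at e1
  rw [integral_sub (integrable_const _) iC] at e2
  have := (ENNReal.toReal_le_toReal (measure_ne_top (stdG (GIdx R P)) _)
    (measure_ne_top (stdG (GIdx R P)) _)).1 ((e1.trans (by linarith)).trans e2)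
  exact this

end Gordon

end CCA

end


noncomputable section

namespace CCA

/-! ### Gordon's comparison for countable families and for two matrices -/

section GordonCountable

variable {R P Q : Type*} [Fintype R] [Fintype P] [Fintype Q] [DecidableEq R] [DecidableEq P]
  [DecidableEq Q]

/-- The matrix-vector product with the matrix given by its family of entries. -/
def mv (G : R × P → ℝ) (u : P → ℝ) : R → ℝ := fun i => ∑ j, u j * G (i, j)

lemma continuous_mv : Continuous fun p : (R × P → ℝ) × (P → ℝ) => mv p.1 p.2 := by
  unfold mv; fun_prop

/-- Gordon's comparison for finite families. -/
lemma gordon_finite {N : Type*} [Fintype N] [DecidableEq N] (u : N → P → ℝ)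
    (S : N → Set (R → ℝ)) (hS : ∀ x, IsOpen (S x)) {δ : ℝ} (hδ : 0 < δ) :
    stdG (R × P) {G | ∃ x, mv G (u x) ∈ S x} ≤
      2 * stdG (R ⊕ P) {w | ∃ x, ∃ y ∈ S x,
        l2 (y - l2 (u x) • fun i => w (Sum.inl i)) < ∑ j, u x j * w (Sum.inr j) + 4 * δ} := by
  have hopen : IsOpen {G : R × P → ℝ | ∃ x, mv G (u x) ∈ S x} := by
    simp only [Set.ofPred_exists]
    exact isOpen_iUnion fun x => (hS x).preimage (continuous_mv.comp (by fun_prop :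
      Continuous fun G : R × P → ℝ => (G, u x)))
  have hinj1 : Function.Injective fun p : R × P => (Sum.inl (Sum.inl p) : GIdx R P) := by
    intro a b h; simpa using h
  have hinj2 : Function.Injective fun p : R ⊕ P => (Sum.inr p : GIdx R P) := Sum.inr_injective
  set T := (fun w : GIdx R P → ℝ => w ∘ fun p : R × P => (Sum.inl (Sum.inl p) : GIdx R P)) ⁻¹'
    {G : R × P → ℝ | ∃ x, mv G (u x) ∈ S x} with hT
  have hTm : MeasurableSet T := (hopen.preimage (by fun_prop)).measurableSet
  rw [← stdG_map_comp hinj1, Measure.map_apply (by fun_prop) hopen.measurableSet]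
  -- The auxiliary variable does not enter the event, so conditioning on its being nonnegative costs
  -- only a factor 2.
  refine (stdG_le_two_mul (Sum.inl (Sum.inr ())) hTm ?_).trans ?_
  · intro w hw
    simpa [hT, Function.comp_def] using hw
  gcongr 2 * ?_
  refine le_trans (measure_mono ?_) ((gordon_finite_aux u S hδ).trans ?_)
  · rintro w ⟨⟨x, hx⟩, hw⟩
    refine ⟨x, ?_, ?_⟩
    · have : (fun i => procA u w x (some i)) = mv (w ∘ fun p => Sum.inl (Sum.inl p)) (u x) := by
        ext i; simp [procA_some, mv]
      rw [this]; exact hx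
    · rw [procA_none]
      exact mul_nonneg (l2_nonneg _) hw
  · rw [← stdG_map_comp hinj2]
    refine le_trans (measure_mono ?_) (Measure.le_map_apply
      (measurable_pi_iff.2 fun _ => measurable_pi_apply _ : Measurable
        fun w : GIdx R P → ℝ => w ∘ fun p : R ⊕ P => (Sum.inr p : GIdx R P)).aemeasurable _)
    rintro w ⟨x, y, hy, h⟩
    refine ⟨x, y, hy, ?_⟩
    rw [procC_none] at h
    have h1 : (fun i => procC u w x (some i)) = l2 (u x) • fun i => w (Sum.inr (Sum.inl i)) := by
      ext i; simp [procC_some]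
    rw [h1] at h
    exact h

/-- Gordon's comparison for countable families. -/
lemma gordon_countable (u : ℕ → P → ℝ) (S : ℕ → Set (R → ℝ)) (hS : ∀ x, IsOpen (S x))
    {δ : ℝ} (hδ : 0 < δ) :
    stdG (R × P) {G | ∃ x, mv G (u x) ∈ S x} ≤
      2 * stdG (R ⊕ P) {w | ∃ x, ∃ y ∈ S x,
        l2 (y - l2 (u x) • fun i => w (Sum.inl i)) < ∑ j, u x j * w (Sum.inr j) + 4 * δ} := by
  have h1 : {G : R × P → ℝ | ∃ x, mv G (u x) ∈ S x} =
      ⋃ k : ℕ, {G | ∃ x : Fin k, mv G (u x) ∈ S x} := by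
    ext G
    simp only [Set.mem_ofPred_eq, Set.mem_iUnion]
    constructor
    · rintro ⟨x, hx⟩
      exact ⟨x + 1, ⟨x, by omega⟩, hx⟩
    · rintro ⟨_, x, hx⟩
      exact ⟨x, hx⟩
  have hmono : Monotone fun k : ℕ => {G : R × P → ℝ | ∃ x : Fin k, mv G (u x) ∈ S x} := by
    rintro k l hkl G ⟨x, hx⟩
    exact ⟨⟨x, by omega⟩, hx⟩
  rw [h1, hmono.measure_iUnion]
  refine iSup_le fun k => (gordon_finite (fun x : Fin k => u x) (fun x => S x)
    (fun x => hS x) hδ).trans ?_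
  gcongr 2 * stdG (R ⊕ P) ?_
  rintro w ⟨x, hx⟩
  exact ⟨x, hx⟩

/-- Gordon's comparison for two independent Gaussian matrices. -/
lemma gordon_two (u : ℕ → P → ℝ) (v : ℕ → Q → ℝ) (S : ℕ → Set ((R → ℝ) × (R → ℝ)))
    (hS : ∀ x, IsOpen (S x)) {δ δ' : ℝ} (hδ : 0 < δ) (hδ' : 0 < δ') :
    ((stdG (R × P)).prod (stdG (R × Q))) {G | ∃ x, (mv G.1 (u x), mv G.2 (v x)) ∈ S x} ≤
      4 * ((stdG (R ⊕ P)).prod (stdG (R ⊕ Q))) {w | ∃ x, ∃ y ∈ S x,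
        l2 (y.1 - l2 (u x) • fun i => w.1 (Sum.inl i)) < ∑ j, u x j * w.1 (Sum.inr j) + 4 * δ ∧
        l2 (y.2 - l2 (v x) • fun i => w.2 (Sum.inl i)) < ∑ j, v x j * w.2 (Sum.inr j) + 4 * δ'} := by
  have hcP : ∀ x, Continuous fun G : R × P → ℝ => mv G (u x) := fun x =>
    continuous_mv.comp (by fun_prop : Continuous fun G : R × P → ℝ => (G, u x))
  have hcQ : ∀ x, Continuous fun G : R × Q → ℝ => mv G (v x) := fun x =>
    continuous_mv.comp (by fun_prop : Continuous fun G : R × Q → ℝ => (G, v x))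
  set E1 : Set ((R × P → ℝ) × (R × Q → ℝ)) := {G | ∃ x, (mv G.1 (u x), mv G.2 (v x)) ∈ S x} with hE1
  set E2 : Set ((R ⊕ P → ℝ) × (R × Q → ℝ)) := {G | ∃ x, ∃ y, (y, mv G.2 (v x)) ∈ S x ∧
    l2 (y - l2 (u x) • fun i => G.1 (Sum.inl i)) < ∑ j, u x j * G.1 (Sum.inr j) + 4 * δ} with hE2
  set E3 : Set ((R ⊕ P → ℝ) × (R ⊕ Q → ℝ)) := {w | ∃ x, ∃ y ∈ S x,
        l2 (y.1 - l2 (u x) • fun i => w.1 (Sum.inl i)) < ∑ j, u x j * w.1 (Sum.inr j) + 4 * δ ∧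
        l2 (y.2 - l2 (v x) • fun i => w.2 (Sum.inl i)) < ∑ j, v x j * w.2 (Sum.inr j) + 4 * δ'}
    with hE3
  have o1 : IsOpen E1 := by
    simp only [hE1, Set.ofPred_exists]
    exact isOpen_iUnion fun x => (hS x).preimage
      (((hcP x).comp continuous_fst).prodMk ((hcQ x).comp continuous_snd))
  have ol : ∀ (x : ℕ) (y : R → ℝ), IsOpen {w : R ⊕ P → ℝ |
      l2 (y - l2 (u x) • fun i => w (Sum.inl i)) < ∑ j, u x j * w (Sum.inr j) + 4 * δ} := fun x y =>
    isOpen_lt (continuous_l2.comp (by fun_prop)) (by fun_prop)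
  have ol' : ∀ (x : ℕ) (y : R → ℝ), IsOpen {w : R ⊕ Q → ℝ |
      l2 (y - l2 (v x) • fun i => w (Sum.inl i)) < ∑ j, v x j * w (Sum.inr j) + 4 * δ'} := fun x y =>
    isOpen_lt (continuous_l2.comp (by fun_prop)) (by fun_prop)
  have o2 : IsOpen E2 := by
    simp only [hE2, Set.ofPred_exists]
    refine isOpen_iUnion fun x => isOpen_iUnion fun y => IsOpen.inter ?_ ?_
    · exact (hS x).preimage (continuous_const.prodMk ((hcQ x).comp continuous_snd))
    · exact (ol x y).preimage continuous_fst
  have o3 : IsOpen E3 := by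
    have : E3 = ⋃ x, ⋃ y ∈ S x, {w : (R ⊕ P → ℝ) × (R ⊕ Q → ℝ) |
        l2 (y.1 - l2 (u x) • fun i => w.1 (Sum.inl i)) < ∑ j, u x j * w.1 (Sum.inr j) + 4 * δ ∧
        l2 (y.2 - l2 (v x) • fun i => w.2 (Sum.inl i)) < ∑ j, v x j * w.2 (Sum.inr j) + 4 * δ'} := by
      ext w
      simp only [hE3, Set.mem_iUnion, Set.mem_ofPred_eq, exists_prop]
    rw [this]
    refine isOpen_iUnion fun x => isOpen_biUnion fun y _ => IsOpen.inter ?_ ?_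
    · exact (ol x y.1).preimage continuous_fst
    · exact (ol' x y.2).preimage continuous_snd
  -- The comparison is applied to one matrix with the other frozen, and then to the second one. All
  -- sets involved are open, which settles measurability for Fubini; each application contributes a
  -- factor 2.
  rw [Measure.prod_apply_symm o1.measurableSet]
  calc ∫⁻ H, stdG (R × P) ((fun G => (G, H)) ⁻¹' E1) ∂(stdG (R × Q))
      ≤ ∫⁻ H, 2 * stdG (R ⊕ P) ((fun G => (G, H)) ⁻¹' E2) ∂(stdG (R × Q)) := by
        refine lintegral_mono fun H => ?_
        refine (gordon_countable u (fun x => {y | (y, mv H (v x)) ∈ S x}) (fun x => ?_) hδ)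
        exact (hS x).preimage (by fun_prop : Continuous fun y : R → ℝ => (y, mv H (v x)))
    _ = 2 * ((stdG (R ⊕ P)).prod (stdG (R × Q))) E2 := by
        rw [lintegral_const_mul' _ _ (by norm_num), Measure.prod_apply_symm o2.measurableSet]
    _ = 2 * ∫⁻ w, stdG (R × Q) (Prod.mk w ⁻¹' E2) ∂(stdG (R ⊕ P)) := by
        rw [Measure.prod_apply o2.measurableSet]
    _ ≤ 2 * ∫⁻ w, 2 * stdG (R ⊕ Q) (Prod.mk w ⁻¹' E3) ∂(stdG (R ⊕ P)) := by
        gcongr 2 * ?_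
        refine lintegral_mono fun w => ?_
        set S' : ℕ → Set (R → ℝ) := fun x => {y' | ∃ y, (y, y') ∈ S x ∧
          l2 (y - l2 (u x) • fun i => w (Sum.inl i)) < ∑ j, u x j * w (Sum.inr j) + 4 * δ} with hS'
        have hS'o : ∀ x, IsOpen (S' x) := fun x => by
          simp only [hS', Set.ofPred_exists]
          refine isOpen_iUnion fun y => IsOpen.inter ?_ isOpen_const
          exact (hS x).preimage (by fun_prop : Continuous fun y' : R → ℝ => (y, y'))
        have h1 : Prod.mk w ⁻¹' E2 = {H | ∃ x, mv H (v x) ∈ S' x} := by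
          ext H; simp [hE2, hS']
        rw [h1]
        refine (gordon_countable v S' hS'o hδ').trans ?_
        gcongr 2 * stdG (R ⊕ Q) ?_
        rintro w' ⟨x, y', ⟨y, hy, hy1⟩, hy2⟩
        exact ⟨x, (y, y'), hy, hy1, hy2⟩
    _ = 4 * ((stdG (R ⊕ P)).prod (stdG (R ⊕ Q))) E3 := by
        rw [lintegral_const_mul' _ _ (by norm_num), Measure.prod_apply o3.measurableSet, ← mul_assoc]
        norm_num

end GordonCountable

/-! ### Moments of Gaussian norms and scalar products -/

section Tails

variable {ι : Type*} [Fintype ι] [DecidableEq ι]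

lemma lintegral_coord_pow (e : ι) (q : ℕ) : ∫⁻ x, ‖x e‖ₑ ^ q ∂(stdG ι) = gMom q := by
  have := lintegral_dual_pow (ContinuousLinearMap.proj (R := ℝ) (φ := fun _ : ι => ℝ) e) q
  simpa [Pi.single_apply] using this

/-- Moments of the norm of a Gaussian vector. -/
lemma lintegral_l2_pow_le (s : ℕ) :
    ∫⁻ x, ENNReal.ofReal (l2 x) ^ (2 * s) ∂(stdG ι) ≤ (Fintype.card ι : ℝ≥0∞) ^ s * gMom (2 * s) := by
  rcases Nat.eq_zero_or_pos s with rfl | hs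
  · simp [gMom]
  obtain ⟨s, rfl⟩ : ∃ k, s = k + 1 := ⟨s - 1, by omega⟩
  have pt : ∀ x : ι → ℝ, ENNReal.ofReal (l2 x) ^ (2 * (s + 1)) ≤
      (Fintype.card ι : ℝ≥0∞) ^ s * ∑ e, ‖x e‖ₑ ^ (2 * (s + 1)) := by
    intro x
    have h1 : ENNReal.ofReal (l2 x) ^ (2 * (s + 1)) = (∑ e, ‖x e‖ₑ ^ 2) ^ (s + 1) := by
      rw [pow_mul, ← ENNReal.ofReal_pow (l2_nonneg _), sq_l2,
        ENNReal.ofReal_sum_of_nonneg fun _ _ => sq_nonneg _]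
      congr 2
      ext e
      rw [← sq_abs, ENNReal.ofReal_pow (abs_nonneg _), ← Real.norm_eq_abs, ofReal_norm]
    rw [h1]
    let _ : MeasurableSpace ι := ⊤
    have : MeasurableSingletonClass ι := ⟨fun _ => trivial⟩
    have h2 := lintegral_pow_le (Measure.count : Measure ι) (f := fun e => ‖x e‖ₑ ^ 2)
      (measurable_of_finite _).aemeasurable s
    simp only [lintegral_count, tsum_fintype] at h2
    rw [Measure.count_univ] at h2
    simpa [pow_mul] using h2
  refine (lintegral_mono pt).trans ?_
  rw [lintegral_const_mul _ (by fun_prop), lintegral_finsetSum _ (by fun_prop)]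
  simp only [lintegral_coord_pow, Finset.sum_const, Finset.card_univ, nsmul_eq_mul]
  rw [← mul_assoc, ← pow_succ]

/-- The squared norm of a Gaussian vector is concentrated. -/
lemma lintegral_sq_l2_sub_pow_le (s : ℕ) (hs : 0 < s) :
    ∫⁻ x, ‖(l2 x ^ 2 - Fintype.card ι : ℝ)‖ₑ ^ (2 * s) ∂(stdG ι) ≤
      (ENNReal.ofReal (Real.pi / 2) ^ (2 * s) * (2 ^ (2 * s) * gMom (2 * s)) *
        (2 ^ (2 * s) * gMom (2 * s))) * (Fintype.card ι : ℝ≥0∞) ^ s := by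
  obtain ⟨q, hq⟩ : ∃ q, 2 * s = q + 1 := ⟨2 * s - 1, by omega⟩
  set f : (ι → ℝ) → ℂ := fun x => ∑ e, (x e : ℂ) ^ 2 with hf
  have hfd : ∀ x, HasFDerivAt f (∑ e, ((2 * (x e : ℂ)) •
      (Complex.ofRealCLM.comp (ContinuousLinearMap.proj (R := ℝ) (φ := fun _ : ι => ℝ) e)))) x := by
    intro x
    refine HasFDerivAt.fun_sum fun e _ => ?_
    have h1 : HasFDerivAt (fun x : ι → ℝ => (x e : ℂ))
      (Complex.ofRealCLM.comp (ContinuousLinearMap.proj (R := ℝ) (φ := fun _ : ι => ℝ) e)) x :=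
      (Complex.ofRealCLM.comp (ContinuousLinearMap.proj (R := ℝ) (φ := fun _ : ι => ℝ) e)).hasFDerivAt
    have := h1.pow 2
    simpa using this
  have hfC : ContDiff ℝ 1 f := by
    refine ContDiff.sum fun e _ => ContDiff.pow ?_ 2
    exact (Complex.ofRealCLM.comp
      (ContinuousLinearMap.proj (R := ℝ) (φ := fun _ : ι => ℝ) e)).contDiff
  have hsq : ∀ e, Integrable (fun x : ι → ℝ => x e ^ 2) (stdG ι) := fun e => by
    have : MemLp (fun x : ι → ℝ => x e) 2 (stdG ι) :=
      IsGaussian.memLp_dual (stdG ι) (ContinuousLinearMap.proj (R := ℝ) (φ := fun _ : ι => ℝ) e) 2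
        (by norm_num)
    exact this.integrable_sq
  have hcsq : ∀ e, Integrable (fun x : ι → ℝ => (x e : ℂ) ^ 2) (stdG ι) := fun e => by
    have := (hsq e).ofReal (𝕜 := ℂ)
    simpa using this
  have hfi : Integrable f (stdG ι) := integrable_finsetSum _ fun e _ => hcsq e
  have hone : ∀ e, ∫ x : ι → ℝ, x e ^ 2 ∂(stdG ι) = 1 := by
    intro e
    have h1 : ∀ x t : _, HasDerivAt (fun s => (Function.update x e s : ι → ℝ) e)
        ((fun _ : ι → ℝ => (1 : ℝ)) (Function.update x e t)) t := fun x t => by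
      simpa using hasDerivAt_id' t
    have := integral_mul_stdG (F := ℝ) e (f := fun x => x e) (f' := fun _ => 1) h1
      (integrable_coord e) (by simpa [sq] using hsq e) (integrable_const _)
    simpa [sq] using this
  have hint : ∫ x, f x ∂(stdG ι) = Fintype.card ι := by
    rw [hf, integral_finsetSum _ fun e _ => hcsq e]
    have : ∀ e, ∫ x : ι → ℝ, (x e : ℂ) ^ 2 ∂(stdG ι) = 1 := fun e => by
      have h := integral_ofReal (𝕜 := ℂ) (μ := stdG ι) (f := fun x : ι → ℝ => x e ^ 2)
      rw [hone] at h
      simpa using h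
    simp [this]
  have hpt : ∀ x, f x - ∫ y, f y ∂(stdG ι) = ((l2 x ^ 2 - Fintype.card ι : ℝ) : ℂ) := fun x => by
    rw [hint, sq_l2]; simp [hf]
  -- The gradient of |x|² has length 2|x|, whose moments of order 2s are of order N^s for N
  -- coordinates.
  have hconc := lintegral_concentration hfC hfi q (g := fun x => 2 * l2 x)
    (fun x => mul_nonneg (by norm_num) (l2_nonneg _)) (fun x => by
      rw [(hfd x).fderiv, mul_pow, sq_l2, Finset.mul_sum]
      refine Finset.sum_le_sum fun e _ => le_of_eq ?_
      have h1 : (∑ i, (2 * (x i : ℂ)) • Complex.ofRealCLM.comp (ContinuousLinearMap.proj (R := ℝ)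
          (φ := fun _ : ι => ℝ) i)) (Pi.single e 1) = 2 * (x e : ℂ) := by
        simp only [sum_apply, smul_apply, ContinuousLinearMap.comp_apply,
          ContinuousLinearMap.proj_apply, Complex.ofRealCLM_apply]
        rw [Finset.sum_eq_single e (fun i _ hi => by simp [hi]) (by simp)]
        simp
      rw [h1, norm_mul, Complex.norm_real, mul_pow, Real.norm_eq_abs, sq_abs]
      norm_num)
  rw [← hq] at hconc
  simp only [hpt] at hconc
  have e1 : ∀ r : ℝ, ‖(r : ℂ)‖ₑ = ‖r‖ₑ := fun r => by
    rw [← ofReal_norm, ← ofReal_norm, Complex.norm_real]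
  simp only [e1] at hconc
  refine hconc.trans ?_
  have h2 : ∀ x : ι → ℝ, ENNReal.ofReal (2 * l2 x) ^ (2 * s) =
      2 ^ (2 * s) * ENNReal.ofReal (l2 x) ^ (2 * s) := fun x => by
    rw [ENNReal.ofReal_mul (by norm_num), mul_pow]; simp
  simp only [h2]
  rw [lintegral_const_mul' _ _ (by finiteness)]
  calc _ ≤ ENNReal.ofReal (Real.pi / 2) ^ (2 * s) * (2 ^ (2 * s) * gMom (2 * s)) *
        (2 ^ (2 * s) * ((Fintype.card ι : ℝ≥0∞) ^ s * gMom (2 * s))) := by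
        gcongr; exact lintegral_l2_pow_le s
    _ = _ := by ring

/-- Moments of the scalar product of two independent Gaussian vectors. -/
lemma lintegral_inner_pow_le (s : ℕ) :
    ∫⁻ w, ‖∑ i, w.1 i * w.2 i‖ₑ ^ (2 * s) ∂((stdG ι).prod (stdG ι)) ≤
      (gMom (2 * s) * gMom (2 * s)) * (Fintype.card ι : ℝ≥0∞) ^ s := by
  rw [lintegral_prod _ (by fun_prop)]
  have : ∀ x : ι → ℝ, ∫⁻ y, ‖∑ i, x i * y i‖ₑ ^ (2 * s) ∂(stdG ι) =
      gMom (2 * s) * ENNReal.ofReal (l2 x) ^ (2 * s) := by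
    intro x
    have := lintegral_dual_pow (∑ i : ι, x i • ContinuousLinearMap.proj (R := ℝ)
      (φ := fun _ : ι => ℝ) i) (2 * s)
    simp only [sum_apply, smul_apply, ContinuousLinearMap.proj_apply,
      smul_eq_mul] at this
    rw [this]
    simp [l2, Pi.single_apply]
  simp only [this]
  rw [lintegral_const_mul' _ _ (gMom_lt_top _).ne, mul_assoc]
  gcongr
  exact (lintegral_l2_pow_le (ι := ι) s).trans_eq (mul_comm _ _)

end Tails

end CCA

end


noncomputable section

namespace CCA

/-! ### Operator norms and the right edge by Gordon's comparison -/

section Edge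

variable {R P Q : Type*} [Fintype R] [Fintype P] [Fintype Q] [DecidableEq R] [DecidableEq P]
  [DecidableEq Q]

lemma mv_smul (G : R × P → ℝ) (c : ℝ) (u : P → ℝ) : mv G (c • u) = c • mv G u := by
  ext i; simp [mv, Finset.mul_sum, mul_assoc]

lemma l2_pos {u : P → ℝ} (hu : u ≠ 0) : 0 < l2 u := by
  rw [l2_eq_norm]; exact norm_pos_iff.2 (by simpa using hu)

/-- The operator norm of a Gaussian matrix is dominated by the norms of two Gaussian vectors. -/
lemma gordon_norm {t : ℝ} (δ : ℝ) (hδ : 0 < δ) :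
    stdG (R × P) {G | ∃ u, t * l2 u < l2 (mv G u)} ≤
      2 * stdG (R ⊕ P) {w | t < l2 (fun i => w (Sum.inl i)) + l2 (fun j => w (Sum.inr j)) + δ} := by
  classical
  -- The event is homogeneous and open in u, so it suffices to test a dense sequence. Requiring norm
  -- above 1 lets the additive error δ be absorbed into δ times the norm.
  set d : ℕ → P → ℝ := TopologicalSpace.denseSeq (P → ℝ)
  set S : ℕ → Set (R → ℝ) := fun x => {y | 1 < l2 (d x) ∧ t * l2 (d x) < l2 y} with hSdef
  have hS : ∀ x, IsOpen (S x) := fun x => by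
    refine IsOpen.inter isOpen_const ?_
    exact isOpen_lt continuous_const continuous_l2
  have h := gordon_countable d S hS (show 0 < δ / 4 by positivity)
  refine le_trans (measure_mono ?_) (h.trans ?_)
  · rintro G ⟨u, hu⟩
    have hu0 : u ≠ 0 := by
      rintro rfl
      have h1 : mv G (0 : P → ℝ) = 0 := by ext; simp [mv]
      rw [h1] at hu
      simp [l2] at hu
    have ho : IsOpen {u : P → ℝ | 1 < l2 u ∧ t * l2 u < l2 (mv G u)} := by
      refine IsOpen.inter (isOpen_lt continuous_const continuous_l2) ?_
      exact isOpen_lt (continuous_const.mul continuous_l2) (continuous_l2.comp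
        (continuous_mv.comp (by fun_prop : Continuous fun u : P → ℝ => (G, u))))
    have hne : {u : P → ℝ | 1 < l2 u ∧ t * l2 u < l2 (mv G u)}.Nonempty := by
      have hp := l2_pos hu0
      refine ⟨(2 / l2 u) • u, ?_, ?_⟩
      · rw [l2_smul, abs_of_pos (by positivity), div_mul_cancel₀ _ hp.ne']; norm_num
      · rw [mv_smul, l2_smul, l2_smul, abs_of_pos (by positivity), mul_left_comm]
        exact mul_lt_mul_of_pos_left hu (by positivity)
    obtain ⟨x, hx⟩ := (TopologicalSpace.denseRange_denseSeq (P → ℝ)).exists_mem_open ho hne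
    exact ⟨x, hx⟩
  · gcongr 2 * stdG (R ⊕ P) ?_
    rintro w ⟨x, y, ⟨h1, h2⟩, h3⟩
    have h4 := l2_add_le (y - l2 (d x) • fun i => w (Sum.inl i)) (l2 (d x) • fun i => w (Sum.inl i))
    rw [sub_add_cancel, l2_smul, abs_of_nonneg (l2_nonneg _)] at h4
    have h5 := sum_mul_le_l2 (d x) (fun j => w (Sum.inr j))
    have h6 : t * l2 (d x) <
        l2 (d x) * (l2 (fun i => w (Sum.inl i)) + l2 (fun j => w (Sum.inr j)) + δ) := by
      nlinarith
    have := l2_nonneg (d x)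
    show t < _
    nlinarith

/-- The pointwise inequality behind the location of the edge. -/
lemma quad_le {κ : ℝ} (h0 : 0 < κ) (h1 : κ < 1) (a b h h' : ℝ) :
    -κ * a ^ 2 - κ * b ^ 2 + 2 * (a * b) ≤
      (1 - κ ^ 2) / κ * ((a - h) ^ 2 + (b - h') ^ 2) + 2 * (1 - κ ^ 2) * (h * h') := by
  have h2 : 0 < 1 - κ ^ 2 := by nlinarith
  rw [← sub_nonneg]
  -- Eliminating a and then b leaves two complete squares and no remainder; this is where the value
  -- (1 - κ²)/κ is seen to be the right one.
  have key : (1 - κ ^ 2) / κ * ((a - h) ^ 2 + (b - h') ^ 2) + 2 * (1 - κ ^ 2) * (h * h') -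
      (-κ * a ^ 2 - κ * b ^ 2 + 2 * (a * b)) =
      ((a - κ * b - (1 - κ ^ 2) * h) ^ 2 + (1 - κ ^ 2) * (b - h' - κ * h) ^ 2) / κ := by
    field_simp
    ring
  rw [key]
  positivity

/-- By Cauchy–Schwarz the error is at most |u||g| + δs, so after division by s it is at most |u|(1 +
δ) + δ. The constants 3 and 7 are crude and use |u| ≤ 3/2 and δ ≤ 1. -/
lemma l2_err_sq_le {δ : ℝ} (hδ : 0 < δ) (hδ1 : δ ≤ 1) {s : ℝ} (hs : 0 < s) {u g : P → ℝ}
    {y b : R → ℝ} (hu : l2 u ^ 2 < 2) (hg : l2 g ≤ (1 + δ) * s)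
    (hy : l2 (y - l2 u • b) < ∑ j, u j * g j + 4 * (δ * s / 4)) :
    l2 (s⁻¹ • (y - l2 u • b)) ^ 2 ≤ l2 u ^ 2 * (1 + 3 * δ) + 7 * δ := by
  have k1 := sum_mul_le_l2 u g
  have k2 := l2_nonneg u
  have k3 : l2 u ≤ 3 / 2 := by
    by_contra hcon
    push Not at hcon
    nlinarith
  have k4 : l2 (y - l2 u • b) ≤ s * (l2 u * (1 + δ) + δ) := by
    have := mul_le_mul_of_nonneg_left hg k2
    linarith
  have k5 : l2 (s⁻¹ • (y - l2 u • b)) ≤ l2 u * (1 + δ) + δ := by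
    rw [l2_smul, abs_of_pos (by positivity), inv_mul_le_iff₀ hs]
    exact k4
  have k6 : δ ^ 2 ≤ δ := by nlinarith
  have k7 : l2 u ^ 2 * δ ^ 2 ≤ l2 u ^ 2 * δ := by gcongr
  have k8 : l2 u * δ ≤ 3 / 2 * δ := by gcongr
  have k9 : l2 u * δ ^ 2 ≤ 3 / 2 * δ := by gcongr
  calc _ ≤ (l2 u * (1 + δ) + δ) ^ 2 := by gcongr; exact l2_nonneg _
    _ = l2 u ^ 2 + 2 * (l2 u ^ 2 * δ) + l2 u ^ 2 * δ ^ 2 + 2 * (l2 u * δ) +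
        2 * (l2 u * δ ^ 2) + δ ^ 2 := by ring
    _ ≤ _ := by linarith

/-- `quad_le` is summed over coordinates with |u|h and |v|h' as reference points. The squared errors
give |u|² + |v|² up to factors 1 + O(δ), and the cross term is small since h and h' are nearly
orthogonal. The 18 is 3 + 14 from the errors and 1 from the cross term. -/
lemma quad_sum_le {κ : ℝ} (h0 : 0 < κ) (h1 : κ < 1) {δ : ℝ} (hδ : 0 < δ) (hδ1 : δ ≤ 1) {p q : ℝ}
    (hp : 0 < p) (hq : 0 < q) {u g : P → ℝ} {v g' : Q → ℝ} {hh hh' : R → ℝ} {y : (R → ℝ) × (R → ℝ)}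
    (n1 : 1 < l2 u ^ 2 + l2 v ^ 2) (n2 : l2 u ^ 2 + l2 v ^ 2 < 2)
    (c1 : l2 g ≤ (1 + δ) * p) (c2 : l2 g' ≤ (1 + δ) * q) (c3 : ∑ i, hh i * hh' i ≤ δ * (p * q))
    (h3 : l2 (y.1 - l2 u • hh) < ∑ j, u j * g j + 4 * (δ * p / 4))
    (h4 : l2 (y.2 - l2 v • hh') < ∑ j, v j * g' j + 4 * (δ * q / 4)) :
    -κ * l2 (p⁻¹ • y.1) ^ 2 - κ * l2 (q⁻¹ • y.2) ^ 2 + 2 * ∑ i, (p⁻¹ • y.1) i * (q⁻¹ • y.2) i ≤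
      (1 - κ ^ 2) / κ * (1 + 18 * δ) * (l2 u ^ 2 + l2 v ^ 2) := by
  have h2 : 0 < 1 - κ ^ 2 := by nlinarith
  set lam := (1 - κ ^ 2) / κ with hlam
  have hlam0 : 0 < lam := by positivity
  have hlam1 : 1 - κ ^ 2 ≤ lam := by rw [hlam, le_div_iff₀ h0]; nlinarith
  have g1 : l2 u ^ 2 < 2 := lt_of_le_of_lt (le_add_of_nonneg_right (sq_nonneg (l2 v))) n2
  have g2 : l2 v ^ 2 < 2 := lt_of_le_of_lt (le_add_of_nonneg_left (sq_nonneg (l2 u))) n2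
  have f1 := l2_err_sq_le hδ hδ1 hp g1 c1 h3
  have f2 := l2_err_sq_le hδ hδ1 hq g2 c2 h4
  have f3 : (-κ * l2 (p⁻¹ • y.1) ^ 2 - κ * l2 (q⁻¹ • y.2) ^ 2 +
        2 * ∑ i, (p⁻¹ • y.1) i * (q⁻¹ • y.2) i) ≤ lam * (l2 (p⁻¹ • (y.1 - l2 u • hh)) ^ 2 + l2 (q⁻¹ • (y.2 - l2 v • hh')) ^ 2) +
      2 * (1 - κ ^ 2) * (l2 u * l2 v * (p⁻¹ * q⁻¹ * ∑ i, hh i * hh' i)) := by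
    simp only [sq_l2]
    simp only [Finset.mul_sum, ← Finset.sum_add_distrib, ← Finset.sum_sub_distrib]
    refine Finset.sum_le_sum fun i _ => ?_
    have := quad_le h0 h1 (p⁻¹ * y.1 i) (q⁻¹ * y.2 i) (p⁻¹ * (l2 u * hh i)) (q⁻¹ * (l2 v * hh' i))
    simp only [Pi.smul_apply, Pi.sub_apply, smul_eq_mul, mul_sub]
    rw [← hlam] at this
    refine this.trans (le_of_eq ?_)
    ring
  have f4 : p⁻¹ * q⁻¹ * ∑ i, hh i * hh' i ≤ δ := by
    rw [← mul_inv, inv_mul_le_iff₀ (by positivity), mul_comm]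
    exact c3
  have f5 : 0 ≤ l2 u * l2 v := mul_nonneg (l2_nonneg _) (l2_nonneg _)
  have f6 : 2 * (l2 u * l2 v) ≤ l2 u ^ 2 + l2 v ^ 2 := by nlinarith [sq_nonneg (l2 u - l2 v)]
  have f7 : 2 * (1 - κ ^ 2) * (l2 u * l2 v * (p⁻¹ * q⁻¹ * ∑ i, hh i * hh' i)) ≤
      lam * (δ * (l2 u ^ 2 + l2 v ^ 2)) := by
    calc _ ≤ 2 * (1 - κ ^ 2) * (l2 u * l2 v * δ) := by gcongr
      _ = (1 - κ ^ 2) * (δ * (2 * (l2 u * l2 v))) := by ring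
      _ ≤ lam * (δ * (l2 u ^ 2 + l2 v ^ 2)) := by gcongr
  have f8 : lam * (l2 (p⁻¹ • (y.1 - l2 u • hh)) ^ 2 + l2 (q⁻¹ • (y.2 - l2 v • hh')) ^ 2) ≤
      lam * ((l2 u ^ 2 + l2 v ^ 2) * (1 + 3 * δ) + 14 * δ * (l2 u ^ 2 + l2 v ^ 2)) := by
    refine mul_le_mul_of_nonneg_left ?_ hlam0.le
    have := mul_lt_mul_of_pos_left n1 hδ
    linarith
  have f9 : lam * (1 + 18 * δ) * (l2 u ^ 2 + l2 v ^ 2) =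
    lam * ((l2 u ^ 2 + l2 v ^ 2) * (1 + 3 * δ) + 14 * δ * (l2 u ^ 2 + l2 v ^ 2)) +
    lam * (δ * (l2 u ^ 2 + l2 v ^ 2)) := by ring
  linarith

/-- Comparison for the quadratic form whose largest value is the right edge. -/
lemma gordon_edge {κ : ℝ} (h0 : 0 < κ) (h1 : κ < 1) {δ : ℝ} (hδ : 0 < δ) (hδ1 : δ ≤ 1) {p q : ℝ}
    (hp : 0 < p) (hq : 0 < q) :
    ((stdG (R × P)).prod (stdG (R × Q))) {G | ∃ u v,
      (1 - κ ^ 2) / κ * (1 + 18 * δ) * (l2 u ^ 2 + l2 v ^ 2) <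
        -κ * l2 (p⁻¹ • mv G.1 u) ^ 2 - κ * l2 (q⁻¹ • mv G.2 v) ^ 2 +
          2 * ∑ i, (p⁻¹ • mv G.1 u) i * (q⁻¹ • mv G.2 v) i} ≤
      4 * ((stdG (R ⊕ P)).prod (stdG (R ⊕ Q))) {w | (1 + δ) * p < l2 (fun j => w.1 (Sum.inr j)) ∨
        (1 + δ) * q < l2 (fun j => w.2 (Sum.inr j)) ∨
        δ * (p * q) < ∑ i, w.1 (Sum.inl i) * w.2 (Sum.inl i)} := by
  classical
  have h2 : 0 < 1 - κ ^ 2 := by nlinarith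
  set lam := (1 - κ ^ 2) / κ with hlam
  have hlam0 : 0 < lam := by positivity
  have hlam1 : 1 - κ ^ 2 ≤ lam := by rw [hlam, le_div_iff₀ h0]; nlinarith
  set d : ℕ → (P → ℝ) × (Q → ℝ) := TopologicalSpace.denseSeq ((P → ℝ) × (Q → ℝ))
  set F : (R → ℝ) × (R → ℝ) → ℝ := fun y => -κ * l2 (p⁻¹ • y.1) ^ 2 - κ * l2 (q⁻¹ • y.2) ^ 2 +
          2 * ∑ i, (p⁻¹ • y.1) i * (q⁻¹ • y.2) i with hF
  have hFc : Continuous F := by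
    have e1 : Continuous fun y : (R → ℝ) × (R → ℝ) => l2 (p⁻¹ • y.1) :=
      continuous_l2.comp (by fun_prop)
    have e2 : Continuous fun y : (R → ℝ) × (R → ℝ) => l2 (q⁻¹ • y.2) :=
      continuous_l2.comp (by fun_prop)
    simp only [hF, Pi.smul_apply]
    fun_prop
  have hNc : Continuous fun z : (P → ℝ) × (Q → ℝ) => l2 z.1 ^ 2 + l2 z.2 ^ 2 :=
    ((continuous_l2.comp continuous_fst).pow 2).add ((continuous_l2.comp continuous_snd).pow 2)
  set S : ℕ → Set ((R → ℝ) × (R → ℝ)) := fun x => {y | (1 < l2 (d x).1 ^ 2 + l2 (d x).2 ^ 2 ∧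
    l2 (d x).1 ^ 2 + l2 (d x).2 ^ 2 < 2) ∧
      lam * (1 + 18 * δ) * (l2 (d x).1 ^ 2 + l2 (d x).2 ^ 2) < F y} with hSdef
  have hS : ∀ x, IsOpen (S x) := fun x => by
    refine IsOpen.inter isOpen_const ?_
    exact isOpen_lt continuous_const hFc
  have h := gordon_two (fun x => (d x).1) (fun x => (d x).2) S hS
    (show 0 < δ * p / 4 by positivity) (show 0 < δ * q / 4 by positivity)
  refine le_trans (measure_mono ?_) (h.trans ?_)
  · rintro G ⟨u, v, huv⟩
    change _ < F (mv G.1 u, mv G.2 v) at huv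
    -- Homogeneity of degree two allows (u, v) to be rescaled into the open shell between squared
    -- norms 1 and 2, where density of the sequence applies.
    have hFs : ∀ (c : ℝ) (y : (R → ℝ) × (R → ℝ)), F (c • y) = c ^ 2 * F y := by
      intro c y
      have e1 : ∀ (b : ℝ) (z : R → ℝ), l2 (b • c • z) ^ 2 = c ^ 2 * l2 (b • z) ^ 2 := fun b z => by
        rw [smul_comm, l2_smul, mul_pow, sq_abs]
      simp only [hF, Prod.smul_fst, Prod.smul_snd, e1]
      have : ∑ i, (p⁻¹ • c • y.1) i * (q⁻¹ • c • y.2) i =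
          c ^ 2 * ∑ i, (p⁻¹ • y.1) i * (q⁻¹ • y.2) i := by
        rw [Finset.mul_sum]
        refine Finset.sum_congr rfl fun i _ => ?_
        simp only [Pi.smul_apply, smul_eq_mul]; ring
      rw [this]; ring
    have hpos : 0 < l2 u ^ 2 + l2 v ^ 2 := by
      by_contra hcon
      have e1 : l2 u = 0 := by nlinarith [sq_nonneg (l2 u), sq_nonneg (l2 v)]
      have e2 : l2 v = 0 := by nlinarith [sq_nonneg (l2 u), sq_nonneg (l2 v)]
      have e3 : u = 0 := by by_contra h; exact (l2_pos h).ne' e1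
      have e4 : v = 0 := by by_contra h; exact (l2_pos h).ne' e2
      subst e3 e4
      have e5 : (mv G.1 (0 : P → ℝ), mv G.2 (0 : Q → ℝ)) = (0 : ℝ) • (0 : (R → ℝ) × (R → ℝ)) := by
        ext <;> simp [mv]
      rw [e5, hFs, e1, e2] at huv
      simp at huv
    set A : Set ((P → ℝ) × (Q → ℝ)) := {z | (1 < l2 z.1 ^ 2 + l2 z.2 ^ 2 ∧
      l2 z.1 ^ 2 + l2 z.2 ^ 2 < 2) ∧ lam * (1 + 18 * δ) * (l2 z.1 ^ 2 + l2 z.2 ^ 2) <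
        F (mv G.1 z.1, mv G.2 z.2)} with hA
    have ho : IsOpen A := by
      refine (IsOpen.inter (isOpen_lt continuous_const hNc) (isOpen_lt hNc continuous_const)).inter ?_
      refine isOpen_lt (continuous_const.mul hNc) (hFc.comp ?_)
      exact (continuous_mv.comp (by fun_prop : Continuous fun z : (P → ℝ) × (Q → ℝ) =>
        (G.1, z.1))).prodMk (continuous_mv.comp (by fun_prop :
          Continuous fun z : (P → ℝ) × (Q → ℝ) => (G.2, z.2)))
    have hne : A.Nonempty := by
      set c := √(3 / 2 / (l2 u ^ 2 + l2 v ^ 2)) with hc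
      have hc2 : c ^ 2 * (l2 u ^ 2 + l2 v ^ 2) = 3 / 2 := by
        rw [hc, Real.sq_sqrt (by positivity), div_mul_cancel₀ _ hpos.ne']
      have hcp : 0 < c ^ 2 := by
        by_contra hcon
        have : c ^ 2 = 0 := by nlinarith [sq_nonneg c]
        rw [this] at hc2; norm_num at hc2
      have e1 : l2 (c • u) ^ 2 + l2 (c • v) ^ 2 = c ^ 2 * (l2 u ^ 2 + l2 v ^ 2) := by
        rw [l2_smul, l2_smul, mul_pow, mul_pow, sq_abs]; ring
      refine ⟨(c • u, c • v), ⟨?_, ?_⟩, ?_⟩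
      · simp only [e1, hc2]; norm_num
      · simp only [e1, hc2]; norm_num
      · simp only [e1, mv_smul]
        rw [← Prod.smul_mk, hFs]
        calc _ = c ^ 2 * (lam * (1 + 18 * δ) * (l2 u ^ 2 + l2 v ^ 2)) := by ring
          _ < _ := mul_lt_mul_of_pos_left huv hcp
    obtain ⟨x, hx⟩ := (TopologicalSpace.denseRange_denseSeq _).exists_mem_open ho hne
    exact ⟨x, hx⟩
  · gcongr 4 * ((stdG (R ⊕ P)).prod (stdG (R ⊕ Q))) ?_
    rintro w ⟨x, y, ⟨⟨n1, n2⟩, h2⟩, h3, h4⟩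
    by_contra hcon
    rw [Set.mem_ofPred_eq, not_or, not_or, not_lt, not_lt, not_lt] at hcon
    exact absurd h2 (not_lt.2 (quad_sum_le h0 h1 hδ hδ1 hp hq n1 n2 hcon.1 hcon.2.1 hcon.2.2 h3 h4))

end Edge

end CCA

end


noncomputable section

namespace CCA

/-! ### The null model in standard Gaussian coordinates -/

section Model

open scoped Matrix.Norms.L2Operator

/-- Index set of the Gaussian variables in the pair `(U, V)`. -/
abbrev GI (n m k : ℕ) : Type := (Fin n × Fin m) ⊕ (Fin n × Fin k)

variable {n m k : ℕ}

/-- The matrix `U` as a function of the underlying standard Gaussian variables. -/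
def matU (x : GI n m k → ℝ) : Matrix (Fin n) (Fin m) ℝ := .of fun i j => (√m)⁻¹ * x (.inl (i, j))

/-- The matrix `V` as a function of the underlying standard Gaussian variables. -/
def matV (x : GI n m k → ℝ) : Matrix (Fin n) (Fin k) ℝ := .of fun i j => (√k)⁻¹ * x (.inr (i, j))

lemma stdG_map_sum (ι ι' : Type*) [Fintype ι] [Fintype ι'] :
    (stdG (ι ⊕ ι')).map (fun x => (x ∘ Sum.inl, x ∘ Sum.inr)) = (stdG ι).prod (stdG ι') :=
  (measurePreserving_sumPiEquivProdPi fun _ : ι ⊕ ι' => gaussianReal 0 1).map_eq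

lemma gaussianMatrix_eq_map (n p : ℕ) :
    gaussianMatrix n p = (stdG (Fin n × Fin p)).map fun x i j => (√p)⁻¹ * x (i, j) := by
  have h1 : (stdG (Fin n × Fin p)).map (MeasurableEquiv.curry (Fin n) (Fin p) ℝ) =
      Measure.pi fun _ : Fin n => stdG (Fin p) := by
    have := Measure.infinitePi_map_curry (ι := Fin n) (κ := Fin p) (fun _ _ => gaussianReal 0 1)
    simp only [Measure.infinitePi_eq_pi] at this
    exact this
  have h2 : ∀ f : ℝ → ℝ, Measurable f → (stdG (Fin p)).map (fun x j => f (x j)) =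
      Measure.pi fun _ : Fin p => (gaussianReal 0 1).map f := fun f hf => by
    have : ∀ _ : Fin p, IsProbabilityMeasure ((gaussianReal 0 1).map f) :=
      fun _ => Measure.isProbabilityMeasure_map hf.aemeasurable
    exact Measure.pi_map_pi (fun _ => hf.aemeasurable)
  have h3 : gaussianReal 0 ((p : ℝ≥0)⁻¹) = (gaussianReal 0 1).map fun t => (√p)⁻¹ * t := by
    rw [gaussianReal_eq_map]; simp
  have h4 : gaussianMatrix n p =
      (Measure.pi fun _ : Fin n => stdG (Fin p)).map fun x i j => (√p)⁻¹ * x i j := by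
    have hm : Measurable fun (x : Fin p → ℝ) j => (√(p : ℝ))⁻¹ * x j := by fun_prop
    have : ∀ _ : Fin n, IsProbabilityMeasure ((stdG (Fin p)).map fun x j => (√p)⁻¹ * x j) :=
      fun _ => Measure.isProbabilityMeasure_map hm.aemeasurable
    rw [Measure.pi_map_pi (f := fun _ (x : Fin p → ℝ) j => (√p)⁻¹ * x j)
      (fun _ => hm.aemeasurable), gaussianMatrix, h3, h2 _ (by fun_prop)]
  rw [h4, ← h1, Measure.map_map (by fun_prop) (by fun_prop)]
  rfl

/-- The null model as the law of a function of standard Gaussian variables. -/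
lemma nullLaw_apply (hm : 0 < m) (hk : 0 < k) (S : Set ((Fin n → Fin m → ℝ) × (Fin n → Fin k → ℝ))) :
    nullLaw n m k S = stdG (GI n m k) {x | (matU x, matV x) ∈ S} := by
  have hcont : Continuous fun x : GI n m k → ℝ =>
      ((fun i j => (√m)⁻¹ * x (.inl (i, j)), fun i j => (√k)⁻¹ * x (.inr (i, j))) :
        (Fin n → Fin m → ℝ) × (Fin n → Fin k → ℝ)) := by fun_prop
  have h : nullLaw n m k = (stdG (GI n m k)).map fun x : GI n m k → ℝ =>
      ((fun i j => (√m)⁻¹ * x (.inl (i, j)), fun i j => (√k)⁻¹ * x (.inr (i, j))) :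
        (Fin n → Fin m → ℝ) × (Fin n → Fin k → ℝ)) := by
    rw [nullLaw, gaussianMatrix_eq_map, gaussianMatrix_eq_map, Measure.map_prod_map _ _ (by fun_prop)
      (by fun_prop), ← stdG_map_sum, Measure.map_map (by fun_prop) (by fun_prop)]
    rfl
  -- Injectivity makes the scaling map a measurable embedding, so the identity holds for arbitrary
  -- sets, with outer measure. No measurability of the events in the theorem is needed.
  have hinj : Function.Injective fun x : GI n m k → ℝ =>
      ((fun i j => (√m)⁻¹ * x (.inl (i, j)), fun i j => (√k)⁻¹ * x (.inr (i, j))) :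
        (Fin n → Fin m → ℝ) × (Fin n → Fin k → ℝ)) := by
    intro x y hxy
    have hm' : (√(m : ℝ))⁻¹ ≠ 0 := by positivity
    have hk' : (√(k : ℝ))⁻¹ ≠ 0 := by positivity
    simp only [Prod.mk.injEq, funext_iff] at hxy
    ext (⟨i, j⟩ | ⟨i, j⟩)
    · exact mul_left_cancel₀ hm' (hxy.1 i j)
    · exact mul_left_cancel₀ hk' (hxy.2 i j)
  rw [h, (hcont.measurableEmbedding hinj).map_apply]
  rfl

/-- The dimensions are comparable. -/
structure Reg (c n m k : ℕ) : Prop where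
  n_pos : 0 < n
  n_le_m : n ≤ c * m
  m_le : m ≤ c * n
  n_le_k : n ≤ c * k
  k_le : k ≤ c * n

lemma Reg.m_pos {c : ℕ} (h : Reg c n m k) : 0 < m :=
  Nat.pos_of_ne_zero fun h0 => by have := h.n_pos; have := h.n_le_m; simp [h0] at this; omega

lemma Reg.k_pos {c : ℕ} (h : Reg c n m k) : 0 < k :=
  Nat.pos_of_ne_zero fun h0 => by have := h.n_pos; have := h.n_le_k; simp [h0] at this; omega

lemma Reg.c_pos {c : ℕ} (h : Reg c n m k) : 0 < c :=
  Nat.pos_of_ne_zero fun h0 => by have := h.n_pos; have := h.n_le_m; simp [h0] at this; omega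

/-- The events have probability smaller than every power of `n`, uniformly in comparable
dimensions. -/
def Negl (c : ℕ) (E : ∀ n m k : ℕ, Set (GI n m k → ℝ)) : Prop :=
  ∀ s : ℕ, ∃ C : ℝ≥0∞, C ≠ ∞ ∧ ∀ n m k, Reg c n m k → stdG (GI n m k) (E n m k) ≤ C / n ^ s

lemma Negl.mono {c : ℕ} {E F : ∀ n m k : ℕ, Set (GI n m k → ℝ)} (hF : Negl c F)
    (h : ∀ n m k, Reg c n m k → E n m k ⊆ F n m k) : Negl c E := fun s => by
  obtain ⟨C, hC, hb⟩ := hF s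
  exact ⟨C, hC, fun n m k hr => (measure_mono (h n m k hr)).trans (hb n m k hr)⟩

lemma Negl.union {c : ℕ} {E F : ∀ n m k : ℕ, Set (GI n m k → ℝ)} (hE : Negl c E) (hF : Negl c F) :
    Negl c fun n m k => E n m k ∪ F n m k := fun s => by
  obtain ⟨C, hC, hb⟩ := hE s
  obtain ⟨D, hD, hd⟩ := hF s
  refine ⟨C + D, by finiteness, fun n m k hr => (measure_union_le _ _).trans ?_⟩
  rw [ENNReal.add_div]
  exact add_le_add (hb n m k hr) (hd n m k hr)

/-- Bounds for a larger power of `n` imply bounds for a smaller one. -/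
lemma div_pow_le_div_pow {C : ℝ≥0∞} (hn : 0 < n) {s t : ℕ} (hst : s ≤ t) :
    C / (n : ℝ≥0∞) ^ t ≤ C / n ^ s := by
  refine ENNReal.div_le_div_left (pow_le_pow_right₀ ?_ hst) _
  exact_mod_cast hn

lemma mul_pow_div_le {C a N : ℝ≥0∞} {t : ℕ} (ha : a ≠ 0) (ha' : a ≠ ∞) (hN : N ≠ 0) (hN' : N ≠ ∞) :
    C * N ^ t / (a * N) ^ (2 * t) ≤ C / a ^ (2 * t) / N ^ t := by
  have h1 : a ^ (2 * t) ≠ 0 := pow_ne_zero _ ha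
  have h2 : a ^ (2 * t) ≠ ∞ := by finiteness
  have h3 : N ^ t ≠ 0 := pow_ne_zero _ hN
  have h4 : N ^ t ≠ ∞ := by finiteness
  rw [ENNReal.div_le_iff (pow_ne_zero _ (mul_ne_zero ha hN)) (by finiteness)]
  calc C * N ^ t = (C / a ^ (2 * t) * a ^ (2 * t)) * N ^ t := by rw [ENNReal.div_mul_cancel h1 h2]
    _ = C / a ^ (2 * t) / N ^ t * N ^ t * a ^ (2 * t) * N ^ t := by
        rw [ENNReal.div_mul_cancel h3 h4]
    _ ≤ _ := le_of_eq (by rw [mul_pow, two_mul t, pow_add N]; ring)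

lemma l2_tail {δ : ℝ} (hδ : 0 < δ) (s : ℕ) : ∃ C : ℝ≥0∞, C ≠ ∞ ∧
    ∀ (ι : Type) [Fintype ι], 0 < Fintype.card ι →
      stdG ι {x | (1 + δ) * √(Fintype.card ι) < l2 x} ≤ C / (Fintype.card ι : ℝ≥0∞) ^ (s + 1) := by
  classical
  set C0 : ℝ≥0∞ := ENNReal.ofReal (Real.pi / 2) ^ (2 * (s + 1)) *
    (2 ^ (2 * (s + 1)) * gMom (2 * (s + 1))) * (2 ^ (2 * (s + 1)) * gMom (2 * (s + 1)))
  have hg := (gMom_lt_top (2 * (s + 1))).ne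
  have hC0 : C0 ≠ ∞ := by finiteness
  have hδ' : ENNReal.ofReal δ ^ (2 * (s + 1)) ≠ 0 := by
    simp [hδ]
  refine ⟨C0 / ENNReal.ofReal δ ^ (2 * (s + 1)), ENNReal.div_ne_top hC0 hδ', fun ι _ hN => ?_⟩
  set N := Fintype.card ι with hNdef
  have hN0 : (N : ℝ≥0∞) ≠ 0 := by exact_mod_cast hN.ne'
  have hsub : {x : ι → ℝ | (1 + δ) * √N < l2 x} ⊆
      {x | (ENNReal.ofReal δ * N) ^ (2 * (s + 1)) ≤ ‖(l2 x ^ 2 - N : ℝ)‖ₑ ^ (2 * (s + 1))} := by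
    intro x hx
    simp only [Set.mem_ofPred_eq] at hx ⊢
    gcongr
    have h1 : δ * N ≤ l2 x ^ 2 - N := by
      have h2 : ((1 + δ) * √N) ^ 2 ≤ l2 x ^ 2 := by gcongr
      rw [mul_pow, Real.sq_sqrt (by positivity)] at h2
      nlinarith [mul_pos hδ hδ, (by exact_mod_cast hN : (0 : ℝ) < N)]
    calc ENNReal.ofReal δ * N = ENNReal.ofReal (δ * N) := by
          rw [ENNReal.ofReal_mul hδ.le, ENNReal.ofReal_natCast]
      _ ≤ ENNReal.ofReal (l2 x ^ 2 - N) := ENNReal.ofReal_le_ofReal h1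
      _ ≤ _ := by rw [← ofReal_norm]; exact ENNReal.ofReal_le_ofReal (le_abs_self _)
  have hmeas : AEMeasurable (fun x : ι → ℝ => ‖(l2 x ^ 2 - N : ℝ)‖ₑ ^ (2 * (s + 1))) (stdG ι) := by
    have : Measurable (l2 : (ι → ℝ) → ℝ) := continuous_l2.measurable
    fun_prop
  -- Markov's inequality with the moment of order 2(s+1): the quotient N^(s+1) / (δN)^(2(s+1)) is of
  -- order N^(-(s+1)).
  refine (measure_mono hsub).trans ((meas_ge_le_lintegral_div hmeas (by positivity)
    (by finiteness)).trans ?_)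
  refine (ENNReal.div_le_div_right (lintegral_sq_l2_sub_pow_le (s + 1) (by omega)) _).trans ?_
  exact mul_pow_div_le (by simpa using hδ) (by finiteness) (by exact_mod_cast hN.ne') (by finiteness)

end Model

end CCA

end


noncomputable section

namespace CCA

/-! ### High-probability bounds for norms and for the quadratic form -/

section Norms

open scoped Matrix.Norms.L2Operator

variable {n m k : ℕ}

/-- The operator norm of a real matrix is determined by real vectors. -/
lemma norm_map_ofReal_le {p q : ℕ} (A : Matrix (Fin p) (Fin q) ℝ) {t : ℝ} (ht : 0 ≤ t)
    (h : ∀ u, l2 (A.mulVec u) ≤ t * l2 u) : ‖A.map Complex.ofReal‖ ≤ t := by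
  rw [Matrix.l2_opNorm_def]
  refine ContinuousLinearMap.opNorm_le_bound _ ht fun v => ?_
  have h1 : ‖v‖ ^ 2 = l2 (fun j => (v j).re) ^ 2 + l2 (fun j => (v j).im) ^ 2 := by
    rw [EuclideanSpace.norm_sq_eq, sq_l2, sq_l2, ← Finset.sum_add_distrib]
    exact Finset.sum_congr rfl fun j _ => by rw [← Complex.normSq_eq_norm_sq, Complex.normSq_apply]; ring
  set y := ((Matrix.toEuclideanLin ≪≫ₗ LinearMap.toContinuousLinearMap) (A.map Complex.ofReal)) v
    with hy
  have hyi : ∀ i, y i = ∑ j, (A i j : ℂ) * v j := fun i => by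
    simp [hy, Matrix.toLpLin_apply, Matrix.mulVec, dotProduct]
  have h2 : ‖y‖ ^ 2 = l2 (A.mulVec fun j => (v j).re) ^ 2 + l2 (A.mulVec fun j => (v j).im) ^ 2 := by
    rw [EuclideanSpace.norm_sq_eq, sq_l2, sq_l2, ← Finset.sum_add_distrib]
    refine Finset.sum_congr rfl fun i _ => ?_
    rw [← Complex.normSq_eq_norm_sq, Complex.normSq_apply, hyi]
    simp [Matrix.mulVec, dotProduct, Complex.re_sum, Complex.im_sum, sq]
  refine abs_le_of_sq_le_sq' ?_ (by positivity) |>.2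
  rw [h2, mul_pow, h1, mul_add, ← mul_pow, ← mul_pow]
  gcongr
  exacts [l2_nonneg _, h _, l2_nonneg _, h _]

/-- The operator norm of `U`. -/
def opU (x : GI n m k → ℝ) : ℝ := ‖(matU x).map Complex.ofReal‖

/-- The operator norm of `V`. -/
def opV (x : GI n m k → ℝ) : ℝ := ‖(matV x).map Complex.ofReal‖

lemma continuous_matU : Continuous fun x : GI n m k → ℝ => (matU x).map Complex.ofReal := by
  refine continuous_matrix fun i j => ?_
  simp only [matU, Matrix.map_apply, Matrix.of_apply]
  fun_prop

lemma continuous_matV : Continuous fun x : GI n m k → ℝ => (matV x).map Complex.ofReal := by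
  refine continuous_matrix fun i j => ?_
  simp only [matV, Matrix.map_apply, Matrix.of_apply]
  fun_prop

lemma continuous_opU : Continuous (opU : (GI n m k → ℝ) → ℝ) := continuous_matU.norm

lemma continuous_opV : Continuous (opV : (GI n m k → ℝ) → ℝ) := continuous_matV.norm

lemma opU_nonneg (x : GI n m k → ℝ) : 0 ≤ opU x := norm_nonneg _

lemma opV_nonneg (x : GI n m k → ℝ) : 0 ≤ opV x := norm_nonneg _

lemma matU_mulVec (x : GI n m k → ℝ) (u : Fin m → ℝ) :
    (matU x).mulVec u = (√m)⁻¹ • mv (x ∘ Sum.inl) u := by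
  ext i
  simp only [matU, Matrix.mulVec, dotProduct, mv, Matrix.of_apply, Pi.smul_apply, smul_eq_mul,
    Finset.mul_sum, Function.comp_apply]
  exact Finset.sum_congr rfl fun j _ => by ring

lemma matV_mulVec (x : GI n m k → ℝ) (u : Fin k → ℝ) :
    (matV x).mulVec u = (√k)⁻¹ • mv (x ∘ Sum.inr) u := by
  ext i
  simp only [matV, Matrix.mulVec, dotProduct, mv, Matrix.of_apply, Pi.smul_apply, smul_eq_mul,
    Finset.mul_sum, Function.comp_apply]
  exact Finset.sum_congr rfl fun j _ => by ring

lemma stdG_mv_le {t : ℝ} :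
    stdG (Fin n × Fin m) {G | ∃ u, t * l2 u < l2 (mv G u)} ≤
      2 * stdG (Fin n ⊕ Fin m) {w | t < 2 * l2 w + 1} := by
  refine (gordon_norm 1 one_pos).trans ?_
  gcongr 2 * stdG _ ?_
  intro w hw
  have h1 : l2 (fun i => w (Sum.inl i)) ≤ l2 w := by
    refine abs_le_of_sq_le_sq' ?_ (l2_nonneg _) |>.2
    rw [sq_l2, sq_l2, Fintype.sum_sum_type]
    exact le_add_of_nonneg_right (Finset.sum_nonneg fun _ _ => sq_nonneg _)
  have h2 : l2 (fun i => w (Sum.inr i)) ≤ l2 w := by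
    refine abs_le_of_sq_le_sq' ?_ (l2_nonneg _) |>.2
    rw [sq_l2, sq_l2, Fintype.sum_sum_type]
    exact le_add_of_nonneg_left (Finset.sum_nonneg fun _ _ => sq_nonneg _)
  simp only [Set.mem_ofPred_eq] at hw ⊢
  linarith

lemma measurable_comp_right {α β : Type*} (f : α → β) : Measurable fun w : β → ℝ => w ∘ f :=
  measurable_pi_iff.2 fun _ => measurable_pi_apply _

/-- U is a rescaled marginal of the Gaussian family, and its operator norm is tested on real vectors
by `norm_map_ofReal_le`. The bound is kept in terms of a Gaussian norm because it yields both tails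
and moments. -/
lemma stdG_opU_le (hm : 0 < m) {t : ℝ} (ht : 0 ≤ t) :
    stdG (GI n m k) {x | t < opU x} ≤
      2 * stdG (Fin n ⊕ Fin m) {w | t < (√m)⁻¹ * (2 * l2 w + 1)} := by
  have hm' : 0 < √(m : ℝ) := by positivity
  have h1 := stdG_mv_le (n := n) (m := m) (t := t * √m)
  simp only [lt_inv_mul_iff₀ hm', mul_comm _ t]
  refine le_trans ?_ h1
  have hinj : Function.Injective (Sum.inl : Fin n × Fin m → GI n m k) := Sum.inl_injective
  rw [← stdG_map_comp hinj]
  refine le_trans (measure_mono ?_) (Measure.le_map_apply (measurable_comp_right _).aemeasurable _)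
  intro x hx
  by_contra hcon
  simp only [Set.mem_preimage, Set.mem_ofPred_eq, not_exists, not_lt] at hcon hx
  refine absurd hx (not_lt.2 (norm_map_ofReal_le _ ht fun u => ?_))
  rw [matU_mulVec, l2_smul, abs_of_pos (by positivity), inv_mul_le_iff₀ hm']
  calc _ ≤ _ := hcon u
    _ = _ := by ring

lemma stdG_opV_le (hk : 0 < k) {t : ℝ} (ht : 0 ≤ t) :
    stdG (GI n m k) {x | t < opV x} ≤
      2 * stdG (Fin n ⊕ Fin k) {w | t < (√k)⁻¹ * (2 * l2 w + 1)} := by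
  have hm' : 0 < √(k : ℝ) := by positivity
  have h1 := stdG_mv_le (n := n) (m := k) (t := t * √k)
  simp only [lt_inv_mul_iff₀ hm', mul_comm _ t]
  refine le_trans ?_ h1
  have hinj : Function.Injective (Sum.inr : Fin n × Fin k → GI n m k) := Sum.inr_injective
  rw [← stdG_map_comp hinj]
  refine le_trans (measure_mono ?_) (Measure.le_map_apply (measurable_comp_right _).aemeasurable _)
  intro x hx
  by_contra hcon
  simp only [Set.mem_preimage, Set.mem_ofPred_eq, not_exists, not_lt] at hcon hx
  refine absurd hx (not_lt.2 (norm_map_ofReal_le _ ht fun u => ?_))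
  rw [matV_mulVec, l2_smul, abs_of_pos (by positivity), inv_mul_le_iff₀ hm']
  calc _ ≤ _ := hcon u
    _ = _ := by ring

/-- The tail of the norm of a Gaussian vector in comparable dimensions. -/
lemma l2_tail_scaled (c s : ℕ) : ∃ C : ℝ≥0∞, C ≠ ∞ ∧ ∀ n p : ℕ, 0 < n → n ≤ c * p →
    stdG (Fin n ⊕ Fin p) {w | 5 * (c + 1) < (√p)⁻¹ * (2 * l2 w + 1)} ≤ C / (n : ℝ≥0∞) ^ s := by
  obtain ⟨C, hC, hb⟩ := l2_tail one_pos s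
  refine ⟨C, hC, fun n p hn hnp => ?_⟩
  have hp : 0 < p := Nat.pos_of_ne_zero fun h => by simp [h] at hnp; omega
  have hp' : 0 < √(p : ℝ) := by positivity
  have hcard : Fintype.card (Fin n ⊕ Fin p) = n + p := by simp
  have h1 := hb (Fin n ⊕ Fin p) (by omega)
  rw [hcard] at h1
  -- Origin of the 5: the tail bound with δ = 1 controls the Gaussian norm by 2√(n+p) ≤ 2(c+1)√p, so
  -- doubling costs 4(c+1)√p, and the additive 1 is covered by one more (c+1)√p.
  refine (measure_mono ?_).trans (h1.trans ?_)
  · intro w hw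
    simp only [Set.mem_ofPred_eq, lt_inv_mul_iff₀ hp'] at hw ⊢
    have hp1 : (1 : ℝ) ≤ √p := by
      rw [Real.one_le_sqrt]; exact_mod_cast hp
    have h2 : √((n + p : ℕ) : ℝ) ≤ (c + 1) * √p := by
      rw [Real.sqrt_le_left (by positivity), mul_pow, Real.sq_sqrt (by positivity)]
      have : ((n + p : ℕ) : ℝ) ≤ (c + 1) * p := by
        push_cast
        have : (n : ℝ) ≤ c * p := by exact_mod_cast hnp
        linarith
      refine this.trans ?_
      gcongr
      nlinarith [(Nat.cast_nonneg c : (0 : ℝ) ≤ c)]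
    have hc0 : (0 : ℝ) ≤ c := Nat.cast_nonneg c
    nlinarith
  · refine le_trans ?_ (div_pow_le_div_pow hn (Nat.le_succ s))
    gcongr
    omega

/-- The operator norms are bounded with overwhelming probability. -/
lemma negl_norm (c : ℕ) : Negl c fun _ _ _ => {x | 5 * (c + 1) < opU x ∨ 5 * (c + 1) < opV x} := by
  have h0 : (0 : ℝ) ≤ 5 * (c + 1) := by positivity
  refine Negl.union (E := fun n m k => {x | 5 * (c + 1) < opU x})
    (F := fun n m k => {x | 5 * (c + 1) < opV x}) (fun s => ?_) (fun s => ?_)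
  all_goals
    obtain ⟨C, hC, hb⟩ := l2_tail_scaled c s
    refine ⟨2 * C, by finiteness, fun n m k hr => ?_⟩
    rw [mul_div_assoc]
  · exact (stdG_opU_le hr.m_pos h0).trans (by gcongr; exact hb n m hr.n_pos hr.n_le_m)
  · exact (stdG_opV_le hr.k_pos h0).trans (by gcongr; exact hb n k hr.n_pos hr.n_le_k)

lemma ennreal_add_pow_le (a b : ℝ≥0∞) (q : ℕ) : (a + b) ^ q ≤ 2 ^ q * (a ^ q + b ^ q) := by
  have h : a + b ≤ 2 * max a b := by
    rw [two_mul]; exact add_le_add (le_max_left _ _) (le_max_right _ _)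
  refine (pow_le_pow_left₀ (zero_le) h q).trans ?_
  rw [mul_pow]
  gcongr
  rcases max_cases a b with h | h
  · rw [h.1]; exact le_self_add
  · rw [h.1]; exact le_add_self

/-- Moments of a variable whose tails are dominated. -/
lemma lintegral_pow_le_of_tail {α β : Type*} [MeasurableSpace α] [MeasurableSpace β] {μ : Measure α}
    {ν : Measure β} {Y : α → ℝ} {X : β → ℝ} (hY : Measurable Y) (hX : Measurable X)
    (hY0 : ∀ a, 0 ≤ Y a) (hX0 : ∀ b, 0 ≤ X b) (h : ∀ t, 0 ≤ t → μ {a | t < Y a} ≤ 2 * ν {b | t < X b})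
    (q : ℕ) : ∫⁻ a, ENNReal.ofReal (Y a) ^ (q + 1) ∂μ ≤
      2 * ∫⁻ b, ENNReal.ofReal (X b) ^ (q + 1) ∂ν := by
  have hq : (0 : ℝ) < ((q + 1 : ℕ) : ℝ) := by positivity
  -- The layer-cake formula turns the domination of tails into a domination of moments.
  have e1 := lintegral_rpow_eq_lintegral_meas_lt_mul μ (ae_of_all _ hY0) hY.aemeasurable hq
  have e2 := lintegral_rpow_eq_lintegral_meas_lt_mul ν (ae_of_all _ hX0) hX.aemeasurable hq
  simp only [Real.rpow_natCast] at e1 e2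
  simp only [← ENNReal.ofReal_pow (hY0 _), ← ENNReal.ofReal_pow (hX0 _)]
  rw [e1, e2, mul_left_comm]
  gcongr
  rw [← lintegral_const_mul' _ _ (by norm_num)]
  refine setLIntegral_mono' measurableSet_Ioi fun t ht => ?_
  rw [← mul_assoc]
  gcongr
  exact h t (le_of_lt ht)

lemma lintegral_l2_scaled (c s : ℕ) : ∃ C : ℝ≥0∞, C ≠ ∞ ∧ ∀ n p : ℕ, 0 < n → n ≤ c * p →
    ∫⁻ w, ENNReal.ofReal ((√p)⁻¹ * (2 * l2 w + 1)) ^ (2 * s) ∂(stdG (Fin n ⊕ Fin p)) ≤ C := by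
  have hg := (gMom_lt_top (2 * s)).ne
  refine ⟨2 ^ (2 * s) * (2 ^ (2 * s) * ((c + 1) ^ s * gMom (2 * s)) + 1), by finiteness,
    fun n p hn hnp => ?_⟩
  have hp : 0 < p := Nat.pos_of_ne_zero fun h => by simp [h] at hnp; omega
  have hp0 : (p : ℝ≥0∞) ^ s ≠ 0 := by positivity
  have e1 : ∀ w : Fin n ⊕ Fin p → ℝ, ENNReal.ofReal ((√p)⁻¹ * (2 * l2 w + 1)) ^ (2 * s) ≤
      ((p : ℝ≥0∞) ^ s)⁻¹ * (2 ^ (2 * s) * (2 ^ (2 * s) * ENNReal.ofReal (l2 w) ^ (2 * s) + 1)) := by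
    intro w
    rw [ENNReal.ofReal_mul (by positivity), mul_pow]
    have h1 : ENNReal.ofReal (√(p : ℝ))⁻¹ ^ (2 * s) = ((p : ℝ≥0∞) ^ s)⁻¹ := by
      rw [pow_mul, ← ENNReal.ofReal_pow (by positivity), inv_pow, Real.sq_sqrt (by positivity),
        ENNReal.ofReal_inv_of_pos (by positivity), ENNReal.ofReal_natCast, ENNReal.inv_pow]
    rw [h1]
    gcongr
    rw [ENNReal.ofReal_add (mul_nonneg (by norm_num) (l2_nonneg _)) (by norm_num),
      ENNReal.ofReal_mul (by norm_num)]
    refine (ennreal_add_pow_le _ _ _).trans (le_of_eq ?_)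
    rw [mul_pow]; norm_num
  refine (lintegral_mono e1).trans ?_
  have hl : Measurable (l2 : (Fin n ⊕ Fin p → ℝ) → ℝ) := continuous_l2.measurable
  rw [lintegral_const_mul _ (by fun_prop), lintegral_const_mul _ (by fun_prop),
    lintegral_add_right _ measurable_const, lintegral_const_mul _ (by fun_prop)]
  simp only [lintegral_const, measure_univ, mul_one]
  have h2 := lintegral_l2_pow_le (ι := Fin n ⊕ Fin p) s
  have h3 : ((Fintype.card (Fin n ⊕ Fin p) : ℕ) : ℝ≥0∞) ≤ (c + 1) * p := by
    have : Fintype.card (Fin n ⊕ Fin p) ≤ (c + 1) * p := by simp; nlinarith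
    exact_mod_cast this
  rw [ENNReal.inv_mul_le_iff hp0 (by finiteness)]
  have h4 : (1 : ℝ≥0∞) ≤ (p : ℝ≥0∞) ^ s := one_le_pow₀ (by exact_mod_cast hp)
  calc _ ≤ 2 ^ (2 * s) * (2 ^ (2 * s) * (((c + 1) * p) ^ s * gMom (2 * s)) + (p : ℝ≥0∞) ^ s) := by
        gcongr
        refine h2.trans ?_
        gcongr
    _ = _ := by rw [mul_pow]; ring

/-- A bound for the size of the data. -/
def opK (x : GI n m k → ℝ) : ℝ := 1 + opU x + opV x

lemma one_le_opK (x : GI n m k → ℝ) : 1 ≤ opK x := by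
  have := opU_nonneg x; have := opV_nonneg x; unfold opK; linarith

/-- All moments of the operator norms are bounded. -/
lemma lintegral_opK_pow (c q : ℕ) : ∃ C : ℝ≥0∞, C ≠ ∞ ∧ ∀ n m k : ℕ, Reg c n m k →
    ∫⁻ x, ENNReal.ofReal (opK x) ^ q ∂(stdG (GI n m k)) ≤ C := by
  obtain ⟨C, hC, hb⟩ := lintegral_l2_scaled c (q + 1)
  refine ⟨2 ^ (2 * (q + 1)) * (2 ^ (2 * (q + 1)) * (1 + 2 * C) + 2 * C), by finiteness,
    fun n m k hr => ?_⟩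
  have hl : ∀ p, Measurable (l2 : (Fin n ⊕ Fin p → ℝ) → ℝ) := fun p => continuous_l2.measurable
  have hU : Measurable (opU : (GI n m k → ℝ) → ℝ) := continuous_opU.measurable
  have hV : Measurable (opV : (GI n m k → ℝ) → ℝ) := continuous_opV.measurable
  have bU : ∫⁻ x, ENNReal.ofReal (opU x) ^ (2 * (q + 1)) ∂(stdG (GI n m k)) ≤ 2 * C := by
    refine (lintegral_pow_le_of_tail hU (X := fun w : Fin n ⊕ Fin m → ℝ =>
      (√m)⁻¹ * (2 * l2 w + 1)) (ν := stdG _) (by have := hl m; fun_prop) opU_nonneg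
      (fun w => by have := l2_nonneg w; positivity) (fun t ht => stdG_opU_le hr.m_pos ht)
      (2 * q + 1)).trans ?_
    gcongr
    exact hb n m hr.n_pos hr.n_le_m
  have bV : ∫⁻ x, ENNReal.ofReal (opV x) ^ (2 * (q + 1)) ∂(stdG (GI n m k)) ≤ 2 * C := by
    refine (lintegral_pow_le_of_tail hV (X := fun w : Fin n ⊕ Fin k → ℝ =>
      (√k)⁻¹ * (2 * l2 w + 1)) (ν := stdG _) (by have := hl k; fun_prop) opV_nonneg
      (fun w => by have := l2_nonneg w; positivity) (fun t ht => stdG_opV_le hr.k_pos ht)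
      (2 * q + 1)).trans ?_
    gcongr
    exact hb n k hr.n_pos hr.n_le_k
  have pt : ∀ x : GI n m k → ℝ, ENNReal.ofReal (opK x) ^ q ≤ 2 ^ (2 * (q + 1)) *
      (2 ^ (2 * (q + 1)) * (1 + ENNReal.ofReal (opU x) ^ (2 * (q + 1))) +
        ENNReal.ofReal (opV x) ^ (2 * (q + 1))) := by
    intro x
    have h1 : (1 : ℝ≥0∞) ≤ ENNReal.ofReal (opK x) := by
      rw [ENNReal.one_le_ofReal]; exact one_le_opK x
    -- Since `opK` is at least 1, the power may be raised to the even exponent 2(q+1), for which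
    -- Gaussian moments are available.
    refine (pow_le_pow_right₀ h1 (show q ≤ 2 * (q + 1) by omega)).trans ?_
    rw [opK, ENNReal.ofReal_add (by have := opU_nonneg x; positivity) (opV_nonneg x),
      ENNReal.ofReal_add (by norm_num) (opU_nonneg x)]
    refine (ennreal_add_pow_le _ _ _).trans ?_
    gcongr
    refine (ennreal_add_pow_le _ _ _).trans (le_of_eq ?_)
    simp
  refine (lintegral_mono pt).trans ?_
  rw [lintegral_const_mul _ (by fun_prop), lintegral_add_right _ (by fun_prop),
    lintegral_const_mul _ (by fun_prop), lintegral_add_right _ (by fun_prop)]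
  simp only [lintegral_const, measure_univ, mul_one]
  gcongr

lemma div_pow_le_of_le_mul {C : ℝ≥0∞} {c p t : ℕ} (hn : 0 < n) (h : n ≤ c * p) :
    C / (p : ℝ≥0∞) ^ t ≤ C * c ^ t / (n : ℝ≥0∞) ^ t := by
  have hp : (p : ℝ≥0∞) ^ t ≠ 0 := pow_ne_zero _ (by
    have : p ≠ 0 := by rintro rfl; simp at h; omega
    exact_mod_cast this)
  have hn0 : (n : ℝ≥0∞) ^ t ≠ 0 := pow_ne_zero _ (by exact_mod_cast hn.ne')
  rw [ENNReal.div_le_iff hp (by finiteness), mul_comm, ← mul_div_assoc,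
    ENNReal.le_div_iff_mul_le (.inl hn0) (.inl (by finiteness))]
  have h1 : (n : ℝ≥0∞) ^ t ≤ (c : ℝ≥0∞) ^ t * (p : ℝ≥0∞) ^ t := by
    rw [← mul_pow]
    gcongr
    exact_mod_cast h
  calc C * (n : ℝ≥0∞) ^ t ≤ C * ((c : ℝ≥0∞) ^ t * (p : ℝ≥0∞) ^ t) := by gcongr
    _ = _ := by ring

lemma stdG_inner_tail (c s : ℕ) {δ : ℝ} (hδ : 0 < δ) : ∃ C : ℝ≥0∞, C ≠ ∞ ∧ ∀ n m k : ℕ,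
    Reg c n m k → ((stdG (Fin n)).prod (stdG (Fin n)))
      {w | δ * (√m * √k) < ∑ i, w.1 i * w.2 i} ≤ C / (n : ℝ≥0∞) ^ s := by
  have hg := (gMom_lt_top (2 * s)).ne
  by_cases hc : c = 0
  · exact ⟨0, by simp, fun n m k hr => absurd hr.c_pos (by omega)⟩
  have hc0 : (0 : ℝ) < c := by exact_mod_cast Nat.pos_of_ne_zero hc
  have ha : ENNReal.ofReal (δ / c) ≠ 0 := by
    simp only [ne_eq, ENNReal.ofReal_eq_zero, not_le]; positivity
  refine ⟨gMom (2 * s) * gMom (2 * s) / ENNReal.ofReal (δ / c) ^ (2 * s),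
    ENNReal.div_ne_top (by finiteness) (pow_ne_zero _ ha), fun n m k hr => ?_⟩
  have hn := hr.n_pos
  have hsub : {w : (Fin n → ℝ) × (Fin n → ℝ) | δ * (√m * √k) < ∑ i, w.1 i * w.2 i} ⊆
      {w | (ENNReal.ofReal (δ / c) * n) ^ (2 * s) ≤ ‖∑ i, w.1 i * w.2 i‖ₑ ^ (2 * s)} := by
    intro w hw
    simp only [Set.mem_ofPred_eq] at hw ⊢
    gcongr
    have h1 : (n : ℝ) / c ≤ √m * √k := by
      rw [← Real.sqrt_mul (by positivity)]
      refine Real.le_sqrt_of_sq_le ?_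
      rw [div_pow, div_le_iff₀ (by positivity)]
      have e1 : (n : ℝ) ≤ c * m := by exact_mod_cast hr.n_le_m
      have e2 : (n : ℝ) ≤ c * k := by exact_mod_cast hr.n_le_k
      calc (n : ℝ) ^ 2 = n * n := sq _
        _ ≤ (c * m) * (c * k) := by gcongr
        _ = _ := by ring
    calc ENNReal.ofReal (δ / c) * n = ENNReal.ofReal (δ * (n / c)) := by
          rw [← ENNReal.ofReal_natCast n, ← ENNReal.ofReal_mul (by positivity)]
          congr 1; ring
      _ ≤ ENNReal.ofReal (∑ i, w.1 i * w.2 i) :=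
          ENNReal.ofReal_le_ofReal ((mul_le_mul_of_nonneg_left h1 hδ.le).trans hw.le)
      _ ≤ _ := by rw [← ofReal_norm]; exact ENNReal.ofReal_le_ofReal (le_abs_self _)
  refine (measure_mono hsub).trans ((meas_ge_le_lintegral_div (by fun_prop)
    (pow_ne_zero _ (mul_ne_zero ha (by exact_mod_cast hn.ne'))) (by finiteness)).trans ?_)
  refine (ENNReal.div_le_div_right (lintegral_inner_pow_le s) _).trans ?_
  rw [Fintype.card_fin]
  exact mul_pow_div_le ha (by finiteness) (by exact_mod_cast hn.ne') (by finiteness)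

/-- With overwhelming probability the quadratic form of the Schur complement stays below the
edge. -/
lemma negl_edge (c : ℕ) {κ : ℝ} (h0 : 0 < κ) (h1 : κ < 1) {δ : ℝ} (hδ : 0 < δ) (hδ1 : δ ≤ 1) :
    Negl c fun _ _ _ => {x | ∃ u v, (1 - κ ^ 2) / κ * (1 + 18 * δ) * (l2 u ^ 2 + l2 v ^ 2) <
        -κ * l2 ((matU x).mulVec u) ^ 2 - κ * l2 ((matV x).mulVec v) ^ 2 +
          2 * ∑ i, (matU x).mulVec u i * (matV x).mulVec v i} := by
  intro s
  obtain ⟨C, hC, hb⟩ := l2_tail hδ s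
  obtain ⟨D, hD, hd⟩ := stdG_inner_tail c s hδ
  refine ⟨4 * (C * c ^ (s + 1) + C * c ^ (s + 1) + D), by finiteness, fun n m k hr => ?_⟩
  have hn := hr.n_pos
  have hm := hr.m_pos
  have hk := hr.k_pos
  have hp : 0 < √(m : ℝ) := by positivity
  have hq : 0 < √(k : ℝ) := by positivity
  simp only [matU_mulVec, matV_mulVec]
  -- The choices p = √m and q = √k normalize the entries. The three exceptional events are two large
  -- Gaussian norms and one large scalar product.
  have step := gordon_edge (R := Fin n) (P := Fin m) (Q := Fin k) h0 h1 hδ hδ1 hp hq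
  rw [← stdG_map_sum] at step
  refine ((Measure.le_map_apply ((measurable_comp_right _).prodMk
    (measurable_comp_right _)).aemeasurable _).trans step).trans ?_
  rw [mul_div_assoc, ENNReal.add_div, ENNReal.add_div]
  gcongr 4 * ?_
  refine (measure_union_le _ _).trans ?_
  rw [add_assoc]
  refine add_le_add ?_ ((measure_union_le _ _).trans (add_le_add ?_ ?_))
  · have e := hb (Fin m) (by simpa using hm)
    rw [Fintype.card_fin] at e
    refine le_trans ?_ (e.trans ((div_pow_le_of_le_mul hn hr.n_le_m).trans
      (div_pow_le_div_pow hn (Nat.le_succ s))))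
    have hmap : (((stdG (Fin n ⊕ Fin m)).prod (stdG (Fin n ⊕ Fin k))).map
        fun w => w.1 ∘ Sum.inr) = stdG (Fin m) := by
      rw [← stdG_map_comp (Sum.inr_injective : Function.Injective (Sum.inr : Fin m → Fin n ⊕ Fin m)),
        ← (measurePreserving_fst (μ := stdG (Fin n ⊕ Fin m)) (ν := stdG (Fin n ⊕ Fin k))).map_eq,
        Measure.map_map (measurable_comp_right _) measurable_fst,
        (measurePreserving_fst (μ := stdG (Fin n ⊕ Fin m)) (ν := stdG (Fin n ⊕ Fin k))).map_eq]
      rfl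
    rw [← hmap]
    exact Measure.le_map_apply ((measurable_comp_right _).comp measurable_fst).aemeasurable _
  · have e := hb (Fin k) (by simpa using hk)
    rw [Fintype.card_fin] at e
    refine le_trans ?_ (e.trans ((div_pow_le_of_le_mul hn hr.n_le_k).trans
      (div_pow_le_div_pow hn (Nat.le_succ s))))
    have hmap : (((stdG (Fin n ⊕ Fin m)).prod (stdG (Fin n ⊕ Fin k))).map
        fun w => w.2 ∘ Sum.inr) = stdG (Fin k) := by
      rw [← stdG_map_comp (Sum.inr_injective : Function.Injective (Sum.inr : Fin k → Fin n ⊕ Fin k)),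
        ← (measurePreserving_snd (μ := stdG (Fin n ⊕ Fin m)) (ν := stdG (Fin n ⊕ Fin k))).map_eq,
        Measure.map_map (measurable_comp_right _) measurable_snd,
        (measurePreserving_snd (μ := stdG (Fin n ⊕ Fin m)) (ν := stdG (Fin n ⊕ Fin k))).map_eq]
      rfl
    rw [← hmap]
    exact Measure.le_map_apply ((measurable_comp_right _).comp measurable_snd).aemeasurable _
  · refine le_trans ?_ (hd n m k hr)
    have hmap : (((stdG (Fin n ⊕ Fin m)).prod (stdG (Fin n ⊕ Fin k))).map
        (Prod.map (fun w => w ∘ Sum.inl) (fun w => w ∘ Sum.inl))) =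
        (stdG (Fin n)).prod (stdG (Fin n)) := by
      rw [← Measure.map_prod_map _ _ (measurable_comp_right _) (measurable_comp_right _),
        stdG_map_comp (Sum.inl_injective : Function.Injective (Sum.inl : Fin n → Fin n ⊕ Fin m)),
        stdG_map_comp (Sum.inl_injective : Function.Injective (Sum.inl : Fin n → Fin n ⊕ Fin k))]
    rw [← hmap]
    exact Measure.le_map_apply ((measurable_comp_right _).prodMap
      (measurable_comp_right _)).aemeasurable _

end Norms

end CCA

end


noncomputable section

namespace CCA

/-! ### Schur complement and deterministic resolvent bounds -/

section Deterministic

open scoped Matrix.Norms.L2Operator ComplexConjugate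
open Matrix

/-- The Euclidean norm of a complex vector. -/
def nrm {ι : Type*} [Fintype ι] (v : ι → ℂ) : ℝ := ‖WithLp.toLp 2 v‖

section Nrm

variable {ι ι' : Type*} [Fintype ι] [Fintype ι']

lemma nrm_nonneg (v : ι → ℂ) : 0 ≤ nrm v := norm_nonneg _

lemma sq_nrm (v : ι → ℂ) : nrm v ^ 2 = ∑ i, ‖v i‖ ^ 2 := by
  rw [nrm, EuclideanSpace.norm_sq_eq]

lemma nrm_add_le (v w : ι → ℂ) : nrm (v + w) ≤ nrm v + nrm w := by
  simp only [nrm, WithLp.toLp_add]; exact norm_add_le _ _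

lemma nrm_sub_le (v w : ι → ℂ) : nrm (v - w) ≤ nrm v + nrm w := by
  simp only [nrm, WithLp.toLp_sub]; exact norm_sub_le _ _

lemma nrm_smul (c : ℂ) (v : ι → ℂ) : nrm (c • v) = ‖c‖ * nrm v := by
  simp only [nrm, WithLp.toLp_smul, norm_smul]

lemma nrm_zero : nrm (0 : ι → ℂ) = 0 := by simp [nrm]

lemma eq_zero_of_nrm_eq_zero {v : ι → ℂ} (h : nrm v = 0) : v = 0 := by
  simpa [nrm] using h

lemma norm_dotProduct_le (v w : ι → ℂ) : ‖star v ⬝ᵥ w‖ ≤ nrm v * nrm w := by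
  have := norm_inner_le_norm (𝕜 := ℂ) (WithLp.toLp 2 v) (WithLp.toLp 2 w)
  rw [EuclideanSpace.inner_toLp_toLp, dotProduct_comm] at this
  exact this

lemma norm_dotProduct_le' (v w : ι → ℂ) : ‖v ⬝ᵥ w‖ ≤ nrm v * nrm w := by
  have h := norm_dotProduct_le (star v) w
  have h2 : nrm (star v) = nrm v :=
    (sq_eq_sq₀ (nrm_nonneg _) (nrm_nonneg _)).1 (by simp [sq_nrm])
  rwa [star_star, h2] at h

lemma star_dotProduct_self_eq (v : ι → ℂ) : star v ⬝ᵥ v = ((nrm v ^ 2 : ℝ) : ℂ) := by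
  rw [sq_nrm]
  simp only [dotProduct, Pi.star_apply]
  push_cast
  refine Finset.sum_congr rfl fun i _ => ?_
  rw [RCLike.star_def, Complex.conj_mul']

lemma nrm_mulVec_le [DecidableEq ι] [DecidableEq ι'] (A : Matrix ι' ι ℂ) (v : ι → ℂ) :
    nrm (A *ᵥ v) ≤ ‖A‖ * nrm v := l2_opNorm_mulVec A (WithLp.toLp 2 v)

lemma opNorm_le_of_nrm [DecidableEq ι] [DecidableEq ι'] (A : Matrix ι' ι ℂ) {c : ℝ} (hc : 0 ≤ c)
    (h : ∀ v, nrm (A *ᵥ v) ≤ c * nrm v) : ‖A‖ ≤ c := by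
  rw [l2_opNorm_def]
  refine ContinuousLinearMap.opNorm_le_bound _ hc fun v => ?_
  exact h v.ofLp

end Nrm

variable {τm τk : ℝ}

lemma kappa_pos (hm : 0 < τm) (hk : 0 < τk) : 0 < kappa τm τk :=
  Real.rpow_pos_of_pos (mul_pos hm hk) _

lemma alpha_mul (h0 : 0 < kappa τm τk) (h1 : kappa τm τk < 1) :
    alpha τm τk * (kappa τm τk ^ 2 - 1) = kappa τm τk := by
  have : kappa τm τk ^ 2 - 1 ≠ 0 := by nlinarith
  rw [alpha, div_mul_cancel₀ _ this]

variable {n m k : ℕ} (U : Matrix (Fin n) (Fin m) ℝ) (V : Matrix (Fin n) (Fin k) ℝ) (z : ℂ)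

/-- The quadratic form of the Schur complement. -/
def quadForm (κ : ℝ) (a : Fin m → ℂ) (b : Fin k → ℂ) : ℝ :=
  -κ * nrm (U.map Complex.ofReal *ᵥ a) ^ 2 - κ * nrm (V.map Complex.ofReal *ᵥ b) ^ 2 +
    2 * (star (U.map Complex.ofReal *ᵥ a) ⬝ᵥ (V.map Complex.ofReal *ᵥ b)).re

lemma star_mulVec_transpose {p q : ℕ} (A : Matrix (Fin p) (Fin q) ℝ) (a : Fin q → ℂ) (b : Fin p → ℂ) :
    star a ⬝ᵥ ((A.map Complex.ofReal)ᵀ *ᵥ b) = star (A.map Complex.ofReal *ᵥ a) ⬝ᵥ b := by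
  rw [star_mulVec, dotProduct_mulVec]
  congr 2
  ext i j
  simp [conjTranspose_apply]

lemma lin_rows {w f : Idx n m k → ℂ} (hf : lin τm τk U V z *ᵥ w = f) :
    (f ∘ Sum.inl ∘ Sum.inl = -z • (w ∘ Sum.inl ∘ Sum.inl) + ((√(kappa τm τk) : ℝ) : ℂ) •
      ((U.map Complex.ofReal)ᵀ *ᵥ (w ∘ Sum.inr ∘ Sum.inl))) ∧
    (f ∘ Sum.inl ∘ Sum.inr = -z • (w ∘ Sum.inl ∘ Sum.inr) + ((√(kappa τm τk) : ℝ) : ℂ) •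
      ((V.map Complex.ofReal)ᵀ *ᵥ (w ∘ Sum.inr ∘ Sum.inr))) ∧
    (f ∘ Sum.inr ∘ Sum.inl =
      ((√(kappa τm τk) : ℝ) : ℂ) • (U.map Complex.ofReal *ᵥ (w ∘ Sum.inl ∘ Sum.inl)) +
        (((alpha τm τk * kappa τm τk : ℝ) : ℂ) • (w ∘ Sum.inr ∘ Sum.inl) +
          (alpha τm τk : ℂ) • (w ∘ Sum.inr ∘ Sum.inr))) ∧
    (f ∘ Sum.inr ∘ Sum.inr =
      ((√(kappa τm τk) : ℝ) : ℂ) • (V.map Complex.ofReal *ᵥ (w ∘ Sum.inl ∘ Sum.inr)) +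
        ((alpha τm τk : ℂ) • (w ∘ Sum.inr ∘ Sum.inl) +
          ((alpha τm τk * kappa τm τk : ℝ) : ℂ) • (w ∘ Sum.inr ∘ Sum.inr))) := by
  subst hf
  simp only [lin, fromBlocks_mulVec, transpose_smul, zero_mulVec, smul_mulVec, one_mulVec,
    add_zero, zero_add]
  refine ⟨?_, ?_, ?_, ?_⟩ <;> ext i <;> simp [Function.comp_def]

/-- Solving the last two block rows. -/
lemma solve_rows {κ α : ℝ} (h0 : 0 < κ) (hα : α * (κ ^ 2 - 1) = κ) {ι : Type*}
    {b b' g g' p p' : ι → ℂ}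
    (h : g = p + (((α * κ : ℝ) : ℂ) • b + (α : ℂ) • b'))
    (h' : g' = p' + ((α : ℂ) • b + ((α * κ : ℝ) : ℂ) • b')) :
    b = (g - (κ : ℂ)⁻¹ • g') - p + (κ : ℂ)⁻¹ • p' ∧ b' = (g' - (κ : ℂ)⁻¹ • g) - p' + (κ : ℂ)⁻¹ • p := by
  have hκ : (κ : ℂ) ≠ 0 := by exact_mod_cast h0.ne'
  have hα' : (α : ℂ) * (κ ^ 2 - 1) = κ := by exact_mod_cast hα
  subst h h'
  constructor
  all_goals
    ext i
    simp only [Pi.add_apply, Pi.sub_apply, Pi.smul_apply, smul_eq_mul]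
    push_cast
    field_simp
  · linear_combination (-b i) * hα'
  · linear_combination (-b' i) * hα'

/-- The bilinear identity for `f = L w`. -/
lemma lin_identity (h0 : 0 < kappa τm τk) (h1 : kappa τm τk < 1) (w f : Idx n m k → ℂ)
    (hf : lin τm τk U V z *ᵥ w = f) :
    (quadForm U V (kappa τm τk) (w ∘ Sum.inl ∘ Sum.inl) (w ∘ Sum.inl ∘ Sum.inr) : ℂ) -
        z * ((nrm (w ∘ Sum.inl ∘ Sum.inl) ^ 2 + nrm (w ∘ Sum.inl ∘ Sum.inr) ^ 2 : ℝ) : ℂ) =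
      star (w ∘ Sum.inl ∘ Sum.inl) ⬝ᵥ (f ∘ Sum.inl ∘ Sum.inl) +
      star (w ∘ Sum.inl ∘ Sum.inr) ⬝ᵥ (f ∘ Sum.inl ∘ Sum.inr) -
      ((√(kappa τm τk) : ℝ) : ℂ) * (star (U.map Complex.ofReal *ᵥ (w ∘ Sum.inl ∘ Sum.inl)) ⬝ᵥ
        (f ∘ Sum.inr ∘ Sum.inl - (kappa τm τk : ℂ)⁻¹ • f ∘ Sum.inr ∘ Sum.inr)) -
      ((√(kappa τm τk) : ℝ) : ℂ) * (star (V.map Complex.ofReal *ᵥ (w ∘ Sum.inl ∘ Sum.inr)) ⬝ᵥ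
        (f ∘ Sum.inr ∘ Sum.inr - (kappa τm τk : ℂ)⁻¹ • f ∘ Sum.inr ∘ Sum.inl)) := by
  -- The first two rows are paired with the first two blocks of w, and the other blocks are
  -- substituted from the last two rows, whose coefficient matrix has inverse with entries 1 and
  -- -1/κ. On the left everything is real except the factor z.
  obtain ⟨f1, f2, f3, f4⟩ := lin_rows U V z hf
  obtain ⟨e1, e2⟩ := solve_rows h0 (alpha_mul h0 h1) f3 f4
  set κ := kappa τm τk
  set a := w ∘ Sum.inl ∘ Sum.inl
  set a' := w ∘ Sum.inl ∘ Sum.inr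
  set b := w ∘ Sum.inr ∘ Sum.inl
  set b' := w ∘ Sum.inr ∘ Sum.inr
  set g := f ∘ Sum.inr ∘ Sum.inl
  set g' := f ∘ Sum.inr ∘ Sum.inr
  set p := U.map Complex.ofReal *ᵥ a with hp
  set p' := V.map Complex.ofReal *ᵥ a' with hp'
  have hs : ((√κ : ℝ) : ℂ) * ((√κ : ℝ) : ℂ) = κ := by
    rw [← Complex.ofReal_mul, Real.mul_self_sqrt h0.le]
  have hκ : (κ : ℂ) ≠ 0 := by exact_mod_cast h0.ne'
  have hre : ((2 * (star p ⬝ᵥ p').re : ℝ) : ℂ) = star p ⬝ᵥ p' + star p' ⬝ᵥ p := by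
    have : star p' ⬝ᵥ p = conj (star p ⬝ᵥ p') := by
      rw [← RCLike.star_def, ← star_dotProduct]
    rw [this, Complex.add_conj]
  rw [f1, f2, quadForm, ← hp, ← hp']
  simp only [dotProduct_add, dotProduct_smul, star_mulVec_transpose, smul_eq_mul, ← hp, ← hp']
  have i1 : star p ⬝ᵥ b = star p ⬝ᵥ (g - (κ : ℂ)⁻¹ • g') - ((√κ : ℝ) : ℂ) * (star p ⬝ᵥ p) +
      (κ : ℂ)⁻¹ * (((√κ : ℝ) : ℂ) * (star p ⬝ᵥ p')) := by
    conv_lhs => rw [e1]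
    simp only [dotProduct_add, dotProduct_sub, dotProduct_smul, smul_eq_mul]
  have i2 : star p' ⬝ᵥ b' = star p' ⬝ᵥ (g' - (κ : ℂ)⁻¹ • g) - ((√κ : ℝ) : ℂ) * (star p' ⬝ᵥ p') +
      (κ : ℂ)⁻¹ * (((√κ : ℝ) : ℂ) * (star p' ⬝ᵥ p)) := by
    conv_lhs => rw [e2]
    simp only [dotProduct_add, dotProduct_sub, dotProduct_smul, smul_eq_mul]
  rw [i1, i2, Complex.ofReal_add, hre]
  rw [star_dotProduct_self_eq, star_dotProduct_self_eq, star_dotProduct_self_eq,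
    star_dotProduct_self_eq]
  push_cast
  have hs' : ((√κ : ℝ) : ℂ) * (κ : ℂ)⁻¹ * ((√κ : ℝ) : ℂ) = 1 := by
    rw [mul_right_comm, hs, mul_inv_cancel₀ hκ]
  linear_combination ((nrm p : ℂ) ^ 2 + (nrm p' : ℂ) ^ 2) * hs - (star p ⬝ᵥ p' + star p' ⬝ᵥ p) * hs'

/-- The constant in the bound for the linearized resolvent. -/
def cRes (κ : ℝ) : ℝ := 6 * (1 + κ⁻¹) ^ 2

lemma cRes_pos {κ : ℝ} (h0 : 0 < κ) : 0 < cRes κ := by unfold cRes; positivity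

lemma nrm_block_le {ι ι' : Type*} [Fintype ι] [Fintype ι'] (w : ι → ℂ) {g : ι' → ι}
    (hg : Function.Injective g) : nrm (w ∘ g) ≤ nrm w := by
  refine abs_le_of_sq_le_sq' ?_ (nrm_nonneg _) |>.2
  rw [sq_nrm, sq_nrm]
  exact (Finset.sum_map Finset.univ ⟨g, hg⟩ (fun i => ‖w i‖ ^ 2)).symm.trans_le
    (Finset.sum_le_sum_of_subset_of_nonneg (Finset.subset_univ _) fun _ _ _ => sq_nonneg _)

lemma inj_block : (Function.Injective (Sum.inl ∘ Sum.inl : Fin m → Idx n m k)) ∧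
    (Function.Injective (Sum.inl ∘ Sum.inr : Fin k → Idx n m k)) ∧
    (Function.Injective (Sum.inr ∘ Sum.inl : Fin n → Idx n m k)) ∧
    (Function.Injective (Sum.inr ∘ Sum.inr : Fin n → Idx n m k)) :=
  ⟨Sum.inl_injective.comp Sum.inl_injective, Sum.inl_injective.comp Sum.inr_injective,
    Sum.inr_injective.comp Sum.inl_injective, Sum.inr_injective.comp Sum.inr_injective⟩

lemma sq_nrm_idx (w : Idx n m k → ℂ) : nrm w ^ 2 =
    (nrm (w ∘ Sum.inl ∘ Sum.inl) ^ 2 + nrm (w ∘ Sum.inl ∘ Sum.inr) ^ 2) +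
      (nrm (w ∘ Sum.inr ∘ Sum.inl) ^ 2 + nrm (w ∘ Sum.inr ∘ Sum.inr) ^ 2) := by
  simp only [sq_nrm, Fintype.sum_sum_type, Function.comp_apply]

/-- A is the norm of the first two blocks, B and B' those of the last two, F that of the image. The
estimate `hR` is quadratic in A on the left and linear on the right, so one factor A cancels; `b1`
and `b2` then carry the bound over to the whole vector. -/
lemma coercive_arith {A F K c d B B' W : ℝ} (hA0 : 0 ≤ A) (hF0 : 0 ≤ F) (hB : 0 ≤ B) (hB' : 0 ≤ B')
    (hK : 1 ≤ K) (hc1 : 1 ≤ c) (hd : 0 < d) (hR : d * A ^ 2 ≤ A * (4 * c * K * F))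
    (b1 : B ≤ c * (F + K * A)) (b2 : B' ≤ c * (F + K * A))
    (hW : W ^ 2 = A ^ 2 + (B ^ 2 + B' ^ 2)) :
    W ≤ 6 * c ^ 2 * 4 * K ^ 2 * (1 + d⁻¹) * F := by
  have hK0 : 0 ≤ K := by linarith
  have hc0 : 0 ≤ c := by linarith
  have hAle : A ≤ d⁻¹ * (4 * c * K * F) := by
    rcases hA0.eq_or_lt with h | h
    · rw [← h]; positivity
    · rw [le_inv_mul_iff₀ hd]
      have : A * (d * A) ≤ A * (4 * c * K * F) := by linarith
      exact le_of_mul_le_mul_left this h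
  have hw2 : W ≤ A + B + B' := by
    refine abs_le_of_sq_le_sq' ?_ (by positivity) |>.2
    rw [hW]
    have := mul_nonneg hA0 hB
    have := mul_nonneg hA0 hB'
    have := mul_nonneg hB hB'
    linarith [show (A + B + B') ^ 2 = A ^ 2 + (B ^ 2 + B' ^ 2) + 2 * (A * B) + 2 * (A * B') +
      2 * (B * B') by ring]
  have hKA : A ≤ K * A := le_mul_of_one_le_left hA0 hK
  have hcKA : K * A ≤ c * (K * A) := le_mul_of_one_le_left (mul_nonneg hK0 hA0) hc1
  have hcKA' : c * (K * A) ≤ c * (K * (d⁻¹ * (4 * c * K * F))) := by gcongr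
  have hd0 : 0 < d⁻¹ := inv_pos.2 hd
  have hck : c ≤ c ^ 2 * K ^ 2 := by
    calc c = c * 1 * 1 := by ring
      _ ≤ c * c * K ^ 2 := by gcongr; exact one_le_pow₀ hK
      _ = _ := by ring
  have hcF : c * F ≤ (c ^ 2 * K ^ 2) * F := by gcongr
  have hq0 : 0 ≤ c ^ 2 * K ^ 2 * F := by positivity
  have hlast : c * (K * (d⁻¹ * (4 * c * K * F))) = 4 * (c ^ 2 * K ^ 2 * F * d⁻¹) := by ring
  have hpos : 0 ≤ c ^ 2 * K ^ 2 * F * d⁻¹ := by positivity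
  calc W ≤ A + B + B' := hw2
    _ ≤ 2 * (c * F) + 3 * (c * (K * A)) := by linarith
    _ ≤ 24 * (c ^ 2 * K ^ 2 * F) + 24 * (c ^ 2 * K ^ 2 * F * d⁻¹) := by linarith
    _ = _ := by ring

set_option maxHeartbeats 800000 in
/-- Coercivity of the linearized matrix off the range of the quadratic form. -/
lemma nrm_le_lin (h0 : 0 < kappa τm τk) (h1 : kappa τm τk < 1) {K d : ℝ} (hK : 1 ≤ K) (hd : 0 < d)
    (hU : ‖U.map Complex.ofReal‖ ≤ K) (hV : ‖V.map Complex.ofReal‖ ≤ K)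
    (hz : ∀ a b, d * (nrm a ^ 2 + nrm b ^ 2) ≤
      ‖(quadForm U V (kappa τm τk) a b : ℂ) - z * ((nrm a ^ 2 + nrm b ^ 2 : ℝ) : ℂ)‖)
    (w : Idx n m k → ℂ) :
    nrm w ≤ cRes (kappa τm τk) * 4 * K ^ 2 * (1 + d⁻¹) * nrm (lin τm τk U V z *ᵥ w) := by
  obtain ⟨f, hf⟩ : ∃ f, lin τm τk U V z *ᵥ w = f := ⟨_, rfl⟩
  rw [hf]
  have hid := lin_identity U V z h0 h1 w f hf
  obtain ⟨-, -, f3, f4⟩ := lin_rows U V z hf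
  obtain ⟨e1, e2⟩ := solve_rows h0 (alpha_mul h0 h1) f3 f4
  obtain ⟨j1, j2, j3, j4⟩ := inj_block (n := n) (m := m) (k := k)
  have F1 : nrm (f ∘ Sum.inl ∘ Sum.inl) ≤ nrm f := nrm_block_le f j1
  have F2 : nrm (f ∘ Sum.inl ∘ Sum.inr) ≤ nrm f := nrm_block_le f j2
  have F3 : nrm (f ∘ Sum.inr ∘ Sum.inl) ≤ nrm f := nrm_block_le f j3
  have F4 : nrm (f ∘ Sum.inr ∘ Sum.inr) ≤ nrm f := nrm_block_le f j4
  have hzz := hz (w ∘ Sum.inl ∘ Sum.inl) (w ∘ Sum.inl ∘ Sum.inr)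
  rw [hid] at hzz
  have hw := sq_nrm_idx w
  set κ := kappa τm τk
  set F := nrm f
  set a := w ∘ Sum.inl ∘ Sum.inl
  set a' := w ∘ Sum.inl ∘ Sum.inr
  set b := w ∘ Sum.inr ∘ Sum.inl
  set b' := w ∘ Sum.inr ∘ Sum.inr
  set g := f ∘ Sum.inr ∘ Sum.inl
  set g' := f ∘ Sum.inr ∘ Sum.inr
  set A := √(nrm a ^ 2 + nrm a' ^ 2) with hA
  have hF0 : 0 ≤ F := nrm_nonneg _
  have hA0 : 0 ≤ A := Real.sqrt_nonneg _
  have hA2 : A ^ 2 = nrm a ^ 2 + nrm a' ^ 2 := Real.sq_sqrt (by positivity)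
  have hK0 : 0 ≤ K := by linarith
  have a1 : nrm a ≤ A := Real.le_sqrt_of_sq_le (by nlinarith [sq_nonneg (nrm a')])
  have a2 : nrm a' ≤ A := Real.le_sqrt_of_sq_le (by nlinarith [sq_nonneg (nrm a)])
  have p1 : nrm (U.map Complex.ofReal *ᵥ a) ≤ K * A :=
    (nrm_mulVec_le _ _).trans (mul_le_mul hU a1 (nrm_nonneg _) hK0)
  have p2 : nrm (V.map Complex.ofReal *ᵥ a') ≤ K * A :=
    (nrm_mulVec_le _ _).trans (mul_le_mul hV a2 (nrm_nonneg _) hK0)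
  have hκn : ‖(κ : ℂ)⁻¹‖ = κ⁻¹ := by rw [norm_inv, Complex.norm_real, Real.norm_of_nonneg h0.le]
  have hs1 : √κ ≤ 1 := Real.sqrt_le_one.2 h1.le
  have hsn : ‖((√κ : ℝ) : ℂ)‖ = √κ := by rw [Complex.norm_real, Real.norm_of_nonneg (Real.sqrt_nonneg _)]
  set c := 1 + κ⁻¹ with hc
  have hc1 : 1 ≤ c := by have := inv_pos.2 h0; linarith
  have g1 : nrm (g - (κ : ℂ)⁻¹ • g') ≤ c * F := by
    refine (nrm_sub_le _ _).trans ?_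
    rw [nrm_smul, hκn, hc, add_mul, one_mul]
    gcongr
  have g2 : nrm (g' - (κ : ℂ)⁻¹ • g) ≤ c * F := by
    refine (nrm_sub_le _ _).trans ?_
    rw [nrm_smul, hκn, hc, add_mul, one_mul]
    gcongr
  have hR : d * A ^ 2 ≤ A * (4 * c * K * F) := by
    rw [hA2]
    refine hzz.trans ?_
    have t1 := norm_dotProduct_le a (f ∘ Sum.inl ∘ Sum.inl)
    have t2 := norm_dotProduct_le a' (f ∘ Sum.inl ∘ Sum.inr)
    have t3 := norm_dotProduct_le (U.map Complex.ofReal *ᵥ a) (g - (κ : ℂ)⁻¹ • g')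
    have t4 := norm_dotProduct_le (V.map Complex.ofReal *ᵥ a') (g' - (κ : ℂ)⁻¹ • g)
    have t1' : ‖star a ⬝ᵥ (f ∘ Sum.inl ∘ Sum.inl)‖ ≤ A * F :=
      t1.trans (mul_le_mul a1 F1 (nrm_nonneg _) hA0)
    have t2' : ‖star a' ⬝ᵥ (f ∘ Sum.inl ∘ Sum.inr)‖ ≤ A * F :=
      t2.trans (mul_le_mul a2 F2 (nrm_nonneg _) hA0)
    have hKA : 0 ≤ K * A := mul_nonneg hK0 hA0
    have t3' : √κ * ‖star (U.map Complex.ofReal *ᵥ a) ⬝ᵥ (g - (κ : ℂ)⁻¹ • g')‖ ≤ K * A * (c * F) :=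
      (mul_le_of_le_one_left (norm_nonneg _) hs1).trans
        (t3.trans (mul_le_mul p1 g1 (nrm_nonneg _) hKA))
    have t4' : √κ * ‖star (V.map Complex.ofReal *ᵥ a') ⬝ᵥ (g' - (κ : ℂ)⁻¹ • g)‖ ≤ K * A * (c * F) :=
      (mul_le_of_le_one_left (norm_nonneg _) hs1).trans
        (t4.trans (mul_le_mul p2 g2 (nrm_nonneg _) hKA))
    refine (norm_sub_le _ _).trans ?_
    refine (add_le_add_left ((norm_sub_le _ _).trans (add_le_add_left (norm_add_le _ _) _)) _).trans ?_
    rw [norm_mul, norm_mul, hsn]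
    have hAF : A * F ≤ A * F * (c * K) :=
      le_mul_of_one_le_right (mul_nonneg hA0 hF0) (by nlinarith)
    linarith
  have bb : ∀ (x p p' : Fin n → ℂ), nrm x ≤ c * F → nrm p ≤ K * A → nrm p' ≤ K * A →
      nrm (x - (((√κ : ℝ) : ℂ) • p) + (κ : ℂ)⁻¹ • (((√κ : ℝ) : ℂ) • p')) ≤ c * (F + K * A) := by
    intro x p p' hx hp hp'
    refine (nrm_add_le _ _).trans ((add_le_add_left (nrm_sub_le _ _) _).trans ?_)
    rw [nrm_smul, nrm_smul, nrm_smul, hsn, hκn]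
    have u1 : √κ * nrm p ≤ K * A := (mul_le_of_le_one_left (nrm_nonneg _) hs1).trans hp
    have u2 : √κ * nrm p' ≤ K * A := (mul_le_of_le_one_left (nrm_nonneg _) hs1).trans hp'
    have u3 : κ⁻¹ * (√κ * nrm p') ≤ κ⁻¹ * (K * A) := by gcongr
    have : c * (K * A) = K * A + κ⁻¹ * (K * A) := by rw [hc]; ring
    linarith
  have b1 : nrm b ≤ c * (F + K * A) := by rw [e1]; exact bb _ _ _ g1 p1 p2
  have b2 : nrm b' ≤ c * (F + K * A) := by rw [e2]; exact bb _ _ _ g2 p2 p1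
  rw [cRes, ← hc]
  exact coercive_arith hA0 hF0 (nrm_nonneg _) (nrm_nonneg _) hK hc1 hd hR b1 b2
    (by rw [hw, hA2])

/-- Invertibility of the linearized matrix and the bound for its inverse. -/
lemma resolvent_bound (h0 : 0 < kappa τm τk) (h1 : kappa τm τk < 1) {K d : ℝ} (hK : 1 ≤ K)
    (hd : 0 < d) (hU : ‖U.map Complex.ofReal‖ ≤ K) (hV : ‖V.map Complex.ofReal‖ ≤ K)
    (hz : ∀ a b, d * (nrm a ^ 2 + nrm b ^ 2) ≤
      ‖(quadForm U V (kappa τm τk) a b : ℂ) - z * ((nrm a ^ 2 + nrm b ^ 2 : ℝ) : ℂ)‖) :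
    IsUnit (lin τm τk U V z) ∧
      ‖resolvent τm τk U V z‖ ≤ cRes (kappa τm τk) * 4 * K ^ 2 * (1 + d⁻¹) := by
  have hb := nrm_le_lin U V z h0 h1 hK hd hU hV hz
  have hunit : IsUnit (lin τm τk U V z) := by
    rw [← mulVec_injective_iff_isUnit]
    intro v w hvw
    have := hb (v - w)
    rw [mulVec_sub, sub_eq_zero.2 hvw, nrm_zero, mul_zero] at this
    exact sub_eq_zero.1 (eq_zero_of_nrm_eq_zero (le_antisymm this (nrm_nonneg _)))
  refine ⟨hunit, opNorm_le_of_nrm _ (by have := cRes_pos h0; positivity) fun v => ?_⟩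
  refine (hb _).trans (le_of_eq ?_)
  rw [mulVec_mulVec, resolvent, mul_nonsing_inv _ ((isUnit_iff_isUnit_det _).1 hunit), one_mulVec]

lemma im_gap {a : Fin m → ℂ} {b : Fin k → ℂ} {d : ℝ} (hz : d ≤ |z.im|) :
    d * (nrm a ^ 2 + nrm b ^ 2) ≤
      ‖(quadForm U V (kappa τm τk) a b : ℂ) - z * ((nrm a ^ 2 + nrm b ^ 2 : ℝ) : ℂ)‖ := by
  refine le_trans ?_ (Complex.abs_im_le_norm _)
  rw [Complex.sub_im, Complex.ofReal_im, Complex.im_mul_ofReal, zero_sub, abs_neg, abs_mul,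
    abs_of_nonneg (by positivity : 0 ≤ nrm a ^ 2 + nrm b ^ 2)]
  gcongr

lemma resolvent_bound_im (h0 : 0 < kappa τm τk) (h1 : kappa τm τk < 1) {K d : ℝ} (hK : 1 ≤ K)
    (hd : 0 < d) (hU : ‖U.map Complex.ofReal‖ ≤ K) (hV : ‖V.map Complex.ofReal‖ ≤ K)
    (hz : d ≤ |z.im|) : IsUnit (lin τm τk U V z) ∧
      ‖resolvent τm τk U V z‖ ≤ cRes (kappa τm τk) * 4 * K ^ 2 * (1 + d⁻¹) :=
  resolvent_bound U V z h0 h1 hK hd hU hV fun _ _ => im_gap U V z hz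

lemma isUnit_lin (h0 : 0 < kappa τm τk) (h1 : kappa τm τk < 1) (hz : z.im ≠ 0) :
    IsUnit (lin τm τk U V z) :=
  (resolvent_bound_im U V z h0 h1 (K := 1 + ‖U.map Complex.ofReal‖ + ‖V.map Complex.ofReal‖)
    (by have := norm_nonneg (U.map Complex.ofReal); have := norm_nonneg (V.map Complex.ofReal)
        linarith) (abs_pos.2 hz) (by have := norm_nonneg (V.map Complex.ofReal); linarith)
    (by have := norm_nonneg (U.map Complex.ofReal); linarith) le_rfl).1

end Deterministic

end CCA

end


noncomputable section

namespace CCA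

/-! ### Symmetries, positivity and analyticity of the resolvent -/

section Resolvent

open scoped Matrix.Norms.L2Operator ComplexConjugate
open Matrix

variable {τm τk : ℝ} {n m k : ℕ} (U : Matrix (Fin n) (Fin m) ℝ) (V : Matrix (Fin n) (Fin k) ℝ)
  (z : ℂ)

lemma lin_transpose : (lin τm τk U V z)ᵀ = lin τm τk U V z := by
  simp [lin, fromBlocks_transpose]

lemma resolvent_transpose : (resolvent τm τk U V z)ᵀ = resolvent τm τk U V z := by
  rw [resolvent, transpose_nonsing_inv, lin_transpose]

lemma lin_conj : lin τm τk U V (conj z) = (lin τm τk U V z).map conj := by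
  ext (⟨i | i⟩ | ⟨i | i⟩) (⟨j | j⟩ | ⟨j | j⟩) <;> simp [lin, Matrix.one_apply] <;>
    split_ifs <;> simp

/-- The data are real. This symmetry carries convergence from the upper to the lower half-plane. -/
lemma resolvent_conj : resolvent τm τk U V (conj z) = (resolvent τm τk U V z).map conj := by
  rw [resolvent, resolvent, lin_conj]
  have h : ∀ A : Matrix (Idx n m k) (Idx n m k) ℂ, A.map conj = (Aᴴ)ᵀ := fun A => by
    ext i j; simp [conjTranspose_apply]
  rw [h, h, conjTranspose_nonsing_inv, transpose_nonsing_inv]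

/-- For w = G e_j, the imaginary part of `lin_identity` reads Im z · (|a|² + |b|²) = Im G_jj, where
a and b are the first two blocks of w. -/
lemma im_resolvent_inl_inl_nonneg (h0 : 0 < kappa τm τk) (h1 : kappa τm τk < 1) (hz : 0 < z.im)
    (j : Fin m) : 0 ≤ (resolvent τm τk U V z (.inl (.inl j)) (.inl (.inl j))).im := by
  have hu := isUnit_lin U V z h0 h1 hz.ne'
  set w : Idx n m k → ℂ := resolvent τm τk U V z *ᵥ Pi.single (.inl (.inl j)) 1 with hw
  have hf : lin τm τk U V z *ᵥ w = Pi.single (.inl (.inl j)) 1 := by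
    rw [hw, mulVec_mulVec, resolvent, mul_nonsing_inv _ ((isUnit_iff_isUnit_det _).1 hu), one_mulVec]
  have hid := lin_identity U V z h0 h1 w _ hf
  have s1 : (Pi.single (.inl (.inl j)) 1 : Idx n m k → ℂ) ∘ Sum.inl ∘ Sum.inl = Pi.single j 1 := by
    ext i; simp [Pi.single_apply]
  have s2 : (Pi.single (.inl (.inl j)) 1 : Idx n m k → ℂ) ∘ Sum.inl ∘ Sum.inr = 0 := by
    ext i; simp
  have s3 : (Pi.single (.inl (.inl j)) 1 : Idx n m k → ℂ) ∘ Sum.inr ∘ Sum.inl = 0 := by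
    ext i; simp
  have s4 : (Pi.single (.inl (.inl j)) 1 : Idx n m k → ℂ) ∘ Sum.inr ∘ Sum.inr = 0 := by
    ext i; simp
  rw [s1, s2, s3, s4] at hid
  have hwj : w (.inl (.inl j)) = resolvent τm τk U V z (.inl (.inl j)) (.inl (.inl j)) := by
    simp [hw]
  have := congrArg Complex.im hid
  rw [Complex.sub_im, Complex.im_mul_ofReal, Complex.ofReal_im] at this
  simp only [dotProduct_single, Pi.star_apply, Function.comp_apply, hwj, dotProduct_zero, add_zero,
    sub_self, smul_zero, mul_zero, sub_zero, mul_one, RCLike.star_def, Complex.conj_im, zero_sub] at this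
  have h2 : 0 ≤ z.im * (nrm (w ∘ Sum.inl ∘ Sum.inl) ^ 2 + nrm (w ∘ Sum.inl ∘ Sum.inr) ^ 2) := by
    positivity
  linarith

lemma im_resolvent_inl_inr_nonneg (h0 : 0 < kappa τm τk) (h1 : kappa τm τk < 1) (hz : 0 < z.im)
    (j : Fin k) : 0 ≤ (resolvent τm τk U V z (.inl (.inr j)) (.inl (.inr j))).im := by
  have hu := isUnit_lin U V z h0 h1 hz.ne'
  set w : Idx n m k → ℂ := resolvent τm τk U V z *ᵥ Pi.single (.inl (.inr j)) 1 with hw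
  have hf : lin τm τk U V z *ᵥ w = Pi.single (.inl (.inr j)) 1 := by
    rw [hw, mulVec_mulVec, resolvent, mul_nonsing_inv _ ((isUnit_iff_isUnit_det _).1 hu), one_mulVec]
  have hid := lin_identity U V z h0 h1 w _ hf
  have s1 : (Pi.single (.inl (.inr j)) 1 : Idx n m k → ℂ) ∘ Sum.inl ∘ Sum.inr = Pi.single j 1 := by
    ext i; simp [Pi.single_apply]
  have s2 : (Pi.single (.inl (.inr j)) 1 : Idx n m k → ℂ) ∘ Sum.inl ∘ Sum.inl = 0 := by
    ext i; simp
  have s3 : (Pi.single (.inl (.inr j)) 1 : Idx n m k → ℂ) ∘ Sum.inr ∘ Sum.inl = 0 := by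
    ext i; simp
  have s4 : (Pi.single (.inl (.inr j)) 1 : Idx n m k → ℂ) ∘ Sum.inr ∘ Sum.inr = 0 := by
    ext i; simp
  rw [s1, s2, s3, s4] at hid
  have hwj : w (.inl (.inr j)) = resolvent τm τk U V z (.inl (.inr j)) (.inl (.inr j)) := by
    simp [hw]
  have := congrArg Complex.im hid
  rw [Complex.sub_im, Complex.im_mul_ofReal, Complex.ofReal_im] at this
  simp only [dotProduct_single, Pi.star_apply, Function.comp_apply, hwj, dotProduct_zero, zero_add,
    sub_self, smul_zero, mul_zero, sub_zero, mul_one, RCLike.star_def, Complex.conj_im, zero_sub] at this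
  have h2 : 0 ≤ z.im * (nrm (w ∘ Sum.inl ∘ Sum.inl) ^ 2 + nrm (w ∘ Sum.inl ∘ Sum.inr) ^ 2) := by
    positivity
  linarith

/-- The projection to the first two blocks. -/
def projI : Matrix (Idx n m k) (Idx n m k) ℂ := fromBlocks 1 0 0 0

lemma norm_projI_le : ‖(projI : Matrix (Idx n m k) (Idx n m k) ℂ)‖ ≤ 1 := by
  have : (projI : Matrix (Idx n m k) (Idx n m k) ℂ) = diagonal (Sum.elim (fun _ => 1) fun _ => 0) := by
    ext (i | i) (j | j) <;> simp [projI, Matrix.one_apply, diagonal_apply]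
  rw [this, l2_opNorm_diagonal, pi_norm_le_iff_of_nonneg zero_le_one]
  rintro (i | i) <;> simp

/-- The spectral parameter appears in the first two diagonal blocks only; hence a projection sits in
the middle of the resolvent identity. -/
lemma lin_sub (w : ℂ) : lin τm τk U V z - lin τm τk U V w = (w - z) • projI := by
  ext (⟨i | i⟩ | ⟨i | i⟩) (⟨j | j⟩ | ⟨j | j⟩) <;> simp [lin, projI, Matrix.one_apply] <;>
    split_ifs <;> ring

lemma resolvent_sub {w : ℂ} (hz : IsUnit (lin τm τk U V z)) (hw : IsUnit (lin τm τk U V w)) :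
    resolvent τm τk U V z - resolvent τm τk U V w =
      (z - w) • (resolvent τm τk U V z * projI * resolvent τm τk U V w) := by
  have h := lin_sub (τm := τm) (τk := τk) U V w z
  have e1 : resolvent τm τk U V z * lin τm τk U V z = 1 :=
    nonsing_inv_mul _ ((isUnit_iff_isUnit_det _).1 hz)
  have e2 : lin τm τk U V w * resolvent τm τk U V w = 1 :=
    mul_nonsing_inv _ ((isUnit_iff_isUnit_det _).1 hw)
  calc _ = resolvent τm τk U V z * (lin τm τk U V w - lin τm τk U V z) * resolvent τm τk U V w := by
        rw [mul_sub, sub_mul, e1, one_mul, mul_assoc, e2, mul_one]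
    _ = _ := by rw [h, mul_smul_comm, smul_mul_assoc]

lemma hasDerivAt_lin : HasDerivAt (lin τm τk U V) (-projI) z := by
  have h : lin τm τk U V = fun w => lin τm τk U V 0 + w • (-projI) := by
    ext1 w
    have := lin_sub (τm := τm) (τk := τk) U V w 0
    rw [sub_eq_iff_eq_add] at this
    rw [this, zero_sub, neg_smul, smul_neg, add_comm]
  rw [h]
  simpa using (((hasDerivAt_id z).smul_const (-projI : Matrix (Idx n m k) (Idx n m k) ℂ)).const_add
    (lin τm τk U V 0))

lemma differentiableAt_resolvent (hz : IsUnit (lin τm τk U V z)) :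
    DifferentiableAt ℂ (resolvent τm τk U V) z := by
  have h : resolvent τm τk U V = fun w => Ring.inverse (lin τm τk U V w) := by
    ext1 w; rw [resolvent, nonsing_inv_eq_ringInverse]
  rw [h]
  obtain ⟨u, hu⟩ := hz
  have h1 : DifferentiableAt ℂ Ring.inverse (lin τm τk U V z) := by
    rw [← hu]; exact differentiableAt_inverse u.isUnit
  exact h1.comp z (hasDerivAt_lin U V z).differentiableAt

/-- A bilinear form. -/
def bform {ι : Type*} [Fintype ι] (a : ι → ℂ) (A : Matrix ι ι ℂ) (b : ι → ℂ) : ℂ := a ⬝ᵥ A *ᵥ b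

lemma norm_bform_le {ι : Type*} [Fintype ι] [DecidableEq ι] (a : ι → ℂ) (A : Matrix ι ι ℂ) (b : ι → ℂ) :
    ‖bform a A b‖ ≤ ‖A‖ * (nrm a * nrm b) := by
  refine (norm_dotProduct_le' _ _).trans ?_
  calc nrm a * nrm (A *ᵥ b) ≤ nrm a * (‖A‖ * nrm b) := by
        gcongr
        exacts [nrm_nonneg _, nrm_mulVec_le A b]
    _ = _ := by ring

/-- The bilinear form as a continuous linear functional of the matrix. -/
def bformL {ι : Type*} [Fintype ι] [DecidableEq ι] (a b : ι → ℂ) : Matrix ι ι ℂ →L[ℂ] ℂ :=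
  LinearMap.mkContinuous
    { toFun := fun A => bform a A b
      map_add' := fun A B => by simp [bform, add_mulVec, dotProduct_add]
      map_smul' := fun c A => by simp [bform, smul_mulVec, dotProduct_smul] }
    (nrm a * nrm b) fun A => (norm_bform_le a A b).trans (le_of_eq (mul_comm _ _))

@[simp] lemma bformL_apply {ι : Type*} [Fintype ι] [DecidableEq ι] (a b : ι → ℂ) (A : Matrix ι ι ℂ) :
    bformL a b A = bform a A b := rfl

lemma bform_single {ι : Type*} [Fintype ι] [DecidableEq ι] (A : Matrix ι ι ℂ) (i j : ι) :
    bform (Pi.single i 1) A (Pi.single j 1) = A i j := by simp [bform]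

lemma nrm_single {ι : Type*} [Fintype ι] [DecidableEq ι] (i : ι) : nrm (Pi.single i (1 : ℂ)) = 1 := by
  simp [nrm]

lemma norm_entry_le {ι : Type*} [Fintype ι] [DecidableEq ι] (A : Matrix ι ι ℂ) (i j : ι) :
    ‖A i j‖ ≤ ‖A‖ := by
  rw [← bform_single A i j]
  exact (norm_bform_le _ _ _).trans (by simp [nrm_single])

end Resolvent

/-! ### The resolvent as a function of the Gaussian variables -/

section Gaussian

open scoped Matrix.Norms.L2Operator ComplexConjugate
open Matrix

variable {τm τk : ℝ} {n m k : ℕ}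

/-- The row of the linearized matrix in which a Gaussian variable sits. -/
def rowI : GI n m k → Idx n m k
  | .inl p => .inr (.inl p.1)
  | .inr p => .inr (.inr p.1)

/-- The column of the linearized matrix in which a Gaussian variable sits. -/
def colI : GI n m k → Idx n m k
  | .inl p => .inl (.inl p.2)
  | .inr p => .inl (.inr p.2)

/-- The standard deviation of the entries of the linearized matrix. -/
def coefI (κ : ℝ) : GI n m k → ℝ
  | .inl _ => √κ * (√m)⁻¹
  | .inr _ => √κ * (√k)⁻¹

/-- The direction in which a Gaussian variable moves the linearized matrix. -/
def dirI (κ : ℝ) (e : GI n m k) : Matrix (Idx n m k) (Idx n m k) ℂ :=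
  (coefI κ e : ℂ) • (Matrix.single (rowI e) (colI e) 1 + Matrix.single (colI e) (rowI e) 1)

variable (τm τk) in
/-- The linearized matrix as a function of the Gaussian variables. -/
def linG (z : ℂ) (x : GI n m k → ℝ) : Matrix (Idx n m k) (Idx n m k) ℂ :=
  lin τm τk (matU x) (matV x) z

variable (τm τk) in
/-- The linearized resolvent as a function of the Gaussian variables. -/
def resG (z : ℂ) (x : GI n m k → ℝ) : Matrix (Idx n m k) (Idx n m k) ℂ :=
  resolvent τm τk (matU x) (matV x) z

variable (z : ℂ)

lemma sum_single_apply {ι κ' : Type*} [Fintype κ'] [DecidableEq ι] (f g : κ' → ι) (c : κ' → ℂ)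
    (a b : ι) : (∑ e, c e • Matrix.single (f e) (g e) (1 : ℂ)) a b =
      ∑ e, if f e = a ∧ g e = b then c e else 0 := by
  rw [Matrix.sum_apply]
  refine Finset.sum_congr rfl fun e _ => ?_
  simp [Matrix.single_apply]

/-- The randomness enters linearly, through fixed symmetric rank-two directions. Integration by
parts and gradient estimates use only this form. -/
lemma linG_eq (x : GI n m k → ℝ) :
    linG τm τk z x = lin τm τk 0 0 z + ∑ e, x e • dirI (kappa τm τk) e := by
  have h1 : ∀ e, x e • dirI (kappa τm τk) e =
      ((x e * coefI (kappa τm τk) e : ℝ) : ℂ) • Matrix.single (rowI e) (colI e) (1 : ℂ) +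
      ((x e * coefI (kappa τm τk) e : ℝ) : ℂ) • Matrix.single (colI e) (rowI e) (1 : ℂ) := by
    intro e
    rw [dirI, ← smul_add, ← Complex.coe_smul, smul_smul]
    push_cast; rfl
  simp only [h1, Finset.sum_add_distrib]
  ext a b
  rw [Matrix.add_apply, Matrix.add_apply, sum_single_apply, sum_single_apply, Fintype.sum_sum_type,
    Fintype.sum_sum_type, Fintype.sum_prod_type, Fintype.sum_prod_type, Fintype.sum_prod_type,
    Fintype.sum_prod_type]
  rcases a with (a | a) | (a | a) <;> rcases b with (b | b) | (b | b) <;>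
    simp [linG, lin, rowI, colI, coefI, matU, matV, ite_and, Finset.sum_ite_eq'] <;> ring

lemma hasFDerivAt_linG (x : GI n m k → ℝ) : HasFDerivAt (linG τm τk z)
    (∑ e, (ContinuousLinearMap.proj (R := ℝ) (φ := fun _ : GI n m k => ℝ) e).smulRight
      (dirI (kappa τm τk) e)) x := by
  have h : linG τm τk z = fun x : GI n m k → ℝ => lin τm τk 0 0 z + (∑ e,
      (ContinuousLinearMap.proj (R := ℝ) (φ := fun _ : GI n m k => ℝ) e).smulRight
      (dirI (kappa τm τk) e)) x := by
    ext1 x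
    rw [linG_eq, _root_.sum_apply]
    rfl
  rw [h]
  exact (ContinuousLinearMap.hasFDerivAt _).const_add _

lemma contDiff_linG : ContDiff ℝ 1 (linG τm τk z : (GI n m k → ℝ) → _) := by
  have h : (linG τm τk z : (GI n m k → ℝ) → _) = fun x => lin τm τk 0 0 z + (∑ e,
      (ContinuousLinearMap.proj (R := ℝ) (φ := fun _ : GI n m k => ℝ) e).smulRight
      (dirI (kappa τm τk) e)) x := by
    ext1 x
    rw [linG_eq, _root_.sum_apply]
    rfl
  rw [h]
  exact contDiff_const.add (ContinuousLinearMap.contDiff _)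

variable {z}

lemma isUnit_linG (h0 : 0 < kappa τm τk) (h1 : kappa τm τk < 1) (hz : z.im ≠ 0)
    (x : GI n m k → ℝ) : IsUnit (linG τm τk z x) := isUnit_lin _ _ z h0 h1 hz

lemma linG_mul_resG (h0 : 0 < kappa τm τk) (h1 : kappa τm τk < 1) (hz : z.im ≠ 0)
    (x : GI n m k → ℝ) : linG τm τk z x * resG τm τk z x = 1 :=
  mul_nonsing_inv _ ((isUnit_iff_isUnit_det _).1 (isUnit_linG h0 h1 hz x))

lemma contDiff_resG (h0 : 0 < kappa τm τk) (h1 : kappa τm τk < 1) (hz : z.im ≠ 0) :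
    ContDiff ℝ 1 (resG τm τk z : (GI n m k → ℝ) → _) := by
  have h : (resG τm τk z : (GI n m k → ℝ) → _) = fun x => Ring.inverse (linG τm τk z x) := by
    ext1 x; rw [resG, resolvent, nonsing_inv_eq_ringInverse, linG]
  rw [h, contDiff_iff_contDiffAt]
  intro x
  obtain ⟨u, hu⟩ := isUnit_linG h0 h1 hz x
  have h2 : ContDiffAt ℝ 1 Ring.inverse (linG τm τk z x) := by
    rw [← hu]; exact contDiffAt_ringInverse ℝ u
  exact h2.comp x (contDiff_linG z).contDiffAt

/-- The derivative of inversion, -G(dL)G, evaluated in the direction of one Gaussian variable. -/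
lemma hasFDerivAt_resG (h0 : 0 < kappa τm τk) (h1 : kappa τm τk < 1) (hz : z.im ≠ 0)
    (x : GI n m k → ℝ) : ∃ D : (GI n m k → ℝ) →L[ℝ] Matrix (Idx n m k) (Idx n m k) ℂ,
    HasFDerivAt (resG τm τk z) D x ∧ ∀ e, D (Pi.single e 1) =
      -(resG τm τk z x * dirI (kappa τm τk) e * resG τm τk z x) := by
  have h : (resG τm τk z : (GI n m k → ℝ) → _) = fun x => Ring.inverse (linG τm τk z x) := by
    ext1 x; rw [resG, resolvent, nonsing_inv_eq_ringInverse, linG]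
  obtain ⟨u, hu⟩ := isUnit_linG h0 h1 hz x
  have hinv : ((u⁻¹ : (Matrix (Idx n m k) (Idx n m k) ℂ)ˣ) : Matrix (Idx n m k) (Idx n m k) ℂ) =
      resG τm τk z x := by
    rw [congrFun h x, ← hu, Ring.inverse_unit]
  have h2 := hasFDerivAt_ringInverse (𝕜 := ℝ) u
  rw [hu] at h2
  refine ⟨_, by rw [h]; exact h2.comp x (hasFDerivAt_linG z x), fun e => ?_⟩
  rw [ContinuousLinearMap.comp_apply, _root_.sum_apply,
    Finset.sum_eq_single e (fun i _ hi => by simp [hi]) (by simp)]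
  simp [hinv]

lemma opU_le_opK (x : GI n m k → ℝ) : opU x ≤ opK x ∧ opV x ≤ opK x := by
  have := opU_nonneg x; have := opV_nonneg x; constructor <;> (unfold opK; linarith)

lemma norm_resG_le (h0 : 0 < kappa τm τk) (h1 : kappa τm τk < 1) {η : ℝ} (hη : 0 < η) (hzη : η ≤ |z.im|) (x : GI n m k → ℝ) :
    ‖resG τm τk z x‖ ≤ cRes (kappa τm τk) * 4 * (1 + η⁻¹) * opK x ^ 2 := by
  refine (resolvent_bound_im _ _ z h0 h1 (one_le_opK x) hη (opU_le_opK x).1 (opU_le_opK x).2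
    hzη).2.trans (le_of_eq ?_)
  ring

end Gaussian

end CCA

end


noncomputable section

namespace CCA

/-! ### Moments and concentration of the resolvent -/

section Moments

open scoped Matrix.Norms.L2Operator ComplexConjugate
open Matrix

variable {τm τk : ℝ}

lemma continuous_resG {n m k : ℕ} {z : ℂ} (h0 : 0 < kappa τm τk) (h1 : kappa τm τk < 1)
    (hz : z.im ≠ 0) : Continuous (resG τm τk z : (GI n m k → ℝ) → _) :=
  (contDiff_resG h0 h1 hz).continuous

lemma im_ne_zero_of_le {η : ℝ} (hη : 0 < η) {z : ℂ} (hz : η ≤ |z.im|) : z.im ≠ 0 :=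
  abs_pos.1 (hη.trans_le hz)

/-- All moments of the linearized resolvent are bounded. -/
lemma lintegral_resG_pow (h0 : 0 < kappa τm τk) (h1 : kappa τm τk < 1) (c : ℕ) {η : ℝ} (hη : 0 < η)
    (q : ℕ) : ∃ C : ℝ≥0∞, C ≠ ∞ ∧ ∀ n m k : ℕ, Reg c n m k → ∀ z : ℂ, η ≤ |z.im| →
      ∫⁻ x, ‖resG τm τk z x‖ₑ ^ q ∂(stdG (GI n m k)) ≤ C := by
  obtain ⟨C, hC, hb⟩ := lintegral_opK_pow c (2 * q)
  set D := ENNReal.ofReal (cRes (kappa τm τk) * 4 * (1 + η⁻¹)) ^ q with hD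
  refine ⟨D * C, by finiteness, fun n m k hr z hz => ?_⟩
  have pt : ∀ x : GI n m k → ℝ, ‖resG τm τk z x‖ₑ ^ q ≤ D * ENNReal.ofReal (opK x) ^ (2 * q) := by
    intro x
    have hc := cRes_pos h0
    have hK : 0 ≤ opK x := zero_le_one.trans (one_le_opK x)
    rw [hD, pow_mul, ← mul_pow, ← ofReal_norm, ← ENNReal.ofReal_pow hK,
      ← ENNReal.ofReal_mul (by positivity)]
    exact pow_le_pow_left' (ENNReal.ofReal_le_ofReal (norm_resG_le h0 h1 hη hz x)) q
  refine (lintegral_mono pt).trans ?_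
  rw [lintegral_const_mul' _ _ (by finiteness)]
  gcongr
  exact hb n m k hr

/-- The real version of the bound for moments. -/
lemma integral_resG_pow (h0 : 0 < kappa τm τk) (h1 : kappa τm τk < 1) (c : ℕ) {η : ℝ} (hη : 0 < η)
    (q : ℕ) : ∃ C : ℝ, 0 < C ∧ ∀ n m k : ℕ, Reg c n m k → ∀ z : ℂ, η ≤ |z.im| →
      Integrable (fun x => ‖resG τm τk z x‖ ^ q) (stdG (GI n m k)) ∧
      ∫ x, ‖resG τm τk z x‖ ^ q ∂(stdG (GI n m k)) ≤ C := by
  obtain ⟨C, hC, hb⟩ := lintegral_resG_pow h0 h1 c hη q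
  refine ⟨C.toReal + 1, by positivity, fun n m k hr z hz => ?_⟩
  have hcont : Continuous (fun x : GI n m k → ℝ => ‖resG τm τk z x‖ ^ q) :=
    (continuous_resG h0 h1 (im_ne_zero_of_le hη hz)).norm.pow q
  have e : ∀ x : GI n m k → ℝ, ENNReal.ofReal (‖resG τm τk z x‖ ^ q) = ‖resG τm τk z x‖ₑ ^ q :=
    fun x => by rw [ENNReal.ofReal_pow (norm_nonneg _), ofReal_norm]
  have hfin := hb n m k hr z hz
  constructor
  · refine ⟨hcont.aestronglyMeasurable, ?_⟩
    rw [hasFiniteIntegral_iff_ofReal (ae_of_all _ fun x => by positivity)]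
    simp only [e]
    exact hfin.trans_lt hC.lt_top
  · rw [integral_eq_lintegral_of_nonneg_ae (ae_of_all _ fun x => by positivity)
      hcont.aestronglyMeasurable]
    simp only [e]
    exact (ENNReal.toReal_mono hC hfin).trans (by linarith)

/-- Symmetry of G moves it from the middle onto both test vectors, which factorizes the partial
derivatives of a bilinear form. -/
lemma bform_mul_single_mul {ι : Type*} [Fintype ι] [DecidableEq ι] (a b : ι → ℂ) (G : Matrix ι ι ℂ)
    (hG : Gᵀ = G) (r c : ι) :
    bform a (G * Matrix.single r c 1 * G) b = (G *ᵥ a) r * (G *ᵥ b) c := by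
  have h1 : Matrix.single r c (1 : ℂ) = vecMulVec (Pi.single r 1) (Pi.single c 1) := by
    ext i j
    simp only [vecMulVec_apply, Matrix.single_apply, Pi.single_apply, eq_comm (a := r),
      eq_comm (a := c)]
    split_ifs <;> simp_all
  rw [bform, ← mulVec_mulVec, ← mulVec_mulVec, h1, vecMulVec_mulVec, single_one_dotProduct,
    dotProduct_mulVec, ← mulVec_transpose, hG]
  simp [mul_comm]

lemma rowI_colI_injective {n m k : ℕ} :
    Function.Injective fun e : GI n m k => (rowI e, colI e) := by
  rintro (⟨i, j⟩ | ⟨i, j⟩) (⟨i', j'⟩ | ⟨i', j'⟩) h <;> simp_all [rowI, colI]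

lemma sq_coefI_le {n m k c : ℕ} (hr : Reg c n m k) (h0 : 0 < kappa τm τk) (h1 : kappa τm τk < 1)
    (e : GI n m k) : coefI (kappa τm τk) e ^ 2 ≤ c / n := by
  have hm := hr.m_pos
  have hk := hr.k_pos
  have hn := hr.n_pos
  have key : ∀ p : ℕ, 0 < p → n ≤ c * p → (√(kappa τm τk) * (√(p : ℝ))⁻¹) ^ 2 ≤ c / n := by
    intro p hp hnp
    rw [mul_pow, inv_pow, Real.sq_sqrt h0.le, Real.sq_sqrt (by positivity),
      le_div_iff₀ (by positivity)]
    have : (n : ℝ) ≤ c * p := by exact_mod_cast hnp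
    have hp' : (0 : ℝ) < p := by exact_mod_cast hp
    calc kappa τm τk * (p : ℝ)⁻¹ * n ≤ 1 * (p : ℝ)⁻¹ * (c * p) := by gcongr
      _ = c := by field_simp
  rcases e with e | e
  · exact key m hm hr.n_le_m
  · exact key k hk hr.n_le_k

/-- Distinct Gaussian variables sit in distinct matrix positions, so the sum of the products
|p_i|²|q_j|² is at most |p|²|q|²; the variance of each entry contributes the factor 1/n. -/
lemma sum_gradient_le {n m k c : ℕ} (hr : Reg c n m k) (h0 : 0 < kappa τm τk)
    (h1 : kappa τm τk < 1) (p q : Idx n m k → ℂ) :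
    ∑ e : GI n m k, ‖(coefI (kappa τm τk) e : ℂ) *
      (p (rowI e) * q (colI e) + p (colI e) * q (rowI e))‖ ^ 2 ≤
      4 * (c / n) * (nrm p ^ 2 * nrm q ^ 2) := by
  have hcn : (0 : ℝ) ≤ c / n := by positivity
  have t1 : ∀ (p q : Idx n m k → ℂ), ∑ e : GI n m k, ‖p (rowI e)‖ ^ 2 * ‖q (colI e)‖ ^ 2 ≤
      nrm p ^ 2 * nrm q ^ 2 := by
    intro p q
    rw [sq_nrm, sq_nrm, Finset.sum_mul_sum, ← Finset.univ.sum_product' Finset.univ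
      fun i j => ‖p i‖ ^ 2 * ‖q j‖ ^ 2]
    refine (Finset.sum_map Finset.univ ⟨_, rowI_colI_injective⟩
      (fun ij : Idx n m k × Idx n m k => ‖p ij.1‖ ^ 2 * ‖q ij.2‖ ^ 2)).symm.trans_le ?_
    exact Finset.sum_le_sum_of_subset_of_nonneg (fun _ _ => by simp)
      fun _ _ _ => by positivity
  calc _ ≤ ∑ e : GI n m k, (c / n) * (2 * (‖p (rowI e)‖ ^ 2 * ‖q (colI e)‖ ^ 2) +
        2 * (‖q (rowI e)‖ ^ 2 * ‖p (colI e)‖ ^ 2)) := by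
        refine Finset.sum_le_sum fun e _ => ?_
        rw [norm_mul, mul_pow, Complex.norm_real, Real.norm_eq_abs, sq_abs]
        refine mul_le_mul (sq_coefI_le hr h0 h1 e) ?_ (sq_nonneg _) hcn
        have h3 := norm_add_le (p (rowI e) * q (colI e)) (p (colI e) * q (rowI e))
        rw [norm_mul, norm_mul] at h3
        calc _ ≤ (‖p (rowI e)‖ * ‖q (colI e)‖ + ‖p (colI e)‖ * ‖q (rowI e)‖) ^ 2 := by gcongr
          _ ≤ _ := by
            nlinarith [sq_nonneg (‖p (rowI e)‖ * ‖q (colI e)‖ - ‖p (colI e)‖ * ‖q (rowI e)‖)]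
    _ = (c / n) * (2 * ∑ e : GI n m k, ‖p (rowI e)‖ ^ 2 * ‖q (colI e)‖ ^ 2 +
        2 * ∑ e : GI n m k, ‖q (rowI e)‖ ^ 2 * ‖p (colI e)‖ ^ 2) := by
        rw [← Finset.mul_sum, Finset.sum_add_distrib, ← Finset.mul_sum, ← Finset.mul_sum]
    _ ≤ (c / n) * (2 * (nrm p ^ 2 * nrm q ^ 2) + 2 * (nrm q ^ 2 * nrm p ^ 2)) := by
        gcongr
        exacts [t1 p q, t1 q p]
    _ = _ := by ring

/-- Bilinear forms of the resolvent are concentrated. -/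
lemma lintegral_bform_sub_pow (h0 : 0 < kappa τm τk) (h1 : kappa τm τk < 1) (c : ℕ) {η : ℝ}
    (hη : 0 < η) (s : ℕ) (hs : 0 < s) : ∃ C : ℝ≥0∞, C ≠ ∞ ∧ ∀ n m k : ℕ, Reg c n m k → ∀ z : ℂ,
      η ≤ |z.im| → ∀ a b : Idx n m k → ℂ, nrm a ≤ 1 → nrm b ≤ 1 →
      ∫⁻ x, ‖bform a (resG τm τk z x) b - ∫ y, bform a (resG τm τk z y) b ∂(stdG (GI n m k))‖ₑ ^ (2 * s)
        ∂(stdG (GI n m k)) ≤ C / (n : ℝ≥0∞) ^ s := by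
  obtain ⟨C, hC, hb⟩ := lintegral_resG_pow h0 h1 c hη (4 * s)
  obtain ⟨C1, hC1, hb1⟩ := lintegral_resG_pow h0 h1 c hη 1
  obtain ⟨q, hq⟩ : ∃ q, 2 * s = q + 1 := ⟨2 * s - 1, by omega⟩
  have hg := (gMom_lt_top (q + 1)).ne
  set D := ENNReal.ofReal (Real.pi / 2) ^ (q + 1) * (2 ^ (q + 1) * gMom (q + 1)) with hD
  have hDf : D ≠ ∞ := by finiteness
  refine ⟨D * ((4 * c) ^ s * C), by finiteness, fun n m k hr z hz a b ha hb' => ?_⟩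
  have hz' := im_ne_zero_of_le hη hz
  have hn := hr.n_pos
  have hcont := continuous_resG (n := n) (m := m) (k := k) h0 h1 hz'
  set f : (GI n m k → ℝ) → ℂ := fun x => bform a (resG τm τk z x) b with hf
  have hfC : ContDiff ℝ 1 f :=
    ((bformL a b).restrictScalars ℝ).contDiff.comp (contDiff_resG h0 h1 hz')
  have hfi : Integrable f (stdG (GI n m k)) := by
    refine ⟨hfC.continuous.aestronglyMeasurable, ?_⟩
    refine lt_of_le_of_lt ?_ ((hb1 n m k hr z hz).trans_lt hC1.lt_top)
    refine lintegral_mono fun x => ?_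
    rw [pow_one, ← ofReal_norm, ← ofReal_norm]
    refine ENNReal.ofReal_le_ofReal ((norm_bform_le a _ b).trans ?_)
    exact mul_le_of_le_one_right (norm_nonneg _) (mul_le_one₀ ha (nrm_nonneg _) hb')
  -- Each partial derivative is an entry of (Ga)(Gb)ᵀ, symmetrized and scaled by the standard
  -- deviation, so the gradient is at most √(4c/n)‖G‖².
  have hconc := lintegral_concentration hfC hfi q
    (g := fun x => √(4 * (c / n)) * ‖resG τm τk z x‖ ^ 2) (fun x => by positivity) (fun x => by
      obtain ⟨L, hL, hLe⟩ := hasFDerivAt_resG (τm := τm) (τk := τk) h0 h1 hz' x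
      have hfd : HasFDerivAt f (((bformL a b).restrictScalars ℝ).comp L) x :=
        ((bformL a b).restrictScalars ℝ).hasFDerivAt.comp x hL
      have hsym : (resG τm τk z x)ᵀ = resG τm τk z x := resolvent_transpose _ _ _
      have hval : ∀ e, fderiv ℝ f x (Pi.single e 1) = -((coefI (kappa τm τk) e : ℂ) *
          ((resG τm τk z x *ᵥ a) (rowI e) * (resG τm τk z x *ᵥ b) (colI e) +
           (resG τm τk z x *ᵥ a) (colI e) * (resG τm τk z x *ᵥ b) (rowI e))) := by
        intro e
        rw [hfd.fderiv, ContinuousLinearMap.comp_apply, hLe, map_neg]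
        congr 1
        rw [dirI, mul_smul_comm, smul_mul_assoc, mul_add, add_mul]
        change bformL a b _ = _
        rw [map_smul, map_add, bformL_apply, bformL_apply, bform_mul_single_mul _ _ _ hsym,
          bform_mul_single_mul _ _ _ hsym, smul_eq_mul]
      simp only [hval, norm_neg]
      refine (sum_gradient_le hr h0 h1 _ _).trans ?_
      rw [mul_pow, Real.sq_sqrt (by positivity)]
      have e1 : nrm (resG τm τk z x *ᵥ a) ≤ ‖resG τm τk z x‖ :=
        (nrm_mulVec_le _ _).trans (mul_le_of_le_one_right (norm_nonneg _) ha)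
      have e2 : nrm (resG τm τk z x *ᵥ b) ≤ ‖resG τm τk z x‖ :=
        (nrm_mulVec_le _ _).trans (mul_le_of_le_one_right (norm_nonneg _) hb')
      rw [sq (‖resG τm τk z x‖ ^ 2)]
      have := nrm_nonneg (resG τm τk z x *ᵥ a)
      have := nrm_nonneg (resG τm τk z x *ᵥ b)
      gcongr)
  rw [← hq] at hconc
  refine hconc.trans ?_
  rw [hq, ← hD, mul_div_assoc]
  gcongr D * ?_
  rw [← hq]
  have pt : ∀ x : GI n m k → ℝ, ENNReal.ofReal (√(4 * (c / n)) * ‖resG τm τk z x‖ ^ 2) ^ (2 * s) =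
      (4 * c / n : ℝ≥0∞) ^ s * ‖resG τm τk z x‖ₑ ^ (4 * s) := by
    intro x
    rw [ENNReal.ofReal_mul (by positivity), mul_pow, ENNReal.ofReal_pow (norm_nonneg _), ofReal_norm,
      ← pow_mul, show 2 * (2 * s) = 4 * s by ring]
    congr 1
    rw [pow_mul, ← ENNReal.ofReal_pow (by positivity), Real.sq_sqrt (by positivity),
      ENNReal.ofReal_mul (by norm_num), ENNReal.ofReal_div_of_pos (by positivity),
      ENNReal.ofReal_natCast, ENNReal.ofReal_natCast, mul_div_assoc]
    norm_num
  simp only [pt]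
  have hn0 : (n : ℝ≥0∞) ≠ 0 := by exact_mod_cast hn.ne'
  rw [lintegral_const_mul' _ _ (ENNReal.pow_ne_top (ENNReal.div_ne_top (by finiteness) hn0))]
  calc _ ≤ (4 * c / n : ℝ≥0∞) ^ s * C := by gcongr; exact hb n m k hr z hz
    _ = _ := by
      rw [ENNReal.div_eq_inv_mul, mul_pow, ENNReal.div_eq_inv_mul, ENNReal.inv_pow]; ring

end Moments

end CCA

end


noncomputable section

namespace CCA

/-! ### The approximate self-consistent equation for the mean -/

section SelfConsistent

open scoped Matrix.Norms.L2Operator ComplexConjugate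
open Matrix

variable {τm τk : ℝ} {n m k : ℕ}

/-- The block an index belongs to. -/
def blockOf : Idx n m k → Fin 4
  | .inl (.inl _) => 0
  | .inl (.inr _) => 1
  | .inr (.inl _) => 2
  | .inr (.inr _) => 3

/-- The projection to a block. -/
def prj (d : Fin 4) : Matrix (Idx n m k) (Idx n m k) ℂ :=
  diagonal fun i => if blockOf i = d then 1 else 0

/-- The trace of a diagonal block. -/
def trB (d : Fin 4) (A : Matrix (Idx n m k) (Idx n m k) ℂ) : ℂ :=
  ∑ i, if blockOf i = d then A i i else 0

lemma norm_prj_le (d : Fin 4) : ‖(prj d : Matrix (Idx n m k) (Idx n m k) ℂ)‖ ≤ 1 := by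
  rw [prj, l2_opNorm_diagonal, pi_norm_le_iff_of_nonneg zero_le_one]
  intro i
  split_ifs <;> simp

/-- The covariance operator restricted to the traces. -/
def psi (κ : ℝ) (A : Matrix (Idx n m k) (Idx n m k) ℂ) : Matrix (Idx n m k) (Idx n m k) ℂ :=
  ((κ / m : ℝ) : ℂ) • (trB 2 A • prj 0 + trB 0 A • prj 2) +
    ((κ / k : ℝ) : ℂ) • (trB 3 A • prj 1 + trB 1 A • prj 3)

/-- The remaining part of the covariance operator. -/
def rho (κ : ℝ) (A : Matrix (Idx n m k) (Idx n m k) ℂ) : Matrix (Idx n m k) (Idx n m k) ℂ :=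
  ((κ / m : ℝ) : ℂ) • (prj 2 * Aᵀ * prj 0 + prj 0 * Aᵀ * prj 2) +
    ((κ / k : ℝ) : ℂ) • (prj 3 * Aᵀ * prj 1 + prj 1 * Aᵀ * prj 3)

lemma dirI_mul_mul (κ : ℝ) (e : GI n m k) (A : Matrix (Idx n m k) (Idx n m k) ℂ) :
    dirI κ e * A * dirI κ e =
      ((coefI κ e : ℂ) ^ 2 * A (colI e) (rowI e)) • Matrix.single (rowI e) (colI e) 1 +
      ((coefI κ e : ℂ) ^ 2 * A (colI e) (colI e)) • Matrix.single (rowI e) (rowI e) 1 +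
      ((coefI κ e : ℂ) ^ 2 * A (rowI e) (rowI e)) • Matrix.single (colI e) (colI e) 1 +
      ((coefI κ e : ℂ) ^ 2 * A (rowI e) (colI e)) • Matrix.single (colI e) (rowI e) 1 := by
  have h : ∀ i j i' j' : Idx n m k, Matrix.single i j (1 : ℂ) * A * Matrix.single i' j' (1 : ℂ) =
      A j i' • Matrix.single i j' (1 : ℂ) := fun i j i' j' => by
    rw [single_mul_mul_single]; simp
  rw [dirI, smul_mul_assoc, smul_mul_assoc, mul_smul_comm, add_mul, add_mul, mul_add, mul_add,
    h, h, h, h]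
  simp only [smul_add, smul_smul, sq]
  simp only [mul_assoc]
  abel

/-- In the product of two rank-two directions around A, matching positions produce diagonal matrices
weighted by block traces, of order one after division by the dimension. Crossed positions only
transpose A between blocks, with a coefficient of order 1/n. -/
lemma sum_dirI_mul_mul {κ : ℝ} (hκ : 0 ≤ κ) (A : Matrix (Idx n m k) (Idx n m k) ℂ) :
    ∑ e, dirI κ e * A * dirI κ e = psi κ A + rho κ A := by
  have c1 : ∀ e : Fin n × Fin m, ((coefI κ (Sum.inl e : GI n m k) : ℝ) : ℂ) ^ 2 =
      ((κ / m : ℝ) : ℂ) := fun e => by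
    rw [← Complex.ofReal_pow, coefI, mul_pow, inv_pow, Real.sq_sqrt hκ, Real.sq_sqrt (by positivity)]
    rfl
  have c2 : ∀ e : Fin n × Fin k, ((coefI κ (Sum.inr e : GI n m k) : ℝ) : ℂ) ^ 2 =
      ((κ / k : ℝ) : ℂ) := fun e => by
    rw [← Complex.ofReal_pow, coefI, mul_pow, inv_pow, Real.sq_sqrt hκ, Real.sq_sqrt (by positivity)]
    rfl
  simp only [dirI_mul_mul, Finset.sum_add_distrib]
  ext a b
  rw [Matrix.add_apply, Matrix.add_apply, Matrix.add_apply, sum_single_apply, sum_single_apply,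
    sum_single_apply, sum_single_apply, Fintype.sum_sum_type,
    Fintype.sum_sum_type, Fintype.sum_sum_type, Fintype.sum_sum_type]
  simp only [c1, c2, Fintype.sum_prod_type]
  rcases a with (a | a) | (a | a) <;> rcases b with (b | b) | (b | b) <;>
    simp [psi, rho, trB, prj, blockOf, rowI, colI, ite_and, Finset.sum_ite_eq', diagonal_apply,
      Finset.mul_sum, Fintype.sum_sum_type, mul_diagonal, diagonal_mul]

/-- The expected resolvent. -/
def expG (τm τk : ℝ) (n m k : ℕ) (z : ℂ) : Matrix (Idx n m k) (Idx n m k) ℂ :=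
  ∫ x, resG τm τk z x ∂(stdG (GI n m k))

lemma integrable_resG (h0 : 0 < kappa τm τk) (h1 : kappa τm τk < 1) {c : ℕ} (hr : Reg c n m k)
    {z : ℂ} (hz : z.im ≠ 0) (q : ℕ) :
    Integrable (fun x => ‖resG τm τk z x‖ ^ q) (stdG (GI n m k)) := by
  obtain ⟨C, -, h⟩ := integral_resG_pow h0 h1 c (abs_pos.2 hz) q
  exact (h n m k hr z le_rfl).1

lemma bform_expG (h0 : 0 < kappa τm τk) (h1 : kappa τm τk < 1) {c : ℕ} (hr : Reg c n m k)
    {z : ℂ} (hz : z.im ≠ 0) (a b : Idx n m k → ℂ) :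
    bform a (expG τm τk n m k z) b = ∫ x, bform a (resG τm τk z x) b ∂(stdG (GI n m k)) := by
  have hi : Integrable (resG τm τk z) (stdG (GI n m k)) := by
    rw [← integrable_norm_iff (continuous_resG h0 h1 hz).aestronglyMeasurable]
    simpa using integrable_resG h0 h1 hr hz 1
  exact (((bformL a b).restrictScalars ℝ).integral_comp_comm hi).symm

/-- The integration by parts formula for the resolvent. -/
lemma integral_smul_resG (h0 : 0 < kappa τm τk) (h1 : kappa τm τk < 1) {c : ℕ} (hr : Reg c n m k)
    {z : ℂ} (hz : z.im ≠ 0) (e : GI n m k) :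
    Integrable (fun x => x e • resG τm τk z x) (stdG (GI n m k)) ∧
    Integrable (fun x => resG τm τk z x * dirI (kappa τm τk) e * resG τm τk z x) (stdG (GI n m k)) ∧
    ∫ x, x e • resG τm τk z x ∂(stdG (GI n m k)) =
      ∫ x, -(resG τm τk z x * dirI (kappa τm τk) e * resG τm τk z x) ∂(stdG (GI n m k)) := by
  have hc := continuous_resG (n := n) (m := m) (k := k) h0 h1 hz
  have i2 := integrable_resG h0 h1 hr hz 2
  have hi : Integrable (resG τm τk z) (stdG (GI n m k)) := by
    rw [← integrable_norm_iff hc.aestronglyMeasurable]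
    simpa using integrable_resG h0 h1 hr hz 1
  have ie : Integrable (fun x : GI n m k → ℝ => x e ^ 2) (stdG (GI n m k)) := by
    have : MemLp (fun x : GI n m k → ℝ => x e) 2 (stdG (GI n m k)) :=
      IsGaussian.memLp_dual (stdG (GI n m k))
        (ContinuousLinearMap.proj (R := ℝ) (φ := fun _ : GI n m k => ℝ) e) 2 (by norm_num)
    exact this.integrable_sq
  have j1 : Integrable (fun x => x e • resG τm τk z x) (stdG (GI n m k)) := by
    refine (ie.add i2).mono' (by fun_prop) (ae_of_all _ fun x => ?_)
    rw [norm_smul, Pi.add_apply, Real.norm_eq_abs]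
    nlinarith [sq_nonneg (|x e| - ‖resG τm τk z x‖), sq_abs (x e), abs_nonneg (x e),
      norm_nonneg (resG τm τk z x)]
  have j2 : Integrable (fun x => resG τm τk z x * dirI (kappa τm τk) e * resG τm τk z x)
      (stdG (GI n m k)) := by
    refine (i2.const_mul ‖dirI (kappa τm τk) e‖).mono' (by fun_prop) (ae_of_all _ fun x => ?_)
    refine (norm_mul_le _ _).trans ((mul_le_mul_of_nonneg_right (norm_mul_le _ _)
      (norm_nonneg _)).trans (le_of_eq (by ring)))
  refine ⟨j1, j2, ?_⟩
  refine integral_mul_stdG e (fun x t => ?_) hi j1 j2.neg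
  obtain ⟨D, hD, hDe⟩ := hasFDerivAt_resG (τm := τm) (τk := τk) h0 h1 hz (Function.update x e t)
  have := hD.comp_hasDerivAt t (hasDerivAt_update x e t)
  rw [hDe] at this
  exact this

/-- The Schwinger-Dyson equation. -/
lemma schwinger_dyson (h0 : 0 < kappa τm τk) (h1 : kappa τm τk < 1) {c : ℕ} (hr : Reg c n m k)
    {z : ℂ} (hz : z.im ≠ 0) :
    Integrable (fun x => (psi (kappa τm τk) (resG τm τk z x) + rho (kappa τm τk) (resG τm τk z x)) *
      resG τm τk z x) (stdG (GI n m k)) ∧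
    lin τm τk 0 0 z * expG τm τk n m k z - ∫ x, (psi (kappa τm τk) (resG τm τk z x) +
      rho (kappa τm τk) (resG τm τk z x)) * resG τm τk z x ∂(stdG (GI n m k)) = 1 := by
  have hi : Integrable (resG τm τk z) (stdG (GI n m k)) := by
    rw [← integrable_norm_iff (continuous_resG h0 h1 hz).aestronglyMeasurable]
    simpa using integrable_resG h0 h1 hr hz 1
  set B := fun e : GI n m k => dirI (kappa τm τk) e
  have key := fun e => integral_smul_resG (τm := τm) (τk := τk) h0 h1 hr hz e
  have e1 : ∀ x : GI n m k → ℝ, (psi (kappa τm τk) (resG τm τk z x) +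
      rho (kappa τm τk) (resG τm τk z x)) * resG τm τk z x =
      ∑ e, B e * (resG τm τk z x * B e * resG τm τk z x) := fun x => by
    rw [← sum_dirI_mul_mul h0.le, Finset.sum_mul]
    exact Finset.sum_congr rfl fun e _ => by simp only [B, mul_assoc]
  have hL : ∀ e (f : (GI n m k → ℝ) → Matrix (Idx n m k) (Idx n m k) ℂ),
      Integrable f (stdG (GI n m k)) → ∫ x, B e * f x ∂(stdG (GI n m k)) =
        B e * ∫ x, f x ∂(stdG (GI n m k)) := fun e f hf =>
    (ContinuousLinearMap.mul ℝ _ (B e)).integral_comp_comm hf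
  have hI : ∀ e (f : (GI n m k → ℝ) → Matrix (Idx n m k) (Idx n m k) ℂ),
      Integrable f (stdG (GI n m k)) → Integrable (fun x => B e * f x) (stdG (GI n m k)) :=
    fun e f hf => (ContinuousLinearMap.mul ℝ _ (B e)).integrable_comp hf
  simp only [e1]
  refine ⟨integrable_finsetSum _ fun e _ => hI e _ (key e).2.1, ?_⟩
  rw [integral_finsetSum _ fun e _ => hI e _ (key e).2.1]
  -- Integration by parts read backwards: the quadratic term is the expectation of the random part
  -- of L(z) times the resolvent.
  have e2 : ∀ e, ∫ x, B e * (resG τm τk z x * B e * resG τm τk z x) ∂(stdG (GI n m k)) =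
      -(∫ x, B e * (x e • resG τm τk z x) ∂(stdG (GI n m k))) := fun e => by
    rw [hL e _ (key e).2.1, hL e _ (key e).1, (key e).2.2, integral_neg, mul_neg, neg_neg]
  rw [Finset.sum_congr rfl fun e _ => e2 e, Finset.sum_neg_distrib, sub_neg_eq_add]
  rw [← integral_finsetSum _ fun e _ => hI e _ (key e).1, expG]
  have e3 : lin τm τk 0 0 z * ∫ x, resG τm τk z x ∂(stdG (GI n m k)) =
      ∫ x, lin τm τk 0 0 z * resG τm τk z x ∂(stdG (GI n m k)) :=
    ((ContinuousLinearMap.mul ℝ _ (lin τm τk 0 0 z)).integral_comp_comm hi).symm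
  have e5 : Integrable (fun x => lin τm τk 0 0 z * resG τm τk z x) (stdG (GI n m k)) :=
    (ContinuousLinearMap.mul ℝ _ (lin τm τk 0 0 z)).integrable_comp hi
  rw [e3, ← integral_add e5 (integrable_finsetSum _ fun e _ => hI e _ (key e).1)]
  -- The identity L(z)G(z) = 1, split into its deterministic and its random part.
  have e4 : ∀ x : GI n m k → ℝ, lin τm τk 0 0 z * resG τm τk z x +
      ∑ e, B e * (x e • resG τm τk z x) = 1 := fun x => by
    rw [← linG_mul_resG h0 h1 hz x, linG_eq, add_mul, Finset.sum_mul]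
    congr 1
    exact Finset.sum_congr rfl fun e _ => by rw [mul_smul_comm, smul_mul_assoc]
  rw [integral_congr_ae (ae_of_all _ e4)]
  simp

lemma norm_trB_sq_le (d : Fin 4) (A : Matrix (Idx n m k) (Idx n m k) ℂ) :
    ‖trB d A‖ ^ 2 ≤ (m + k + 2 * n : ℕ) * ∑ i, ‖A i i‖ ^ 2 := by
  have h1 : ‖trB d A‖ ≤ ∑ i, ‖A i i‖ := by
    refine (norm_sum_le _ _).trans (Finset.sum_le_sum fun i _ => ?_)
    split_ifs <;> simp
  have h2 := sq_sum_le_card_mul_sum_sq (s := (Finset.univ : Finset (Idx n m k))) (f := fun i => ‖A i i‖)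
  calc _ ≤ (∑ i, ‖A i i‖) ^ 2 := by gcongr
    _ ≤ _ := h2
    _ = _ := by
      congr 2
      simp only [Finset.card_univ, Fintype.card_sum, Fintype.card_fin]
      ring

lemma psi_sub (κ : ℝ) (A B : Matrix (Idx n m k) (Idx n m k) ℂ) : psi κ (A - B) = psi κ A - psi κ B := by
  have h : ∀ d, trB d (A - B) = trB d A - trB d B := fun d => by
    rw [trB, trB, trB, ← Finset.sum_sub_distrib]
    exact Finset.sum_congr rfl fun i _ => by split_ifs <;> simp
  simp only [psi, h, sub_smul, smul_add, smul_sub]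
  abel

lemma kappa_div_le {c : ℕ} {κ : ℝ} (h0 : 0 < κ) (h1 : κ < 1) {p : ℕ} (hn : 0 < n) (h : n ≤ c * p) :
    ‖((κ / p : ℝ) : ℂ)‖ ≤ c / n := by
  have hp : 0 < p := Nat.pos_of_ne_zero fun h0 => by simp [h0] at h; omega
  rw [Complex.norm_real, Real.norm_of_nonneg (by positivity), div_le_div_iff₀ (by positivity)
    (by positivity)]
  have : (n : ℝ) ≤ c * p := by exact_mod_cast h
  calc κ * n ≤ 1 * (c * p) := by gcongr
    _ = _ := by ring

lemma norm_psi_sq_le {c : ℕ} (hr : Reg c n m k) {κ : ℝ} (h0 : 0 < κ) (h1 : κ < 1)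
    (A : Matrix (Idx n m k) (Idx n m k) ℂ) :
    ‖psi κ A‖ ^ 2 ≤ 16 * (c / n) ^ 2 * ((m + k + 2 * n : ℕ) * ∑ i, ‖A i i‖ ^ 2) := by
  set S := √((m + k + 2 * n : ℕ) * ∑ i, ‖A i i‖ ^ 2) with hS
  have hS2 : S ^ 2 = (m + k + 2 * n : ℕ) * ∑ i, ‖A i i‖ ^ 2 := Real.sq_sqrt (by positivity)
  have ht : ∀ d d' : Fin 4, ‖trB d A • (prj d' : Matrix (Idx n m k) (Idx n m k) ℂ)‖ ≤ S := by
    intro d d'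
    rw [norm_smul]
    exact (mul_le_of_le_one_right (norm_nonneg _) (norm_prj_le d')).trans
      (Real.le_sqrt_of_sq_le (norm_trB_sq_le d A))
  have hm := kappa_div_le h0 h1 hr.n_pos hr.n_le_m
  have hk := kappa_div_le h0 h1 hr.n_pos hr.n_le_k
  have hS0 : 0 ≤ S := Real.sqrt_nonneg _
  have h : ‖psi κ A‖ ≤ 4 * (c / n) * S := by
    refine (norm_add_le _ _).trans ?_
    rw [norm_smul, norm_smul]
    calc _ ≤ (c / n : ℝ) * (S + S) + (c / n : ℝ) * (S + S) := by
          gcongr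
          · exact (norm_add_le _ _).trans (add_le_add (ht _ _) (ht _ _))
          · exact (norm_add_le _ _).trans (add_le_add (ht _ _) (ht _ _))
      _ = _ := by ring
  calc _ ≤ (4 * (c / n) * S) ^ 2 := by gcongr
    _ = _ := by rw [mul_pow, hS2]; ring

lemma norm_rho_le {c : ℕ} (hr : Reg c n m k) {κ : ℝ} (h0 : 0 < κ) (h1 : κ < 1)
    {A : Matrix (Idx n m k) (Idx n m k) ℂ} (hA : Aᵀ = A) : ‖rho κ A‖ ≤ 4 * (c / n) * ‖A‖ := by
  have hm := kappa_div_le h0 h1 hr.n_pos hr.n_le_m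
  have hk := kappa_div_le h0 h1 hr.n_pos hr.n_le_k
  have ht : ∀ d d' : Fin 4, ‖(prj d * Aᵀ * prj d' : Matrix (Idx n m k) (Idx n m k) ℂ)‖ ≤ ‖A‖ := by
    intro d d'
    rw [hA]
    refine (norm_mul_le _ _).trans ?_
    refine (mul_le_of_le_one_right (norm_nonneg _) (norm_prj_le d')).trans ?_
    exact (norm_mul_le _ _).trans (mul_le_of_le_one_left (norm_nonneg _) (norm_prj_le d))
  refine (norm_add_le _ _).trans ?_
  rw [norm_smul, norm_smul]
  calc _ ≤ (c / n : ℝ) * (‖A‖ + ‖A‖) + (c / n : ℝ) * (‖A‖ + ‖A‖) := by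
        gcongr
        · exact (norm_add_le _ _).trans (add_le_add (ht _ _) (ht _ _))
        · exact (norm_add_le _ _).trans (add_le_add (ht _ _) (ht _ _))
    _ = _ := by ring

/-- The variance of the entries of the resolvent. -/
lemma integral_entry_sub_sq (h0 : 0 < kappa τm τk) (h1 : kappa τm τk < 1) (c : ℕ) {η : ℝ}
    (hη : 0 < η) : ∃ C : ℝ, 0 < C ∧ ∀ n m k : ℕ, Reg c n m k → ∀ z : ℂ, η ≤ |z.im| →
      ∀ i : Idx n m k,
      Integrable (fun x => ‖(resG τm τk z x - expG τm τk n m k z) i i‖ ^ 2) (stdG (GI n m k)) ∧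
      ∫ x, ‖(resG τm τk z x - expG τm τk n m k z) i i‖ ^ 2 ∂(stdG (GI n m k)) ≤ C / n := by
  obtain ⟨C, hC, hb⟩ := lintegral_bform_sub_pow h0 h1 c hη 1 one_pos
  refine ⟨C.toReal + 1, by positivity, fun n m k hr z hz i => ?_⟩
  have hn := hr.n_pos
  have hz' := im_ne_zero_of_le hη hz
  have h := hb n m k hr z hz (Pi.single i 1) (Pi.single i 1) (nrm_single i).le (nrm_single i).le
  have hc := continuous_resG (n := n) (m := m) (k := k) h0 h1 hz'
  have hcont : Continuous (fun x : GI n m k → ℝ =>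
      ‖(resG τm τk z x - expG τm τk n m k z) i i‖ ^ 2) := by
    have : Continuous fun x : GI n m k → ℝ => (resG τm τk z x) i i := hc.matrix_elem i i
    simp only [Matrix.sub_apply]
    fun_prop
  have e : ∀ x : GI n m k → ℝ, ENNReal.ofReal (‖(resG τm τk z x - expG τm τk n m k z) i i‖ ^ 2) =
      ‖bform (Pi.single i 1) (resG τm τk z x) (Pi.single i 1) -
        ∫ y, bform (Pi.single i 1) (resG τm τk z y) (Pi.single i 1) ∂(stdG (GI n m k))‖ₑ ^ (2 * 1) := by
    intro x
    rw [← bform_expG h0 h1 hr hz', bform_single, bform_single, ENNReal.ofReal_pow (norm_nonneg _),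
      ofReal_norm, Matrix.sub_apply]
  have hn0 : (n : ℝ≥0∞) ≠ 0 := by exact_mod_cast hn.ne'
  have hfin : C / (n : ℝ≥0∞) ^ 1 ≠ ∞ := ENNReal.div_ne_top hC (by simpa using hn0)
  constructor
  · refine ⟨hcont.aestronglyMeasurable, ?_⟩
    rw [hasFiniteIntegral_iff_ofReal (ae_of_all _ fun x => by positivity)]
    simp only [e]
    exact h.trans_lt hfin.lt_top
  · rw [integral_eq_lintegral_of_nonneg_ae (ae_of_all _ fun x => by positivity)
      hcont.aestronglyMeasurable]
    simp only [e]
    refine (ENNReal.toReal_mono hfin h).trans ?_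
    rw [ENNReal.toReal_div, pow_one, ENNReal.toReal_natCast]
    gcongr
    linarith

/-- The expected resolvent approximately satisfies the self-consistent equation. -/
lemma norm_selfConsistent_le (h0 : 0 < kappa τm τk) (h1 : kappa τm τk < 1) (c : ℕ) {η : ℝ}
    (hη : 0 < η) : ∃ C : ℝ, 0 < C ∧ ∀ n m k : ℕ, Reg c n m k → ∀ z : ℂ, η ≤ |z.im| →
      ‖(lin τm τk 0 0 z - psi (kappa τm τk) (expG τm τk n m k z)) * expG τm τk n m k z - 1‖ ≤
        C / √n := by
  obtain ⟨C1, hC1, hb1⟩ := integral_resG_pow h0 h1 c hη 2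
  obtain ⟨C2, hC2, hb2⟩ := integral_entry_sub_sq h0 h1 c hη
  refine ⟨16 * c ^ 2 * (2 * c + 2) ^ 2 * C2 + C1 + 4 * c * C1, by positivity,
    fun n m k hr z hz => ?_⟩
  have hz' := im_ne_zero_of_le hη hz
  have hn := hr.n_pos
  have hnR : (0 : ℝ) < n := by exact_mod_cast hn
  have hs : 0 < √(n : ℝ) := by positivity
  obtain ⟨hi, heq⟩ := schwinger_dyson h0 h1 hr hz'
  obtain ⟨i2, b2⟩ := hb1 n m k hr z hz
  set κ := kappa τm τk
  set E := expG τm τk n m k z with hE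
  set G : (GI n m k → ℝ) → Matrix (Idx n m k) (Idx n m k) ℂ := resG τm τk z with hG
  have hGi : Integrable G (stdG (GI n m k)) := by
    rw [← integrable_norm_iff (continuous_resG h0 h1 hz').aestronglyMeasurable]
    simpa using integrable_resG h0 h1 hr hz' 1
  have hfix : ∫ x, psi κ E * G x ∂(stdG (GI n m k)) = psi κ E * E :=
    (ContinuousLinearMap.mul ℝ _ (psi κ E)).integral_comp_comm hGi
  have hfixi : Integrable (fun x => psi κ E * G x) (stdG (GI n m k)) :=
    (ContinuousLinearMap.mul ℝ _ (psi κ E)).integrable_comp hGi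
  -- Replacing ψ(G) by ψ(E) inside the expectation leaves the fluctuation ψ(G - E)G and the
  -- lower-order term ρ(G)G.
  have herr : (lin τm τk 0 0 z - psi κ E) * E - 1 =
      ∫ x, (psi κ (G x - E) * G x + rho κ (G x) * G x) ∂(stdG (GI n m k)) := by
    have e1 : ∀ x, psi κ (G x - E) * G x + rho κ (G x) * G x =
        (psi κ (G x) + rho κ (G x)) * G x - psi κ E * G x := fun x => by
      rw [psi_sub, sub_mul, add_mul]; abel
    simp only [e1]
    rw [integral_sub hi hfixi, hfix, ← heq, sub_mul]
    abel
  rw [herr]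
  have hei := fun i => (hb2 n m k hr z hz i)
  set N : ℝ := ((m + k + 2 * n : ℕ) : ℝ) with hN
  have hNle : N ≤ (2 * c + 2) * n := by
    have e1 := hr.m_le
    have e2 := hr.k_le
    have : m + k + 2 * n ≤ (2 * c + 2) * n := by nlinarith
    rw [hN]
    exact_mod_cast this
  have hN0 : 0 ≤ N := by positivity
  -- The arithmetic–geometric inequality with weight √n separates the fluctuation from G: the
  -- expectation of ‖ψ(G - E)‖² is O(1/n), so both resulting terms are O(n^(-1/2)).
  have hbound : ∀ x, ‖psi κ (G x - E) * G x + rho κ (G x) * G x‖ ≤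
      √n * (16 * (c / n) ^ 2 * (N * ∑ i, ‖(G x - E) i i‖ ^ 2)) + (1 / √n) * ‖G x‖ ^ 2 +
        4 * (c / n) * ‖G x‖ ^ 2 := by
    intro x
    refine (norm_add_le _ _).trans (add_le_add ?_ ?_)
    · refine (norm_mul_le _ _).trans ?_
      have h3 := norm_psi_sq_le hr h0 h1 (G x - E)
      have h4 : √(n : ℝ) * ‖psi κ (G x - E)‖ ^ 2 ≤
          √n * (16 * (c / n) ^ 2 * (N * ∑ i, ‖(G x - E) i i‖ ^ 2)) := by gcongr
      refine le_trans ?_ (add_le_add_left h4 _)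
      set p := ‖psi κ (G x - E)‖
      set g := ‖G x‖
      have h5 : √(n : ℝ) * p ^ 2 + 1 / √n * g ^ 2 - 2 * (p * g) = (√n * p - g) ^ 2 / √n := by
        field_simp
        ring
      have h6 : 0 ≤ (√(n : ℝ) * p - g) ^ 2 / √n := by positivity
      have h7 : 0 ≤ p * g := by positivity
      linarith
    · refine (norm_mul_le _ _).trans ?_
      have := norm_rho_le hr h0 h1 (A := G x) (resolvent_transpose _ _ _)
      calc _ ≤ (4 * (c / n) * ‖G x‖) * ‖G x‖ := by gcongr
        _ = _ := by ring
  have isum : Integrable (fun x => ∑ i, ‖(G x - E) i i‖ ^ 2) (stdG (GI n m k)) :=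
    integrable_finsetSum _ fun i _ => (hei i).1
  have iA : Integrable (fun x => √n * (16 * (c / n) ^ 2 * (N * ∑ i, ‖(G x - E) i i‖ ^ 2)))
      (stdG (GI n m k)) := ((isum.const_mul N).const_mul _).const_mul _
  have iB : Integrable (fun x => (1 / √n) * ‖G x‖ ^ 2) (stdG (GI n m k)) := i2.const_mul _
  have iC : Integrable (fun x => 4 * (c / n) * ‖G x‖ ^ 2) (stdG (GI n m k)) := i2.const_mul _
  refine (norm_integral_le_of_norm_le ((iA.add iB).add iC) (ae_of_all _ hbound)).trans ?_
  rw [integral_add' (iA.add iB) iC, integral_add' iA iB, integral_const_mul, integral_const_mul,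
    integral_const_mul, integral_const_mul, integral_const_mul,
    integral_finsetSum _ fun i _ => (hei i).1]
  have s1 : ∑ i, ∫ x, ‖(G x - E) i i‖ ^ 2 ∂(stdG (GI n m k)) ≤ N * (C2 / n) := by
    refine (Finset.sum_le_sum fun i _ => (hei i).2).trans (le_of_eq ?_)
    rw [Finset.sum_const, Finset.card_univ, nsmul_eq_mul]
    congr 1
    rw [hN]
    simp only [Fintype.card_sum, Fintype.card_fin]
    push_cast; ring
  have hsn : √(n : ℝ) * √n = n := Real.mul_self_sqrt hnR.le
  have t1 : √n * (16 * (c / n) ^ 2 * (N * ∑ i, ∫ x, ‖(G x - E) i i‖ ^ 2 ∂(stdG (GI n m k)))) ≤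
      16 * c ^ 2 * (2 * c + 2) ^ 2 * C2 / √n := by
    calc _ ≤ √n * (16 * (c / n) ^ 2 * (((2 * c + 2) * n) * (((2 * c + 2) * n) * (C2 / n)))) := by
          gcongr
          exact s1.trans (by gcongr)
      _ = _ := by
        rw [eq_div_iff hs.ne']
        field_simp
        linear_combination (c : ℝ) ^ 2 * hsn
  have t2 : 1 / √n * ∫ x, ‖G x‖ ^ 2 ∂(stdG (GI n m k)) ≤ C1 / √n := by
    rw [one_div, inv_mul_eq_div]; gcongr
  have t3 : 4 * (c / n) * ∫ x, ‖G x‖ ^ 2 ∂(stdG (GI n m k)) ≤ 4 * c * C1 / √n := by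
    have h1n : √(n : ℝ) ≤ n := by
      rw [Real.sqrt_le_left hnR.le]
      have : (1 : ℝ) ≤ n := by exact_mod_cast hn
      nlinarith
    calc _ ≤ 4 * (c / √n) * C1 := by gcongr
      _ = _ := by ring
  rw [add_div, add_div]
  exact add_le_add (add_le_add t1 t2) t3

end SelfConsistent

end CCA

end


noncomputable section

namespace CCA

/-! ### Stability and uniqueness for the limiting system -/

section Stability

open Matrix

/-- The Cauchy-Schwarz step of the contraction estimate. -/
lemma weighted_cs {δ c ι a b a' b' x x' y y' e e' : ℝ}
    (hc : 0 < c) (hc1 : c ≤ 1) (hι : 0 < ι) (hδι : δ ≤ c * ι)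
    (ha : 0 ≤ a) (hb : 0 ≤ b) (ha' : 0 ≤ a') (hb' : 0 ≤ b') (he : ι ≤ e) (he' : ι ≤ e')
    (h1 : x ^ 2 * a + y ^ 2 * b ≤ (1 - c) * e) (h2 : x' ^ 2 * a' + y' ^ 2 * b' ≤ e' + δ) :
    x * x' * (√a * √a') + y * y' * (√b * √b') ≤ (1 - c ^ 2 / 2) * (√e * √e') := by
  have hcc : c ^ 2 ≤ 1 := pow_le_one₀ hc.le hc1
  have hc2 : 0 ≤ 1 - c ^ 2 / 2 := by linarith
  have e0 : 0 ≤ e := hι.le.trans he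
  have e0' : 0 ≤ e' := hι.le.trans he'
  refine (abs_le_of_sq_le_sq' ?_ (by positivity)).2
  have sa := Real.sq_sqrt ha
  have sb := Real.sq_sqrt hb
  have sa' := Real.sq_sqrt ha'
  have sb' := Real.sq_sqrt hb'
  -- Cauchy–Schwarz, through Lagrange's identity.
  have h4 : (x * x' * (√a * √a') + y * y' * (√b * √b')) ^ 2 ≤
      (x ^ 2 * a + y ^ 2 * b) * (x' ^ 2 * a' + y' ^ 2 * b') := by
    have : (x ^ 2 * √a ^ 2 + y ^ 2 * √b ^ 2) * (x' ^ 2 * √a' ^ 2 + y' ^ 2 * √b' ^ 2) -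
        (x * x' * (√a * √a') + y * y' * (√b * √b')) ^ 2 =
        (x * √a * (y' * √b') - y * √b * (x' * √a')) ^ 2 := by ring
    rw [sa, sb, sa', sb'] at this
    have h0 := sq_nonneg (x * √a * (y' * √b') - y * √b * (x' * √a'))
    linarith
  have h5 : 0 ≤ (1 - c) * e := mul_nonneg (by linarith) e0
  have h6 : c * ι ≤ c * e' := by gcongr
  calc _ ≤ _ := h4
    _ ≤ ((1 - c) * e) * (e' + δ) := mul_le_mul h1 h2 (by positivity) h5
    _ ≤ ((1 - c) * e) * ((1 + c) * e') := mul_le_mul_of_nonneg_left (by linarith) h5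
    _ = (1 - c ^ 2) * (e * e') := by ring
    -- The strict factor 1 - c of the exact solution outweighs the factor 1 + c into which the error
    -- δ ≤ cι was absorbed.
    _ ≤ (1 - c ^ 2 / 2) ^ 2 * (e * e') := by
      refine mul_le_mul_of_nonneg_right ?_ (mul_nonneg e0 e0')
      have := sq_nonneg (c ^ 2 / 2)
      have e : (1 - c ^ 2 / 2) ^ 2 = 1 - c ^ 2 + (c ^ 2 / 2) ^ 2 := by ring
      linarith
    _ = _ := by rw [mul_pow, mul_pow, Real.sq_sqrt e0, Real.sq_sqrt e0']

/-- A two-dimensional contraction estimate with weights. -/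
lemma weighted_contraction {D E δ c ι Λ : ℝ} {p₁ p₂ q₁ q₂ p₁' p₂' q₁' q₂' a b a' b' : ℝ}
    (hc : 0 < c) (hc1 : c ≤ 1) (hι : 0 < ι) (hδι : δ ≤ c * ι) (hD0 : 0 ≤ D)
    (hp₁ : 0 ≤ p₁) (hp₂ : 0 ≤ p₂) (hq₁ : 0 ≤ q₁) (hq₂ : 0 ≤ q₂)
    (hp₁' : 0 ≤ p₁') (hp₂' : 0 ≤ p₂') (hq₁' : 0 ≤ q₁') (hq₂' : 0 ≤ q₂')
    (ha : ι ≤ a) (hb : ι ≤ b) (ha' : ι ≤ a') (hb' : ι ≤ b')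
    (haΛ : a ≤ Λ) (hbΛ : b ≤ Λ) (haΛ' : a' ≤ Λ) (hbΛ' : b' ≤ Λ)
    (hD : D ≤ δ + (p₁ * p₁' * D + p₂ * p₂' * E)) (hE : E ≤ δ + (q₁ * q₁' * D + q₂ * q₂' * E))
    (hp : p₁ ^ 2 * a + p₂ ^ 2 * b ≤ (1 - c) * a) (hq : q₁ ^ 2 * a + q₂ ^ 2 * b ≤ (1 - c) * b)
    (hp' : p₁' ^ 2 * a' + p₂' ^ 2 * b' ≤ a' + δ) (hq' : q₁' ^ 2 * a' + q₂' ^ 2 * b' ≤ b' + δ) :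
    D ≤ 2 * Λ / (ι * c ^ 2) * δ ∧ E ≤ 2 * Λ / (ι * c ^ 2) * δ := by
  have ha0 : 0 < a := hι.trans_le ha
  have hb0 : 0 < b := hι.trans_le hb
  have ha0' : 0 < a' := hι.trans_le ha'
  have hb0' : 0 < b' := hι.trans_le hb'
  set g := √a * √a' with hg
  set h := √b * √b' with hh
  have hg0 : 0 < g := by positivity
  have hh0 : 0 < h := by positivity
  have sqs : ∀ {x y : ℝ}, ι ≤ x → ι ≤ y → x ≤ Λ → y ≤ Λ → ι ≤ √x * √y ∧ √x * √y ≤ Λ := by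
    intro x y hx hy hx' hy'
    rw [← Real.sqrt_mul (hι.le.trans hx)]
    have hΛ : 0 ≤ Λ := by linarith
    constructor
    · exact Real.le_sqrt_of_sq_le (by rw [sq]; exact mul_le_mul hx hy hι.le (by linarith))
    · rw [Real.sqrt_le_left hΛ, sq]
      exact mul_le_mul hx' hy' (by linarith) hΛ
  obtain ⟨hgι, hgΛ⟩ := sqs ha ha' haΛ haΛ'
  obtain ⟨hhι, hhΛ⟩ := sqs hb hb' hbΛ hbΛ'
  -- The weighted supremum norm of (D, E), with weights the geometric means of the two positive
  -- vectors. At the index attaining the maximum the inequality closes up as W ι c²/2 ≤ δ.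
  set W := max (D / g) (E / h) with hW
  have hW0 : 0 ≤ W := le_max_of_le_left (by positivity)
  have hDW : D ≤ W * g := by rw [← div_le_iff₀ hg0]; exact le_max_left _ _
  have hEW : E ≤ W * h := by rw [← div_le_iff₀ hh0]; exact le_max_right _ _
  -- the Cauchy-Schwarz step
  have cs : ∀ {x x' y y' e e' : ℝ}, 0 ≤ x → 0 ≤ x' → 0 ≤ y → 0 ≤ y' → ι ≤ e → ι ≤ e' →
      x ^ 2 * a + y ^ 2 * b ≤ (1 - c) * e → x' ^ 2 * a' + y' ^ 2 * b' ≤ e' + δ →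
      x * x' * D + y * y' * E ≤ W * ((1 - c ^ 2 / 2) * (√e * √e')) := by
    intro x x' y y' e e' hx hx' hy hy' he he' h1 h2
    have h3 : x * x' * D + y * y' * E ≤ W * (x * x' * g + y * y' * h) := by
      calc _ ≤ x * x' * (W * g) + y * y' * (W * h) := by gcongr
        _ = _ := by ring
    exact h3.trans (mul_le_mul_of_nonneg_left
      (weighted_cs hc hc1 hι hδι ha0.le hb0.le ha0'.le hb0'.le he he' h1 h2) hW0)
  have k1 := hD.trans (add_le_add_right (cs hp₁ hp₁' hp₂ hp₂' ha ha' hp hp') δ)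
  have k2 := hE.trans (add_le_add_right (cs hq₁ hq₁' hq₂ hq₂' hb hb' hq hq') δ)
  have hWle : W ≤ 2 / (ι * c ^ 2) * δ := by
    have hcc : 0 < ι * c ^ 2 := by positivity
    have hWι : W * (ι * c ^ 2) ≤ 2 * δ := by
      rcases max_cases (D / g) (E / h) with hm | hm
      · have e1 : D = W * g := by rw [hW, hm.1, div_mul_cancel₀ _ hg0.ne']
        rw [← hg] at k1
        rw [e1] at k1
        have : W * (c ^ 2 / 2) * ι ≤ W * (c ^ 2 / 2) * g := by gcongr
        linarith
      · have e1 : E = W * h := by rw [hW, hm.1, div_mul_cancel₀ _ hh0.ne']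
        rw [← hh] at k2
        rw [e1] at k2
        have : W * (c ^ 2 / 2) * ι ≤ W * (c ^ 2 / 2) * h := by gcongr
        linarith
    rw [div_mul_eq_mul_div, le_div_iff₀ hcc]
    exact hWι
  have hΛ0 : 0 ≤ Λ := by linarith
  have fin : ∀ {X g : ℝ}, X ≤ W * g → g ≤ Λ → X ≤ 2 * Λ / (ι * c ^ 2) * δ := by
    intro X g h1 h2
    calc X ≤ W * Λ := h1.trans (by gcongr)
      _ ≤ (2 / (ι * c ^ 2) * δ) * Λ := by gcongr
      _ = _ := by ring
  exact ⟨fin hDW hgΛ, fin hEW hhΛ⟩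

variable {τm τk : ℝ}

variable (τm τk) in
/-- The matrix inverted by the lower right block of the solution. -/
def sysMat (r s : ℂ) : Matrix (Fin 2) (Fin 2) ℂ :=
  !![alpha τm τk * kappa τm τk - kappa τm τk * r, (alpha τm τk : ℂ);
     (alpha τm τk : ℂ), alpha τm τk * kappa τm τk - kappa τm τk * s]

lemma sysMat_symm {r s : ℂ} {T : Matrix (Fin 2) (Fin 2) ℂ} (h : T * sysMat τm τk r s = 1) :
    T 0 1 = T 1 0 := by
  have e : (sysMat τm τk r s)ᵀ = sysMat τm τk r s := by
    ext i j; fin_cases i <;> fin_cases j <;> rfl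
  have h1 : T = (sysMat τm τk r s)⁻¹ := (inv_eq_left_inv h).symm
  have h2 : Tᵀ = T := by rw [h1, transpose_nonsing_inv, e]
  exact congrFun (congrFun h2 1) 0

/-- The matrix form of Im(1/w) = -Im w / |w|²: T is the inverse of a symmetric matrix whose
imaginary part is diagonal, because α and κ are real. -/
lemma im_sys {r s : ℂ} {T : Matrix (Fin 2) (Fin 2) ℂ} (h : T * sysMat τm τk r s = 1) :
    (T 0 0).im = kappa τm τk * (‖T 0 0‖ ^ 2 * r.im + ‖T 0 1‖ ^ 2 * s.im) ∧
    (T 1 1).im = kappa τm τk * (‖T 0 1‖ ^ 2 * r.im + ‖T 1 1‖ ^ 2 * s.im) := by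
  have hsym := sysMat_symm h
  have e00 := congrFun (congrFun h 0) 0
  have e01 := congrFun (congrFun h 0) 1
  have e10 := congrFun (congrFun h 1) 0
  have e11 := congrFun (congrFun h 1) 1
  simp only [sysMat, mul_apply, Fin.sum_univ_two, of_apply, cons_val', cons_val_zero, cons_val_one,
    cons_val_fin_one, one_apply_eq, ne_eq, one_ne_zero, not_false_eq_true, one_apply_ne,
    zero_ne_one, ← hsym] at e00 e01 e10 e11
  rw [← Complex.normSq_eq_norm_sq, ← Complex.normSq_eq_norm_sq, ← Complex.normSq_eq_norm_sq,
    Complex.normSq_apply, Complex.normSq_apply, Complex.normSq_apply]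
  rw [Complex.ext_iff] at e00 e01 e10 e11
  simp only [Complex.add_re, Complex.add_im, Complex.mul_re, Complex.mul_im, Complex.sub_re,
    Complex.sub_im, Complex.ofReal_re, Complex.ofReal_im, Complex.one_re, Complex.one_im,
    Complex.zero_re, Complex.zero_im] at e00 e01 e10 e11
  constructor
  · linear_combination (T 0 0).re * e00.2 - (T 0 0).im * e00.1 + (T 0 1).re * e01.2 -
      (T 0 1).im * e01.1
  · linear_combination (T 0 1).re * e10.2 - (T 0 1).im * e10.1 + (T 1 1).re * e11.2 -
      (T 1 1).im * e11.1

/-- The resolvent identity T - T' = T(S' - S)T' for the matrices S, S' inverted by T, T'; they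
differ on the diagonal only. -/
lemma sys_sub {r s r' s' : ℂ} {T T' : Matrix (Fin 2) (Fin 2) ℂ} (h : T * sysMat τm τk r s = 1)
    (h' : T' * sysMat τm τk r' s' = 1) :
    T 0 0 - T' 0 0 = kappa τm τk * (T 0 0 * (r - r') * T' 0 0 + T 0 1 * (s - s') * T' 0 1) ∧
    T 1 1 - T' 1 1 = kappa τm τk * (T 0 1 * (r - r') * T' 0 1 + T 1 1 * (s - s') * T' 1 1) := by
  have h2 : sysMat τm τk r' s' * T' = 1 := mul_eq_one_comm.1 h'
  have e1 : sysMat τm τk r' s' - sysMat τm τk r s =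
      !![kappa τm τk * (r - r'), 0; 0, kappa τm τk * (s - s')] := by
    ext i j; fin_cases i <;> fin_cases j <;> simp [sysMat] <;> ring
  have e2 : T - T' = T * !![kappa τm τk * (r - r'), 0; 0, kappa τm τk * (s - s')] * T' := by
    rw [← e1, mul_sub, sub_mul, h, one_mul, mul_assoc, h2, mul_one]
  have hsym := sysMat_symm h
  have hsym' := sysMat_symm h'
  have f1 := congrFun (congrFun e2 0) 0
  have f2 := congrFun (congrFun e2 1) 1
  simp only [mul_apply, Fin.sum_univ_two, Matrix.sub_apply, of_apply, cons_val', cons_val_zero, cons_val_one,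
    cons_val_fin_one, ← hsym, ← hsym'] at f1 f2
  exact ⟨by rw [f1]; ring, by rw [f2]; ring⟩

lemma im_inv_eq {κ τ : ℝ} {z t r : ℂ} (hr : r * (-z - κ * τ * t) = 1) :
    r.im = ‖r‖ ^ 2 * (z.im + κ * τ * t.im) := by
  have h0 : r ≠ 0 := by rintro rfl; simp at hr
  have h1 : -z - κ * τ * t = r⁻¹ := eq_inv_of_mul_eq_one_right hr
  have h2 := congrArg Complex.im h1
  rw [Complex.inv_im, Complex.normSq_eq_norm_sq] at h2
  have h3 : (-z - κ * τ * t).im = -(z.im + κ * τ * t.im) := by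
    have : (κ * τ * t : ℂ) = ((κ * τ : ℝ) : ℂ) * t := by push_cast; rfl
    rw [this, Complex.sub_im, Complex.neg_im, Complex.im_ofReal_mul]; ring
  rw [h3] at h2
  have h4 : ‖r‖ ^ 2 ≠ 0 := by simpa using h0
  field_simp at h2
  linarith

/-- Stability of the self-consistent system. -/
lemma system_stable (hτm : 0 < τm) (hτk : 0 < τk) {η Λ : ℝ} (hη : 0 < η) (hΛ : 0 < Λ) :
    ∃ C δ₀ : ℝ, 0 < C ∧ 0 < δ₀ ∧ ∀ (z r s r' s' r₁ s₁ : ℂ) (T T' : Matrix (Fin 2) (Fin 2) ℂ) (δ : ℝ),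
      η ≤ z.im → ‖z‖ ≤ Λ → SolvesSystem τm τk z r s T → ‖r‖ ≤ Λ → ‖s‖ ≤ Λ → (∀ i j, ‖T i j‖ ≤ Λ) →
      0 ≤ r'.im → 0 ≤ s'.im → ‖r'‖ ≤ Λ → ‖s'‖ ≤ Λ → (∀ i j, ‖T' i j‖ ≤ Λ) →
      T' * sysMat τm τk r' s' = 1 → r₁ * (-z - kappa τm τk * τm * T' 0 0) = 1 →
      s₁ * (-z - kappa τm τk * τk * T' 1 1) = 1 → 0 ≤ δ → δ ≤ δ₀ → ‖r₁ - r'‖ ≤ δ → ‖s₁ - s'‖ ≤ δ →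
      ‖r - r'‖ ≤ C * δ ∧ ‖s - s'‖ ≤ C * δ := by
  have hκ := kappa_pos hτm hτk
  set κ := kappa τm τk
  set τ := τm + τk
  -- ℓ is a lower bound for the moduli of r, s, r₁, s₁; then 2ι = ℓ²η bounds their imaginary parts
  -- below, and half of it survives for r', s' when δ ≤ ι. The defect c of the contraction comes
  -- from the term |r|² Im z ≥ c Im r.
  set ℓ := (Λ + κ * τ * Λ)⁻¹ with hℓ
  have hℓ0 : 0 < ℓ := by positivity
  set ι := ℓ ^ 2 * η / 2 with hι
  have hι0 : 0 < ι := by positivity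
  set c := min 1 (ℓ * η) with hc
  have hc0 : 0 < c := lt_min one_pos (by positivity)
  refine ⟨2 * Λ / (ι * c ^ 2), min ι (c * ι), by positivity, lt_min hι0 (by positivity), ?_⟩
  intro z r s r' s' r₁ s₁ T T' δ hz hzΛ hS hrΛ hsΛ hTΛ hr' hs' hr'Λ hs'Λ hT'Λ hT' hr₁ hs₁ hδ0 hδ hdr hds
  have hT : T * sysMat τm τk r s = 1 := hS.eq_T
  -- the scalar equations
  have inv_mul : ∀ {w : ℂ}, (1 / w).im > 0 → 1 / w * w = 1 := fun {w} h => by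
    have : w ≠ 0 := by rintro rfl; simp at h
    rw [one_div, inv_mul_cancel₀ this]
  have hr : r * (-z - κ * τm * T 0 0) = 1 := by
    have := hS.im_r_pos; rw [hS.eq_r] at this ⊢; exact inv_mul this
  have hs : s * (-z - κ * τk * T 1 1) = 1 := by
    have := hS.im_s_pos; rw [hS.eq_s] at this ⊢; exact inv_mul this
  -- lower bounds
  have low : ∀ {τ' : ℝ} {w t : ℂ}, 0 < τ' → τ' ≤ τ → ‖t‖ ≤ Λ → w * (-z - κ * τ' * t) = 1 → ℓ ≤ ‖w‖ := by
    intro τ' w t h1 h2 h3 h4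
    have h5 : ‖-z - κ * τ' * t‖ ≤ Λ + κ * τ * Λ := by
      refine (norm_sub_le _ _).trans ?_
      rw [norm_neg, norm_mul, norm_mul, Complex.norm_real, Complex.norm_real,
        Real.norm_of_nonneg hκ.le, Real.norm_of_nonneg h1.le]
      gcongr
    have h6 : ‖w‖ * ‖-z - κ * τ' * t‖ = 1 := by rw [← norm_mul, h4, norm_one]
    rw [hℓ, inv_le_iff_one_le_mul₀ (by positivity), ← h6]
    gcongr
  have hτm' : τm ≤ τ := by simp only [τ]; linarith
  have hτk' : τk ≤ τ := by simp only [τ]; linarith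
  have lr := low hτm hτm' (hTΛ 0 0) hr
  have ls := low hτk hτk' (hTΛ 1 1) hs
  have lr₁ := low hτm hτm' (hT'Λ 0 0) hr₁
  have ls₁ := low hτk hτk' (hT'Λ 1 1) hs₁
  -- identities for imaginary parts
  obtain ⟨i1, i2⟩ := im_sys hT
  obtain ⟨i1', i2'⟩ := im_sys hT'
  have jr := im_inv_eq hr
  have js := im_inv_eq hs
  have jr₁ := im_inv_eq hr₁
  have js₁ := im_inv_eq hs₁
  rw [i1] at jr
  rw [i2] at js
  rw [i1'] at jr₁
  rw [i2'] at js₁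
  have hIr := hS.im_r_pos
  have hIs := hS.im_s_pos
  have lowIm : ∀ {w : ℂ} {u : ℝ}, 0 ≤ u → ℓ ≤ ‖w‖ → w.im = ‖w‖ ^ 2 * (z.im + u) → 2 * ι ≤ w.im := by
    intro w u hu hw h
    have e : 2 * ι = ℓ ^ 2 * η := by rw [hι]; ring
    rw [h, e]
    gcongr
    linarith
  have br : 2 * ι ≤ r.im := lowIm (by positivity) lr jr
  have bs : 2 * ι ≤ s.im := lowIm (by positivity) ls js
  have br₁ : 2 * ι ≤ r₁.im := lowIm (by positivity) lr₁ jr₁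
  have bs₁ : 2 * ι ≤ s₁.im := lowIm (by positivity) ls₁ js₁
  have dim : ∀ {w w' : ℂ}, ‖w - w'‖ ≤ δ → w.im ≤ w'.im + δ := by
    intro w w' h
    have := (Complex.abs_im_le_norm (w - w')).trans h
    rw [Complex.sub_im] at this
    linarith [(abs_le.1 this).2]
  have hδι : δ ≤ ι := hδ.trans (min_le_left _ _)
  have br' : ι ≤ r'.im := by linarith [dim hdr]
  have bs' : ι ≤ s'.im := by linarith [dim hds]
  -- contraction of the exact operator
  have contr : ∀ {w : ℂ} {u : ℝ}, ℓ ≤ ‖w‖ → w.im = ‖w‖ ^ 2 * (z.im + u) → 0 ≤ w.im →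
      ‖w‖ ^ 2 * u ≤ (1 - c) * w.im := by
    intro w u hw h h0
    have h1 : c * w.im ≤ ‖w‖ ^ 2 * z.im := by
      calc c * w.im ≤ (ℓ * η) * ‖w‖ := by
            gcongr
            · exact min_le_right _ _
            · exact (le_abs_self _).trans (Complex.abs_im_le_norm w)
        _ ≤ (‖w‖ * z.im) * ‖w‖ := by gcongr
        _ = _ := by ring
    linarith
  have sub_eq : ∀ {τ' : ℝ} {w w₁ t t' : ℂ}, w * (-z - κ * τ' * t) = 1 → w₁ * (-z - κ * τ' * t') = 1 →
      w - w₁ = κ * τ' * (w * w₁) * (t - t') := by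
    intro τ' w w₁ t t' h1 h2
    linear_combination w₁ * h1 - w * h2
  obtain ⟨d1, d2⟩ := sys_sub hT hT'
  have nκ : ‖(κ : ℂ)‖ = κ := by rw [Complex.norm_real, Real.norm_of_nonneg hκ.le]
  -- The difference r - r' is split at r₁. The part r₁ - r' is the error; the part r - r₁ is
  -- proportional to the difference of the diagonal entries of T and T', hence linear in r - r' and
  -- s - s'.
  have dd : ∀ {τ' : ℝ} {w w₁ w' t t' x x' y y' : ℂ}, 0 < τ' → w * (-z - κ * τ' * t) = 1 →
      w₁ * (-z - κ * τ' * t') = 1 → ‖w₁ - w'‖ ≤ δ →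
      t - t' = κ * (x * (r - r') * x' + y * (s - s') * y') →
      ‖w - w'‖ ≤ δ + (κ * √τ' * ‖w‖ * ‖x‖ * (κ * √τ' * ‖w₁‖ * ‖x'‖) * ‖r - r'‖ +
        κ * √τ' * ‖w‖ * ‖y‖ * (κ * √τ' * ‖w₁‖ * ‖y'‖) * ‖s - s'‖) := by
    intro τ' w w₁ w' t t' x x' y y' h0 h1 h2 h3 h4
    have h5 : ‖w - w'‖ ≤ ‖w₁ - w'‖ + ‖w - w₁‖ := by
      rw [add_comm]
      exact norm_sub_le_norm_sub_add_norm_sub _ _ _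
    refine h5.trans (add_le_add h3 ?_)
    rw [sub_eq h1 h2, h4, norm_mul, norm_mul, norm_mul, norm_mul, norm_mul, nκ, Complex.norm_real,
      Real.norm_of_nonneg h0.le]
    have h6 : ‖x * (r - r') * x' + y * (s - s') * y'‖ ≤
        ‖x‖ * ‖r - r'‖ * ‖x'‖ + ‖y‖ * ‖s - s'‖ * ‖y'‖ := by
      refine (norm_add_le _ _).trans (le_of_eq ?_)
      rw [norm_mul, norm_mul, norm_mul, norm_mul]
    have h7 := Real.mul_self_sqrt h0.le
    calc _ ≤ κ * τ' * (‖w‖ * ‖w₁‖) * (κ * (‖x‖ * ‖r - r'‖ * ‖x'‖ + ‖y‖ * ‖s - s'‖ * ‖y'‖)) := by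
          gcongr
      _ = _ := by
        nth_rewrite 1 [← h7]
        ring
  have D1 := dd hτm hr hr₁ hdr d1
  have D2 := dd hτk hs hs₁ hds d2
  have hδc : δ ≤ c * ι := hδ.trans (min_le_right _ _)
  have imle : ∀ {w : ℂ}, ‖w‖ ≤ Λ → w.im ≤ Λ := fun h =>
    (le_abs_self _).trans ((Complex.abs_im_le_norm _).trans h)
  have sqm := Real.sq_sqrt hτm.le
  have sqk := Real.sq_sqrt hτk.le
  -- The weights are the imaginary parts. By `im_sys` the squared coefficients of the exact solution
  -- map (Im r, Im s) strictly below itself, while those of the approximate one map (Im r', Im s')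
  -- below itself up to δ.
  refine weighted_contraction (a := r.im) (b := s.im) (a' := r'.im) (b' := s'.im)
    (p₁ := κ * √τm * ‖r‖ * ‖T 0 0‖) (p₂ := κ * √τm * ‖r‖ * ‖T 0 1‖)
    (p₁' := κ * √τm * ‖r₁‖ * ‖T' 0 0‖) (p₂' := κ * √τm * ‖r₁‖ * ‖T' 0 1‖)
    (q₁ := κ * √τk * ‖s‖ * ‖T 0 1‖) (q₂ := κ * √τk * ‖s‖ * ‖T 1 1‖)
    (q₁' := κ * √τk * ‖s₁‖ * ‖T' 0 1‖) (q₂' := κ * √τk * ‖s₁‖ * ‖T' 1 1‖)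
    hc0 (min_le_left _ _) hι0 hδc (norm_nonneg _) (by positivity) (by positivity)
    (by positivity) (by positivity) (by positivity) (by positivity) (by positivity) (by positivity)
    (by linarith) (by linarith) br' bs' (imle hrΛ) (imle hsΛ) (imle hr'Λ) (imle hs'Λ) D1 D2 ?_ ?_ ?_ ?_
  · refine le_trans (le_of_eq ?_) (contr lr jr hIr.le)
    simp only [mul_pow, sqm]; ring
  · refine le_trans (le_of_eq ?_) (contr ls js hIs.le)
    simp only [mul_pow, sqk]; ring
  · refine le_trans ?_ (dim hdr)
    rw [jr₁]
    simp only [mul_pow, sqm]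
    have : 0 ≤ ‖r₁‖ ^ 2 * z.im := mul_nonneg (sq_nonneg _) (hη.le.trans hz)
    linarith
  · refine le_trans ?_ (dim hds)
    rw [js₁]
    simp only [mul_pow, sqk]
    have : 0 ≤ ‖s₁‖ ^ 2 * z.im := mul_nonneg (sq_nonneg _) (hη.le.trans hz)
    linarith

/-- Uniqueness of the solution of the self-consistent system. -/
lemma system_unique (hτm : 0 < τm) (hτk : 0 < τk) {z : ℂ} (hz : 0 < z.im) {r s r' s' : ℂ}
    {T T' : Matrix (Fin 2) (Fin 2) ℂ} (h : SolvesSystem τm τk z r s T)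
    (h' : SolvesSystem τm τk z r' s' T') : r = r' ∧ s = s' ∧ T = T' := by
  set Λ := 1 + ‖z‖ + ‖r‖ + ‖s‖ + ‖r'‖ + ‖s'‖ + ∑ i, ∑ j, ‖T i j‖ + ∑ i, ∑ j, ‖T' i j‖ with hΛ
  have hT0 : ∀ A : Matrix (Fin 2) (Fin 2) ℂ, 0 ≤ ∑ i, ∑ j, ‖A i j‖ := fun A => by positivity
  have hTle : ∀ (A : Matrix (Fin 2) (Fin 2) ℂ) i j, ‖A i j‖ ≤ ∑ i, ∑ j, ‖A i j‖ := fun A i j =>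
    (Finset.single_le_sum (f := fun j => ‖A i j‖) (fun _ _ => norm_nonneg _) (Finset.mem_univ j)).trans
      (Finset.single_le_sum (f := fun i => ∑ j, ‖A i j‖) (fun _ _ => by positivity)
        (Finset.mem_univ i))
  have := hT0 T
  have := hT0 T'
  have := norm_nonneg z
  have := norm_nonneg r
  have := norm_nonneg s
  have := norm_nonneg r'
  have := norm_nonneg s'
  -- Uniqueness is stability with error δ = 0, the second solution playing the approximate one with
  -- r₁ = r' and s₁ = s'.
  obtain ⟨C, δ₀, -, hδ₀, hst⟩ := system_stable hτm hτk hz (show 0 < Λ by linarith)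
  have inv_mul : ∀ {w : ℂ}, (1 / w).im > 0 → 1 / w * w = 1 := fun {w} h => by
    have : w ≠ 0 := by rintro rfl; simp at h
    rw [one_div, inv_mul_cancel₀ this]
  have key := hst z r s r' s' r' s' T T' 0 le_rfl (by linarith) h (by linarith) (by linarith)
    (fun i j => (hTle T i j).trans (by linarith)) h'.im_r_pos.le h'.im_s_pos.le (by linarith)
    (by linarith) (fun i j => (hTle T' i j).trans (by linarith)) h'.eq_T
    (by have := h'.im_r_pos; rw [h'.eq_r] at this ⊢; exact inv_mul this)
    (by have := h'.im_s_pos; rw [h'.eq_s] at this ⊢; exact inv_mul this) le_rfl hδ₀.le (by simp)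
    (by simp)
  simp only [mul_zero, norm_le_zero_iff, sub_eq_zero] at key
  refine ⟨key.1, key.2, ?_⟩
  have e1 : T * sysMat τm τk r s = 1 := h.eq_T
  have e2 : T' * sysMat τm τk r s = 1 := by rw [key.1, key.2]; exact h'.eq_T
  rw [← inv_eq_left_inv e1, ← inv_eq_left_inv e2]

end Stability

end CCA

end


noncomputable section

namespace CCA

/-! ### The algebra of block scalar matrices -/

section Comparison

open scoped Matrix.Norms.L2Operator ComplexConjugate
open Matrix

variable {τm τk : ℝ} {n m k : ℕ}

lemma detMatrix_sub (r s r' s' : ℂ) (T T' : Matrix (Fin 2) (Fin 2) ℂ) :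
    detMatrix n m k r s T - detMatrix n m k r' s' T' = detMatrix n m k (r - r') (s - s') (T - T') := by
  rw [detMatrix, detMatrix, detMatrix, sub_eq_add_neg, fromBlocks_neg, fromBlocks_add,
    fromBlocks_neg, fromBlocks_add, fromBlocks_neg, fromBlocks_add]
  simp [sub_eq_add_neg, add_smul]

lemma detMatrix_mul (r s r' s' : ℂ) (T T' : Matrix (Fin 2) (Fin 2) ℂ) :
    detMatrix n m k r s T * detMatrix n m k r' s' T' = detMatrix n m k (r * r') (s * s') (T * T') := by
  simp [detMatrix, fromBlocks_multiply, mul_apply, Fin.sum_univ_two, smul_smul, add_smul, mul_comm]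

lemma detMatrix_one : detMatrix n m k 1 1 1 = 1 := by
  simp [detMatrix, fromBlocks_one]

/-- The off-diagonal part of the lower right block. -/
def crossI (b : Bool) : Matrix (Idx n m k) (Idx n m k) ℂ :=
  fromBlocks 0 0 0 (fromBlocks 0 (if b then 1 else 0) (if b then 0 else 1) 0)

lemma norm_crossI_le (b : Bool) : ‖(crossI b : Matrix (Idx n m k) (Idx n m k) ℂ)‖ ≤ 1 := by
  refine opNorm_le_of_nrm _ zero_le_one fun v => ?_
  rw [one_mul]
  refine abs_le_of_sq_le_sq' ?_ (nrm_nonneg _) |>.2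
  rw [sq_nrm, sq_nrm]
  simp only [Fintype.sum_sum_type, crossI, mulVec, dotProduct, fromBlocks_apply₁₁,
    fromBlocks_apply₁₂, fromBlocks_apply₂₁, fromBlocks_apply₂₂, Matrix.zero_apply, zero_mul,
    Finset.sum_const_zero, add_zero, zero_add, norm_zero]
  have h1 : 0 ≤ ∑ i, ‖v (Sum.inl (Sum.inl i))‖ ^ 2 := by positivity
  have h2 : 0 ≤ ∑ i, ‖v (Sum.inl (Sum.inr i))‖ ^ 2 := by positivity
  have h3 : 0 ≤ ∑ i, ‖v (Sum.inr (Sum.inl i))‖ ^ 2 := by positivity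
  have h4 : 0 ≤ ∑ i, ‖v (Sum.inr (Sum.inr i))‖ ^ 2 := by positivity
  cases b <;> simp [Matrix.one_apply] <;> linarith

lemma detMatrix_eq (r s : ℂ) (T : Matrix (Fin 2) (Fin 2) ℂ) : detMatrix n m k r s T =
    r • prj 0 + s • prj 1 + (T 0 0 • prj 2 + T 1 1 • prj 3 + (T 0 1 • crossI true +
      T 1 0 • crossI false)) := by
  ext i j
  rcases i with (i | i) | (i | i) <;> rcases j with (j | j) | (j | j) <;>
    simp [detMatrix, prj, crossI, blockOf, Matrix.one_apply, diagonal_apply]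

lemma norm_detMatrix_le (r s : ℂ) (T : Matrix (Fin 2) (Fin 2) ℂ) :
    ‖detMatrix n m k r s T‖ ≤ ‖r‖ + ‖s‖ + (‖T 0 0‖ + ‖T 1 1‖ + (‖T 0 1‖ + ‖T 1 0‖)) := by
  have h : ∀ (w : ℂ) (A : Matrix (Idx n m k) (Idx n m k) ℂ), ‖A‖ ≤ 1 → ‖w • A‖ ≤ ‖w‖ := fun w A hA => by
    rw [norm_smul]
    exact mul_le_of_le_one_right (norm_nonneg _) hA
  rw [detMatrix_eq]
  refine norm_add_le_of_le (norm_add_le_of_le ?_ ?_) (norm_add_le_of_le (norm_add_le_of_le ?_ ?_)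
    (norm_add_le_of_le ?_ ?_))
  · exact h _ _ (norm_prj_le _)
  · exact h _ _ (norm_prj_le _)
  · exact h _ _ (norm_prj_le _)
  · exact h _ _ (norm_prj_le _)
  · exact h _ _ (norm_crossI_le _)
  · exact h _ _ (norm_crossI_le _)

/-- The deterministic part of the linearized matrix corrected by the covariance operator. -/
lemma lin_sub_psi (z : ℂ) (A : Matrix (Idx n m k) (Idx n m k) ℂ) :
    lin τm τk 0 0 z - psi (kappa τm τk) A =
      detMatrix n m k (-z - ((kappa τm τk / m : ℝ) : ℂ) * trB 2 A)
        (-z - ((kappa τm τk / k : ℝ) : ℂ) * trB 3 A)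
        (sysMat τm τk (trB 0 A / m) (trB 1 A / k)) := by
  -- ψ sees A only through its block traces, so the result is scalar on blocks, and the normalized
  -- traces of A take the places of r and s in the limiting system.
  ext i j
  rcases i with (i | i) | (i | i) <;> rcases j with (j | j) | (j | j) <;>
    simp [detMatrix, lin, psi, prj, blockOf, Matrix.one_apply, diagonal_apply, sysMat]
  all_goals
    split_ifs <;> simp <;> ring

lemma detMatrix_mul_apply (r s : ℂ) (N : Matrix (Fin 2) (Fin 2) ℂ)
    (B : Matrix (Idx n m k) (Idx n m k) ℂ) (j : Idx n m k) :
    (∀ i, (detMatrix n m k r s N * B) (.inl (.inl i)) j = r * B (.inl (.inl i)) j) ∧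
    (∀ i, (detMatrix n m k r s N * B) (.inl (.inr i)) j = s * B (.inl (.inr i)) j) ∧
    (∀ i, (detMatrix n m k r s N * B) (.inr (.inl i)) j =
      N 0 0 * B (.inr (.inl i)) j + N 0 1 * B (.inr (.inr i)) j) ∧
    (∀ i, (detMatrix n m k r s N * B) (.inr (.inr i)) j =
      N 1 0 * B (.inr (.inl i)) j + N 1 1 * B (.inr (.inr i)) j) := by
  refine ⟨fun i => ?_, fun i => ?_, fun i => ?_, fun i => ?_⟩ <;>
    simp [mul_apply, Fintype.sum_sum_type, detMatrix, Matrix.one_apply]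

lemma trB_detMatrix (r s : ℂ) (T : Matrix (Fin 2) (Fin 2) ℂ) :
    trB 0 (detMatrix n m k r s T) = m * r ∧ trB 1 (detMatrix n m k r s T) = k * s ∧
    trB 2 (detMatrix n m k r s T) = n * T 0 0 ∧ trB 3 (detMatrix n m k r s T) = n * T 1 1 := by
  simp [trB, Fintype.sum_sum_type, blockOf, detMatrix]

lemma trB_sub (d : Fin 4) (A B : Matrix (Idx n m k) (Idx n m k) ℂ) :
    trB d (A - B) = trB d A - trB d B := by
  rw [trB, trB, trB, ← Finset.sum_sub_distrib]
  exact Finset.sum_congr rfl fun i _ => by split_ifs <;> simp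

lemma norm_trB_le (A : Matrix (Idx n m k) (Idx n m k) ℂ) :
    ‖trB 0 A‖ ≤ m * ‖A‖ ∧ ‖trB 1 A‖ ≤ k * ‖A‖ ∧ ‖trB 2 A‖ ≤ n * ‖A‖ ∧ ‖trB 3 A‖ ≤ n * ‖A‖ := by
  have h : ∀ {p : ℕ} (f : Fin p → Idx n m k), ‖∑ i, A (f i) (f i)‖ ≤ p * ‖A‖ := fun {p} f => by
    refine (norm_sum_le_of_le _ fun i _ => norm_entry_le A (f i) (f i)).trans ?_
    simp
  simp only [trB, Fintype.sum_sum_type, blockOf]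
  simp [h]

/-- A block scalar matrix with a right inverse is invertible, and the inverse is block scalar. -/
lemma exists_detMatrix_inv (hn : 0 < n) (hm : 0 < m) (hk : 0 < k) {a b : ℂ}
    {N : Matrix (Fin 2) (Fin 2) ℂ} {B : Matrix (Idx n m k) (Idx n m k) ℂ}
    (h : detMatrix n m k a b N * B = 1) : ∃ (r s : ℂ) (T : Matrix (Fin 2) (Fin 2) ℂ),
      a * r = 1 ∧ b * s = 1 ∧ T * N = 1 ∧ B = detMatrix n m k r s T ∧
      ‖r‖ ≤ ‖B‖ ∧ ‖s‖ ≤ ‖B‖ ∧ ∀ i j, ‖T i j‖ ≤ ‖B‖ := by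
  let i0 : Fin m := ⟨0, hm⟩
  let j0 : Fin k := ⟨0, hk⟩
  let l0 : Fin n := ⟨0, hn⟩
  -- The candidate inverse is read off from B at the first index of each block; uniqueness of
  -- inverses then identifies B with the whole block scalar matrix.
  let T : Matrix (Fin 2) (Fin 2) ℂ := !![B (.inr (.inl l0)) (.inr (.inl l0)),
    B (.inr (.inl l0)) (.inr (.inr l0)); B (.inr (.inr l0)) (.inr (.inl l0)),
    B (.inr (.inr l0)) (.inr (.inr l0))]
  have hr : a * B (.inl (.inl i0)) (.inl (.inl i0)) = 1 := by
    rw [← (detMatrix_mul_apply a b N B _).1, h, one_apply_eq]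
  have hs : b * B (.inl (.inr j0)) (.inl (.inr j0)) = 1 := by
    rw [← (detMatrix_mul_apply a b N B _).2.1, h, one_apply_eq]
  have hT : N * T = 1 := by
    have e1 := (detMatrix_mul_apply a b N B (.inr (.inl l0))).2.2.1 l0
    have e2 := (detMatrix_mul_apply a b N B (.inr (.inl l0))).2.2.2 l0
    have e3 := (detMatrix_mul_apply a b N B (.inr (.inr l0))).2.2.1 l0
    have e4 := (detMatrix_mul_apply a b N B (.inr (.inr l0))).2.2.2 l0
    rw [h] at e1 e2 e3 e4
    simp at e1 e2 e3 e4
    ext i j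
    fin_cases i <;> fin_cases j <;> simp [T, mul_apply, Fin.sum_univ_two]
    · exact e1.symm
    · exact e3.symm
    · exact e2.symm
    · exact e4.symm
  refine ⟨_, _, T, hr, hs, mul_eq_one_comm.1 hT, ?_, norm_entry_le _ _ _, norm_entry_le _ _ _, ?_⟩
  · refine ((inv_eq_right_inv h).symm.trans (inv_eq_right_inv ?_))
    rw [detMatrix_mul, hr, hs, hT, detMatrix_one]
  · intro i j
    fin_cases i <;> fin_cases j <;> exact norm_entry_le B _ _

/-- The positivity of the imaginary parts of diagonal entries survives expectation. It places the
approximate r' and s' in the closed upper half-plane, as the stability estimate requires. -/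
lemma im_expG_nonneg (h0 : 0 < kappa τm τk) (h1 : kappa τm τk < 1) {c : ℕ} (hr : Reg c n m k) {z : ℂ}
    (hz : 0 < z.im) : 0 ≤ (trB 0 (expG τm τk n m k z)).im ∧ 0 ≤ (trB 1 (expG τm τk n m k z)).im := by
  have h : ∀ i : Idx n m k, (∀ x : GI n m k → ℝ, 0 ≤ (resG τm τk z x i i).im) →
      0 ≤ (expG τm τk n m k z i i).im := fun i hi => by
    have h2 := bform_expG h0 h1 hr hz.ne' (Pi.single i 1) (Pi.single i 1)
    simp only [bform_single] at h2
    have hint : Integrable (fun x => resG τm τk z x i i) (stdG (GI n m k)) := by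
      have hc := continuous_resG (n := n) (m := m) (k := k) h0 h1 hz.ne'
      refine Integrable.mono' (by simpa using integrable_resG h0 h1 hr hz.ne' 1)
        (Continuous.aestronglyMeasurable (by fun_prop)) (ae_of_all _ fun x => ?_)
      exact norm_entry_le _ _ _
    have h3 : (∫ x, resG τm τk z x i i ∂(stdG (GI n m k))).im =
        ∫ x, (resG τm τk z x i i).im ∂(stdG (GI n m k)) := (integral_im hint).symm
    rw [h2, h3]
    exact integral_nonneg hi
  simp only [trB, Fintype.sum_sum_type, blockOf]
  simp only [Fin.isValue, ↓reduceIte, Complex.add_im, Complex.im_sum]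
  constructor
  · simp
    exact Finset.sum_nonneg fun i _ => h _ fun x => im_resolvent_inl_inl_nonneg _ _ _ h0 h1 hz i
  · simp
    exact Finset.sum_nonneg fun i _ => h _ fun x => im_resolvent_inl_inr_nonneg _ _ _ h0 h1 hz i

lemma norm_expG_le (h0 : 0 < kappa τm τk) (h1 : kappa τm τk < 1) (c : ℕ) {η : ℝ} (hη : 0 < η) :
    ∃ C : ℝ, 0 < C ∧ ∀ n m k : ℕ, Reg c n m k → ∀ z : ℂ, η ≤ |z.im| → ‖expG τm τk n m k z‖ ≤ C := by
  obtain ⟨C, hC, h⟩ := integral_resG_pow h0 h1 c hη 1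
  refine ⟨C, hC, fun n m k hr z hz => (norm_integral_le_integral_norm _).trans ?_⟩
  simpa using (h n m k hr z hz).2

end Comparison

end CCA

end


noncomputable section

namespace CCA

/-! ### From the mean resolvent to an approximate solution -/

section Approximation

open scoped Matrix.Norms.L2Operator ComplexConjugate
open Matrix

variable {τm τk : ℝ}

/-- The size of the deviation of the finite model from its limit. -/
def dev (τm τk : ℝ) (n m k : ℕ) : ℝ := (√n)⁻¹ + |(n : ℝ) / m - τm| + |(n : ℝ) / k - τk|

lemma dev_nonneg (n m k : ℕ) : 0 ≤ dev τm τk n m k := by unfold dev; positivity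

/-- A Neumann series: ZA = 1 + X is invertible, and B = A(1 + X)⁻¹ satisfies A - B = BX. -/
lemma exists_near_right_inverse {ι : Type*} [Fintype ι] [DecidableEq ι] (Z A : Matrix ι ι ℂ)
    (h : ‖Z * A - 1‖ ≤ 1 / 2) :
    ∃ B, Z * B = 1 ∧ ‖B‖ ≤ 2 * ‖A‖ ∧ ‖A - B‖ ≤ 2 * ‖A‖ * ‖Z * A - 1‖ := by
  set X := Z * A - 1 with hX
  have : CompleteSpace (Matrix ι ι ℂ) := FiniteDimensional.complete ℂ _
  have hu : IsUnit (1 + X) := by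
    have := isUnit_one_sub_of_norm_lt_one (x := -X) (by rw [norm_neg]; linarith)
    rwa [sub_neg_eq_add] at this
  obtain ⟨u, hu⟩ := hu
  have hZA : Z * A = u := by rw [hu, hX]; abel
  set B := A * (u⁻¹ : (Matrix ι ι ℂ)ˣ) with hB
  have h1 : Z * B = 1 := by rw [hB, ← mul_assoc, hZA, Units.mul_inv]
  have h2 : A - B = B * X := by
    have : B * (1 + X) = A := by rw [← hu, hB, mul_assoc, Units.inv_mul, mul_one]
    rw [mul_add, mul_one] at this
    rw [← this]; abel
  have h3 : ‖A - B‖ ≤ ‖B‖ * ‖X‖ := by rw [h2]; exact norm_mul_le _ _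
  have h4 : ‖B‖ ≤ 2 * ‖A‖ := by
    have h5 : ‖B‖ ≤ ‖A‖ + ‖A - B‖ := by
      rw [← norm_neg (A - B)]
      refine le_trans (le_of_eq ?_) (norm_add_le _ _)
      congr 1; abel
    have h6 : ‖B‖ * ‖X‖ ≤ ‖B‖ * (1 / 2) := by gcongr
    linarith
  exact ⟨B, h1, h4, h3.trans (by gcongr)⟩

/-- Passage from the finite model, with ratio q and normalized trace t', to the scalar equation with
ratio τ and entry t. Since Im t ≥ 0, the new denominator has modulus at least η. -/
lemma approx_scalar {κ τ η Λ D c q : ℝ} {z w t t' w' : ℂ} (hκ : 0 < κ) (hκ1 : κ < 1) (hτ : 0 < τ)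
    (hη : 0 < η) (hz : η ≤ z.im) (ht : 0 ≤ t.im) (htΛ : ‖t‖ ≤ Λ) (hwΛ : ‖w‖ ≤ Λ)
    (htD : ‖t' - t‖ ≤ D) (hwD : ‖w - w'‖ ≤ D) (hq : 0 ≤ q) (hqc : q ≤ c)
    (hw : (-z - κ * q * t') * w = 1) :
    ∃ w₁, w₁ * (-z - κ * τ * t) = 1 ∧ ‖w₁ - w'‖ ≤ D + η⁻¹ * Λ * (|q - τ| * Λ + c * D) := by
  have e0 : (κ * τ * t : ℂ) = ((κ * τ : ℝ) : ℂ) * t := by push_cast; rfl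
  have hlow : η ≤ ‖-z - κ * τ * t‖ := by
    refine le_trans ?_ (Complex.abs_im_le_norm _)
    rw [e0, Complex.sub_im, Complex.neg_im, Complex.im_ofReal_mul]
    have : 0 ≤ κ * τ * t.im := by positivity
    rw [abs_of_neg (by linarith)]
    linarith
  have hne : -z - κ * τ * t ≠ 0 := norm_pos_iff.1 (hη.trans_le hlow)
  refine ⟨(-z - κ * τ * t)⁻¹, inv_mul_cancel₀ hne, ?_⟩
  set a := -z - κ * τ * t with ha
  have h1 : a⁻¹ - w = a⁻¹ * w * (κ * ((τ - q) * t - q * (t' - t))) := by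
    have h2 : a⁻¹ - w = a⁻¹ * w * ((-z - κ * q * t') - a) := by
      have : a⁻¹ * a = 1 := inv_mul_cancel₀ hne
      linear_combination -a⁻¹ * hw + w * this
    rw [h2, ha]
    ring
  have hΛ : 0 ≤ Λ := (norm_nonneg _).trans htΛ
  have hD : 0 ≤ D := (norm_nonneg _).trans htD
  have hc : 0 ≤ c := hq.trans hqc
  have h3 : ‖(τ - q : ℂ) * t - q * (t' - t)‖ ≤ |q - τ| * Λ + c * D := by
    refine norm_sub_le_of_le ?_ ?_
    · rw [norm_mul, ← Complex.ofReal_sub, Complex.norm_real, Real.norm_eq_abs, abs_sub_comm]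
      gcongr
    · rw [norm_mul, Complex.norm_real, Real.norm_of_nonneg hq]
      gcongr
  have h4 : ‖a⁻¹ - w‖ ≤ η⁻¹ * Λ * (|q - τ| * Λ + c * D) := by
    rw [h1, norm_mul, norm_mul, norm_mul, norm_inv, Complex.norm_real, Real.norm_of_nonneg hκ.le]
    gcongr
    exact (mul_le_of_le_one_left (norm_nonneg _) hκ1.le).trans h3
  have h5 : ‖a⁻¹ - w'‖ ≤ ‖a⁻¹ - w‖ + ‖w - w'‖ := norm_sub_le_norm_sub_add_norm_sub _ _ _
  linarith

set_option maxHeartbeats 800000 in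
/-- The expected resolvent is close to a solution of a perturbed self-consistent system. -/
lemma approx_system (hτm : 0 < τm) (hτk : 0 < τk) (h1 : kappa τm τk < 1) (c : ℕ) {η : ℝ}
    (hη : 0 < η) : ∃ C : ℝ, 0 < C ∧ ∀ n m k : ℕ, Reg c n m k → ∀ z : ℂ, η ≤ z.im → C ≤ √n →
      ∃ (r' s' r₁ s₁ : ℂ) (T' : Matrix (Fin 2) (Fin 2) ℂ), 0 ≤ r'.im ∧ 0 ≤ s'.im ∧ ‖r'‖ ≤ C ∧
        ‖s'‖ ≤ C ∧ (∀ i j, ‖T' i j‖ ≤ C) ∧ T' * sysMat τm τk r' s' = 1 ∧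
        r₁ * (-z - kappa τm τk * τm * T' 0 0) = 1 ∧ s₁ * (-z - kappa τm τk * τk * T' 1 1) = 1 ∧
        ‖r₁ - r'‖ ≤ C * dev τm τk n m k ∧ ‖s₁ - s'‖ ≤ C * dev τm τk n m k ∧
        ‖expG τm τk n m k z - detMatrix n m k r' s' T'‖ ≤ C * dev τm τk n m k := by
  have h0 := kappa_pos hτm hτk
  obtain ⟨C₁, hC₁, hb₁⟩ := norm_selfConsistent_le h0 h1 c hη
  obtain ⟨C₂, hC₂, hb₂⟩ := norm_expG_le h0 h1 c hη
  set Λ := 2 * C₂ with hΛ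
  set D := Λ * C₁ with hD
  set K := D + η⁻¹ * Λ * (Λ + c * D) with hK
  have hΛ0 : 0 < Λ := by positivity
  have hD0 : 0 < D := by positivity
  have hK0 : 0 < K := by positivity
  refine ⟨2 * C₁ + Λ + K + 3 * D, by positivity, fun n m k hr z hz hn => ?_⟩
  have hz' : η ≤ |z.im| := hz.trans (le_abs_self _)
  have hz0 : 0 < z.im := hη.trans_le hz
  have hn0 : (0 : ℝ) < n := by exact_mod_cast hr.n_pos
  have hm0 : (0 : ℝ) < m := by exact_mod_cast hr.m_pos
  have hk0 : (0 : ℝ) < k := by exact_mod_cast hr.k_pos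
  have hsn : 0 < √(n : ℝ) := Real.sqrt_pos.2 hn0
  have hX := hb₁ n m k hr z hz'
  have hA := hb₂ n m k hr z hz'
  set A := expG τm τk n m k z with hAdef
  have hX2 : ‖(lin τm τk 0 0 z - psi (kappa τm τk) A) * A - 1‖ ≤ 1 / 2 := by
    refine hX.trans ?_
    rw [div_le_iff₀ hsn]
    linarith
  -- An exact right inverse of the block scalar matrix L₀ - ψ(E); unlike E itself, it is exactly
  -- block scalar.
  obtain ⟨B, hB1, hB2, hB3⟩ := exists_near_right_inverse _ _ hX2
  rw [lin_sub_psi] at hB1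
  have hBΛ : ‖B‖ ≤ Λ := hB2.trans (by linarith)
  obtain ⟨w, v, T, hw, hv, hT, hB, hwB, hvB, hTB⟩ :=
    exists_detMatrix_inv hr.n_pos hr.m_pos hr.k_pos hB1
  have hAB : ‖A - B‖ ≤ D * (√n)⁻¹ := by
    refine hB3.trans ?_
    calc _ ≤ 2 * C₂ * (C₁ / √n) := by gcongr
      _ = _ := by rw [hD, hΛ]; ring
  have hBA : ‖B - A‖ ≤ D * (√n)⁻¹ := by rwa [norm_sub_rev]
  obtain ⟨t0, t1, t2, t3⟩ := trB_detMatrix (n := n) (m := m) (k := k) w v T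
  rw [← hB] at t0 t1 t2 t3
  have hc' : ∀ {p : ℕ} {u x y : ℂ}, (0 : ℝ) < p → x = p * u → ‖x - y‖ ≤ p * ‖B - A‖ →
      ‖u - y / p‖ ≤ D * (√n)⁻¹ := by
    intro p u x y hp hx hxy
    have hpc : (p : ℂ) ≠ 0 := by exact_mod_cast hp.ne'
    have e : u - y / p = (x - y) / p := by rw [hx]; field_simp
    rw [e, norm_div, Complex.norm_natCast, div_le_iff₀ hp]
    calc _ ≤ p * ‖B - A‖ := hxy
      _ ≤ _ := by rw [mul_comm]; gcongr
  obtain ⟨b0, b1, b2, b3⟩ := norm_trB_le (B - A)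
  rw [trB_sub] at b0 b1 b2 b3
  have q0 := hc' hm0 t0 b0
  have q1 := hc' hk0 t1 b1
  have q2 := hc' hn0 t2 b2
  have q3 := hc' hn0 t3 b3
  obtain ⟨im0, im1⟩ := im_expG_nonneg h0 h1 hr hz0
  have hdiv : ∀ {p : ℕ} {y : ℂ}, 0 ≤ y.im → 0 ≤ (y / p).im := fun {p y} hy => by
    rw [Complex.div_natCast_im]; positivity
  have i0 := hdiv (p := m) im0
  have i1 := hdiv (p := k) im1
  obtain ⟨j0, j1⟩ := im_sys hT
  have hne : (n : ℂ) ≠ 0 := by exact_mod_cast hn0.ne'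
  have sc : ∀ {p : ℕ} {y : ℂ}, ((kappa τm τk / p : ℝ) : ℂ) * y =
      kappa τm τk * ((n / p : ℝ) : ℂ) * (y / n) := fun {p y} => by
    push_cast; field_simp
  rw [sc] at hw hv
  have hnp : ∀ {p : ℕ}, (0 : ℝ) < p → n ≤ c * p → (n : ℝ) / p ≤ c := fun {p} hp h => by
    rw [div_le_iff₀ hp]; exact_mod_cast h
  obtain ⟨r₁, hr₁, hr₁'⟩ := approx_scalar (τ := τm) h0 h1 hτm hη hz (by rw [j0]; positivity)
    ((hTB 0 0).trans hBΛ) (hwB.trans hBΛ) (by rw [norm_sub_rev]; exact q2) q0 (by positivity)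
    (hnp hm0 hr.n_le_m) hw
  obtain ⟨s₁, hs₁, hs₁'⟩ := approx_scalar (τ := τk) h0 h1 hτk hη hz (by rw [j1]; positivity)
    ((hTB 1 1).trans hBΛ) (hvB.trans hBΛ) (by rw [norm_sub_rev]; exact q3) q1 (by positivity)
    (hnp hk0 hr.n_le_k) hv
  have hdev0 := dev_nonneg (τm := τm) (τk := τk) n m k
  have hi0 : 0 ≤ (√(n : ℝ))⁻¹ := by positivity
  have d1 : (√(n : ℝ))⁻¹ ≤ dev τm τk n m k := by
    have : 0 ≤ |(n : ℝ) / m - τm| + |(n : ℝ) / k - τk| := by positivity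
    unfold dev; linarith
  have d2 : |(n : ℝ) / m - τm| ≤ dev τm τk n m k := by
    have : 0 ≤ (√(n : ℝ))⁻¹ + |(n : ℝ) / k - τk| := by positivity
    unfold dev; linarith
  have d3 : |(n : ℝ) / k - τk| ≤ dev τm τk n m k := by
    have : 0 ≤ (√(n : ℝ))⁻¹ + |(n : ℝ) / m - τm| := by positivity
    unfold dev; linarith
  have Kd : ∀ {x : ℝ}, x ≤ dev τm τk n m k →
      D * (√n)⁻¹ + η⁻¹ * Λ * (x * Λ + c * (D * (√n)⁻¹)) ≤
        (2 * C₁ + Λ + K + 3 * D) * dev τm τk n m k := by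
    intro x hx
    calc _ ≤ D * dev τm τk n m k + η⁻¹ * Λ * (dev τm τk n m k * Λ + c * (D * dev τm τk n m k)) := by
          gcongr
      _ = K * dev τm τk n m k := by rw [hK]; ring
      _ ≤ _ := by gcongr; linarith
  have tr : ∀ {x y : ℂ}, ‖x - y‖ ≤ D * (√n)⁻¹ → ‖x - y‖ ≤ D * dev τm τk n m k := fun h =>
    h.trans (by gcongr)
  -- r' and s' are the normalized traces of E, so that the matrix equation with the block T of B
  -- holds exactly; all error is placed in the two scalar equations, through r₁ - r' and s₁ - s'.
  refine ⟨_, _, r₁, s₁, T, i0, i1, ?_, ?_, fun i j => ((hTB i j).trans hBΛ).trans (by linarith), hT,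
    hr₁, hs₁, hr₁'.trans (Kd d2), hs₁'.trans (Kd d3), ?_⟩
  · rw [norm_div, Complex.norm_natCast, div_le_iff₀ hm0]
    refine (norm_trB_le A).1.trans ?_
    rw [mul_comm]
    gcongr
    linarith
  · rw [norm_div, Complex.norm_natCast, div_le_iff₀ hk0]
    refine (norm_trB_le A).2.1.trans ?_
    rw [mul_comm]
    gcongr
    linarith
  · have e : A - detMatrix n m k (trB 0 A / m) (trB 1 A / k) T =
        (A - B) + detMatrix n m k (w - trB 0 A / m) (v - trB 1 A / k) 0 := by
      have : detMatrix n m k (w - trB 0 A / m) (v - trB 1 A / k) 0 =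
          B - detMatrix n m k (trB 0 A / m) (trB 1 A / k) T := by
        rw [hB, detMatrix_sub, sub_self]
      rw [this]; abel
    rw [e]
    refine (norm_add_le _ _).trans ?_
    have n1 := norm_detMatrix_le (n := n) (m := m) (k := k) (w - trB 0 A / m) (v - trB 1 A / k) 0
    simp only [Matrix.zero_apply, norm_zero, add_zero] at n1
    have : 3 * (D * (√n)⁻¹) ≤ 3 * (D * dev τm τk n m k) := by gcongr
    have h6 : 3 * D * dev τm τk n m k ≤ (2 * C₁ + Λ + K + 3 * D) * dev τm τk n m k := by
      gcongr; linarith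
    linarith

end Approximation

end CCA

end


noncomputable section

namespace CCA

/-! ### Existence of solutions and convergence of the mean -/

section Existence

open Matrix

variable {τm τk : ℝ}

lemma eventually_le_mul {τ : ℝ} (hτ : 0 < τ) {p : ℕ → ℕ}
    (h : Tendsto (fun n : ℕ => (n : ℝ) / (p n : ℝ)) atTop (𝓝 τ)) {c : ℕ} (h1 : 2 * τ ≤ c)
    (h2 : 2 / τ ≤ c) : ∀ᶠ n in atTop, n ≤ c * p n ∧ p n ≤ c * n := by
  filter_upwards [h.eventually_lt_const (show τ < 2 * τ by linarith),
    h.eventually_const_lt (show τ / 2 < τ by linarith), eventually_gt_atTop 0] with n hn1 hn2 hn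
  have hp : (0 : ℝ) < p n := by
    rcases (Nat.cast_nonneg (α := ℝ) (p n)).eq_or_lt with h0 | h0
    · rw [← h0, div_zero] at hn2; linarith
    · exact h0
  rw [div_lt_iff₀ hp] at hn1
  rw [lt_div_iff₀ hp] at hn2
  constructor
  · have : (n : ℝ) ≤ c * p n := hn1.le.trans (by gcongr)
    exact_mod_cast this
  · have : (p n : ℝ) ≤ c * n := by
      calc (p n : ℝ) = 2 / τ * (τ / 2 * p n) := by field_simp
        _ ≤ 2 / τ * n := by gcongr
        _ ≤ _ := by gcongr
    exact_mod_cast this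

lemma exists_reg (hτm : 0 < τm) (hτk : 0 < τk) : ∃ c : ℕ, ∀ m k : ℕ → ℕ,
    Tendsto (fun n : ℕ => (n : ℝ) / (m n : ℝ)) atTop (𝓝 τm) →
    Tendsto (fun n : ℕ => (n : ℝ) / (k n : ℝ)) atTop (𝓝 τk) →
    ∀ᶠ n in atTop, Reg c n (m n) (k n) := by
  obtain ⟨c, hc⟩ := exists_nat_ge (2 * τm + 2 / τm + 2 * τk + 2 / τk)
  have : 0 < 2 / τm := by positivity
  have : 0 < 2 / τk := by positivity
  refine ⟨c, fun m k hm hk => ?_⟩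
  filter_upwards [eventually_le_mul hτm hm (c := c) (by linarith) (by linarith),
    eventually_le_mul hτk hk (c := c) (by linarith) (by linarith), eventually_gt_atTop 0]
    with n h1 h2 h3
  exact ⟨h3, h1.1, h1.2, h2.1, h2.2⟩

lemma tendsto_dev {m k : ℕ → ℕ}
    (hm : Tendsto (fun n : ℕ => (n : ℝ) / (m n : ℝ)) atTop (𝓝 τm))
    (hk : Tendsto (fun n : ℕ => (n : ℝ) / (k n : ℝ)) atTop (𝓝 τk)) :
    Tendsto (fun n => dev τm τk n (m n) (k n)) atTop (𝓝 0) := by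
  have h1 : Tendsto (fun n : ℕ => (√(n : ℝ))⁻¹) atTop (𝓝 0) :=
    (Real.tendsto_sqrt_atTop.comp tendsto_natCast_atTop_atTop).inv_tendsto_atTop
  have h2 := (hm.sub_const τm).abs
  have h3 := (hk.sub_const τk).abs
  simpa [dev] using (h1.add h2).add h3

lemma tendsto_div_ceil {τ : ℝ} (hτ : 0 < τ) :
    Tendsto (fun n : ℕ => (n : ℝ) / (⌈τ⁻¹ * n⌉₊ : ℝ)) atTop (𝓝 τ) := by
  have h := ((tendsto_nat_ceil_mul_div_atTop (R := ℝ) (inv_nonneg.2 hτ.le)).comp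
    tendsto_natCast_atTop_atTop).inv₀ (inv_ne_zero hτ.ne')
  simpa using h

lemma sysMat_continuous : Continuous fun p : ℂ × ℂ => sysMat τm τk p.1 p.2 := by
  refine continuous_matrix fun i j => ?_
  fin_cases i <;> fin_cases j <;> simp [sysMat] <;> fun_prop

/-- Solutions of the self-consistent system exist and are bounded away from the real line. -/
lemma exists_solution (hτm : 0 < τm) (hτk : 0 < τk) (h1 : kappa τm τk < 1) {η : ℝ} (hη : 0 < η) :
    ∃ Λ : ℝ, 0 < Λ ∧ ∀ z : ℂ, η ≤ z.im → ∃ (r s : ℂ) (T : Matrix (Fin 2) (Fin 2) ℂ),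
      SolvesSystem τm τk z r s T ∧ ‖r‖ ≤ Λ ∧ ‖s‖ ≤ Λ ∧ ∀ i j, ‖T i j‖ ≤ Λ := by
  obtain ⟨c, hc⟩ := exists_reg hτm hτk
  obtain ⟨C, hC, happ⟩ := approx_system hτm hτk h1 c hη
  refine ⟨C, hC, fun z hz => ?_⟩
  set κ := kappa τm τk with hκ
  have hκ0 : 0 < κ := kappa_pos hτm hτk
  have hm := tendsto_div_ceil hτm
  have hk := tendsto_div_ceil hτk
  -- Any dimensions with the prescribed limiting ratios would do; the finite models serve only to
  -- produce approximate solutions at the fixed point z.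
  set m : ℕ → ℕ := fun n => ⌈τm⁻¹ * n⌉₊
  set k : ℕ → ℕ := fun n => ⌈τk⁻¹ * n⌉₊
  have hsq : ∀ᶠ n : ℕ in atTop, C ≤ √(n : ℝ) :=
    (Real.tendsto_sqrt_atTop.comp tendsto_natCast_atTop_atTop).eventually_ge_atTop C
  obtain ⟨N, hN⟩ := eventually_atTop.1 ((hc m k hm hk).and hsq)
  have hdev := (tendsto_dev hm hk).comp (tendsto_add_atTop_nat N)
  set d : ℕ → ℝ := (fun n => dev τm τk n (m n) (k n)) ∘ fun n => n + N with hd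
  have key : ∀ n : ℕ, ∃ p : ℂ × ℂ × (Fin 2 → Fin 2 → ℂ), 0 ≤ p.1.im ∧ 0 ≤ p.2.1.im ∧ ‖p.1‖ ≤ C ∧
      ‖p.2.1‖ ≤ C ∧ (∀ i j, ‖p.2.2 i j‖ ≤ C) ∧ of p.2.2 * sysMat τm τk p.1 p.2.1 = 1 ∧
      ‖p.1 * (-z - κ * τm * p.2.2 0 0) - 1‖ ≤ C * d n * (‖z‖ + κ * τm * C) ∧
      ‖p.2.1 * (-z - κ * τk * p.2.2 1 1) - 1‖ ≤ C * d n * (‖z‖ + κ * τk * C) := by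
    intro n
    obtain ⟨hr, hs⟩ := hN (n + N) (by omega)
    obtain ⟨r', s', r₁, s₁, T', h1, h2, h3, h4, h5, h6, h7, h8, h9, h10, -⟩ :=
      happ _ _ _ hr z hz hs
    have aux : ∀ {τ : ℝ} {x y t : ℂ}, 0 < τ → ‖t‖ ≤ C → y * (-z - κ * τ * t) = 1 →
        ‖y - x‖ ≤ C * d n → ‖x * (-z - κ * τ * t) - 1‖ ≤ C * d n * (‖z‖ + κ * τ * C) := by
      intro τ x y t hτ ht hy hxy
      rw [← hy, ← sub_mul, norm_mul, norm_sub_rev]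
      refine mul_le_mul hxy ?_ (norm_nonneg _) ((norm_nonneg _).trans hxy)
      refine (norm_sub_le _ _).trans ?_
      rw [norm_neg, norm_mul, norm_mul, Complex.norm_real, Complex.norm_real,
        Real.norm_of_nonneg hκ0.le, Real.norm_of_nonneg hτ.le]
      gcongr
    exact ⟨(r', s', T'), h1, h2, h3, h4, h5, h6, aux hτm (h5 0 0) h7 h9, aux hτk (h5 1 1) h8 h10⟩
  choose p hp using key
  have hbd : ∀ n, p n ∈ Metric.closedBall (0 : ℂ × ℂ × (Fin 2 → Fin 2 → ℂ)) C := fun n => by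
    obtain ⟨-, -, h3, h4, h5, -⟩ := hp n
    rw [mem_closedBall_zero_iff, Prod.norm_def, Prod.norm_def]
    refine max_le h3 (max_le h4 ?_)
    exact (pi_norm_le_iff_of_nonneg hC.le).2 fun i => (pi_norm_le_iff_of_nonneg hC.le).2 (h5 i)
  -- The conditions are closed and the scalar equations hold up to an error tending to 0, so a limit
  -- point solves the system exactly. Strict positivity of the imaginary parts is recovered
  -- afterwards from Im z > 0.
  obtain ⟨q, -, φ, hφ, hq⟩ := tendsto_subseq_of_bounded Metric.isBounded_closedBall hbd
  have cl : ∀ {S : Set (ℂ × ℂ × (Fin 2 → Fin 2 → ℂ))}, IsClosed S → (∀ n, p n ∈ S) → q ∈ S :=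
    fun hS h => hS.mem_of_tendsto hq (Eventually.of_forall fun n => h _)
  have c1 : 0 ≤ q.1.im := cl (S := {p | 0 ≤ p.1.im}) (isClosed_le (by fun_prop) (by fun_prop))
    fun n => (hp n).1
  have c2 : 0 ≤ q.2.1.im := cl (S := {p | 0 ≤ p.2.1.im}) (isClosed_le (by fun_prop) (by fun_prop))
    fun n => (hp n).2.1
  have c3 : ‖q.1‖ ≤ C := cl (S := {p | ‖p.1‖ ≤ C}) (isClosed_le (by fun_prop) (by fun_prop))
    fun n => (hp n).2.2.1
  have c4 : ‖q.2.1‖ ≤ C := cl (S := {p | ‖p.2.1‖ ≤ C}) (isClosed_le (by fun_prop) (by fun_prop))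
    fun n => (hp n).2.2.2.1
  have c5 : ∀ i j, ‖q.2.2 i j‖ ≤ C := fun i j => cl (S := {p | ‖p.2.2 i j‖ ≤ C})
    (isClosed_le (by fun_prop) (by fun_prop)) fun n => (hp n).2.2.2.2.1 i j
  have c6 : of q.2.2 * sysMat τm τk q.1 q.2.1 = 1 :=
    cl (S := {p | of p.2.2 * sysMat τm τk p.1 p.2.1 = 1}) (isClosed_eq
      (Continuous.matrix_mul (continuous_snd.comp continuous_snd)
        (sysMat_continuous.comp (by fun_prop : Continuous fun p : ℂ × ℂ × (Fin 2 → Fin 2 → ℂ) =>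
          (p.1, p.2.1)))) continuous_const) fun n => (hp n).2.2.2.2.2.1
  have lim : ∀ {F : ℂ × ℂ × (Fin 2 → Fin 2 → ℂ) → ℂ} {B : ℝ}, Continuous F →
      (∀ n, ‖F (p n) - 1‖ ≤ C * d n * B) → F q = 1 := by
    intro F B hF h
    have l1 : Tendsto (fun n => F (p (φ n))) atTop (𝓝 (F q)) := (hF.tendsto q).comp hq
    have l2 : Tendsto (fun n => F (p (φ n))) atTop (𝓝 1) := by
      rw [tendsto_iff_norm_sub_tendsto_zero]
      refine squeeze_zero (fun _ => norm_nonneg _) (fun n => h (φ n)) ?_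
      have := ((hdev.comp hφ.tendsto_atTop).const_mul C).mul_const B
      simpa using this
    exact tendsto_nhds_unique l1 l2
  have c7 : q.1 * (-z - κ * τm * q.2.2 0 0) = 1 :=
    lim (F := fun p => p.1 * (-z - κ * τm * p.2.2 0 0)) (by fun_prop) fun n => (hp n).2.2.2.2.2.2.1
  have c8 : q.2.1 * (-z - κ * τk * q.2.2 1 1) = 1 :=
    lim (F := fun p => p.2.1 * (-z - κ * τk * p.2.2 1 1)) (by fun_prop) fun n => (hp n).2.2.2.2.2.2.2
  obtain ⟨j1, j2⟩ := im_sys c6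
  have pos : ∀ {τ : ℝ} {w t : ℂ}, 0 < τ → 0 ≤ t.im → w * (-z - κ * τ * t) = 1 → 0 < w.im := by
    intro τ w t hτ ht hw
    have hw0 : 0 < ‖w‖ := norm_pos_iff.2 (by rintro rfl; simp at hw)
    rw [im_inv_eq hw]
    have : 0 < z.im := by linarith
    positivity
  refine ⟨q.1, q.2.1, of q.2.2, ⟨?_, ?_, ?_, ?_, c6⟩, c3, c4, c5⟩
  · exact pos hτm (by rw [show q.2.2 0 0 = of q.2.2 0 0 from rfl, j1]; positivity) c7
  · exact pos hτk (by rw [show q.2.2 1 1 = of q.2.2 1 1 from rfl, j2]; positivity) c8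
  · rw [one_div]; exact eq_inv_of_mul_eq_one_left c7
  · rw [one_div]; exact eq_inv_of_mul_eq_one_left c8

lemma norm_sys_sub_le {r s r' s' : ℂ} {T T' : Matrix (Fin 2) (Fin 2) ℂ} {Λ δ : ℝ}
    (h1 : kappa τm τk < 1) (h0 : 0 < kappa τm τk)
    (h : T * sysMat τm τk r s = 1) (h' : T' * sysMat τm τk r' s' = 1) (hT : ∀ i j, ‖T i j‖ ≤ Λ)
    (hT' : ∀ i j, ‖T' i j‖ ≤ Λ) (hr : ‖r - r'‖ ≤ δ) (hs : ‖s - s'‖ ≤ δ) (i j : Fin 2) :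
    ‖(T - T') i j‖ ≤ 2 * Λ ^ 2 * δ := by
  have h2 : sysMat τm τk r' s' * T' = 1 := mul_eq_one_comm.1 h'
  have e1 : sysMat τm τk r' s' - sysMat τm τk r s =
      diagonal ![kappa τm τk * (r - r'), kappa τm τk * (s - s')] := by
    ext i j; fin_cases i <;> fin_cases j <;> simp [sysMat] <;> ring
  have e2 : T - T' = T * diagonal ![kappa τm τk * (r - r'), kappa τm τk * (s - s')] * T' := by
    rw [← e1, mul_sub, sub_mul, h, one_mul, mul_assoc, h2, mul_one]
  have hΛ : 0 ≤ Λ := (norm_nonneg _).trans (hT 0 0)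
  have hδ : 0 ≤ δ := (norm_nonneg _).trans hr
  have e3 : (T - T') i j = T i 0 * (kappa τm τk * (r - r')) * T' 0 j +
      T i 1 * (kappa τm τk * (s - s')) * T' 1 j := by
    rw [e2, mul_apply, Fin.sum_univ_two, mul_diagonal, mul_diagonal]
    rfl
  have aux : ∀ {x y w : ℂ}, ‖x‖ ≤ Λ → ‖y‖ ≤ Λ → ‖w‖ ≤ δ → ‖x * (kappa τm τk * w) * y‖ ≤ Λ * δ * Λ := by
    intro x y w hx hy hw
    rw [norm_mul, norm_mul, norm_mul, Complex.norm_real, Real.norm_of_nonneg h0.le]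
    gcongr
    exact (mul_le_of_le_one_left (norm_nonneg _) h1.le).trans hw
  rw [e3]
  refine (norm_add_le_of_le (aux (hT i 0) (hT' 0 j) hr) (aux (hT i 1) (hT' 1 j) hs)).trans
    (le_of_eq (by ring))

open scoped Matrix.Norms.L2Operator in
/-- The expected resolvent is close to the deterministic limit. -/
lemma norm_expG_sub_le (hτm : 0 < τm) (hτk : 0 < τk) (h1 : kappa τm τk < 1) (c : ℕ) {η : ℝ}
    (hη : 0 < η) : ∃ C : ℝ, 0 < C ∧ ∀ n m k : ℕ, Reg c n m k → ∀ z : ℂ, η ≤ z.im → ‖z‖ ≤ η⁻¹ →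
      ∀ (r s : ℂ) (T : Matrix (Fin 2) (Fin 2) ℂ), SolvesSystem τm τk z r s T →
      ‖expG τm τk n m k z - detMatrix n m k r s T‖ ≤ C * dev τm τk n m k := by
  have h0 := kappa_pos hτm hτk
  obtain ⟨Ca, hCa, happ⟩ := approx_system hτm hτk h1 c hη
  obtain ⟨Cs, hCs, hsol⟩ := exists_solution hτm hτk h1 hη
  obtain ⟨Ce, hCe, hexp⟩ := norm_expG_le h0 h1 c hη
  set Λ := Ca + Cs + η⁻¹ with hΛ
  have hη' : 0 < η⁻¹ := inv_pos.2 hη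
  have hΛ0 : 0 < Λ := by positivity
  obtain ⟨C, δ₀, hC, hδ₀, hst⟩ := system_stable hτm hτk hη hΛ0
  -- Below this threshold both `approx_system` and the stability estimate apply. Above it the a
  -- priori bounds suffice, since `dev` is then bounded below.
  set d₀ := min Ca⁻¹ (δ₀ / Ca) with hd₀
  have hd₀' : 0 < d₀ := lt_min (by positivity) (by positivity)
  set B := Ca + (2 * (C * Ca) + 4 * (2 * Λ ^ 2 * (C * Ca))) with hB
  refine ⟨B + (Ce + 6 * Λ) / d₀, by positivity, fun n m k hr z hz hzη r s T hS => ?_⟩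
  have hdev0 := dev_nonneg (τm := τm) (τk := τk) n m k
  have hbd : ‖r‖ ≤ Λ ∧ ‖s‖ ≤ Λ ∧ ∀ i j, ‖T i j‖ ≤ Λ := by
    -- By uniqueness the given solution inherits the bound of the one constructed by compactness.
    obtain ⟨r₀, s₀, T₀, hS₀, b1, b2, b3⟩ := hsol z hz
    obtain ⟨rfl, rfl, rfl⟩ := system_unique hτm hτk (hη.trans_le hz) hS hS₀
    exact ⟨b1.trans (by linarith), b2.trans (by linarith), fun i j => (b3 i j).trans (by linarith)⟩
  obtain ⟨br, bs, bT⟩ := hbd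
  by_cases hsmall : dev τm τk n m k < d₀
  · have hn : Ca ≤ √n := by
      have h2 : (√(n : ℝ))⁻¹ < Ca⁻¹ := by
        refine lt_of_le_of_lt ?_ (hsmall.trans_le (min_le_left _ _))
        have : 0 ≤ |(n : ℝ) / m - τm| + |(n : ℝ) / k - τk| := by positivity
        unfold dev; linarith
      have hn0 : (0 : ℝ) < n := by exact_mod_cast hr.n_pos
      exact ((inv_lt_inv₀ (Real.sqrt_pos.2 hn0) hCa).1 h2).le
    have hδ : Ca * dev τm τk n m k ≤ δ₀ := by
      have := hsmall.le.trans (min_le_right _ _)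
      rw [le_div_iff₀ hCa] at this
      linarith
    obtain ⟨r', s', r₁, s₁, T', i1, i2, n1, n2, n3, e1, e2, e3, d1, d2, d3⟩ := happ n m k hr z hz hn
    obtain ⟨f1, f2⟩ := hst z r s r' s' r₁ s₁ T T' _ hz (by linarith) hS br bs bT i1 i2 (by linarith)
      (by linarith) (fun i j => (n3 i j).trans (by linarith)) e1 e2 e3 (by positivity) hδ d1 d2
    have f3 := norm_sys_sub_le (Λ := Λ) h1 h0 hS.eq_T e1 bT (fun i j => (n3 i j).trans (by linarith)) f1 f2
    have f4 := norm_detMatrix_le (n := n) (m := m) (k := k) (r - r') (s - s') (T - T')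
    have g00 := f3 0 0
    have g01 := f3 0 1
    have g10 := f3 1 0
    have g11 := f3 1 1
    have f5 : ‖expG τm τk n m k z - detMatrix n m k r s T‖ ≤
        ‖expG τm τk n m k z - detMatrix n m k r' s' T'‖ +
          ‖detMatrix n m k r s T - detMatrix n m k r' s' T'‖ := by
      rw [norm_sub_rev (detMatrix n m k r s T)]
      exact norm_sub_le_norm_sub_add_norm_sub _ _ _
    rw [detMatrix_sub] at f5
    have f6 : ‖expG τm τk n m k z - detMatrix n m k r s T‖ ≤ B * dev τm τk n m k := by
      rw [hB]
      linarith
    refine f6.trans ?_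
    gcongr
    have : 0 ≤ (Ce + 6 * Λ) / d₀ := by positivity
    linarith
  · push Not at hsmall
    have f1 := hexp n m k hr z (hz.trans (le_abs_self _))
    have f2 := norm_detMatrix_le (n := n) (m := m) (k := k) r s T
    have := bT 0 0
    have := bT 0 1
    have := bT 1 0
    have := bT 1 1
    calc _ ≤ Ce + 6 * Λ := by
          refine (norm_sub_le _ _).trans ?_
          linarith
      _ = (Ce + 6 * Λ) / d₀ * d₀ := by field_simp
      _ ≤ (Ce + 6 * Λ) / d₀ * dev τm τk n m k := by gcongr
      _ ≤ _ := by
        gcongr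
        have : 0 ≤ B := by positivity
        linarith

end Existence

end CCA

end


noncomputable section

namespace CCA

/-! ### The local law, pointwise and uniform -/

section LocalLaw

open scoped Matrix.Norms.L2Operator ComplexConjugate
open Matrix

variable {τm τk : ℝ}

lemma bform_sub {ι : Type*} [Fintype ι] (a : ι → ℂ) (A B : Matrix ι ι ℂ) (b : ι → ℂ) :
    bform a (A - B) b = bform a A b - bform a B b := by
  rw [bform, bform, bform, sub_mulVec, dotProduct_sub]

lemma rpow_pow_mul_pow_ge {n : ℕ} (hn : 0 < n) {ε : ℝ} {s t : ℕ} (ht : (s : ℝ) ≤ 2 * ε * t) :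
    (n : ℝ) ^ s ≤ ((n : ℝ) ^ (-(1 / 2) + ε : ℝ)) ^ (2 * t) * (n : ℝ) ^ t := by
  have hn0 : (0 : ℝ) < n := by exact_mod_cast hn
  have hn1 : (1 : ℝ) ≤ n := by exact_mod_cast hn
  rw [← Real.rpow_natCast, ← Real.rpow_natCast, ← Real.rpow_natCast, ← Real.rpow_mul hn0.le,
    ← Real.rpow_add hn0]
  refine Real.rpow_le_rpow_of_exponent_le hn1 ?_
  push_cast
  linarith

/-- Concentration of the resolvent at a single point. -/
lemma stdG_bform_tail (h0 : 0 < kappa τm τk) (h1 : kappa τm τk < 1) (c : ℕ) {η ε : ℝ} (hη : 0 < η)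
    (hε : 0 < ε) (s : ℕ) : ∃ C : ℝ≥0∞, C ≠ ∞ ∧ ∀ n m k : ℕ, Reg c n m k → ∀ z : ℂ, η ≤ |z.im| →
      ∀ a b : Idx n m k → ℂ, nrm a ≤ 1 → nrm b ≤ 1 →
      stdG (GI n m k) {x | (n : ℝ) ^ (-(1 / 2) + ε : ℝ) ≤
        ‖bform a (resG τm τk z x) b - bform a (expG τm τk n m k z) b‖} ≤ C / (n : ℝ≥0∞) ^ s := by
  -- The order 2t of the moment is chosen so large that the gain n^(-2εt) over the threshold
  -- n^(-1/2+ε) beats n^(-s).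
  obtain ⟨t₀, ht₀⟩ := exists_nat_ge ((s : ℝ) / (2 * ε))
  set t := t₀ + 1 with htdef
  have ht : (s : ℝ) ≤ 2 * ε * t := by
    rw [div_le_iff₀ (by positivity)] at ht₀
    have : (t : ℝ) = t₀ + 1 := by rw [htdef]; push_cast; rfl
    rw [this]
    linarith
  obtain ⟨C, hC, hb⟩ := lintegral_bform_sub_pow h0 h1 c hη t (Nat.succ_pos _)
  refine ⟨C, hC, fun n m k hr z hz a b ha hb' => ?_⟩
  have h := hb n m k hr z hz a b ha hb'
  rw [← bform_expG h0 h1 hr (im_ne_zero_of_le hη hz)] at h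
  have hn0 : (0 : ℝ) < n := by exact_mod_cast hr.n_pos
  set l := (n : ℝ) ^ (-(1 / 2) + ε : ℝ) with hl
  have hl0 : 0 < l := Real.rpow_pos_of_pos hn0 _
  set L := ENNReal.ofReal l ^ (2 * t) with hL
  set E := {x : GI n m k → ℝ | l ≤ ‖bform a (resG τm τk z x) b - bform a (expG τm τk n m k z) b‖} with hE
  have hsub : E ⊆ {x | L ≤ ‖bform a (resG τm τk z x) b - bform a (expG τm τk n m k z) b‖ₑ ^ (2 * t)} := by
    intro x hx
    have h2 : ENNReal.ofReal l ≤
        ‖bform a (resG τm τk z x) b - bform a (expG τm τk n m k z) b‖ₑ := by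
      rw [← ofReal_norm]
      exact ENNReal.ofReal_le_ofReal hx
    exact pow_le_pow_left' h2 _
  have hmeas : Measurable fun x : GI n m k → ℝ =>
      ‖bform a (resG τm τk z x) b - bform a (expG τm τk n m k z) b‖ₑ ^ (2 * t) := by
    have hc : Continuous fun x : GI n m k → ℝ => bform a (resG τm τk z x) b :=
      (bformL a b).continuous.comp (continuous_resG h0 h1 (im_ne_zero_of_le hη hz))
    exact (hc.measurable.sub_const _).enorm.pow_const _
  have hM : L * stdG (GI n m k) E ≤ C / (n : ℝ≥0∞) ^ t :=
    (mul_le_mul_right (measure_mono hsub) L).trans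
      ((mul_meas_ge_le_lintegral hmeas L).trans h)
  have hns : ((n : ℝ≥0∞)) ^ s ≤ L * (n : ℝ≥0∞) ^ t := by
    have e := ENNReal.ofReal_le_ofReal (rpow_pow_mul_pow_ge hr.n_pos ht)
    rw [ENNReal.ofReal_mul (by positivity), ENNReal.ofReal_pow hn0.le, ENNReal.ofReal_pow hn0.le,
      ENNReal.ofReal_pow hl0.le, ENNReal.ofReal_natCast] at e
    exact e
  have hnz : (n : ℝ≥0∞) ≠ 0 := by exact_mod_cast hr.n_pos.ne'
  have hnt : (n : ℝ≥0∞) ≠ ∞ := ENNReal.natCast_ne_top n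
  rw [ENNReal.le_div_iff_mul_le (Or.inl (pow_ne_zero _ hnz)) (Or.inl (ENNReal.pow_ne_top hnt))]
  calc stdG (GI n m k) E * (n : ℝ≥0∞) ^ s ≤ stdG (GI n m k) E * (L * (n : ℝ≥0∞) ^ t) := by gcongr
    _ = L * stdG (GI n m k) E * (n : ℝ≥0∞) ^ t := by ring
    _ ≤ C / (n : ℝ≥0∞) ^ t * (n : ℝ≥0∞) ^ t := by gcongr
    _ = C := ENNReal.div_mul_cancel (pow_ne_zero _ hnz) (ENNReal.pow_ne_top hnt)

lemma norm_resG_sub_le (h0 : 0 < kappa τm τk) (h1 : kappa τm τk < 1) {n m k : ℕ} {z w : ℂ}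
    (hz : z.im ≠ 0) (hw : w.im ≠ 0) (x : GI n m k → ℝ) :
    ‖resG τm τk z x - resG τm τk w x‖ ≤ ‖z - w‖ * (‖resG τm τk z x‖ * ‖resG τm τk w x‖) := by
  have h : resG τm τk z x - resG τm τk w x =
      (z - w) • (resG τm τk z x * projI * resG τm τk w x) :=
    resolvent_sub _ _ _ (isUnit_lin _ _ z h0 h1 hz) (isUnit_lin _ _ w h0 h1 hw)
  rw [h, norm_smul]
  gcongr
  refine (norm_mul_le _ _).trans ?_
  gcongr
  refine (norm_mul_le _ _).trans ?_
  exact mul_le_of_le_one_right (norm_nonneg _) norm_projI_le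

lemma norm_expG_sub_expG_le (h0 : 0 < kappa τm τk) (h1 : kappa τm τk < 1) (c : ℕ) {η : ℝ} (hη : 0 < η) :
    ∃ C : ℝ, 0 < C ∧ ∀ n m k : ℕ, Reg c n m k → ∀ z w : ℂ, η ≤ |z.im| → η ≤ |w.im| →
      ‖expG τm τk n m k z - expG τm τk n m k w‖ ≤ C * ‖z - w‖ := by
  obtain ⟨C, hC, h⟩ := integral_resG_pow h0 h1 c hη 2
  refine ⟨C, hC, fun n m k hr z w hz hw => ?_⟩
  have hz0 := im_ne_zero_of_le hη hz
  have hw0 := im_ne_zero_of_le hη hw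
  obtain ⟨i1, b1⟩ := h n m k hr z hz
  obtain ⟨i2, b2⟩ := h n m k hr w hw
  have hi : ∀ {v : ℂ}, v.im ≠ 0 → Integrable (resG τm τk v) (stdG (GI n m k)) := fun hv => by
    rw [← integrable_norm_iff (continuous_resG h0 h1 hv).aestronglyMeasurable]
    simpa using integrable_resG h0 h1 hr hv 1
  rw [expG, expG, ← integral_sub (hi hz0) (hi hw0)]
  refine (norm_integral_le_of_norm_le (g := fun x => ‖z - w‖ *
    ((‖resG τm τk z x‖ ^ 2 + ‖resG τm τk w x‖ ^ 2) / 2)) (((i1.add i2).div_const 2).const_mul _)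
    (ae_of_all _ fun x => ?_)).trans ?_
  · refine (norm_resG_sub_le h0 h1 hz0 hw0 x).trans ?_
    gcongr
    have := sq_nonneg (‖resG τm τk z x‖ - ‖resG τm τk w x‖)
    linarith [sub_sq ‖resG τm τk z x‖ ‖resG τm τk w x‖]
  · rw [integral_const_mul, integral_div, integral_add i1 i2, mul_comm]
    gcongr
    linarith

/-- The point of the grid of mesh `1 / n` assigned to `z`. -/
def gridPt (n : ℕ) (p : ℤ × ℤ) : ℂ := ⟨p.1 / n, p.2 / n⟩

/-- Coordinates are rounded up, so that the grid point keeps an imaginary part at least that of z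
and the resolvent bounds remain valid there. -/
lemma exists_gridPt {n R : ℕ} (hn : 0 < n) {z : ℂ} (hz : ‖z‖ ≤ R) : ∃ p ∈
    Finset.Icc (-((R + 1 : ℕ) * n : ℤ)) ((R + 1 : ℕ) * n) ×ˢ
      Finset.Icc (-((R + 1 : ℕ) * n : ℤ)) ((R + 1 : ℕ) * n),
    z.im ≤ (gridPt n p).im ∧ ‖z - gridPt n p‖ ≤ 2 / n := by
  have hn0 : (0 : ℝ) < n := by exact_mod_cast hn
  have hn1 : (1 : ℝ) ≤ n := by exact_mod_cast hn
  have hre := abs_le.1 ((Complex.abs_re_le_norm z).trans hz)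
  have him := abs_le.1 ((Complex.abs_im_le_norm z).trans hz)
  have u1 := Int.le_ceil (z.re * n)
  have u2 := Int.ceil_lt_add_one (z.re * n)
  have v1 := Int.le_ceil (z.im * n)
  have v2 := Int.ceil_lt_add_one (z.im * n)
  have bd : ∀ {x : ℝ}, -(R : ℝ) ≤ x → x ≤ R → ⌈x * n⌉ ∈
      Finset.Icc (-((R + 1 : ℕ) * n : ℤ)) ((R + 1 : ℕ) * n) := by
    intro x h1 h2
    have a1 : -(R : ℝ) * n ≤ x * n := by gcongr
    have a2 : x * n ≤ R * n := by gcongr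
    have c1 := Int.le_ceil (x * n)
    have c2 := Int.ceil_lt_add_one (x * n)
    rw [Finset.mem_Icc]
    constructor
    · have : (-((R + 1 : ℕ) * n : ℤ) : ℝ) ≤ ⌈x * n⌉ := by push_cast; linarith
      exact_mod_cast this
    · have : (⌈x * n⌉ : ℝ) ≤ ((R + 1 : ℕ) * n : ℤ) := by push_cast; linarith
      exact_mod_cast this
  refine ⟨(⌈z.re * n⌉, ⌈z.im * n⌉), Finset.mem_product.2 ⟨bd hre.1 hre.2, bd him.1 him.2⟩, ?_, ?_⟩
  · simp only [gridPt]
    rw [le_div_iff₀ hn0]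
    exact v1
  · refine (Complex.norm_le_abs_re_add_abs_im _).trans ?_
    have e : ∀ {x : ℝ}, |x - (⌈x * n⌉ : ℝ) / n| ≤ 1 / n := by
      intro x
      have c1 := Int.le_ceil (x * n)
      have c2 := Int.ceil_lt_add_one (x * n)
      have : x - (⌈x * n⌉ : ℝ) / n = (x * n - ⌈x * n⌉) / n := by field_simp
      rw [this, abs_div, abs_of_pos hn0]
      gcongr
      rw [abs_le]
      constructor <;> linarith
    simp only [gridPt, Complex.sub_re, Complex.sub_im]
    calc _ ≤ (1 : ℝ) / n + 1 / n := add_le_add e e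
      _ = _ := by ring

lemma card_grid_le {n R : ℕ} (hn : 0 < n) : ((Finset.Icc (-((R + 1 : ℕ) * n : ℤ)) ((R + 1 : ℕ) * n) ×ˢ
      Finset.Icc (-((R + 1 : ℕ) * n : ℤ)) ((R + 1 : ℕ) * n)).card : ℕ) ≤ (3 * (R + 1)) ^ 2 * n ^ 2 := by
  rw [Finset.card_product, Int.card_Icc]
  have : ((((R + 1 : ℕ) * n : ℤ) + 1 - -((R + 1 : ℕ) * n : ℤ)).toNat) ≤ 3 * (R + 1) * n := by
    rw [Int.toNat_le]
    push_cast
    have : (1 : ℤ) ≤ (R + 1) * n := by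
      have : 1 ≤ (R + 1) * n := Nat.mul_pos (by omega) hn
      exact_mod_cast this
    linarith
  calc _ ≤ (3 * (R + 1) * n) * (3 * (R + 1) * n) := Nat.mul_le_mul this this
    _ = _ := by ring

lemma inv_le_rpow {n : ℕ} (hn : 0 < n) {ε : ℝ} (hε : 0 < ε) :
    (1 : ℝ) / n ≤ (√n)⁻¹ ∧ (√(n : ℝ))⁻¹ ≤ (n : ℝ) ^ (-(1 / 2) + ε : ℝ) := by
  have hn0 : (0 : ℝ) < n := by exact_mod_cast hn
  have hn1 : (1 : ℝ) ≤ n := by exact_mod_cast hn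
  constructor
  · rw [one_div, inv_le_inv₀ hn0 (Real.sqrt_pos.2 hn0)]
    exact Real.sqrt_le_iff.2 ⟨hn0.le, by nlinarith⟩
  · rw [Real.sqrt_eq_rpow, ← Real.rpow_neg hn0.le]
    exact Real.rpow_le_rpow_of_exponent_le hn1 (by linarith)

set_option maxHeartbeats 800000 in
/-- Concentration of the resolvent uniformly on compact parts of the upper half-plane. -/
lemma stdG_sup_tail (h0 : 0 < kappa τm τk) (h1 : kappa τm τk < 1) (c : ℕ) {η ε : ℝ} (hη : 0 < η)
    (hε : 0 < ε) : ∃ K : ℝ, 0 < K ∧ ∀ s : ℕ, ∃ C : ℝ≥0∞, C ≠ ∞ ∧ ∀ n m k : ℕ, Reg c n m k →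
      ∀ a b : Idx n m k → ℂ, nrm a ≤ 1 → nrm b ≤ 1 →
      stdG (GI n m k) {x | ∃ z ∈ Omega η, K * (n : ℝ) ^ (-(1 / 2) + ε : ℝ) <
        ‖bform a (resG τm τk z x) b - bform a (expG τm τk n m k z) b‖} ≤ C / (n : ℝ≥0∞) ^ s := by
  obtain ⟨Ce, hCe, hexp⟩ := norm_expG_sub_expG_le h0 h1 c hη
  obtain ⟨R, hR⟩ := exists_nat_ge η⁻¹
  set g := cRes (kappa τm τk) * 4 * (1 + η⁻¹) * (1 + 10 * (c + 1)) ^ 2 with hg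
  have hcr := cRes_pos h0
  have hg0 : 0 < g := by positivity
  refine ⟨1 + 2 * g ^ 2 + 2 * Ce, by positivity, fun s => ?_⟩
  -- The grid has O(n²) points; the two extra powers of n pay for the union bound.
  obtain ⟨C₁, hC₁, hpt⟩ := stdG_bform_tail h0 h1 c hη hε (s + 2)
  obtain ⟨C₂, hC₂, hnorm⟩ := negl_norm c s
  refine ⟨C₂ + (((3 * (R + 1)) ^ 2 : ℕ) : ℝ≥0∞) * C₁,
    ENNReal.add_ne_top.2 ⟨hC₂, ENNReal.mul_ne_top (ENNReal.natCast_ne_top _) hC₁⟩,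
    fun n m k hr a b ha hb => ?_⟩
  have hn0 : (0 : ℝ) < n := by exact_mod_cast hr.n_pos
  set l := (n : ℝ) ^ (-(1 / 2) + ε : ℝ) with hl
  set F := Finset.Icc (-((R + 1 : ℕ) * n : ℤ)) ((R + 1 : ℕ) * n) ×ˢ
      Finset.Icc (-((R + 1 : ℕ) * n : ℤ)) ((R + 1 : ℕ) * n) with hF
  set F' := F.filter fun p => η ≤ (gridPt n p).im with hF'
  set E : ℤ × ℤ → Set (GI n m k → ℝ) := fun p => {x | l ≤
    ‖bform a (resG τm τk (gridPt n p) x) b - bform a (expG τm τk n m k (gridPt n p)) b‖} with hE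
  have hsub : {x | ∃ z ∈ Omega η, (1 + 2 * g ^ 2 + 2 * Ce) * l <
      ‖bform a (resG τm τk z x) b - bform a (expG τm τk n m k z) b‖} ⊆
      {x | 5 * ((c : ℝ) + 1) < opU x ∨ 5 * ((c : ℝ) + 1) < opV x} ∪ ⋃ p ∈ F', E p := by
    rintro x ⟨z, hz, hx⟩
    by_contra hcon
    rw [Set.mem_union, not_or, Set.mem_ofPred_eq, not_or] at hcon
    obtain ⟨⟨hu, hv⟩, hE'⟩ := hcon
    push Not at hu hv
    obtain ⟨p, hp, hpz, hpd⟩ := exists_gridPt hr.n_pos (hz.2.le.trans hR)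
    have hηz : η ≤ |z.im| := hz.1.le.trans (le_abs_self _)
    have hηw : η ≤ (gridPt n p).im := hz.1.le.trans hpz
    have hηw' : η ≤ |(gridPt n p).im| := hηw.trans (le_abs_self _)
    have hpE : x ∉ E p := fun h => hE' (Set.mem_biUnion (Finset.mem_filter.2 ⟨hp, hηw⟩) h)
    simp only [hE, Set.mem_ofPred_eq, not_le] at hpE
    have hK : opK x ≤ 1 + 10 * (c + 1) := by unfold opK; linarith
    have hK0 := one_le_opK x
    have hG : ∀ {w : ℂ}, η ≤ |w.im| → ‖resG τm τk w x‖ ≤ g := fun {w} hw => by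
      refine (norm_resG_le h0 h1 hη hw x).trans ?_
      rw [hg]
      have : 0 ≤ opK x := by linarith
      gcongr
    obtain ⟨l1, l2⟩ := inv_le_rpow hr.n_pos hε
    have hnn : ∀ A : Matrix (Idx n m k) (Idx n m k) ℂ, ‖bform a A b‖ ≤ ‖A‖ := fun A => by
      refine (norm_bform_le a A b).trans (mul_le_of_le_one_right (norm_nonneg _) ?_)
      exact mul_le_one₀ ha (nrm_nonneg _) hb
    have d1 : ‖bform a (resG τm τk z x) b - bform a (resG τm τk (gridPt n p) x) b‖ ≤
        2 / n * (g * g) := by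
      rw [← bform_sub]
      refine (hnn _).trans ((norm_resG_sub_le h0 h1 (im_ne_zero_of_le hη hηz)
        (im_ne_zero_of_le hη hηw') x).trans ?_)
      gcongr
      · exact hG hηz
      · exact hG hηw'
    have d2 : ‖bform a (expG τm τk n m k z) b - bform a (expG τm τk n m k (gridPt n p)) b‖ ≤
        Ce * (2 / n) := by
      rw [← bform_sub]
      refine (hnn _).trans ((hexp n m k hr z _ hηz hηw').trans ?_)
      gcongr
    have d3 : ‖bform a (resG τm τk z x) b - bform a (expG τm τk n m k z) b‖ ≤
        ‖bform a (resG τm τk z x) b - bform a (resG τm τk (gridPt n p) x) b‖ +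
        ‖bform a (resG τm τk (gridPt n p) x) b - bform a (expG τm τk n m k (gridPt n p)) b‖ +
        ‖bform a (expG τm τk n m k z) b - bform a (expG τm τk n m k (gridPt n p)) b‖ := by
      rw [norm_sub_rev (bform a (expG τm τk n m k z) b)]
      refine le_trans (le_of_eq ?_) (norm_add₃_le)
      congr 1; ring
    have e1 : 2 / (n : ℝ) * (g * g) ≤ 2 * g ^ 2 * l := by
      calc 2 / (n : ℝ) * (g * g) = 2 * g ^ 2 * (1 / n) := by ring
        _ ≤ _ := by gcongr; exact l1.trans l2
    have e2 : Ce * (2 / (n : ℝ)) ≤ 2 * Ce * l := by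
      calc Ce * (2 / (n : ℝ)) = 2 * Ce * (1 / n) := by ring
        _ ≤ _ := by gcongr; exact l1.trans l2
    linarith
  refine (measure_mono hsub).trans ((measure_union_le _ _).trans ?_)
  have hnz : (n : ℝ≥0∞) ≠ 0 := by exact_mod_cast hr.n_pos.ne'
  have hnt : (n : ℝ≥0∞) ≠ ∞ := ENNReal.natCast_ne_top n
  have hsum : stdG (GI n m k) (⋃ p ∈ F', E p) ≤
      (((3 * (R + 1)) ^ 2 : ℕ) : ℝ≥0∞) * C₁ / (n : ℝ≥0∞) ^ s := by
    calc _ ≤ ∑ p ∈ F', stdG (GI n m k) (E p) := measure_biUnion_finset_le _ _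
      _ ≤ ∑ p ∈ F', C₁ / (n : ℝ≥0∞) ^ (s + 2) := Finset.sum_le_sum fun p hp =>
        hpt n m k hr _ ((Finset.mem_filter.1 hp).2.trans (le_abs_self _)) a b ha hb
      _ = (F'.card : ℝ≥0∞) * (C₁ / (n : ℝ≥0∞) ^ (s + 2)) := by
        rw [Finset.sum_const, nsmul_eq_mul]
      _ ≤ (((3 * (R + 1)) ^ 2 * n ^ 2 : ℕ) : ℝ≥0∞) * (C₁ / (n : ℝ≥0∞) ^ (s + 2)) := by
        gcongr
        exact (Finset.card_filter_le _ _).trans (card_grid_le hr.n_pos)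
      _ = _ := by
        rw [pow_add, div_eq_mul_inv, div_eq_mul_inv, ENNReal.mul_inv (Or.inl (pow_ne_zero _ hnz))
          (Or.inl (ENNReal.pow_ne_top hnt)), Nat.cast_mul, Nat.cast_pow n]
        have : (n : ℝ≥0∞) ^ 2 * ((n : ℝ≥0∞) ^ 2)⁻¹ = 1 :=
          ENNReal.mul_inv_cancel (pow_ne_zero _ hnz) (ENNReal.pow_ne_top hnt)
        calc _ = (((3 * (R + 1)) ^ 2 : ℕ) : ℝ≥0∞) * C₁ * ((n : ℝ≥0∞) ^ s)⁻¹ *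
              ((n : ℝ≥0∞) ^ 2 * ((n : ℝ≥0∞) ^ 2)⁻¹) := by ring
          _ = _ := by rw [this, mul_one]
  rw [ENNReal.add_div]
  exact add_le_add (hnorm n m k hr) hsum

/-- The anisotropic local law, in non-asymptotic form. -/
lemma local_law (hτm : 0 < τm) (hτk : 0 < τk) (h1 : kappa τm τk < 1) (c : ℕ) {η ε : ℝ} (hη : 0 < η)
    (hε : 0 < ε) : ∃ K : ℝ, 0 < K ∧ ∀ s : ℕ, ∃ C : ℝ≥0∞, C ≠ ∞ ∧ ∀ n m k : ℕ, Reg c n m k →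
      ∀ a b : Idx n m k → ℂ, nrm a ≤ 1 → nrm b ≤ 1 →
      stdG (GI n m k) {x | ∃ z ∈ Omega η, ∃ r' s' T', SolvesSystem τm τk z r' s' T' ∧
        K * ((n : ℝ) ^ (-(1 / 2) + ε : ℝ) + |(n : ℝ) / m - τm| + |(n : ℝ) / k - τk|) <
        ‖bform a (resG τm τk z x) b - bform a (detMatrix n m k r' s' T') b‖} ≤ C / (n : ℝ≥0∞) ^ s := by
  have h0 := kappa_pos hτm hτk
  obtain ⟨K₁, hK₁, hsup⟩ := stdG_sup_tail h0 h1 c hη hε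
  obtain ⟨K₂, hK₂, hexp⟩ := norm_expG_sub_le hτm hτk h1 c hη
  refine ⟨K₁ + K₂, by positivity, fun s => ?_⟩
  obtain ⟨C, hC, hb⟩ := hsup s
  refine ⟨C, hC, fun n m k hr a b ha hb' => (measure_mono ?_).trans (hb n m k hr a b ha hb')⟩
  rintro x ⟨z, hz, r', s', T', hS, hx⟩
  refine ⟨z, hz, ?_⟩
  have e1 := hexp n m k hr z hz.1.le hz.2.le r' s' T' hS
  have e2 : ‖bform a (expG τm τk n m k z) b - bform a (detMatrix n m k r' s' T') b‖ ≤
      K₂ * dev τm τk n m k := by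
    rw [← bform_sub]
    refine (norm_bform_le a _ b).trans ((mul_le_of_le_one_right (norm_nonneg _) ?_).trans e1)
    exact mul_le_one₀ ha (nrm_nonneg _) hb'
  obtain ⟨-, l2⟩ := inv_le_rpow hr.n_pos hε
  have e3 : K₂ * dev τm τk n m k ≤
      K₂ * ((n : ℝ) ^ (-(1 / 2) + ε : ℝ) + |(n : ℝ) / m - τm| + |(n : ℝ) / k - τk|) := by
    unfold dev; gcongr
  have e4 : K₁ * (n : ℝ) ^ (-(1 / 2) + ε : ℝ) ≤
      K₁ * ((n : ℝ) ^ (-(1 / 2) + ε : ℝ) + |(n : ℝ) / m - τm| + |(n : ℝ) / k - τk|) := by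
    have : 0 ≤ |(n : ℝ) / m - τm| + |(n : ℝ) / k - τk| := by positivity
    gcongr; linarith
  have e5 : ‖bform a (resG τm τk z x) b - bform a (detMatrix n m k r' s' T') b‖ ≤
      ‖bform a (resG τm τk z x) b - bform a (expG τm τk n m k z) b‖ +
      ‖bform a (expG τm τk n m k z) b - bform a (detMatrix n m k r' s' T') b‖ :=
    norm_sub_le_norm_sub_add_norm_sub _ _ _
  linarith

end LocalLaw

end CCA

end


noncomputable section

namespace CCA

/-! ### Analytic continuation to the slit plane -/

section Continuation

open scoped ComplexConjugate
open Metric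

/-- The bound obtained by interpolating between Cauchy's estimates on two concentric discs. -/
def discBound (C γ a q : ℝ) : ℝ := ∑' j : ℕ, min (γ * a ^ j) (C * q ^ j)

lemma summable_discBound {C γ a q : ℝ} (hC : 0 ≤ C) (hγ : 0 ≤ γ) (ha : 0 ≤ a) (hq : 0 ≤ q)
    (hq1 : q < 1) : Summable fun j : ℕ => min (γ * a ^ j) (C * q ^ j) :=
  Summable.of_nonneg_of_le (fun j => le_min (by positivity) (by positivity))
    (fun _ => min_le_right _ _) ((summable_geometric_of_lt_one hq hq1).mul_left C)

/-- Dominated convergence. The ratio `a` may exceed 1, so only the minimum with the geometric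
sequence of ratio q is summable. -/
lemma tendsto_discBound {ι : Type*} {l : Filter ι} {C a q : ℝ} {γ : ι → ℝ} (hC : 0 ≤ C)
    (hγ0 : ∀ i, 0 ≤ γ i) (ha : 0 ≤ a) (hq : 0 ≤ q) (hq1 : q < 1) (hγ : Tendsto γ l (𝓝 0)) :
    Tendsto (fun i => discBound C (γ i) a q) l (𝓝 0) := by
  have h := tendsto_tsum_of_dominated_convergence (𝓕 := l)
    (f := fun i (j : ℕ) => min (γ i * a ^ j) (C * q ^ j)) (g := fun _ => (0 : ℝ))
    (bound := fun j => C * q ^ j) ((summable_geometric_of_lt_one hq hq1).mul_left C) (fun j => ?_)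
    (Eventually.of_forall fun i j => ?_)
  · simpa [discBound] using h
  · have h1 : Tendsto (fun i => min (γ i * a ^ j) (C * q ^ j)) l (𝓝 (min (0 * a ^ j) (C * q ^ j))) :=
      (hγ.mul_const _).min tendsto_const_nhds
    rwa [zero_mul, min_eq_left (by positivity)] at h1
  · have := hγ0 i
    rw [Real.norm_of_nonneg (le_min (by positivity) (by positivity))]
    exact min_le_right _ _

/-- An analytic function that is bounded on a disc and small on a concentric smaller disc is small
in between. -/
lemma norm_le_discBound {f : ℂ → ℂ} {w z : ℂ} {ρ r R C γ : ℝ} (hρ : 0 < ρ) (hρR : ρ ≤ R) (hr : r < R)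
    (hf : ∀ u ∈ closedBall w R, DifferentiableAt ℂ f u) (hC : ∀ u ∈ closedBall w R, ‖f u‖ ≤ C)
    (hγ : ∀ u ∈ closedBall w ρ, ‖f u‖ ≤ γ) (hz : z ∈ closedBall w r) :
    ‖f z‖ ≤ discBound C γ (r / ρ) (r / R) := by
  have hR : 0 < R := hρ.trans_le hρR
  have hr0 : 0 ≤ r := dist_nonneg.trans hz
  have hC0 : 0 ≤ C := (norm_nonneg _).trans (hC w (mem_closedBall_self hR.le))
  have hγ0 : 0 ≤ γ := (norm_nonneg _).trans (hγ w (mem_closedBall_self hρ.le))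
  have hd : DifferentiableOn ℂ f (ball w R) := fun u hu =>
    (hf u (ball_subset_closedBall hu)).differentiableWithinAt
  have hcl : ∀ {t : ℝ}, 0 < t → t ≤ R → DiffContOnCl ℂ f (ball w t) := fun {t} ht0 ht => by
    refine DifferentiableOn.diffContOnCl fun u hu => ?_
    rw [closure_ball _ ht0.ne'] at hu
    exact (hf u (closedBall_subset_closedBall ht hu)).differentiableWithinAt
  have hzb : z ∈ ball w R := closedBall_subset_ball hr hz
  have hs := Complex.hasSum_taylorSeries_on_ball hd hzb
  -- Cauchy's estimate for the Taylor coefficients at the centre, applied on the small disc with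
  -- bound γ and on the large one with bound C; the better of the two is used for each coefficient.
  have coef : ∀ {t B : ℝ}, 0 < t → t ≤ R → (∀ u ∈ closedBall w t, ‖f u‖ ≤ B) → ∀ j : ℕ,
      ‖((j.factorial : ℂ))⁻¹ • (z - w) ^ j • iteratedDeriv j f w‖ ≤ B * (r / t) ^ j := by
    intro t B ht0 ht hB j
    have h1 := Complex.norm_iteratedDeriv_le_of_forall_mem_sphere_norm_le j ht0 (hcl ht0 ht)
      fun u hu => hB u (sphere_subset_closedBall hu)
    have hB0 : 0 ≤ B := (norm_nonneg _).trans (hB w (mem_closedBall_self ht0.le))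
    rw [norm_smul, norm_smul, norm_inv, norm_pow, Complex.norm_natCast]
    have hzw : ‖z - w‖ ≤ r := by rwa [← dist_eq_norm]
    have hfac : (0 : ℝ) < j.factorial := by exact_mod_cast j.factorial_pos
    calc _ ≤ (j.factorial : ℝ)⁻¹ * (r ^ j * (j.factorial * B / t ^ j)) := by gcongr
      _ = _ := by rw [div_pow]; field_simp
  have hb : ∀ j : ℕ, ‖((j.factorial : ℂ))⁻¹ • (z - w) ^ j • iteratedDeriv j f w‖ ≤
      min (γ * (r / ρ) ^ j) (C * (r / R) ^ j) := fun j =>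
    le_min (coef hρ hρR hγ j) (coef hR le_rfl hC j)
  have hsum := summable_discBound hC0 hγ0 (by positivity : 0 ≤ r / ρ) (by positivity : 0 ≤ r / R)
    ((div_lt_one hR).2 hr)
  rw [← hs.tsum_eq]
  exact tsum_of_norm_bounded hsum.hasSum hb

/-- The radius of the discs used to reach the real line. -/
def bigR (g : ℝ) : ℝ := √(1 + g ^ 2 / 8)

lemma one_lt_bigR {g : ℝ} (hg : 0 < g) : 1 < bigR g := by
  rw [bigR, Real.lt_sqrt zero_le_one]
  have : 0 < g ^ 2 := by positivity
  linarith

/-- The distance of the discs from the half-line. -/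
def gapOf (g : ℝ) : ℝ := min (g ^ 2 / 16) (g / 2)

lemma gapOf_pos {g : ℝ} (hg : 0 < g) : 0 < gapOf g := lt_min (by positivity) (by positivity)

/-- If |Im z| < g²/16, then (Im z - 1)² > 1 - g²/8, so the squared radius 1 + g²/8 leaves at most
g²/4 for (Re z - x)². The disc thus meets the real line only within g/2 of x. -/
lemma mem_disc_region {l g x : ℝ} (hg : 0 < g) (hx : l + g ≤ x) {z : ℂ}
    (hz : z ∈ closedBall (⟨x, 1⟩ : ℂ) (bigR g)) :
    gapOf g ≤ |z.im| ∨ l + gapOf g ≤ z.re := by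
  by_contra hcon
  push Not at hcon
  obtain ⟨h1, h2⟩ := hcon
  have e1 : gapOf g ≤ g ^ 2 / 16 := min_le_left _ _
  have e2 : gapOf g ≤ g / 2 := min_le_right _ _
  have h3 : dist z ⟨x, 1⟩ ^ 2 ≤ 1 + g ^ 2 / 8 := by
    have := pow_le_pow_left₀ dist_nonneg (mem_closedBall.1 hz) 2
    rwa [bigR, Real.sq_sqrt (by positivity)] at this
  rw [dist_eq_norm, ← Complex.normSq_eq_norm_sq, Complex.normSq_apply] at h3
  simp only [Complex.sub_re, Complex.sub_im] at h3
  have h4 : (g / 2) ^ 2 < (z.re - x) * (z.re - x) := by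
    have : g / 2 < x - z.re := by linarith
    nlinarith
  have h5 : 1 - 2 * (g ^ 2 / 16) < (z.im - 1) * (z.im - 1) := by
    have := (abs_lt.1 h1).2
    have := sq_nonneg z.im
    linarith [sub_sq z.im 1]
  linarith

/-- On the disc of radius 1/2 about x + i the law in the upper half-plane applies, with one
parameter for all |x| ≤ X. -/
lemma small_disc_subset {x X : ℝ} (hx : |x| ≤ X) {z : ℂ} (hz : z ∈ closedBall (⟨x, 1⟩ : ℂ) (1 / 2)) :
    z ∈ Omega (X + 3)⁻¹ := by
  have hX : 0 ≤ X := (abs_nonneg _).trans hx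
  have h1 : ‖z - ⟨x, 1⟩‖ ≤ 1 / 2 := by rwa [← dist_eq_norm]
  have h2 := abs_le.1 ((Complex.abs_im_le_norm _).trans h1)
  simp only [Complex.sub_im] at h2
  constructor
  · have : (X + 3)⁻¹ ≤ (3 : ℝ)⁻¹ := inv_anti₀ (by norm_num) (by linarith)
    linarith [h2.1]
  · rw [inv_inv]
    have h3 : ‖(⟨x, 1⟩ : ℂ)‖ ≤ X + 1 := by
      refine (Complex.norm_le_abs_re_add_abs_im _).trans ?_
      simpa using hx
    have h4 : ‖z‖ ≤ ‖z - ⟨x, 1⟩‖ + ‖(⟨x, 1⟩ : ℂ)‖ := by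
      simpa using norm_add_le (z - ⟨x, 1⟩) (⟨x, 1⟩ : ℂ)
    linarith

lemma isOpen_Omega (η : ℝ) : IsOpen (Omega η) :=
  (isOpen_lt continuous_const Complex.continuous_im).inter
    (isOpen_lt continuous_norm continuous_const)

lemma exists_mem_Omega {z : ℂ} (hz : 0 < z.im) : ∃ η, 0 < η ∧ z ∈ Omega η := by
  refine ⟨min (z.im / 2) (‖z‖ + 1)⁻¹, lt_min (by positivity) (by positivity), ?_, ?_⟩
  · exact (min_le_left _ _).trans_lt (by linarith)
  · have h : ‖z‖ + 1 ≤ (min (z.im / 2) (‖z‖ + 1)⁻¹)⁻¹ := by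
      rw [le_inv_comm₀ (by positivity) (lt_min (by positivity) (by positivity))]
      exact min_le_right _ _
    linarith

/-- Analytic continuation from the upper half-plane to a slit plane by means of approximants. -/
lemma exists_continuation {l : ℝ} {F : ℕ → ℂ → ℂ} {f : ℂ → ℂ}
    (hF : ∀ η > 0, ∀ ε > 0, ∀ᶠ j in atTop, ∀ z ∈ Omega η, ‖F j z - f z‖ ≤ ε)
    (hb : ∀ d > 0, ∃ C, ∀ᶠ j in atTop, ∀ z : ℂ, d ≤ |z.im| ∨ l + d ≤ z.re →
      DifferentiableAt ℂ (F j) z ∧ ‖F j z‖ ≤ C)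
    (hconj : ∀ j, ∀ z : ℂ, F j (conj z) = conj (F j z)) :
    ∃ G : ℂ → ℂ, AnalyticOnNhd ℂ G {z | ¬(z.im = 0 ∧ z.re ≤ l)} ∧ ∀ z, 0 < z.im → G z = f z := by
  have hcO : ∀ η > 0, UniformCauchySeqOn F atTop (Omega η) := fun η hη => by
    rw [Metric.uniformCauchySeqOn_iff]
    intro ε hε
    obtain ⟨N, hN⟩ := eventually_atTop.1 (hF η hη (ε / 3) (by positivity))
    refine ⟨N, fun i hi j hj z hz => ?_⟩
    have h1 := hN i hi z hz
    have h2 := hN j hj z hz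
    rw [← dist_eq_norm] at h1 h2
    linarith [dist_triangle_right (F i z) (F j z) (f z)]
  have key : ∀ z ∈ {z : ℂ | ¬(z.im = 0 ∧ z.re ≤ l)}, ∃ N : Set ℂ, IsOpen N ∧ z ∈ N ∧
      UniformCauchySeqOn F atTop N ∧ ∀ᶠ j in atTop, DifferentiableOn ℂ (F j) N := by
    intro z hz
    -- Local uniform Cauchy estimates: by reflection below the real axis, by the two-disc estimate
    -- on it, and by hypothesis above it.
    rcases lt_trichotomy z.im 0 with him | him | him
    · obtain ⟨η, hη, hzη⟩ := exists_mem_Omega (z := conj z) (by simpa using him)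
      refine ⟨conj ⁻¹' Omega η, (isOpen_Omega η).preimage Complex.continuous_conj, hzη, ?_, ?_⟩
      · have h := hcO η hη
        rw [Metric.uniformCauchySeqOn_iff] at h ⊢
        intro ε hε
        obtain ⟨N, hN⟩ := h ε hε
        refine ⟨N, fun i hi j hj w hw => ?_⟩
        have := hN i hi j hj _ hw
        rwa [hconj, hconj, Complex.dist_conj_conj] at this
      · obtain ⟨C, hC⟩ := hb η hη
        filter_upwards [hC] with j hj w hw
        refine (hj w (Or.inl ?_)).1.differentiableWithinAt
        have : η < (conj w).im := hw.1
        rw [Complex.conj_im] at this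
        rw [← abs_neg]
        exact this.le.trans (le_abs_self _)
    · have hre : l < z.re := by
        by_contra h
        exact hz ⟨him, not_lt.1 h⟩
      set g := z.re - l with hg
      have hg0 : 0 < g := by rw [hg]; linarith
      have hR := one_lt_bigR hg0
      set r := (1 + bigR g) / 2 with hr
      have hrR : r < bigR g := by rw [hr]; linarith
      have hr1 : 1 < r := by rw [hr]; linarith
      have hreg : ∀ w ∈ closedBall (⟨z.re, 1⟩ : ℂ) (bigR g), gapOf g ≤ |w.im| ∨ l + gapOf g ≤ w.re :=
        fun w hw => mem_disc_region hg0 (by rw [hg]; linarith) hw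
      obtain ⟨C, hC⟩ := hb _ (gapOf_pos hg0)
      refine ⟨ball ⟨z.re, 1⟩ r, isOpen_ball, ?_, ?_, ?_⟩
      · have : z - ⟨z.re, 1⟩ = -Complex.I := by
          apply Complex.ext <;> simp [him]
        rw [mem_ball, dist_eq_norm, this, norm_neg, Complex.norm_I]
        exact hr1
      -- Differences of approximants are bounded by 2C on the large disc and eventually small on the
      -- disc of radius 1/2, hence small on the intermediate disc containing z.
      · rw [Metric.uniformCauchySeqOn_iff]
        intro ε hε
        obtain ⟨N₀, hN₀⟩ := eventually_atTop.1 hC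
        have hC0 : 0 ≤ C := (norm_nonneg _).trans (hN₀ N₀ le_rfl _
          (hreg _ (mem_closedBall_self (by linarith)))).2
        have hlim : Tendsto (fun γ : ℝ => discBound (2 * C) |γ| (r / (1 / 2)) (r / bigR g)) (𝓝 0) (𝓝 0) :=
          tendsto_discBound (by positivity) (fun γ => abs_nonneg γ) (by positivity)
            (by positivity) ((div_lt_one (by linarith)).2 hrR) (by simpa using (continuous_abs.tendsto (0 : ℝ)))
        obtain ⟨δ, hδ, hδb⟩ := Metric.eventually_nhds_iff.1 (hlim.eventually_lt_const hε)
        have hδ2 := hδb (y := δ / 2) (by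
          rw [Real.dist_eq, sub_zero, abs_of_pos (by positivity)]; linarith)
        rw [abs_of_pos (by positivity)] at hδ2
        have hc := hcO (|z.re| + 3)⁻¹ (by positivity)
        rw [Metric.uniformCauchySeqOn_iff] at hc
        obtain ⟨N₁, hN₁⟩ := hc (δ / 2) (by positivity)
        refine ⟨max N₀ N₁, fun i hi j hj w hw => ?_⟩
        have hi0 := hN₀ i ((le_max_left _ _).trans hi)
        have hj0 := hN₀ j ((le_max_left _ _).trans hj)
        rw [dist_eq_norm]
        refine lt_of_le_of_lt ?_ hδ2
        refine norm_le_discBound (f := fun u => F i u - F j u) (w := ⟨z.re, 1⟩) (by norm_num)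
          (by linarith) hrR (fun u hu => ?_) (fun u hu => ?_) (fun u hu => ?_)
          (ball_subset_closedBall hw)
        · exact (hi0 u (hreg u hu)).1.sub (hj0 u (hreg u hu)).1
        · refine (norm_sub_le _ _).trans ?_
          linarith [(hi0 u (hreg u hu)).2, (hj0 u (hreg u hu)).2]
        · rw [← dist_eq_norm]
          exact (hN₁ i ((le_max_right _ _).trans hi) j ((le_max_right _ _).trans hj) u
            (small_disc_subset le_rfl hu)).le
      · filter_upwards [hC] with j hj w hw
        exact (hj w (hreg w (ball_subset_closedBall (ball_subset_ball hrR.le hw)))).1.differentiableWithinAt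
    · obtain ⟨η, hη, hzη⟩ := exists_mem_Omega him
      refine ⟨Omega η, isOpen_Omega η, hzη, hcO η hη, ?_⟩
      obtain ⟨C, hC⟩ := hb η hη
      filter_upwards [hC] with j hj w hw
      exact (hj w (Or.inl (hw.1.le.trans (le_abs_self _)))).1.differentiableWithinAt
  have hlim : ∀ z ∈ {z : ℂ | ¬(z.im = 0 ∧ z.re ≤ l)},
      Tendsto (fun j => F j z) atTop (𝓝 (limUnder atTop fun j => F j z)) := fun z hz => by
    obtain ⟨N, -, hzN, hN, -⟩ := key z hz
    exact (hN.cauchySeq hzN).tendsto_limUnder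
  refine ⟨fun z => limUnder atTop fun j => F j z, fun z hz => ?_, fun z hz => ?_⟩
  · obtain ⟨N, hNo, hzN, hN, hd⟩ := key z hz
    have hopen : IsOpen {z : ℂ | ¬(z.im = 0 ∧ z.re ≤ l)} := by
      have : IsClosed {z : ℂ | z.im = 0 ∧ z.re ≤ l} :=
        (isClosed_eq Complex.continuous_im continuous_const).inter
          (isClosed_le Complex.continuous_re continuous_const)
      exact this.isOpen_compl
    set D := N ∩ {z : ℂ | ¬(z.im = 0 ∧ z.re ≤ l)} with hD
    have hu : TendstoUniformlyOn F (fun z => limUnder atTop fun j => F j z) atTop D :=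
      (hN.mono Set.inter_subset_left).tendstoUniformlyOn_of_tendsto fun w hw => hlim w hw.2
    have hdiff := hu.tendstoLocallyUniformlyOn.differentiableOn
      (hd.mono fun j hj => hj.mono Set.inter_subset_left) (hNo.inter hopen)
    exact hdiff.analyticAt ((hNo.inter hopen).mem_nhds ⟨hzN, hz⟩)
  · have hz' : z ∈ {z : ℂ | ¬(z.im = 0 ∧ z.re ≤ l)} := fun h => hz.ne' h.1
    refine tendsto_nhds_unique (hlim z hz') ?_
    obtain ⟨η, hη, hzη⟩ := exists_mem_Omega hz
    rw [Metric.tendsto_atTop]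
    intro ε hε
    obtain ⟨N, hN⟩ := eventually_atTop.1 (hF η hη (ε / 2) (by positivity))
    exact ⟨N, fun j hj => by rw [dist_eq_norm]; linarith [hN j hj z hzη]⟩

end Continuation

end CCA

end


noncomputable section

namespace CCA

/-! ### Good realizations and the extension of the solution -/

section GoodEvent

open scoped Matrix.Norms.L2Operator ComplexConjugate
open Matrix

variable {τm τk : ℝ}

lemma mulVec_map_ofReal {p q : ℕ} (A : Matrix (Fin p) (Fin q) ℝ) (a : Fin q → ℂ) (i : Fin p) :
    (A.map Complex.ofReal *ᵥ a) i = ⟨(A *ᵥ fun j => (a j).re) i, (A *ᵥ fun j => (a j).im) i⟩ := by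
  apply Complex.ext <;> simp [mulVec, dotProduct, Complex.re_sum, Complex.im_sum]

lemma sq_nrm_eq_l2 {ι : Type*} [Fintype ι] (a : ι → ℂ) :
    nrm a ^ 2 = l2 (fun i => (a i).re) ^ 2 + l2 (fun i => (a i).im) ^ 2 := by
  rw [sq_nrm, sq_l2, sq_l2, ← Finset.sum_add_distrib]
  exact Finset.sum_congr rfl fun i _ => by rw [← Complex.normSq_eq_norm_sq, Complex.normSq_apply]; ring

/-- The quadratic form on complex vectors is controlled by its values on real vectors. -/
lemma quadForm_le {n m k : ℕ} {U : Matrix (Fin n) (Fin m) ℝ} {V : Matrix (Fin n) (Fin k) ℝ} {κ l : ℝ}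
    (h : ∀ u v, -κ * l2 (U.mulVec u) ^ 2 - κ * l2 (V.mulVec v) ^ 2 +
      2 * ∑ i, U.mulVec u i * V.mulVec v i ≤ l * (l2 u ^ 2 + l2 v ^ 2)) (a : Fin m → ℂ) (b : Fin k → ℂ) :
    quadForm U V κ a b ≤ l * (nrm a ^ 2 + nrm b ^ 2) := by
  have h1 := h (fun i => (a i).re) (fun i => (b i).re)
  have h2 := h (fun i => (a i).im) (fun i => (b i).im)
  have e : (star (U.map Complex.ofReal *ᵥ a) ⬝ᵥ (V.map Complex.ofReal *ᵥ b)).re =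
      ∑ i, (U *ᵥ fun j => (a j).re) i * (V *ᵥ fun j => (b j).re) i +
      ∑ i, (U *ᵥ fun j => (a j).im) i * (V *ᵥ fun j => (b j).im) i := by
    rw [dotProduct, Complex.re_sum, ← Finset.sum_add_distrib]
    refine Finset.sum_congr rfl fun i _ => ?_
    rw [Pi.star_apply, mulVec_map_ofReal, mulVec_map_ofReal]
    simp
  have eU : nrm (U.map Complex.ofReal *ᵥ a) ^ 2 =
      l2 (U *ᵥ fun j => (a j).re) ^ 2 + l2 (U *ᵥ fun j => (a j).im) ^ 2 := by
    rw [sq_nrm_eq_l2]; simp only [mulVec_map_ofReal]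
  have eV : nrm (V.map Complex.ofReal *ᵥ b) ^ 2 =
      l2 (V *ᵥ fun j => (b j).re) ^ 2 + l2 (V *ᵥ fun j => (b j).im) ^ 2 := by
    rw [sq_nrm_eq_l2]; simp only [mulVec_map_ofReal]
  rw [quadForm, e, eU, eV, sq_nrm_eq_l2 a, sq_nrm_eq_l2 b]
  linarith

/-- The realizations for which norms, edge and resolvent entries are under control. -/
structure Good (τm τk : ℝ) (c : ℕ) (η δ K : ℝ) {n m k : ℕ} (x : GI n m k → ℝ) : Prop where
  opU_le : opU x ≤ 5 * (c + 1)
  opV_le : opV x ≤ 5 * (c + 1)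
  edge : ∀ u v, -kappa τm τk * l2 ((matU x).mulVec u) ^ 2 - kappa τm τk * l2 ((matV x).mulVec v) ^ 2 +
    2 * ∑ i, (matU x).mulVec u i * (matV x).mulVec v i ≤
      lambdaStar τm τk * (1 + 18 * δ) * (l2 u ^ 2 + l2 v ^ 2)
  law : ∀ i j, ∀ z ∈ Omega η, ∀ r s T, SolvesSystem τm τk z r s T →
    ‖resG τm τk z x i j - detMatrix n m k r s T i j‖ ≤
      K * ((n : ℝ) ^ (-(1 / 2) + 1 / 4 : ℝ) + |(n : ℝ) / m - τm| + |(n : ℝ) / k - τk|)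

lemma card_idx_le {c n m k : ℕ} (hr : Reg c n m k) : Fintype.card (Idx n m k) ≤ (2 * c + 2) * n := by
  have h1 := hr.m_le
  have h2 := hr.k_le
  simp only [Idx, Fintype.card_sum, Fintype.card_fin]
  linarith

/-- There are O(n²) pairs of indices, and the single bounds decay faster than any power of n. -/
lemma negl_iUnion_idx {c : ℕ} {E : ∀ n m k : ℕ, Idx n m k → Idx n m k → Set (GI n m k → ℝ)}
    (h : ∀ s : ℕ, ∃ C : ℝ≥0∞, C ≠ ∞ ∧ ∀ n m k : ℕ, Reg c n m k → ∀ i j,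
      stdG (GI n m k) (E n m k i j) ≤ C / (n : ℝ≥0∞) ^ s) :
    Negl c fun n m k => ⋃ i, ⋃ j, E n m k i j := by
  intro s
  obtain ⟨C, hC, hb⟩ := h (s + 2)
  refine ⟨(((2 * c + 2) ^ 2 : ℕ) : ℝ≥0∞) * C, ENNReal.mul_ne_top (ENNReal.natCast_ne_top _) hC,
    fun n m k hr => ?_⟩
  have hnz : (n : ℝ≥0∞) ≠ 0 := by exact_mod_cast hr.n_pos.ne'
  have hnt : (n : ℝ≥0∞) ≠ ∞ := ENNReal.natCast_ne_top n
  calc _ ≤ ∑ i, ∑ j, stdG (GI n m k) (E n m k i j) :=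
        (measure_iUnion_fintype_le _ _).trans
          (Finset.sum_le_sum fun i _ => measure_iUnion_fintype_le _ _)
    _ ≤ ∑ i : Idx n m k, ∑ j : Idx n m k, C / (n : ℝ≥0∞) ^ (s + 2) :=
        Finset.sum_le_sum fun i _ => Finset.sum_le_sum fun j _ => hb n m k hr i j
    _ = ((Fintype.card (Idx n m k) ^ 2 : ℕ) : ℝ≥0∞) * (C / (n : ℝ≥0∞) ^ (s + 2)) := by
        simp only [Finset.sum_const, Finset.card_univ, nsmul_eq_mul]
        push_cast
        ring
    _ ≤ ((((2 * c + 2) * n) ^ 2 : ℕ) : ℝ≥0∞) * (C / (n : ℝ≥0∞) ^ (s + 2)) := by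
        gcongr
        exact card_idx_le hr
    _ = _ := by
        rw [pow_add, div_eq_mul_inv, div_eq_mul_inv, ENNReal.mul_inv (Or.inl (pow_ne_zero _ hnz))
          (Or.inl (ENNReal.pow_ne_top hnt)), mul_pow, Nat.cast_mul, Nat.cast_pow n]
        have : (n : ℝ≥0∞) ^ 2 * ((n : ℝ≥0∞) ^ 2)⁻¹ = 1 :=
          ENNReal.mul_inv_cancel (pow_ne_zero _ hnz) (ENNReal.pow_ne_top hnt)
        calc _ = (((2 * c + 2) ^ 2 : ℕ) : ℝ≥0∞) * C * ((n : ℝ≥0∞) ^ s)⁻¹ *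
              ((n : ℝ≥0∞) ^ 2 * ((n : ℝ≥0∞) ^ 2)⁻¹) := by ring
          _ = _ := by rw [this, mul_one]

lemma negl_not_good (hτm : 0 < τm) (hτk : 0 < τk) (h1 : kappa τm τk < 1) (c : ℕ) {η : ℝ} (hη : 0 < η) :
    ∃ K : ℝ, 0 < K ∧ ∀ δ : ℝ, 0 < δ → δ ≤ 1 →
      Negl c fun n m k => {x : GI n m k → ℝ | ¬ Good τm τk c η δ K x} := by
  have h0 := kappa_pos hτm hτk
  -- Any exponent below 1/2 would do here: for the traces and the continuation, only convergence to
  -- 0 of the error matters.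
  obtain ⟨K, hK, hlaw⟩ := local_law hτm hτk h1 c hη (show (0 : ℝ) < 1 / 4 by norm_num)
  refine ⟨K, hK, fun δ hδ hδ1 => ?_⟩
  have hL := negl_iUnion_idx (c := c) (E := fun n m k i j => {x : GI n m k → ℝ | ∃ z ∈ Omega η,
    ∃ r' s' T', SolvesSystem τm τk z r' s' T' ∧
      K * ((n : ℝ) ^ (-(1 / 2) + 1 / 4 : ℝ) + |(n : ℝ) / m - τm| + |(n : ℝ) / k - τk|) <
      ‖bform (Pi.single i 1) (resG τm τk z x) (Pi.single j 1) -
        bform (Pi.single i 1) (detMatrix n m k r' s' T') (Pi.single j 1)‖}) (fun s => by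
    obtain ⟨C, hC, hb⟩ := hlaw s
    exact ⟨C, hC, fun n m k hr i j => hb n m k hr _ _ (nrm_single i).le (nrm_single j).le⟩)
  refine (((negl_norm c).union (negl_edge c h0 h1 hδ hδ1)).union hL).mono fun n m k hr x hx => ?_
  by_contra hcon
  simp only [Set.mem_union, Set.mem_ofPred_eq, Set.mem_iUnion, not_or, not_exists, not_and, not_lt,
    bform_single] at hcon
  obtain ⟨⟨⟨hu, hv⟩, he⟩, hl⟩ := hcon
  exact hx ⟨hu, hv, he, fun i j z hz r s T hS => hl i j z hz r s T hS⟩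

/-- The bound for the resolvent at a given distance from the half-line. -/
def resBound (τm τk : ℝ) (c : ℕ) (d : ℝ) : ℝ :=
  cRes (kappa τm τk) * 4 * (5 * (c + 1)) ^ 2 * (1 + (d / 2)⁻¹)

/-- To the right of the edge, Re z exceeds the quadratic form on unit vectors by at least d/2, the
other half of d being spent on the factor 1 + 18δ; this replaces the imaginary part in
`resolvent_bound`. -/
lemma Good.isUnit_and_norm_le {c n m k : ℕ} {η δ K d : ℝ} {x : GI n m k → ℝ}
    (h : Good τm τk c η δ K x) (h0 : 0 < kappa τm τk) (h1 : kappa τm τk < 1) (hd : 0 < d)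
    (hδ : lambdaStar τm τk * (18 * δ) ≤ d / 2) {z : ℂ} (hz : d ≤ |z.im| ∨ lambdaStar τm τk + d ≤ z.re) :
    IsUnit (lin τm τk (matU x) (matV x) z) ∧ ‖resG τm τk z x‖ ≤ resBound τm τk c d := by
  have hK : (1 : ℝ) ≤ 5 * (c + 1) := by
    have : (0 : ℝ) ≤ c := Nat.cast_nonneg c
    linarith
  refine resolvent_bound (matU x) (matV x) z h0 h1 hK (half_pos hd) h.opU_le h.opV_le fun a b => ?_
  rcases hz with hz | hz
  · exact im_gap _ _ _ (by linarith)
  · refine le_trans ?_ (Complex.abs_re_le_norm _)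
    rw [Complex.sub_re, Complex.ofReal_re, Complex.re_mul_ofReal, abs_sub_comm]
    refine le_trans ?_ (le_abs_self _)
    have hq := quadForm_le h.edge a b
    set N := nrm a ^ 2 + nrm b ^ 2 with hN
    have hN0 : 0 ≤ N := by positivity
    have : (lambdaStar τm τk + d) * N ≤ z.re * N := by gcongr
    have : lambdaStar τm τk * (18 * δ) * N ≤ d / 2 * N := by gcongr
    linarith

lemma lambdaStar_pos (h0 : 0 < kappa τm τk) (h1 : kappa τm τk < 1) : 0 < lambdaStar τm τk := by
  have : kappa τm τk ^ 2 < 1 := pow_lt_one₀ h0.le h1 two_ne_zero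
  exact div_pos (by linarith) h0

lemma tendsto_rate {m k : ℕ → ℕ}
    (hm : Tendsto (fun n : ℕ => (n : ℝ) / (m n : ℝ)) atTop (𝓝 τm))
    (hk : Tendsto (fun n : ℕ => (n : ℝ) / (k n : ℝ)) atTop (𝓝 τk)) (K : ℝ) :
    Tendsto (fun n : ℕ => K * ((n : ℝ) ^ (-(1 / 2) + 1 / 4 : ℝ) + |(n : ℝ) / m n - τm| +
      |(n : ℝ) / k n - τk|)) atTop (𝓝 0) := by
  have h1 : Tendsto (fun n : ℕ => (n : ℝ) ^ (-(1 / 2) + 1 / 4 : ℝ)) atTop (𝓝 0) := by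
    have := (tendsto_rpow_neg_atTop (show (0 : ℝ) < 1 / 4 by norm_num)).comp
      (tendsto_natCast_atTop_atTop (R := ℝ))
    refine this.congr fun n => ?_
    norm_num
  have h2 := (hm.sub_const τm).abs
  have h3 := (hk.sub_const τk).abs
  simpa using ((h1.add h2).add h3).const_mul K

lemma exists_good (hτm : 0 < τm) (hτk : 0 < τk) (h1 : kappa τm τk < 1) : ∃ c : ℕ, ∀ η δ ε : ℝ, 0 < η →
    0 < δ → δ ≤ 1 → 0 < ε → ∃ n m k : ℕ, Reg c n m k ∧ ∃ (x : GI n m k → ℝ) (K : ℝ),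
      Good τm τk c η δ K x ∧
      K * ((n : ℝ) ^ (-(1 / 2) + 1 / 4 : ℝ) + |(n : ℝ) / m - τm| + |(n : ℝ) / k - τk|) ≤ ε := by
  obtain ⟨c, hc⟩ := exists_reg hτm hτk
  refine ⟨c, fun η δ ε hη hδ hδ1 hε => ?_⟩
  obtain ⟨K, -, hK⟩ := negl_not_good hτm hτk h1 c hη
  obtain ⟨C, hC, hb⟩ := hK δ hδ hδ1 1
  have hm := tendsto_div_ceil hτm
  have hk := tendsto_div_ceil hτk
  have hlim : Tendsto (fun n : ℕ => C / (n : ℝ≥0∞) ^ 1) atTop (𝓝 0) := by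
    simp only [pow_one, div_eq_mul_inv]
    simpa using ENNReal.Tendsto.const_mul ENNReal.tendsto_inv_nat_nhds_zero (Or.inr hC)
  obtain ⟨n, h2, h3, h4⟩ := ((hc _ _ hm hk).and ((hlim.eventually_lt_const one_pos).and
    ((tendsto_rate hm hk K).eventually_le_const hε))).exists
  refine ⟨n, _, _, h2, ?_⟩
  -- If no realization were good, the exceptional event would have probability 1, although its bound
  -- is below 1 for large n.
  by_contra hcon
  push Not at hcon
  have huniv : {x : GI n ⌈τm⁻¹ * n⌉₊ ⌈τk⁻¹ * n⌉₊ → ℝ | ¬ Good τm τk c η δ K x} = Set.univ :=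
    Set.eq_univ_of_forall fun x hx => absurd h4 (not_le.2 (hcon x K hx))
  have h5 := hb _ _ _ h2
  beta_reduce at h5
  rw [huniv, measure_univ] at h5
  exact absurd (h5.trans_lt h3) (lt_irrefl _)

/-- The first index of a block. -/
def corner {c n m k : ℕ} (hr : Reg c n m k) : Fin 4 → Idx n m k
  | 0 => .inl (.inl ⟨0, hr.m_pos⟩)
  | 1 => .inl (.inr ⟨0, hr.k_pos⟩)
  | 2 => .inr (.inl ⟨0, hr.n_pos⟩)
  | 3 => .inr (.inr ⟨0, hr.n_pos⟩)

lemma Omega_mono {η η' : ℝ} (h0 : 0 < η') (h : η' ≤ η) : Omega η ⊆ Omega η' := fun _ hz =>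
  ⟨h.trans_lt hz.1, hz.2.trans_le (inv_anti₀ h0 h)⟩

lemma differentiableAt_resolvent_apply {n m k : ℕ} {U : Matrix (Fin n) (Fin m) ℝ}
    {V : Matrix (Fin n) (Fin k) ℝ} {z : ℂ} (hz : IsUnit (lin τm τk U V z)) (i j : Idx n m k) :
    DifferentiableAt ℂ (fun z => resolvent τm τk U V z i j) z := by
  have h := ((bformL (Pi.single i 1) (Pi.single j 1)).differentiableAt
    (x := resolvent τm τk U V z)).comp z (differentiableAt_resolvent U V z hz)
  refine h.congr_of_eventuallyEq (Eventually.of_forall fun w => ?_)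
  exact (bform_single (resolvent τm τk U V w) i j).symm

/-- Every entry of the solution continues analytically to the slit plane. -/
lemma exists_entry_continuation (hτm : 0 < τm) (hτk : 0 < τk) (h1 : kappa τm τk < 1)
    {sol : ℂ → ℂ × ℂ × Matrix (Fin 2) (Fin 2) ℂ}
    (hsol : ∀ z : ℂ, 0 < z.im → SolvesSystem τm τk z (sol z).1 (sol z).2.1 (sol z).2.2) (d e : Fin 4)
    {f : ℂ → ℂ} (hf : ∀ (c n m k : ℕ) (hr : Reg c n m k) (z : ℂ),
      detMatrix n m k (sol z).1 (sol z).2.1 (sol z).2.2 (corner hr d) (corner hr e) = f z) :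
    ∃ G : ℂ → ℂ, AnalyticOnNhd ℂ G (slitDomain τm τk) ∧ ∀ z, 0 < z.im → G z = f z := by
  have h0 := kappa_pos hτm hτk
  obtain ⟨c, hc⟩ := exists_good hτm hτk h1
  have hj : ∀ j : ℕ, (0 : ℝ) < 1 / ((j : ℝ) + 1) := fun j => Nat.one_div_pos_of_nat
  have hj1 : ∀ j : ℕ, 1 / ((j : ℝ) + 1) ≤ 1 := fun j => by
    rw [div_le_one (by positivity)]
    linarith [(Nat.cast_nonneg j : (0 : ℝ) ≤ j)]
  -- One deterministic good realization for each accuracy 1/(j+1); its resolvent entries are the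
  -- approximants to be continued.
  choose n m k hr x K hx hK using fun j : ℕ => hc _ _ _ (hj j) (hj j) (hj1 j) (hj j)
  have hsmall : ∀ ε > 0, ∀ᶠ j : ℕ in atTop, 1 / ((j : ℝ) + 1) ≤ ε := fun ε hε =>
    tendsto_one_div_add_atTop_nhds_zero_nat.eventually_le_const hε
  have hl := lambdaStar_pos h0 h1
  refine exists_continuation (l := lambdaStar τm τk)
    (F := fun j z => resG τm τk z (x j) (corner (hr j) d) (corner (hr j) e)) (f := f) ?_ ?_ ?_
  · intro η hη ε hε
    filter_upwards [hsmall η hη, hsmall ε hε] with j h2 h3 z hz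
    have hz0 : 0 < z.im := hη.trans hz.1
    rw [← hf c _ _ _ (hr j) z]
    exact ((hx j).law _ _ z (Omega_mono (hj j) h2 hz) _ _ _ (hsol z hz0)).trans ((hK j).trans h3)
  · intro d' hd'
    refine ⟨resBound τm τk c d', ?_⟩
    filter_upwards [hsmall (d' / 2 / (lambdaStar τm τk * 18)) (by positivity)] with j h2 z hz
    rw [le_div_iff₀ (by positivity)] at h2
    obtain ⟨u1, u2⟩ := (hx j).isUnit_and_norm_le h0 h1 hd' (by linarith) hz
    exact ⟨differentiableAt_resolvent_apply u1 _ _, (norm_entry_le _ _ _).trans u2⟩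
  · intro j z
    change resolvent τm τk (matU (x j)) (matV (x j)) (conj z) _ _ = _
    rw [resolvent_conj]
    rfl

/-- The solution of the self-consistent system continues analytically to the slit plane. -/
lemma exists_isDetSolution (hτm : 0 < τm) (hτk : 0 < τk) (h1 : kappa τm τk < 1) :
    ∃ (r s : ℂ → ℂ) (T : ℂ → Matrix (Fin 2) (Fin 2) ℂ), IsDetSolution τm τk r s T := by
  have hex : ∀ z : ℂ, ∃ p : ℂ × ℂ × Matrix (Fin 2) (Fin 2) ℂ, 0 < z.im →
      SolvesSystem τm τk z p.1 p.2.1 p.2.2 := fun z => by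
    by_cases hz : 0 < z.im
    · obtain ⟨Λ, -, h⟩ := exists_solution hτm hτk h1 hz
      obtain ⟨r, s, T, hS, -⟩ := h z le_rfl
      exact ⟨(r, s, T), fun _ => hS⟩
    · exact ⟨0, fun h => absurd h hz⟩
  choose sol hsol using hex
  obtain ⟨r, hr, hr'⟩ := exists_entry_continuation hτm hτk h1 hsol 0 0 (f := fun z => (sol z).1)
    fun c n m k h z => by simp [detMatrix, corner]
  obtain ⟨s, hs, hs'⟩ := exists_entry_continuation hτm hτk h1 hsol 1 1 (f := fun z => (sol z).2.1)
    fun c n m k h z => by simp [detMatrix, corner]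
  obtain ⟨t₀, h0, h0'⟩ := exists_entry_continuation hτm hτk h1 hsol 2 2
    (f := fun z => (sol z).2.2 0 0) fun c n m k h z => by simp [detMatrix, corner]
  obtain ⟨t₁, ht1, ht1'⟩ := exists_entry_continuation hτm hτk h1 hsol 2 3
    (f := fun z => (sol z).2.2 0 1) fun c n m k h z => by simp [detMatrix, corner]
  obtain ⟨t₂, h2, h2'⟩ := exists_entry_continuation hτm hτk h1 hsol 3 2
    (f := fun z => (sol z).2.2 1 0) fun c n m k h z => by simp [detMatrix, corner]
  obtain ⟨t₃, h3, h3'⟩ := exists_entry_continuation hτm hτk h1 hsol 3 3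
    (f := fun z => (sol z).2.2 1 1) fun c n m k h z => by simp [detMatrix, corner]
  refine ⟨r, s, fun z => !![t₀ z, t₁ z; t₂ z, t₃ z], fun z hz => ?_, hr, hs, fun i j => ?_⟩
  · have hT : !![t₀ z, t₁ z; t₂ z, t₃ z] = (sol z).2.2 := by
      ext i j
      fin_cases i <;> fin_cases j <;> simp [h0' z hz, ht1' z hz, h2' z hz, h3' z hz]
    rw [hT, hr' z hz, hs' z hz]
    exact hsol z hz
  · fin_cases i <;> fin_cases j
    exacts [h0, ht1, h2, h3]

end GoodEvent

end CCA

end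


noncomputable section

namespace CCA

/-! ### Overwhelming probability, the local law and the traces -/

section Conclusion

open scoped Matrix.Norms.L2Operator ComplexConjugate
open Matrix

variable {τm τk : ℝ}

/-- The extra power of n absorbs the constant C. -/
lemma eventually_div_pow_le {A : ℝ} {C : ℝ≥0∞} (hC : C ≠ ∞) : ∀ᶠ n : ℕ in atTop,
    C / (n : ℝ≥0∞) ^ (⌈A⌉₊ + 1) ≤ ENNReal.ofReal ((n : ℝ) ^ (-A)) := by
  obtain ⟨N, hN⟩ := ENNReal.exists_nat_gt hC
  filter_upwards [eventually_ge_atTop N, eventually_gt_atTop 0] with n hn hn0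
  have hn0' : (0 : ℝ) < n := by exact_mod_cast hn0
  have hn1 : (1 : ℝ) ≤ n := by exact_mod_cast hn0
  refine ENNReal.div_le_of_le_mul ?_
  have h : (n : ℝ) ≤ (n : ℝ) ^ (-A) * (n : ℝ) ^ (⌈A⌉₊ + 1) := by
    rw [← Real.rpow_natCast, ← Real.rpow_add hn0']
    conv_lhs => rw [← Real.rpow_one (n : ℝ)]
    refine Real.rpow_le_rpow_of_exponent_le hn1 ?_
    push_cast
    linarith [Nat.le_ceil A]
  calc C ≤ (N : ℝ≥0∞) := hN.le
    _ ≤ (n : ℝ≥0∞) := by exact_mod_cast hn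
    _ = ENNReal.ofReal n := (ENNReal.ofReal_natCast n).symm
    _ ≤ ENNReal.ofReal ((n : ℝ) ^ (-A) * (n : ℝ) ^ (⌈A⌉₊ + 1)) := ENNReal.ofReal_le_ofReal h
    _ = _ := by
      rw [ENNReal.ofReal_mul (by positivity), ENNReal.ofReal_pow hn0'.le, ENNReal.ofReal_natCast]

lemma withOverwhelmingProbability_of_le {m k : ℕ → ℕ} (hm : ∀ᶠ n in atTop, 0 < m n ∧ 0 < k n)
    {E : ∀ n, Set ((Fin n → Fin (m n) → ℝ) × (Fin n → Fin (k n) → ℝ))}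
    (h : ∀ s : ℕ, ∃ C : ℝ≥0∞, C ≠ ∞ ∧ ∀ᶠ n in atTop,
      stdG (GI n (m n) (k n)) {x | (matU x, matV x) ∉ E n} ≤ C / (n : ℝ≥0∞) ^ s) :
    WithOverwhelmingProbability (fun n => nullLaw n (m n) (k n)) E := by
  intro A _
  obtain ⟨C, hC, hb⟩ := h (⌈A⌉₊ + 1)
  filter_upwards [hm, hb, eventually_div_pow_le hC] with n h1 h2 h3
  rw [nullLaw_apply h1.1 h1.2]
  exact h2.trans h3

lemma nrm_ofReal {ι : Type} [Fintype ι] (x : EuclideanSpace ℝ ι) : nrm (fun i => (x i : ℂ)) = ‖x‖ := by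
  rw [← sq_eq_sq₀ (nrm_nonneg _) (norm_nonneg _), sq_nrm, EuclideanSpace.norm_sq_eq]
  simp

/-- The anisotropic local law. -/
lemma withOverwhelmingProbability_local_law (hτm : 0 < τm) (hτk : 0 < τk) (h1 : kappa τm τk < 1)
    {r s : ℂ → ℂ} {T : ℂ → Matrix (Fin 2) (Fin 2) ℂ} (hsol : IsDetSolution τm τk r s T)
    {η ε : ℝ} (hη : 0 < η) (hε : 0 < ε) : ∃ C : ℝ, 0 < C ∧ ∀ m k : ℕ → ℕ,
      Tendsto (fun n : ℕ => (n : ℝ) / (m n : ℝ)) atTop (𝓝 τm) →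
      Tendsto (fun n : ℕ => (n : ℝ) / (k n : ℝ)) atTop (𝓝 τk) →
      ∀ x y : ∀ n : ℕ, EuclideanSpace ℝ (Idx n (m n) (k n)),
      (∀ᶠ n in atTop, ‖x n‖ = 1 ∧ ‖y n‖ = 1) →
      WithOverwhelmingProbability (fun n => nullLaw n (m n) (k n))
        (fun n => {ω | ∀ z ∈ Omega η, IsUnit (lin τm τk (.of ω.1) (.of ω.2) z) ∧
          ‖bilin (x n) (resolvent τm τk (.of ω.1) (.of ω.2) z) (y n) -
            bilin (x n) (detMatrix n (m n) (k n) (r z) (s z) (T z)) (y n)‖ ≤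
          C * ((n : ℝ) ^ (-(1 / 2) + ε : ℝ) +
            |(n : ℝ) / (m n : ℝ) - τm| + |(n : ℝ) / (k n : ℝ) - τk|)}) := by
  have h0 := kappa_pos hτm hτk
  obtain ⟨c, hc⟩ := exists_reg hτm hτk
  obtain ⟨K, hK, hlaw⟩ := local_law hτm hτk h1 c hη hε
  refine ⟨K, hK, fun m k hm hk x y hxy => ?_⟩
  refine withOverwhelmingProbability_of_le ((hc m k hm hk).mono fun n h => ⟨h.m_pos, h.k_pos⟩)
    fun q => ?_
  obtain ⟨C, hC, hb⟩ := hlaw q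
  refine ⟨C, hC, ?_⟩
  filter_upwards [hc m k hm hk, hxy] with n hr hn
  refine (measure_mono ?_).trans (hb n (m n) (k n) hr (fun i => (x n i : ℂ)) (fun i => (y n i : ℂ))
    (by rw [nrm_ofReal, hn.1]) (by rw [nrm_ofReal, hn.2]))
  intro ω hω
  by_contra hcon
  refine hω fun z hz => ?_
  have hz0 : 0 < z.im := hη.trans hz.1
  exact ⟨isUnit_lin (matU ω) (matV ω) z h0 h1 hz0.ne', not_lt.1 fun hlt =>
    hcon ⟨z, hz, r z, s z, T z, hsol.solves z hz0, hlt⟩⟩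

lemma norm_diagSum_sub_le {p q : ℕ} {A B : Matrix (Fin p) (Fin q) ℂ} {M : ℝ} (hM : 0 ≤ M)
    (h : ∀ i j, ‖A i j - B i j‖ ≤ M) : ‖diagSum A - diagSum B‖ ≤ p * M := by
  have e : diagSum A - diagSum B = ∑ a : Fin p, ∑ b : Fin q,
      if (a : ℕ) = (b : ℕ) then A a b - B a b else 0 := by
    rw [diagSum, diagSum, ← Finset.sum_sub_distrib]
    refine Finset.sum_congr rfl fun a _ => ?_
    rw [← Finset.sum_sub_distrib]
    exact Finset.sum_congr rfl fun b _ => by split_ifs <;> simp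
  have hrow : ∀ a : Fin p, ‖∑ b : Fin q, if (a : ℕ) = (b : ℕ) then A a b - B a b else 0‖ ≤ M := by
    intro a
    by_cases ha : (a : ℕ) < q
    · rw [Finset.sum_eq_single ⟨a, ha⟩ (fun b _ hb => if_neg fun hab => hb (Fin.ext hab.symm))
        (fun hb => absurd (Finset.mem_univ _) hb)]
      simpa using h a ⟨a, ha⟩
    · rw [Finset.sum_eq_zero fun b _ => if_neg fun hab => ha (by omega)]
      simpa using hM
  rw [e]
  refine (norm_sum_le_of_le _ fun a _ => hrow a).trans ?_
  simp

lemma blockDim_le {c n m k : ℕ} (hr : Reg c n m k) (i : Fin 4) : blockDim n m k i ≤ (c + 1) * n := by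
  have h1 := hr.m_le
  have h2 := hr.k_le
  have h3 : n ≤ (c + 1) * n := Nat.le_mul_of_pos_left n (Nat.succ_pos c)
  have h4 : c * n ≤ (c + 1) * n := Nat.mul_le_mul_right n (Nat.le_succ c)
  fin_cases i
  exacts [h1.trans h4, h2.trans h4, h3, h3]

lemma IsDetSolution.differentiableAt_detMatrix {r s : ℂ → ℂ} {T : ℂ → Matrix (Fin 2) (Fin 2) ℂ}
    (hsol : IsDetSolution τm τk r s T) {z : ℂ} (hz : z ∈ slitDomain τm τk) {n m k : ℕ}
    (i j : Idx n m k) :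
    DifferentiableAt ℂ (fun z => detMatrix n m k (r z) (s z) (T z) i j) z := by
  have e : (fun z => detMatrix n m k (r z) (s z) (T z) i j) = fun z =>
      r z * (prj 0 : Matrix (Idx n m k) (Idx n m k) ℂ) i j +
      s z * (prj 1 : Matrix (Idx n m k) (Idx n m k) ℂ) i j +
      (T z 0 0 * (prj 2 : Matrix (Idx n m k) (Idx n m k) ℂ) i j +
      T z 1 1 * (prj 3 : Matrix (Idx n m k) (Idx n m k) ℂ) i j +
      (T z 0 1 * (crossI true : Matrix (Idx n m k) (Idx n m k) ℂ) i j +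
      T z 1 0 * (crossI false : Matrix (Idx n m k) (Idx n m k) ℂ) i j)) := by
    funext z
    rw [detMatrix_eq]
    rfl
  rw [e]
  have dr := (hsol.analytic_r z hz).differentiableAt
  have ds := (hsol.analytic_s z hz).differentiableAt
  have dT := fun i j => (hsol.analytic_T i j z hz).differentiableAt
  exact ((dr.mul_const _).add (ds.mul_const _)).add ((((dT 0 0).mul_const _).add
    ((dT 1 1).mul_const _)).add (((dT 0 1).mul_const _).add ((dT 1 0).mul_const _)))

/-- The solution is bounded on bounded sets away from the half-line. -/
lemma IsDetSolution.exists_bound {r s : ℂ → ℂ} {T : ℂ → Matrix (Fin 2) (Fin 2) ℂ}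
    (hsol : IsDetSolution τm τk r s T) {d : ℝ} (hd : 0 < d) (ρ : ℝ) : ∃ B : ℝ, 0 ≤ B ∧
      ∀ z : ℂ, ‖z‖ ≤ ρ → (d ≤ |z.im| ∨ lambdaStar τm τk + d ≤ z.re) → ∀ n m k : ℕ,
      ‖detMatrix n m k (r z) (s z) (T z)‖ ≤ B := by
  set S : Set ℂ := {z | ‖z‖ ≤ ρ} ∩ {z | d ≤ |z.im| ∨ lambdaStar τm τk + d ≤ z.re} with hS
  have hSc : IsCompact S := by
    refine Metric.isCompact_of_isClosed_isBounded ?_ ?_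
    · refine (isClosed_le continuous_norm continuous_const).inter (IsClosed.union ?_ ?_)
      · exact isClosed_le continuous_const Complex.continuous_im.abs
      · exact isClosed_le continuous_const Complex.continuous_re
    · refine (Metric.isBounded_closedBall (x := (0 : ℂ)) (r := ρ)).subset fun z hz => ?_
      rw [mem_closedBall_zero_iff]
      exact hz.1
  have hSD : S ⊆ slitDomain τm τk := by
    rintro z ⟨-, hz⟩ ⟨h1, h2⟩
    rcases hz with hz | hz
    · rw [h1, abs_zero] at hz; linarith
    · linarith
  have hcont : ContinuousOn (fun z => ‖r z‖ + ‖s z‖ + (‖T z 0 0‖ + ‖T z 1 1‖ + (‖T z 0 1‖ + ‖T z 1 0‖))) S := by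
    have cr := (hsol.analytic_r.continuousOn.mono hSD).norm
    have cs := (hsol.analytic_s.continuousOn.mono hSD).norm
    have cT := fun i j => ((hsol.analytic_T i j).continuousOn.mono hSD).norm
    exact (cr.add cs).add (((cT 0 0).add (cT 1 1)).add ((cT 0 1).add (cT 1 0)))
  obtain ⟨B, hB⟩ := hSc.exists_bound_of_continuousOn hcont
  refine ⟨max B 0, le_max_right _ _, fun z hz hz' n m k => (norm_detMatrix_le _ _ _).trans ?_⟩
  exact ((le_abs_self _).trans (hB z ⟨hz, hz'⟩)).trans (le_max_left _ _)

lemma exists_gap {l : ℝ} {K : Set ℝ} (hK : IsCompact K) (hKl : K ⊆ Set.Ioi l) :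
    ∃ g X : ℝ, 0 < g ∧ 0 ≤ X ∧ ∀ x ∈ K, l + g ≤ x ∧ |x| ≤ X := by
  rcases K.eq_empty_or_nonempty with rfl | hne
  · exact ⟨1, 0, one_pos, le_rfl, fun x hx => absurd hx (Set.notMem_empty x)⟩
  · obtain ⟨a, ha, hmin⟩ := hK.exists_isLeast hne
    obtain ⟨X, hX⟩ := hK.exists_bound_of_continuousOn continuousOn_id
    refine ⟨a - l, max X 0, sub_pos.2 (hKl ha), le_max_right _ _, fun x hx => ⟨?_, ?_⟩⟩
    · linarith [hmin hx]
    · exact (hX x hx).trans (le_max_left _ _)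

/-- On good realizations the local law extends to the real line to the right of the edge. -/
lemma Good.norm_entry_sub_le {c n m k : ℕ} {δ K g X B : ℝ} {ω : GI n m k → ℝ} {r s : ℂ → ℂ}
    {T : ℂ → Matrix (Fin 2) (Fin 2) ℂ} (h0 : 0 < kappa τm τk) (h1 : kappa τm τk < 1) (hg : 0 < g)
    (hX : 0 ≤ X) (hω : Good τm τk c (X + 3)⁻¹ δ K ω)
    (hδ : lambdaStar τm τk * (18 * δ) ≤ gapOf g / 2) (hsol : IsDetSolution τm τk r s T)
    (hB : ∀ z : ℂ, ‖z‖ ≤ X + 1 + bigR g → (gapOf g ≤ |z.im| ∨ lambdaStar τm τk + gapOf g ≤ z.re) →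
      ‖detMatrix n m k (r z) (s z) (T z)‖ ≤ B) {x : ℝ} (hx : lambdaStar τm τk + g ≤ x) (hxX : |x| ≤ X)
    (i j : Idx n m k) :
    ‖resG τm τk x ω i j - detMatrix n m k (r x) (s x) (T x) i j‖ ≤
      discBound (resBound τm τk c (gapOf g) + B)
        (K * ((n : ℝ) ^ (-(1 / 2) + 1 / 4 : ℝ) + |(n : ℝ) / m - τm| + |(n : ℝ) / k - τk|))
        (1 / (1 / 2)) (1 / bigR g) := by
  have hR := one_lt_bigR hg
  have hd := gapOf_pos hg
  have hη : 0 < (X + 3)⁻¹ := by positivity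
  have hreg : ∀ u ∈ Metric.closedBall (⟨x, 1⟩ : ℂ) (bigR g),
      gapOf g ≤ |u.im| ∨ lambdaStar τm τk + gapOf g ≤ u.re := fun u hu => mem_disc_region hg hx hu
  have hnorm : ∀ u ∈ Metric.closedBall (⟨x, 1⟩ : ℂ) (bigR g), ‖u‖ ≤ X + 1 + bigR g := fun u hu => by
    have h3 : ‖(⟨x, 1⟩ : ℂ)‖ ≤ X + 1 := by
      refine (Complex.norm_le_abs_re_add_abs_im _).trans ?_
      simpa using hxX
    have h4 : ‖u - ⟨x, 1⟩‖ ≤ bigR g := by rwa [← dist_eq_norm]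
    have h5 : ‖u‖ ≤ ‖u - ⟨x, 1⟩‖ + ‖(⟨x, 1⟩ : ℂ)‖ := by
      simpa using norm_add_le (u - ⟨x, 1⟩) (⟨x, 1⟩ : ℂ)
    linarith
  -- The point x lies at distance exactly 1 from the centre x + i, below the radius `bigR g`; the
  -- law of the good event is used on the concentric disc of radius 1/2.
  refine norm_le_discBound
    (f := fun u => resG τm τk u ω i j - detMatrix n m k (r u) (s u) (T u) i j) (w := ⟨x, 1⟩)
    (by norm_num) (by linarith) hR (fun u hu => ?_) (fun u hu => ?_) (fun u hu => ?_) ?_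
  · refine (differentiableAt_resolvent_apply
      (hω.isUnit_and_norm_le h0 h1 hd hδ (hreg u hu)).1 i j).sub
        (hsol.differentiableAt_detMatrix ?_ i j)
    rintro ⟨h2, h3⟩
    rcases hreg u hu with h4 | h4
    · rw [h2, abs_zero] at h4; linarith
    · linarith
  · refine norm_sub_le_of_le ?_ ?_
    · exact (norm_entry_le _ _ _).trans (hω.isUnit_and_norm_le h0 h1 hd hδ (hreg u hu)).2
    · exact (norm_entry_le _ _ _).trans (hB u (hnorm u hu) (hreg u hu))
  · have hu' := small_disc_subset hxX hu
    exact hω.law i j u hu' _ _ _ (hsol.solves u (hη.trans hu'.1))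
  · have : (x : ℂ) - ⟨x, 1⟩ = -Complex.I := by apply Complex.ext <;> simp
    rw [Metric.mem_closedBall, dist_eq_norm, this, norm_neg, Complex.norm_I]

/-- The normalized block traces to the right of the edge. -/
lemma withOverwhelmingProbability_traces (hτm : 0 < τm) (hτk : 0 < τk) (h1 : kappa τm τk < 1)
    {r s : ℂ → ℂ} {T : ℂ → Matrix (Fin 2) (Fin 2) ℂ} (hsol : IsDetSolution τm τk r s T)
    {m k : ℕ → ℕ} (hm : Tendsto (fun n : ℕ => (n : ℝ) / (m n : ℝ)) atTop (𝓝 τm))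
    (hk : Tendsto (fun n : ℕ => (n : ℝ) / (k n : ℝ)) atTop (𝓝 τk)) {K : Set ℝ} (hK : IsCompact K)
    (hKl : K ⊆ Set.Ioi (lambdaStar τm τk)) (i j : Fin 4) :
    ∃ δ : ℕ → ℝ, Tendsto δ atTop (𝓝 0) ∧
      WithOverwhelmingProbability (fun n => nullLaw n (m n) (k n))
        (fun n => {ω | ∀ z ∈ K, IsUnit (lin τm τk (.of ω.1) (.of ω.2) (z : ℂ)) ∧
          (1 / (n : ℝ)) *
            ‖diagSum (block (resolvent τm τk (.of ω.1) (.of ω.2) (z : ℂ)) i j) -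
              diagSum (block (detMatrix n (m n) (k n) (r z) (s z) (T z)) i j)‖ ≤ δ n}) := by
  have h0 := kappa_pos hτm hτk
  have hl := lambdaStar_pos h0 h1
  obtain ⟨c, hc⟩ := exists_reg hτm hτk
  obtain ⟨g, X, hg, hX, hgX⟩ := exists_gap hK hKl
  have hR := one_lt_bigR hg
  have hd := gapOf_pos hg
  obtain ⟨C, hC, hgood⟩ := negl_not_good hτm hτk h1 c (η := (X + 3)⁻¹) (by positivity)
  -- So small that the margin 18δ in the edge estimate uses up at most half of the distance to the
  -- half-line.
  set δ₀ := min 1 (gapOf g / 2 / (lambdaStar τm τk * 18)) with hδ₀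
  have hδ₀' : 0 < δ₀ := lt_min one_pos (by positivity)
  have hδl : lambdaStar τm τk * (18 * δ₀) ≤ gapOf g / 2 := by
    have : δ₀ ≤ gapOf g / 2 / (lambdaStar τm τk * 18) := min_le_right _ _
    rw [le_div_iff₀ (by positivity)] at this
    linarith
  obtain ⟨B, hB0, hB⟩ := hsol.exists_bound hd (X + 1 + bigR g)
  have hres : 0 ≤ resBound τm τk c (gapOf g) := by
    have := cRes_pos h0
    unfold resBound
    positivity
  set γ : ℕ → ℝ := fun n => C * ((n : ℝ) ^ (-(1 / 2) + 1 / 4 : ℝ) + |(n : ℝ) / m n - τm| +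
    |(n : ℝ) / k n - τk|) with hγ
  have hγ0 : ∀ n, 0 ≤ γ n := fun n => by positivity
  set D : ℕ → ℝ := fun n =>
    discBound (resBound τm τk c (gapOf g) + B) (γ n) (1 / (1 / 2)) (1 / bigR g) with hD
  have hDlim : Tendsto D atTop (𝓝 0) := tendsto_discBound (by positivity) hγ0 (by norm_num)
    (by positivity) ((div_lt_one (by linarith)).2 hR) (tendsto_rate hm hk C)
  have hD0 : ∀ n, 0 ≤ D n := fun n => tsum_nonneg fun q => by
    have := hγ0 n
    have : 0 ≤ bigR g := by linarith
    exact le_min (by positivity) (by positivity)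
  -- Every entry is within `D n` of its limit, and a block has at most (c+1)n diagonal entries.
  refine ⟨fun n => (c + 1) * D n, by simpa using hDlim.const_mul ((c : ℝ) + 1), ?_⟩
  refine withOverwhelmingProbability_of_le ((hc m k hm hk).mono fun n h => ⟨h.m_pos, h.k_pos⟩)
    fun q => ?_
  obtain ⟨C', hC', hb⟩ := hgood δ₀ hδ₀' (min_le_left _ _) q
  refine ⟨C', hC', ?_⟩
  filter_upwards [hc m k hm hk] with n hr
  refine (measure_mono fun ω hω => ?_).trans (hb n (m n) (k n) hr)
  intro hG
  refine hω fun x hx => ⟨(hG.isUnit_and_norm_le h0 h1 hd hδl (Or.inr ?_)).1, ?_⟩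
  · have : gapOf g ≤ g / 2 := min_le_right _ _
    rw [Complex.ofReal_re]
    linarith [(hgX x hx).1]
  · have hn0 : (0 : ℝ) < n := by exact_mod_cast hr.n_pos
    have hent := fun p q => hG.norm_entry_sub_le h0 h1 hg hX hδl hsol
      (fun z hz hz' => hB z hz hz' n (m n) (k n)) (hgX x hx).1 (hgX x hx).2 p q
    have hsum := norm_diagSum_sub_le (A := block (resG τm τk x ω) i j)
      (B := block (detMatrix n (m n) (k n) (r x) (s x) (T x)) i j) (hD0 n) fun a b => hent _ _
    have hdim : ((blockDim n (m n) (k n) i : ℕ) : ℝ) ≤ (c + 1) * n := by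
      exact_mod_cast blockDim_le hr i
    rw [one_div, inv_mul_le_iff₀ hn0]
    refine hsum.trans ?_
    calc _ ≤ ((c : ℝ) + 1) * n * D n := mul_le_mul_of_nonneg_right hdim (hD0 n)
      _ = _ := by ring

end Conclusion

end CCA

end

theorem theorem4p3 (τm τk : ℝ) (hτm : 0 < τm) (hτk : 0 < τk) (hκ : CCA.kappa τm τk < 1) :
    -- the system has exactly one solution at each point of the upper half-plane
    (∀ z : ℂ, 0 < z.im → ∃! p : ℂ × ℂ × Matrix (Fin 2) (Fin 2) ℂ,
      CCA.SolvesSystem τm τk z p.1 p.2.1 p.2.2) ∧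
    -- the solution extends analytically to the slit domain
    (∃ (r s : ℂ → ℂ) (T : ℂ → Matrix (Fin 2) (Fin 2) ℂ), CCA.IsDetSolution τm τk r s T) ∧
    ∀ (r s : ℂ → ℂ) (T : ℂ → Matrix (Fin 2) (Fin 2) ℂ), CCA.IsDetSolution τm τk r s T →
      -- the anisotropic local law
      (∀ η : ℝ, 0 < η → ∀ ε : ℝ, 0 < ε → ∃ C : ℝ, 0 < C ∧
        ∀ m k : ℕ → ℕ,
          Tendsto (fun n : ℕ => (n : ℝ) / (m n : ℝ)) atTop (𝓝 τm) →
          Tendsto (fun n : ℕ => (n : ℝ) / (k n : ℝ)) atTop (𝓝 τk) →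
        ∀ x y : ∀ n : ℕ, EuclideanSpace ℝ (CCA.Idx n (m n) (k n)),
          (∀ᶠ n in atTop, ‖x n‖ = 1 ∧ ‖y n‖ = 1) →
          CCA.WithOverwhelmingProbability (fun n => CCA.nullLaw n (m n) (k n))
            (fun n => {ω | ∀ z ∈ CCA.Omega η,
              IsUnit (CCA.lin τm τk (.of ω.1) (.of ω.2) z) ∧
              ‖CCA.bilin (x n) (CCA.resolvent τm τk (.of ω.1) (.of ω.2) z) (y n) -
                CCA.bilin (x n) (CCA.detMatrix n (m n) (k n) (r z) (s z) (T z)) (y n)‖ ≤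
              C * ((n : ℝ) ^ (-(1 / 2) + ε : ℝ) +
                |(n : ℝ) / (m n : ℝ) - τm| + |(n : ℝ) / (k n : ℝ) - τk|)})) ∧
      -- the normalized block traces on the real line to the right of the edge
      (∀ m k : ℕ → ℕ,
          Tendsto (fun n : ℕ => (n : ℝ) / (m n : ℝ)) atTop (𝓝 τm) →
          Tendsto (fun n : ℕ => (n : ℝ) / (k n : ℝ)) atTop (𝓝 τk) →
        ∀ K : Set ℝ, IsCompact K → K ⊆ Set.Ioi (CCA.lambdaStar τm τk) →
        ∀ i j : Fin 4, ∃ δ : ℕ → ℝ, Tendsto δ atTop (𝓝 0) ∧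
          CCA.WithOverwhelmingProbability (fun n => CCA.nullLaw n (m n) (k n))
            (fun n => {ω | ∀ z ∈ K,
              IsUnit (CCA.lin τm τk (.of ω.1) (.of ω.2) (z : ℂ)) ∧
              (1 / (n : ℝ)) *
                ‖CCA.diagSum (CCA.block (CCA.resolvent τm τk (.of ω.1) (.of ω.2) (z : ℂ)) i j) -
                  CCA.diagSum (CCA.block
                    (CCA.detMatrix n (m n) (k n) (r z) (s z) (T z)) i j)‖ ≤ δ n})) := by
  refine ⟨fun z hz => ?_, CCA.exists_isDetSolution hτm hτk hκ, fun r s T hsol =>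
    ⟨fun η hη ε hε => CCA.withOverwhelmingProbability_local_law hτm hτk hκ hsol hη hε,
      fun m k hm hk K hK hKl i j =>
        CCA.withOverwhelmingProbability_traces hτm hτk hκ hsol hm hk hK hKl i j⟩⟩
  obtain ⟨Λ, -, h⟩ := CCA.exists_solution hτm hτk hκ hz
  obtain ⟨r, s, T, hS, -⟩ := h z le_rfl
  refine ⟨(r, s, T), hS, fun p hp => ?_⟩
  obtain ⟨h1, h2, h3⟩ := CCA.system_unique hτm hτk hz hp hS
  exact Prod.ext h1 (Prod.ext h2 h3)
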